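/- **Setting.** Let $n\in\{2,3\}$ and $k\ge 1$. Let $\Omega_E\subset\mathbb R^n$ be a bounded polygonal/polyhedral region with boundary $\Gamma$ and outward unit normal $\mathbf n_E$, compactly contained in a bounded polygonal/polyhedral region $O$. Put $\Omega_A=O\setminus\overline{\Omega_E}$, with outward unit normal $\mathbf n_A$, and let $\partial O=\Gamma_A^D\cup\Gamma_A^N$ be a disjoint splitting. Let $\mu,\rho_E,\rho_f,c>0$, $n\lambda+2\mu>0$, $\operatorname{Re}s>0$, and $\mathbf C^{-1}M=\frac1{2\mu}M-\frac{\lambda}{2\mu(n\lambda+2\mu)}\operatorname{tr}(M)I$. Let $(\sigma,\mathbf u,\gamma,\mathbf q,v)$ be a weak solution, with complex-valued fields such that $\mathbf u,v$ are in $H^1$ and $\sigma,\mathbf q$ are in $H(\mathrm{div})$, of $$\mathbf C^{-1}\sigma-\nabla\mathbf u+\gamma=0,\quad \gamma=\tfrac12(\nabla\mathbf u-\nabla^{\top}\mathbf u),\quad -\nabla\cdot\sigma+\rho_Es^2\mathbf u=\mathbf f\quad\text{in }\Omega_E,$$ $$\mathbf q-\nabla v=0,\quad -\nabla\cdot\mathbf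 q+(s/c)^2v=f\quad\text{in }\Omega_A,$$ $$\mathbf q\cdot\mathbf n_A-s\,\mathbf u\cdot\mathbf n_E=-\nabla v^{\rm inc}\cdot\mathbf n_A,\quad -\sigma\mathbf n_E+\rho_fs\,v\,\mathbf n_A=-\rho_fs\,v^{\rm inc}\mathbf n_A\quad\text{on }\Gamma,$$ $$v=g_D\ \text{ on }\Gamma_A^D,\qquad \mathbf q\cdot\mathbf n_A=g_N\ \text{ on }\Gamma_A^N .$$ **Meshes.** Let $\mathcal T_E,\mathcal T_A$ be conforming simplicial triangulations of $\Omega_E,\Omega_A$, with the same faces on $\Gamma$ and resolving $\Gamma_A^D$ and $\Gamma_A^N$. They are regular with a common mesh size $h>0$: for a constant $\kappa$, every element $K$, of diameter $h_K$, contains a ball of radius $h_K/\kappa$ and satisfies $h_K\le h\le\kappa h_K$. The normal traces of $\sigma,\mathbf q$ on the element boundaries are assumed to be in $L^2$. Let $\tau_E,\tau_A$ be measurable stabilization functions on $\partial\mathcal T_E,\partial\mathcal T_A$ with $0<\tau_0\le\tau_E,\tau_A\le\tau_1$. **Local spaces.** Let $P_k$ be the polynomials of degree at most $k$, and $A(K)$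 the skew-symmetric tensors with entries in $P_k$. Let $V(K)=P_k^{n\times n}+\nabla\times((\nabla\times A(K))\,b_K)$, where $\eta_F$ is the barycentric coordinate of $K$ vanishing on the face $F$, and $b_K=\prod_F\eta_F$ for $n=2$, $b_K=\sum_F\big(\prod_{F'\ne F}\eta_{F'}\big)\nabla\eta_F\otimes\nabla\eta_F$ for $n=3$. The curls are row-wise for $n=3$; for $n=2$, $(\nabla\times M)_i=\partial_1M_{i2}-\partial_2M_{i1}$ and the $i$-th row of $\nabla\times\mathbf m$ is $(-\partial_2m_i,\partial_1m_i)$. **Scheme.** Let $(\sigma_h,\mathbf u_h,\gamma_h,\widehat{\mathbf u}_h,\mathbf q_h,v_h,\widehat v_h)$, elementwise in $V(K),P_k^n,A(K)$ and $P_k^n,P_k$ for $\sigma_h,\mathbf u_h,\gamma_h$ and $\mathbf q_h,v_h$, and facewise single-valued in $P_k^n$ and $P_k$ for $\widehat{\mathbf u}_h$ and $\widehat v_h$, solve, for all test functions $(\underline\tau,\mathbf t,\underline\eta,\boldsymbol\mu,\mathbf r,w,\xi)$ in the same spaces, $$(\mathbf C^{-1}\sigma_h,\underline\tau)_{\mathcal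 T_E}+(\mathbf u_h,\nabla\cdot\underline\tau)_{\mathcal T_E}+(\gamma_h,\underline\tau)_{\mathcal T_E}-\langle\widehat{\mathbf u}_h,\underline\tau\mathbf n\rangle_{\partial\mathcal T_E}=0,$$ $$(\sigma_h,\nabla\mathbf t)_{\mathcal T_E}-\langle\widehat\sigma_h\mathbf n,\mathbf t\rangle_{\partial\mathcal T_E}+\rho_Es^2(\mathbf u_h,\mathbf t)_{\mathcal T_E}=(\mathbf f,\mathbf t)_{\mathcal T_E},\quad(\sigma_h,\underline\eta)_{\mathcal T_E}=0,\quad\langle\widehat\sigma_h\mathbf n,\boldsymbol\mu\rangle_{\partial\mathcal T_E\setminus\Gamma}=0,$$ $$(\mathbf q_h,\mathbf r)_{\mathcal T_A}+(v_h,\nabla\cdot\mathbf r)_{\mathcal T_A}-\langle\widehat v_h,\mathbf r\cdot\mathbf n\rangle_{\partial\mathcal T_A}=0,$$ $$(\mathbf q_h,\nabla w)_{\mathcal T_A}-\langle\widehat{\mathbf q}_h\cdot\mathbf n,w\rangle_{\partial\mathcal T_A}+(s/c)^2(v_h,w)_{\mathcal T_A}=(f,w)_{\mathcal T_A},$$ $$\langle\widehat{\mathbf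 q}_h\cdot\mathbf n,\xi\rangle_{\partial\mathcal T_A\setminus(\Gamma\cup\Gamma_A^D)}=\langle g_N,\xi\rangle_{\Gamma_A^N},\qquad\langle\widehat v_h,\xi\rangle_{\Gamma_A^D}=\langle g_D,\xi\rangle_{\Gamma_A^D},$$ $$\langle\widehat{\mathbf q}_h\cdot\mathbf n_A-s\,\widehat{\mathbf u}_h\cdot\mathbf n_E,\xi\rangle_\Gamma=-\langle\nabla v^{\rm inc}\cdot\mathbf n_A,\xi\rangle_\Gamma,\quad\langle-\widehat\sigma_h\mathbf n_E+\rho_fs\,\widehat v_h\mathbf n_A,\boldsymbol\mu\rangle_\Gamma=-\rho_fs\,\langle v^{\rm inc}\mathbf n_A,\boldsymbol\mu\rangle_\Gamma,$$ where $\widehat\sigma_h\mathbf n=\sigma_h\mathbf n-\tau_E(\mathbf u_h-\widehat{\mathbf u}_h)$ and $\widehat{\mathbf q}_h\cdot\mathbf n=\mathbf q_h\cdot\mathbf n-\tau_A(v_h-\widehat v_h)$, and all inner products are complex $L^2$ inner products, conjugate-linear in the second argument. **Projections and errors.** On $K\in\mathcal T_A$ the pair $(\Pi_A\mathbf q,\Pi_Av)\in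 P_k^n\times P_k$ is defined by $(\Pi_A\mathbf q,\mathbf r)_K=(\mathbf q,\mathbf r)_K$ for $\mathbf r\in P_{k-1}^n$, $(\Pi_Av,w)_K=(v,w)_K$ for $w\in P_{k-1}$, and $\langle\Pi_A\mathbf q\cdot\mathbf n-\tau_A\Pi_Av,\xi\rangle_F=\langle\mathbf q\cdot\mathbf n-\tau_AP_Mv,\xi\rangle_F$ for $\xi\in P_k$ and all faces $F$ of $K$, where $P_M$ is the $L^2(F)$-projection onto $P_k$. On $K\in\mathcal T_E$, $(\Pi_E\sigma,\Pi_E\mathbf u)$ is the row-wise version with $\tau_E$, and $\Pi\gamma$ is the $L^2(K)$-projection of $\gamma$ onto $A(K)$. Let $$\Theta=\big(\|\sigma-\Pi_E\sigma\|_{\mathcal T_E}^2+\|\mathbf u-\Pi_E\mathbf u\|_{\mathcal T_E}^2+\|\gamma-\Pi\gamma\|_{\mathcal T_E}^2+\|\mathbf q-\Pi_A\mathbf q\|_{\mathcal T_A}^2+\|v-\Pi_Av\|_{\mathcal T_A}^2\big)^{1/2},$$ $e_{\mathbf u}=\Pi_E\mathbf u-\mathbf u_h$ and $e_\gamma=\Pi\gamma-\gamma_h=e_\gamma^0+e_\gamma^c$,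 where $e_\gamma^c|_K=\frac1{|K|}\int_Ke_\gamma$ for $K\in\mathcal T_E$. **Lemma.** There exist positive constants $C_\gamma^0$ and $C_\gamma^c$, depending only on $n$, $k$, the physical constants and $s$, the regions and the splitting of the boundary, $\kappa$, $\tau_0$ and $\tau_1$ (in particular independent of $h$), such that $$\|e_\gamma^0\|_{\mathcal T_E}\le C_\gamma^0\,\Theta\qquad\text{and}\qquad\|e_\gamma^c\|_{\mathcal T_E}\le C_\gamma^c\left(h^{-1/2}\,\Theta+\|h^{-1}e_{\mathbf u}\|_{\mathcal T_E}\right).$$ -/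

import Mathlib

open MeasureTheory ComplexConjugate
open scoped ContDiff

noncomputable section

/-! ### Points, polynomials, inner products -/

/-- Points of `ℝⁿ` with the Euclidean norm. -/
abbrev Pt (n : ℕ) : Type := EuclideanSpace ℝ (Fin n)

/-- Complex polynomials in the `n` Cartesian coordinates. -/
abbrev CPoly (n : ℕ) : Type := MvPolynomial (Fin n) ℂ

/-- Vectors of polynomials. -/
abbrev PolyV (n : ℕ) : Type := Fin n → CPoly n

/-- Tensors (square matrices) of polynomials. -/
abbrev PolyT (n : ℕ) : Type := Matrix (Fin n) (Fin n) (CPoly n)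

/-- Value of a polynomial at a point. -/
def evS {n : ℕ} (p : CPoly n) (x : Pt n) : ℂ := MvPolynomial.eval (fun i => (x i : ℂ)) p

/-- Value of a polynomial vector at a point. -/
def evV {n : ℕ} (p : PolyV n) (x : Pt n) : Fin n → ℂ := fun i => evS (p i) x

/-- Value of a polynomial tensor at a point. -/
def evT {n : ℕ} (p : PolyT n) (x : Pt n) : Matrix (Fin n) (Fin n) ℂ :=
  Matrix.of fun i j => evS (p i j) x

/-- `P_k`, scalar polynomials of degree at most `k`. -/
def PkS (n k : ℕ) : Set (CPoly n) := {p | p.totalDegree ≤ k}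

/-- `[P_k]ⁿ`. -/
def PkV (n k : ℕ) : Set (PolyV n) := {p | ∀ i, p i ∈ PkS n k}

/-- `[P_k]ⁿˣⁿ`. -/
def PkT (n k : ℕ) : Set (PolyT n) := {p | ∀ i j, p i j ∈ PkS n k}

/-- The gradient of a polynomial vector, `(∇ t)_{ij} = ∂_j t_i`. -/
def gradV {n : ℕ} (t : PolyV n) : PolyT n := Matrix.of fun i j => MvPolynomial.pderiv j (t i)

/-- The gradient of a scalar polynomial. -/
def gradS {n : ℕ} (w : CPoly n) : PolyV n := fun j => MvPolynomial.pderiv j w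

/-- The divergence of a polynomial vector. -/
def divV {n : ℕ} (r : PolyV n) : CPoly n := ∑ j, MvPolynomial.pderiv j (r j)

/-- The row-wise divergence of a polynomial tensor. -/
def divT {n : ℕ} (t : PolyT n) : PolyV n := fun i => ∑ j, MvPolynomial.pderiv j (t i j)

/-- Complex `L²` inner product of scalar functions with respect to a measure. -/
def ipS {n : ℕ} (m : Measure (Pt n)) (f g : Pt n → ℂ) : ℂ := ∫ x, f x * conj (g x) ∂m

/-- Complex `L²` inner product of vector-valued functions. -/
def ipV {n : ℕ} (m : Measure (Pt n)) (f g : Pt n → Fin n → ℂ) : ℂ :=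
  ∫ x, ∑ i, f x i * conj (g x i) ∂m

/-- Complex `L²` inner product of tensor-valued functions (Frobenius product). -/
def ipT {n : ℕ} (m : Measure (Pt n)) (f g : Pt n → Matrix (Fin n) (Fin n) ℂ) : ℂ :=
  ∫ x, ∑ i, ∑ j, f x i j * conj (g x i j) ∂m

/-! ### Simplices, faces, normals -/

/-- The closed simplex with a given (finite) set of vertices; used for elements and for faces. -/
def cell {n : ℕ} (K : Finset (Pt n)) : Set (Pt n) := convexHull ℝ (K : Set (Pt n))

/-- The faces (of codimension one) of an element with `n + 1` vertices. -/
def facets {n : ℕ} (K : Finset (Pt n)) : Finset (Finset (Pt n)) := K.powersetCard n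

/-- Lebesgue measure on an element. -/
def volK {n : ℕ} (K : Finset (Pt n)) : Measure (Pt n) := volume.restrict (cell K)

/-- Surface measure on a face (the Hausdorff measure of dimension `n - 1`, normalised so that it
is the Lebesgue measure of the hyperplane). -/
def surf {n : ℕ} (F : Finset (Pt n)) : Measure (Pt n) := (μHE[n - 1]).restrict (cell F)

/-- The barycentric coordinate of `K` associated with its face `F`: the affine function that
vanishes at the vertices of `F` and is `1` at the vertex of `K` opposite to `F`. -/
def bary {n : ℕ} (K F : Finset (Pt n)) : Pt n →ᵃ[ℝ] ℝ :=
  Classical.epsilon fun l => (∀ y ∈ F, l y = 0) ∧ ∀ x ∈ K, x ∉ F → l x = 1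

/-- On a nondegenerate simplex the barycentric coordinate has its defining property. -/
theorem bary_spec {n : ℕ} {K F : Finset (Pt n)} (hK : K.card = n + 1)
    (hi : AffineIndependent ℝ (fun x : K => (x : Pt n))) (hF : F ∈ facets K) :
    (∀ y ∈ F, bary K F y = 0) ∧ ∀ x ∈ K, x ∉ F → bary K F x = 1 := by
  classical
  obtain ⟨hFK, hFc⟩ := Finset.mem_powersetCard.1 hF
  have hne : (K \ F).card = 1 := by rw [Finset.card_sdiff_of_subset hFK]; omega
  obtain ⟨z, hz⟩ := Finset.card_eq_one.1 hne
  have hzK : z ∈ K ∧ z ∉ F := by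
    have : z ∈ K \ F := by rw [hz]; simp
    simpa using this
  have htop : affineSpan ℝ (Set.range (fun x : K => (x : Pt n))) = ⊤ := by
    rw [hi.affineSpan_eq_top_iff_card_eq_finrank_add_one]; simp [hK]
  let b : AffineBasis K ℝ (Pt n) := ⟨_, hi, htop⟩
  refine Classical.epsilon_spec (p := fun l : Pt n →ᵃ[ℝ] ℝ =>
    (∀ y ∈ F, l y = 0) ∧ ∀ x ∈ K, x ∉ F → l x = 1) ⟨b.coord ⟨z, hzK.1⟩, ?_, ?_⟩
  · intro y hy
    refine b.coord_apply_ne (i := ⟨z, hzK.1⟩) (j := ⟨y, hFK hy⟩) ?_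
    intro h
    exact hzK.2 (by rw [Subtype.mk.injEq] at h; rw [h]; exact hy)
  · intro x hx hxF
    have : x ∈ K \ F := by simp [hx, hxF]
    rw [hz, Finset.mem_singleton] at this
    subst this
    exact b.coord_apply_eq ⟨x, hx⟩

/-- The `i`-th Cartesian component of the (constant) gradient of `bary K F`. -/
def baryGrad {n : ℕ} (K F : Finset (Pt n)) (i : Fin n) : ℝ :=
  (bary K F).linear (EuclideanSpace.single i 1)

/-- The barycentric coordinate as a polynomial in the Cartesian coordinates. -/
def baryPoly {n : ℕ} (K F : Finset (Pt n)) : CPoly n :=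
  MvPolynomial.C ((bary K F 0 : ℝ) : ℂ)
    + ∑ i, MvPolynomial.C ((baryGrad K F i : ℝ) : ℂ) * MvPolynomial.X i

/-- The unit normal on the face `F` of `K` that points out of `K`; it is the direction
of `-∇(bary K F)`. -/
def nrm {n : ℕ} (K F : Finset (Pt n)) (i : Fin n) : ℝ :=
  -baryGrad K F i / Real.sqrt (∑ j, baryGrad K F j ^ 2)

/-- `a · n` on the face `F` of `K`. -/
def dotN {n : ℕ} (K F : Finset (Pt n)) (a : Fin n → ℂ) : ℂ := ∑ j, a j * (nrm K F j : ℂ)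

/-- `M n` on the face `F` of `K`. -/
def mulN {n : ℕ} (K F : Finset (Pt n)) (M : Matrix (Fin n) (Fin n) ℂ) : Fin n → ℂ :=
  fun i => ∑ j, M i j * (nrm K F j : ℂ)

/-! ### Local spaces -/

/-- `A(K)`: skew-symmetric tensors with entries in `P_k`. -/
def skewSpace (n k : ℕ) : Set (PolyT n) := {a | a + a.transpose = 0 ∧ a ∈ PkT n k}

/-- The planar curl of a tensor (a vector). -/
def curlT2 (M : PolyT 2) : PolyV 2 := fun i =>
  MvPolynomial.pderiv 0 (M i 1) - MvPolynomial.pderiv 1 (M i 0)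

/-- The planar curl of a vector (a tensor). -/
def curlV2 (m : PolyV 2) : PolyT 2 := Matrix.of fun i =>
  ![-MvPolynomial.pderiv 1 (m i), MvPolynomial.pderiv 0 (m i)]

/-- The row-wise curl of a tensor in three dimensions. -/
def curlT3 (M : PolyT 3) : PolyT 3 := Matrix.of fun i =>
  ![MvPolynomial.pderiv 1 (M i 2) - MvPolynomial.pderiv 2 (M i 1),
    MvPolynomial.pderiv 2 (M i 0) - MvPolynomial.pderiv 0 (M i 2),
    MvPolynomial.pderiv 0 (M i 1) - MvPolynomial.pderiv 1 (M i 0)]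

/-- The scalar bubble in two dimensions. -/
def bubble2 (K : Finset (Pt 2)) : CPoly 2 := ∏ F ∈ facets K, baryPoly K F

open scoped Classical in
/-- The bubble matrix in three dimensions. -/
def bubble3 (K : Finset (Pt 3)) : PolyT 3 := Matrix.of fun i j =>
  ∑ F ∈ facets K, (∏ F' ∈ (facets K).erase F, baryPoly K F')
    * MvPolynomial.C ((baryGrad K F i * baryGrad K F j : ℝ) : ℂ)

/-- `B(K) = ∇ × ((∇ × A(K)) b_K)`, for `n = 2` and `n = 3`. -/
def bubbleSpace : (n : ℕ) → (k : ℕ) → Finset (Pt n) → Set (PolyT n)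
  | 2, k, K => {t | ∃ a ∈ skewSpace 2 k, t = curlV2 fun i => curlT2 a i * bubble2 K}
  | 3, k, K => {t | ∃ a ∈ skewSpace 3 k, t = curlT3 (curlT3 a * bubble3 K)}
  | _, _, _ => {0}

/-- `V(K) = [P_k]ⁿˣⁿ + B(K)`. -/
def stressSpace (n k : ℕ) (K : Finset (Pt n)) : Set (PolyT n) :=
  {t | ∃ p ∈ PkT n k, ∃ b ∈ bubbleSpace n k K, t = p + b}

/-! ### The physical problem -/

/-- The physical constants and the Laplace parameter; the conditions on the Lamé constants say
that Hooke's tensor is positive definite. -/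
structure Coeff (n : ℕ) where
  mu : ℝ
  lam : ℝ
  rhoE : ℝ
  rhoF : ℝ
  c : ℝ
  s : ℂ
  mu_pos : 0 < mu
  lam_pos : 0 < n * lam + 2 * mu
  rhoE_pos : 0 < rhoE
  rhoF_pos : 0 < rhoF
  c_pos : 0 < c
  s_pos : 0 < s.re

/-- The inverse `C⁻¹` of Hooke's tensor. -/
def Coeff.hookeInv {n : ℕ} (P : Coeff n) (M : Matrix (Fin n) (Fin n) ℂ) :
    Matrix (Fin n) (Fin n) ℂ :=
  ((1 / (2 * P.mu) : ℝ) : ℂ) • M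
    - (((P.lam / (2 * P.mu * (n * P.lam + 2 * P.mu)) : ℝ) : ℂ) * M.trace) • 1

/-- The geometry: the bounded elastic region `ΩE`, a bounded region `O` that compactly contains it
and whose boundary is the artificial boundary, split into a Dirichlet and a Neumann part. -/
structure Geom (n : ℕ) where
  ΩE : Set (Pt n)
  O : Set (Pt n)
  ΓD : Set (Pt n)
  ΓN : Set (Pt n)
  isOpen_ΩE : IsOpen ΩE
  isOpen_O : IsOpen O
  bounded_O : Bornology.IsBounded O
  closure_subset : closure ΩE ⊆ O
  union_eq : ΓD ∪ ΓN = frontier O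
  disj : Disjoint ΓD ΓN

/-- The acoustic region. -/
def Geom.ΩA {n : ℕ} (D : Geom n) : Set (Pt n) := D.O \ closure D.ΩE

/-- The interface. -/
def Geom.Γ {n : ℕ} (D : Geom n) : Set (Pt n) := frontier D.ΩE

/-- The data: the sources, the boundary data, and the traces on the interface of the incident
field `v^inc` and of its gradient. -/
structure Data (n : ℕ) where
  fE : Pt n → Fin n → ℂ
  fA : Pt n → ℂ
  gD : Pt n → ℂ
  gN : Pt n → ℂ
  vinc : Pt n → ℂ
  gradVinc : Pt n → Fin n → ℂ

/-- The fields `σ, u, γ, q, v`, with `gradU = ∇u`, `divσ = ∇·σ`, `gradV = ∇v`, `divq = ∇·q`, and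
with the traces `σT, uT, qT, vT` on the mesh skeleton (of `σT` and `qT` only the normal components
matter). -/
structure Fields (n : ℕ) where
  σ : Pt n → Matrix (Fin n) (Fin n) ℂ
  u : Pt n → Fin n → ℂ
  γ : Pt n → Matrix (Fin n) (Fin n) ℂ
  q : Pt n → Fin n → ℂ
  v : Pt n → ℂ
  gradU : Pt n → Matrix (Fin n) (Fin n) ℂ
  divσ : Pt n → Fin n → ℂ
  gradV : Pt n → Fin n → ℂ
  divq : Pt n → ℂ
  σT : Pt n → Matrix (Fin n) (Fin n) ℂ
  uT : Pt n → Fin n → ℂ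
  qT : Pt n → Fin n → ℂ
  vT : Pt n → ℂ

/-- The `i`-th partial derivative of a smooth test function. -/
def pd {n : ℕ} (i : Fin n) (φ : Pt n → ℂ) (x : Pt n) : ℂ :=
  fderiv ℝ φ x (EuclideanSpace.single i 1)

/-- `v ∈ H¹(Ω)` with weak gradient `G`. -/
def IsH1 {n : ℕ} (Ω : Set (Pt n)) (v : Pt n → ℂ) (G : Pt n → Fin n → ℂ) : Prop :=
  MemLp v 2 (volume.restrict Ω) ∧ (∀ i, MemLp (fun x => G x i) 2 (volume.restrict Ω)) ∧
  ∀ φ : Pt n → ℂ, ContDiff ℝ ∞ φ → HasCompactSupport φ → tsupport φ ⊆ Ω →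
    ∀ i, ∫ x in Ω, v x * pd i φ x = -∫ x in Ω, G x i * φ x

/-- `q ∈ H(div; Ω)` with weak divergence `d`. -/
def IsHdiv {n : ℕ} (Ω : Set (Pt n)) (q : Pt n → Fin n → ℂ) (d : Pt n → ℂ) : Prop :=
  (∀ i, MemLp (fun x => q x i) 2 (volume.restrict Ω)) ∧ MemLp d 2 (volume.restrict Ω) ∧
  ∀ φ : Pt n → ℂ, ContDiff ℝ ∞ φ → HasCompactSupport φ → tsupport φ ⊆ Ω →
    ∫ x in Ω, ∑ i, q x i * pd i φ x = -∫ x in Ω, d x * φ x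

/-- `vT` is the trace on the boundaries of the elements of `T` of the `H¹` function `v` with
gradient `G`, characterised by Green's formula. -/
def IsTrace {n : ℕ} (T : Finset (Finset (Pt n))) (v : Pt n → ℂ) (G : Pt n → Fin n → ℂ)
    (vT : Pt n → ℂ) : Prop :=
  ∀ K ∈ T, (∀ F ∈ facets K, MemLp vT 2 (surf F)) ∧
    ∀ φ : Pt n → ℂ, ContDiff ℝ ∞ φ → ∀ i,
      ∫ x, (v x * pd i φ x + G x i * φ x) ∂(volK K)
        = ∑ F ∈ facets K, ∫ x, vT x * φ x * (nrm K F i : ℂ) ∂(surf F)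

/-- `qT · n` is the normal trace on the boundaries of the elements of `T` of the `H(div)`
field `q` with divergence `d`, characterised by Green's formula. -/
def IsNormalTrace {n : ℕ} (T : Finset (Finset (Pt n))) (q : Pt n → Fin n → ℂ) (d : Pt n → ℂ)
    (qT : Pt n → Fin n → ℂ) : Prop :=
  ∀ K ∈ T, (∀ F ∈ facets K, MemLp (fun x => dotN K F (qT x)) 2 (surf F)) ∧
    ∀ φ : Pt n → ℂ, ContDiff ℝ ∞ φ →
      ∫ x, ((∑ i, q x i * pd i φ x) + d x * φ x) ∂(volK K)
        = ∑ F ∈ facets K, ∫ x, dotN K F (qT x) * φ x ∂(surf F)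

/-- The differential equations of the coupled system, in the weak sense. -/
structure SolvesPDE {n : ℕ} (P : Coeff n) (D : Geom n) (B : Data n) (X : Fields n) : Prop where
  u_H1 : ∀ i, IsH1 D.ΩE (fun x => X.u x i) (fun x => X.gradU x i)
  σ_Hdiv : ∀ i, IsHdiv D.ΩE (fun x => X.σ x i) (fun x => X.divσ x i)
  v_H1 : IsH1 D.ΩA X.v X.gradV
  q_Hdiv : IsHdiv D.ΩA X.q X.divq
  spin : ∀ᵐ x ∂(volume.restrict D.ΩE),
    X.γ x = (1 / 2 : ℂ) • (X.gradU x - (X.gradU x).transpose)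
  hooke : ∀ᵐ x ∂(volume.restrict D.ΩE), P.hookeInv (X.σ x) - X.gradU x + X.γ x = 0
  balance : ∀ᵐ x ∂(volume.restrict D.ΩE), ∀ i,
    -X.divσ x i + P.rhoE * P.s ^ 2 * X.u x i = B.fE x i
  velocity : ∀ᵐ x ∂(volume.restrict D.ΩA), ∀ i, X.q x i - X.gradV x i = 0
  wave : ∀ᵐ x ∂(volume.restrict D.ΩA), -X.divq x + (P.s / P.c) ^ 2 * X.v x = B.fA x

/-! ### Meshes -/

/-- The relatively open face `F` lies in the boundary portion `S`. -/
def LiesOn {n : ℕ} (S : Set (Pt n)) (F : Finset (Pt n)) : Prop :=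
  intrinsicInterior ℝ (cell F) ⊆ S

/-- `F` is a face of some element of `T`. -/
def IsFaceOf {n : ℕ} (T : Finset (Finset (Pt n))) (F : Finset (Pt n)) : Prop :=
  ∃ K ∈ T, F ∈ facets K

/-- A conforming simplicial triangulation of `Ω`. An element is given by its vertex set. -/
structure IsTriangulation {n : ℕ} (T : Finset (Finset (Pt n))) (Ω : Set (Pt n)) : Prop where
  card : ∀ K ∈ T, K.card = n + 1
  indep : ∀ K ∈ T, AffineIndependent ℝ (fun x : K => (x : Pt n))
  conforming : ∀ K ∈ T, ∀ K' ∈ T,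
    cell K ∩ cell K' = convexHull ℝ ((K : Set (Pt n)) ∩ (K' : Set (Pt n)))
  cover : interior (⋃ K ∈ T, cell K) = Ω

/-- Regularity with constant `κ` and mesh size `h`: every element contains a ball of radius
`h_K / κ`, and `h_K ≤ h ≤ κ h_K`, where `h_K` is the diameter of the element `K`. -/
def IsRegularMesh {n : ℕ} (κ h : ℝ) (T : Finset (Finset (Pt n))) : Prop :=
  ∀ K ∈ T, (∃ x, Metric.closedBall x (Metric.diam (cell K) / κ) ⊆ cell K) ∧
    Metric.diam (cell K) ≤ h ∧ h ≤ κ * Metric.diam (cell K)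

/-- `TE` and `TA` are regular triangulations of the two regions, with common mesh size `h`,
compatible along the interface, and resolving the splitting of the artificial boundary. -/
structure IsMeshPair {n : ℕ} (D : Geom n) (κ h : ℝ) (TE TA : Finset (Finset (Pt n))) :
    Prop where
  h_pos : 0 < h
  triE : IsTriangulation TE D.ΩE
  triA : IsTriangulation TA D.ΩA
  regE : IsRegularMesh κ h TE
  regA : IsRegularMesh κ h TA
  compatible : ∀ F, LiesOn D.Γ F → (IsFaceOf TE F ↔ IsFaceOf TA F)
  split : ∀ F, IsFaceOf TA F → LiesOn (frontier D.O) F → LiesOn D.ΓD F ∨ LiesOn D.ΓN F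

/-- A stabilization function on `∂T` (it may take two values on an interior face), with values
between `τ₀` and `τ₁`. -/
def IsStab {n : ℕ} (τ₀ τ₁ : ℝ) (T : Finset (Finset (Pt n))) (τ : Finset (Pt n) → Pt n → ℝ) :
    Prop :=
  ∀ K ∈ T, Measurable (τ K) ∧ ∀ F ∈ facets K, ∀ x ∈ cell F, τ₀ ≤ τ K x ∧ τ K x ≤ τ₁

/-- The traces of the exact fields on the skeleton, and the transmission and boundary conditions;
on a face of the interface, `K` is the elastic and `K'` the acoustic element, so that `nrm K F` is
the normal `n_E` and `nrm K' F` the normal `n_A`. -/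
structure HasTraces {n : ℕ} (P : Coeff n) (D : Geom n) (B : Data n)
    (TE TA : Finset (Finset (Pt n))) (X : Fields n) : Prop where
  u_tr : ∀ i, IsTrace TE (fun x => X.u x i) (fun x => X.gradU x i) (fun x => X.uT x i)
  σ_tr : ∀ i, IsNormalTrace TE (fun x => X.σ x i) (fun x => X.divσ x i) (fun x => X.σT x i)
  v_tr : IsTrace TA X.v X.gradV X.vT
  q_tr : IsNormalTrace TA X.q X.divq X.qT
  kinematic : ∀ K ∈ TE, ∀ K' ∈ TA, ∀ F ∈ facets K, F ∈ facets K' → LiesOn D.Γ F →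
    ∀ᵐ x ∂(surf F),
      dotN K' F (X.qT x) - P.s * dotN K F (X.uT x) = -dotN K' F (B.gradVinc x)
  dynamic : ∀ K ∈ TE, ∀ K' ∈ TA, ∀ F ∈ facets K, F ∈ facets K' → LiesOn D.Γ F →
    ∀ᵐ x ∂(surf F), ∀ i,
      -mulN K F (X.σT x) i + P.rhoF * P.s * X.vT x * (nrm K' F i : ℂ)
        = -(P.rhoF * P.s * B.vinc x * (nrm K' F i : ℂ))
  dirichlet : ∀ K ∈ TA, ∀ F ∈ facets K, LiesOn D.ΓD F → ∀ᵐ x ∂(surf F), X.vT x = B.gD x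
  neumann : ∀ K ∈ TA, ∀ F ∈ facets K, LiesOn D.ΓN F →
    ∀ᵐ x ∂(surf F), dotN K F (X.qT x) = B.gN x

/-! ### The HDG scheme -/

/-- The discrete unknowns: one polynomial per element for the volume unknowns, and one per face for
the numerical traces `uHat` and `vHat`. -/
structure Discrete (n : ℕ) where
  σ : Finset (Pt n) → PolyT n
  u : Finset (Pt n) → PolyV n
  γ : Finset (Pt n) → PolyT n
  uHat : Finset (Pt n) → PolyV n
  q : Finset (Pt n) → PolyV n
  v : Finset (Pt n) → CPoly n
  vHat : Finset (Pt n) → CPoly n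

/-- The product of the spaces `V_h, W_h^E, A_h, M_h` (vector), `W_h^A, W_h, M_h` (scalar). It
serves as trial and as test space. -/
structure InSpaces {n : ℕ} (k : ℕ) (TE TA : Finset (Finset (Pt n))) (Y : Discrete n) : Prop where
  σ : ∀ K ∈ TE, Y.σ K ∈ stressSpace n k K
  u : ∀ K ∈ TE, Y.u K ∈ PkV n k
  γ : ∀ K ∈ TE, Y.γ K ∈ skewSpace n k
  uHat : ∀ K ∈ TE, ∀ F ∈ facets K, Y.uHat F ∈ PkV n k
  q : ∀ K ∈ TA, Y.q K ∈ PkV n k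
  v : ∀ K ∈ TA, Y.v K ∈ PkS n k
  vHat : ∀ K ∈ TA, ∀ F ∈ facets K, Y.vHat F ∈ PkS n k

/-- The numerical flux `σ̂_h n = σ_h n - τ_E (u_h - û_h)` on the face `F` of `K`. -/
def Discrete.σHatN {n : ℕ} (Y : Discrete n) (τE : Finset (Pt n) → Pt n → ℝ)
    (K F : Finset (Pt n)) (x : Pt n) : Fin n → ℂ := fun i =>
  mulN K F (evT (Y.σ K) x) i - (τE K x : ℂ) * (evS (Y.u K i) x - evS (Y.uHat F i) x)

/-- The numerical flux `q̂_h · n = q_h · n - τ_A (v_h - v̂_h)` on the face `F` of `K`. -/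
def Discrete.qHatN {n : ℕ} (Y : Discrete n) (τA : Finset (Pt n) → Pt n → ℝ)
    (K F : Finset (Pt n)) (x : Pt n) : ℂ :=
  dotN K F (evV (Y.q K) x) - (τA K x : ℂ) * (evS (Y.v K) x - evS (Y.vHat F) x)

open scoped Classical in
/-- The HDG scheme: `Y` is a discrete solution; `Z` runs over all test functions. -/
structure SolvesHDG {n : ℕ} (P : Coeff n) (D : Geom n) (B : Data n) (k : ℕ)
    (TE TA : Finset (Finset (Pt n))) (τE τA : Finset (Pt n) → Pt n → ℝ) (Y : Discrete n) :
    Prop where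
  mem : InSpaces k TE TA Y
  hooke : ∀ Z, InSpaces k TE TA Z →
    ∑ K ∈ TE, ipT (volK K) (fun x => P.hookeInv (evT (Y.σ K) x)) (evT (Z.σ K))
      + ∑ K ∈ TE, ipV (volK K) (evV (Y.u K)) (evV (divT (Z.σ K)))
      + ∑ K ∈ TE, ipT (volK K) (evT (Y.γ K)) (evT (Z.σ K))
      - ∑ K ∈ TE, ∑ F ∈ facets K,
          ipV (surf F) (evV (Y.uHat F)) (fun x => mulN K F (evT (Z.σ K) x)) = 0
  balance : ∀ Z, InSpaces k TE TA Z →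
    ∑ K ∈ TE, ipT (volK K) (evT (Y.σ K)) (evT (gradV (Z.u K)))
      - ∑ K ∈ TE, ∑ F ∈ facets K, ipV (surf F) (Y.σHatN τE K F) (evV (Z.u K))
      + P.rhoE * P.s ^ 2 * ∑ K ∈ TE, ipV (volK K) (evV (Y.u K)) (evV (Z.u K))
      = ∑ K ∈ TE, ipV (volK K) B.fE (evV (Z.u K))
  symm : ∀ Z, InSpaces k TE TA Z →
    ∑ K ∈ TE, ipT (volK K) (evT (Y.σ K)) (evT (Z.γ K)) = 0
  conserveE : ∀ Z, InSpaces k TE TA Z →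
    ∑ K ∈ TE, ∑ F ∈ (facets K).filter (fun F => ¬ LiesOn D.Γ F),
      ipV (surf F) (Y.σHatN τE K F) (evV (Z.uHat F)) = 0
  velocity : ∀ Z, InSpaces k TE TA Z →
    ∑ K ∈ TA, ipV (volK K) (evV (Y.q K)) (evV (Z.q K))
      + ∑ K ∈ TA, ipS (volK K) (evS (Y.v K)) (evS (divV (Z.q K)))
      - ∑ K ∈ TA, ∑ F ∈ facets K,
          ipS (surf F) (evS (Y.vHat F)) (fun x => dotN K F (evV (Z.q K) x)) = 0
  wave : ∀ Z, InSpaces k TE TA Z →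
    ∑ K ∈ TA, ipV (volK K) (evV (Y.q K)) (evV (gradS (Z.v K)))
      - ∑ K ∈ TA, ∑ F ∈ facets K, ipS (surf F) (Y.qHatN τA K F) (evS (Z.v K))
      + (P.s / P.c) ^ 2 * ∑ K ∈ TA, ipS (volK K) (evS (Y.v K)) (evS (Z.v K))
      = ∑ K ∈ TA, ipS (volK K) B.fA (evS (Z.v K))
  conserveA : ∀ Z, InSpaces k TE TA Z →
    ∑ K ∈ TA, ∑ F ∈ (facets K).filter (fun F => ¬ LiesOn D.Γ F ∧ ¬ LiesOn D.ΓD F),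
        ipS (surf F) (Y.qHatN τA K F) (evS (Z.vHat F))
      = ∑ K ∈ TA, ∑ F ∈ (facets K).filter (fun F => LiesOn D.ΓN F),
          ipS (surf F) B.gN (evS (Z.vHat F))
  dirichlet : ∀ Z, InSpaces k TE TA Z →
    ∑ K ∈ TA, ∑ F ∈ (facets K).filter (fun F => LiesOn D.ΓD F),
        ipS (surf F) (evS (Y.vHat F)) (evS (Z.vHat F))
      = ∑ K ∈ TA, ∑ F ∈ (facets K).filter (fun F => LiesOn D.ΓD F),
          ipS (surf F) B.gD (evS (Z.vHat F))
  kinematic : ∀ Z, InSpaces k TE TA Z →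
    ∑ K ∈ TE, ∑ K' ∈ TA, ∑ F ∈ (facets K ∩ facets K').filter (fun F => LiesOn D.Γ F),
        ipS (surf F) (fun x => Y.qHatN τA K' F x - P.s * dotN K F (evV (Y.uHat F) x))
          (evS (Z.vHat F))
      = -∑ K ∈ TE, ∑ K' ∈ TA, ∑ F ∈ (facets K ∩ facets K').filter (fun F => LiesOn D.Γ F),
          ipS (surf F) (fun x => dotN K' F (B.gradVinc x)) (evS (Z.vHat F))
  dynamic : ∀ Z, InSpaces k TE TA Z →
    ∑ K ∈ TE, ∑ K' ∈ TA, ∑ F ∈ (facets K ∩ facets K').filter (fun F => LiesOn D.Γ F),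
        ipV (surf F) (fun x i => -Y.σHatN τE K F x i
            + P.rhoF * P.s * evS (Y.vHat F) x * (nrm K' F i : ℂ)) (evV (Z.uHat F))
      = -(P.rhoF * P.s * ∑ K ∈ TE, ∑ K' ∈ TA,
          ∑ F ∈ (facets K ∩ facets K').filter (fun F => LiesOn D.Γ F),
            ipV (surf F) (fun x i => B.vinc x * (nrm K' F i : ℂ)) (evV (Z.uHat F)))

/-! ### Projections and errors -/

/-- `(Pq, Pv)` is the HDG projection on `K`, with stabilization `τ`, of the pair `(q, v)` with
boundary traces `qT`, `vT`; on each face, `Pm` is the `L²` projection `P_M v`. -/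
def IsHDGProj {n : ℕ} (k : ℕ) (τ : Pt n → ℝ) (K : Finset (Pt n)) (q : Pt n → Fin n → ℂ)
    (v : Pt n → ℂ) (qT : Pt n → Fin n → ℂ) (vT : Pt n → ℂ) (Pq : PolyV n) (Pv : CPoly n) : Prop :=
  Pq ∈ PkV n k ∧ Pv ∈ PkS n k ∧
  (∀ r ∈ PkV n (k - 1), ipV (volK K) (evV Pq) (evV r) = ipV (volK K) q (evV r)) ∧
  (∀ w ∈ PkS n (k - 1), ipS (volK K) (evS Pv) (evS w) = ipS (volK K) v (evS w)) ∧
  ∀ F ∈ facets K, ∃ Pm ∈ PkS n k,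
    (∀ ξ ∈ PkS n k, ipS (surf F) (evS Pm) (evS ξ) = ipS (surf F) vT (evS ξ)) ∧
    ∀ ξ ∈ PkS n k,
      ipS (surf F) (fun x => dotN K F (evV Pq x) - (τ x : ℂ) * evS Pv x) (evS ξ)
        = ipS (surf F) (fun x => dotN K F (qT x) - (τ x : ℂ) * evS Pm x) (evS ξ)

/-- The projections of the exact fields. -/
structure Proj (n : ℕ) where
  σ : Finset (Pt n) → PolyT n
  u : Finset (Pt n) → PolyV n
  γ : Finset (Pt n) → PolyT n
  q : Finset (Pt n) → PolyV n
  v : Finset (Pt n) → CPoly n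

/-- `R` collects the projections of the exact fields `X`: the acoustic HDG projection of `(q, v)`,
its component-wise version for `(σ, u)` (rows of `σ` with components of `u`), and
the `L²` projection of `γ` onto `A(K)`. -/
structure IsProj {n : ℕ} (k : ℕ) (TE TA : Finset (Finset (Pt n)))
    (τE τA : Finset (Pt n) → Pt n → ℝ) (X : Fields n) (R : Proj n) : Prop where
  elastic : ∀ K ∈ TE, ∀ i, IsHDGProj k (τE K) K (fun x => X.σ x i) (fun x => X.u x i)
    (fun x => X.σT x i) (fun x => X.uT x i) (R.σ K i) (R.u K i)
  acoustic : ∀ K ∈ TA, IsHDGProj k (τA K) K X.q X.v X.qT X.vT (R.q K) (R.v K)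
  spin : ∀ K ∈ TE, R.γ K ∈ skewSpace n k ∧
    ∀ η ∈ skewSpace n k, ipT (volK K) (evT (R.γ K)) (evT η) = ipT (volK K) X.γ (evT η)

/-- Square of the `L²(T)` norm of an elementwise defined scalar. -/
def sqS {n : ℕ} (T : Finset (Finset (Pt n))) (f : Finset (Pt n) → Pt n → ℂ) : ℝ :=
  ∑ K ∈ T, ∫ x, ‖f K x‖ ^ 2 ∂(volK K)

/-- Square of the `L²(T)` norm of an elementwise defined vector field. -/
def sqV {n : ℕ} (T : Finset (Finset (Pt n))) (f : Finset (Pt n) → Pt n → Fin n → ℂ) : ℝ :=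
  ∑ K ∈ T, ∫ x, ∑ i, ‖f K x i‖ ^ 2 ∂(volK K)

/-- Square of the `L²(T)` norm of an elementwise defined tensor field. -/
def sqT {n : ℕ} (T : Finset (Finset (Pt n)))
    (f : Finset (Pt n) → Pt n → Matrix (Fin n) (Fin n) ℂ) : ℝ :=
  ∑ K ∈ T, ∫ x, ∑ i, ∑ j, ‖f K x i j‖ ^ 2 ∂(volK K)

/-- `Θ(σ, u, γ, q, v)`, the `L²` norm of all the projection errors together. -/
def Theta {n : ℕ} (TE TA : Finset (Finset (Pt n))) (X : Fields n) (R : Proj n) : ℝ :=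
  Real.sqrt (sqT TE (fun K x => X.σ x - evT (R.σ K) x) + sqV TE (fun K x => X.u x - evV (R.u K) x)
    + sqT TE (fun K x => X.γ x - evT (R.γ K) x) + sqV TA (fun K x => X.q x - evV (R.q K) x)
    + sqS TA (fun K x => X.v x - evS (R.v K) x))

/-- The projection of the error in the displacement, `e_u = Π_E u - u_h`. -/
def errU {n : ℕ} (R : Proj n) (Y : Discrete n) (K : Finset (Pt n)) (x : Pt n) : Fin n → ℂ :=
  evV (R.u K) x - evV (Y.u K) x

/-- The projection of the error in the rotation, `e_γ = Π γ - γ_h`. -/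
def errγ {n : ℕ} (R : Proj n) (Y : Discrete n) (K : Finset (Pt n)) (x : Pt n) :
    Matrix (Fin n) (Fin n) ℂ :=
  evT (R.γ K) x - evT (Y.γ K) x

/-- The piecewise constant part of `e_γ`: its mean value on each element. -/
def errγc {n : ℕ} (R : Proj n) (Y : Discrete n) (K : Finset (Pt n)) (_ : Pt n) :
    Matrix (Fin n) (Fin n) ℂ :=
  Matrix.of fun i j => ⨍ y in cell K, errγ R Y K y i j

/-- The mean-free part of `e_γ`. -/
def errγ0 {n : ℕ} (R : Proj n) (Y : Discrete n) (K : Finset (Pt n)) (x : Pt n) :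
    Matrix (Fin n) (Fin n) ℂ :=
  errγ R Y K x - errγc R Y K x

end

set_option linter.unusedSectionVars false

open Filter Topology

/-! The proof is an energy argument for the differences `eσ`, `eu`, `eγ`, `eq`, `ev` between the
projections of the exact fields and the discrete fields, completed by two special test functions for
the rotation.

Error equations. The HDG projection is designed so that subtracting the scheme from Green's formula
leaves only projection errors as data: its moment conditions absorb the volume terms
(`IsHDGProj.gradient_eq`), and its face condition gives the exact normal traces, tested against
`P_k`, the form of the numerical flux (`IsHDGProj.projFlux`). Testing the error equations with the
errors themselves yields one identity per element (`energyE`, `energyA`) with flux terms on facets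
as right-hand side. After summation these cancel across interior facets, vanish on Dirichlet facets
because the trace error is zero there, and drop out on Neumann facets. On the interface, with total
coupling `c`, the elastic side leaves `-ρ_f conj(s) c` and the acoustic side `conj(s) conj(c)`. The
weights `s` and `ρ_f s` turn the sum into `ρ_f |s|² (conj c - c)`, which is purely imaginary
(`re_sum_flux`). As `Re s > 0`, the real part of the rest is coercive in `eσ`, `eu`, `eq`, `ev` and
the stabilized jumps (`re_energy_le`).

Mean-free rotation. One term on the way, the product of `eγ` with `σ - Π_E σ`, is not controlled by
the energy. But `σ - Π_E σ` is orthogonal to constant tensors, so only `eγ - A` matters, with any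
constant `A` on each element. That quantity is reached through the bubbles: for `τ = ∇×((∇×eγ) b_K)`
integration by parts gives, up to sign, the integral of the form of `b_K` at `∇×eγ`, and the curl of
a skew tensor determines all its first derivatives, so a Poincaré inequality for polynomials applies
(`exists_bubble_test`). Moreover `τ` is divergence free with vanishing normal trace, so the first
error equation tested with a multiple of it contains neither `eu` nor the trace error and bounds `eγ
- A` by `eσ` and the projection errors (`exists_eγ_bound`). Young's inequality then absorbs the `eσ`
contribution into the energy (`exists_energy_bound`). Since the mean value is the best constant, the
first estimate follows (`exists_mean_free_bound`).

Mean rotation. The first error equation is tested with the mean of `eγ`, a constant tensor. Its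
divergence vanishes, so besides the terms already bounded only facet products with the trace error
remain. The trace error is `eu` minus a jump; trace inequalities for `eu` and for the test function
give `h⁻¹ ‖eu‖`, while the jump, bounded by the energy, meets only one trace inequality and gives
`h^{-1/2} Θ` (`exists_local_mean_bound`).

All mesh-independent constants in the polynomial inequalities come from linear algebra in finite
dimension on the unit ball, transported by scaling: a shape regular simplex lies between two
concentric balls of comparable radii, so no reference simplex is needed. -/

noncomputable section

/-! ### Square integrable vector fields: inner product, Young and Cauchy-Schwarz inequalities. -/

section SquareIntegrable

variable {α : Type*} [MeasurableSpace α] {ι : Type*} [Fintype ι] {m : Measure α}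
  {f g f' : α → ι → ℂ}

/-- Componentwise square integrability. -/
def L2F (m : Measure α) (f : α → ι → ℂ) : Prop := ∀ i, MemLp (fun x => f x i) 2 m

/-- The complex `L²` product of vector-valued functions. -/
def ip (m : Measure α) (f g : α → ι → ℂ) : ℂ := ∫ x, ∑ i, f x i * conj (g x i) ∂m

/-- The square of the `L²` norm of a vector-valued function. -/
def nsq (m : Measure α) (f : α → ι → ℂ) : ℝ := ∫ x, ∑ i, ‖f x i‖ ^ 2 ∂m

theorem L2F.add (hf : L2F m f) (hg : L2F m g) : L2F m (fun x => f x + g x) :=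
  fun i => (hf i).add (hg i)

theorem L2F.sub (hf : L2F m f) (hg : L2F m g) : L2F m (fun x => f x - g x) :=
  fun i => (hf i).sub (hg i)

theorem L2F.neg (hf : L2F m f) : L2F m (fun x => -f x) :=
  fun i => (hf i).neg

theorem L2F.smul (c : ℂ) (hf : L2F m f) : L2F m (fun x => c • f x) :=
  fun i => (hf i).const_mul c

theorem MemLp.integrable_mul_conj {f g : α → ℂ} (hf : MemLp f 2 m) (hg : MemLp g 2 m) :
    Integrable (fun x => f x * conj (g x)) m := by
  have : MemLp (fun x => conj (g x)) 2 m := by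
    refine hg.of_le (Complex.continuous_conj.comp_aestronglyMeasurable hg.1) ?_
    filter_upwards with x
    simp
  exact hf.integrable_mul this

theorem L2F.integrable_ip (hf : L2F m f) (hg : L2F m g) :
    Integrable (fun x => ∑ i, f x i * conj (g x i)) m :=
  integrable_finsetSum _ fun i _ => MemLp.integrable_mul_conj (hf i) (hg i)

theorem L2F.integrable_sq (hf : L2F m f) : Integrable (fun x => ∑ i, ‖f x i‖ ^ 2) m :=
  integrable_finsetSum _ fun i _ => (hf i).integrable_norm_pow (by norm_num)

theorem ip_add_left (hf : L2F m f) (hf' : L2F m f') (hg : L2F m g) :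
    ip m (fun x => f x + f' x) g = ip m f g + ip m f' g := by
  rw [ip, ip, ip, ← integral_add (hf.integrable_ip hg) (hf'.integrable_ip hg)]
  simp [add_mul, Finset.sum_add_distrib]

theorem ip_sub_left (hf : L2F m f) (hf' : L2F m f') (hg : L2F m g) :
    ip m (fun x => f x - f' x) g = ip m f g - ip m f' g := by
  rw [ip, ip, ip, ← integral_sub (hf.integrable_ip hg) (hf'.integrable_ip hg)]
  simp [sub_mul, Finset.sum_sub_distrib]

theorem conj_ip : conj (ip m f g) = ip m g f := by
  rw [ip, ip, ← integral_conj]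
  simp [mul_comm]

theorem ip_sub_right (hf : L2F m f) (hf' : L2F m f') (hg : L2F m g) :
    ip m g (fun x => f x - f' x) = ip m g f - ip m g f' := by
  rw [← conj_ip, ip_sub_left hf hf' hg, map_sub, conj_ip, conj_ip]

theorem ip_smul_left (c : ℂ) : ip m (fun x => c • f x) g = c * ip m f g := by
  rw [ip, ip, ← integral_const_mul]
  simp [Finset.mul_sum, mul_assoc]

theorem ip_smul_right (c : ℂ) : ip m f (fun x => c • g x) = conj c * ip m f g := by
  rw [← conj_ip, ip_smul_left, map_mul, conj_ip]

theorem ip_self : ip m f f = (nsq m f : ℂ) := by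
  rw [ip, nsq, ← integral_complex_ofReal]
  refine integral_congr_ae (Filter.Eventually.of_forall fun x => ?_)
  push_cast
  exact Finset.sum_congr rfl fun i _ => Complex.mul_conj' _

theorem nsq_nonneg : 0 ≤ nsq m f :=
  integral_nonneg fun x => Finset.sum_nonneg fun i _ => by positivity

theorem nsq_smul (c : ℂ) : nsq m (fun x => c • f x) = ‖c‖ ^ 2 * nsq m f := by
  rw [nsq, nsq, ← integral_const_mul]
  simp [mul_pow, Finset.mul_sum]

/-- Young's inequality for the `L²` product. -/
theorem norm_ip_le_young (hf : L2F m f) (hg : L2F m g) {ε : ℝ} (hε : 0 < ε) :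
    ‖ip m f g‖ ≤ ε * nsq m f + 1 / (4 * ε) * nsq m g := by
  rw [nsq, nsq, ← integral_const_mul, ← integral_const_mul,
    ← integral_add (hf.integrable_sq.const_mul _) (hg.integrable_sq.const_mul _)]
  refine norm_integral_le_of_norm_le
    ((hf.integrable_sq.const_mul _).add (hg.integrable_sq.const_mul _))
    (Filter.Eventually.of_forall fun x => ?_)
  rw [Finset.mul_sum, Finset.mul_sum, ← Finset.sum_add_distrib]
  refine (norm_sum_le _ _).trans (Finset.sum_le_sum fun i _ => ?_)
  rw [norm_mul, RCLike.norm_conj]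
  have h : ε * ‖f x i‖ ^ 2 + 1 / (4 * ε) * ‖g x i‖ ^ 2 - ‖f x i‖ * ‖g x i‖
      = ε * (‖f x i‖ - ‖g x i‖ / (2 * ε)) ^ 2 := by
    field_simp
    ring
  have : 0 ≤ ε * (‖f x i‖ - ‖g x i‖ / (2 * ε)) ^ 2 := by positivity
  linarith

/-- The optimal weight is `√y / (2√x)`, which degenerates when `x` or `y` vanishes. Both square
roots are therefore enlarged by a small `η`, whose effect on the product is at most `δ`. -/
theorem le_sqrt_mul_sqrt_of_young {a x y : ℝ} (hx : 0 ≤ x) (hy : 0 ≤ y)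
    (h : ∀ ε : ℝ, 0 < ε → a ≤ ε * x + 1 / (4 * ε) * y) : a ≤ √x * √y := by
  refine le_of_forall_pos_le_add fun δ hδ => ?_
  obtain ⟨η, hη, hηδ⟩ : ∃ η : ℝ, 0 < η ∧ (√x + √y) * η + η ^ 2 ≤ δ := by
    refine ⟨min 1 (δ / (√x + √y + 1)), by positivity, ?_⟩
    have h1 : min 1 (δ / (√x + √y + 1)) ≤ 1 := min_le_left _ _
    have h2 : min 1 (δ / (√x + √y + 1)) ≤ δ / (√x + √y + 1) := min_le_right _ _
    have h0 : 0 < min 1 (δ / (√x + √y + 1)) := by positivity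
    rw [le_div_iff₀ (by positivity)] at h2
    nlinarith [Real.sqrt_nonneg x, Real.sqrt_nonneg y]
  have hX : 0 < √x + η := by positivity
  have hY : 0 < √y + η := by positivity
  have := h ((√y + η) / (2 * (√x + η))) (by positivity)
  have e1 : (√y + η) / (2 * (√x + η)) * x ≤ (√y + η) / (2 * (√x + η)) * (√x + η) ^ 2 := by
    gcongr
    nlinarith [Real.sq_sqrt hx, Real.sqrt_nonneg x]
  have e2 : 1 / (4 * ((√y + η) / (2 * (√x + η)))) * y
      ≤ 1 / (4 * ((√y + η) / (2 * (√x + η)))) * (√y + η) ^ 2 := by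
    gcongr
    nlinarith [Real.sq_sqrt hy, Real.sqrt_nonneg y]
  have e3 : (√y + η) / (2 * (√x + η)) * (√x + η) ^ 2 + 
      1 / (4 * ((√y + η) / (2 * (√x + η)))) * (√y + η) ^ 2 = (√x + η) * (√y + η) := by
    field_simp
    ring
  nlinarith

/-- The Cauchy-Schwarz inequality. -/
theorem norm_ip_le (hf : L2F m f) (hg : L2F m g) : ‖ip m f g‖ ≤ √(nsq m f) * √(nsq m g) :=
  le_sqrt_mul_sqrt_of_young nsq_nonneg nsq_nonneg fun _ hε => norm_ip_le_young hf hg hε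

theorem ip_eq_zero_of_nsq_right (hf : L2F m f) (hg : L2F m g) (h : nsq m g = 0) :
    ip m f g = 0 := by
  have := norm_ip_le hf hg
  rw [h] at this
  simpa using this

theorem nsq_add_le (hf : L2F m f) (hg : L2F m g) :
    nsq m (fun x => f x + g x) ≤ 2 * nsq m f + 2 * nsq m g := by
  rw [nsq, nsq, nsq, ← integral_const_mul, ← integral_const_mul,
    ← integral_add (hf.integrable_sq.const_mul _) (hg.integrable_sq.const_mul _)]
  refine integral_mono (hf.add hg).integrable_sq
    ((hf.integrable_sq.const_mul _).add (hg.integrable_sq.const_mul _)) fun x => ?_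
  simp only [Finset.mul_sum, ← Finset.sum_add_distrib, Pi.add_apply]
  refine Finset.sum_le_sum fun i _ => ?_
  have h1 := norm_add_le (f x i) (g x i)
  have h2 := norm_nonneg (f x i + g x i)
  nlinarith [sq_nonneg (‖f x i‖ - ‖g x i‖)]

theorem nsq_sub_le (hf : L2F m f) (hg : L2F m g) :
    nsq m (fun x => f x - g x) ≤ 2 * nsq m f + 2 * nsq m g := by
  have := nsq_add_le hf hg.neg
  simpa [nsq, sub_eq_add_neg] using this

theorem nsq_eq_zero_iff (hf : L2F m f) : nsq m f = 0 ↔ ∀ᵐ x ∂m, f x = 0 := by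
  rw [nsq, integral_eq_zero_iff_of_nonneg
    (fun x => Finset.sum_nonneg fun i _ => by positivity) hf.integrable_sq]
  refine Filter.eventually_congr (Filter.Eventually.of_forall fun x => ?_)
  simp only [Pi.zero_apply]
  rw [Finset.sum_eq_zero_iff_of_nonneg (fun i _ => by positivity)]
  simp [funext_iff]

end SquareIntegrable

/-! ### Tensor and scalar fields as vector fields, so that one theory serves all three. -/

section Conversions

variable {n : ℕ}

/-- A tensor field as a vector field indexed by pairs. -/
def flat (f : Pt n → Matrix (Fin n) (Fin n) ℂ) (x : Pt n) (p : Fin n × Fin n) : ℂ := f x p.1 p.2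

/-- A scalar field as a vector field with one component. -/
def one (f : Pt n → ℂ) (x : Pt n) (_ : Unit) : ℂ := f x

theorem ipT_eq (m : Measure (Pt n)) (f g : Pt n → Matrix (Fin n) (Fin n) ℂ) :
    ipT m f g = ip m (flat f) (flat g) := by
  simp [ipT, ip, flat, Fintype.sum_prod_type]

theorem ipS_eq (m : Measure (Pt n)) (f g : Pt n → ℂ) : ipS m f g = ip m (one f) (one g) := by
  simp [ipS, ip, one]

theorem sqT_eq (T : Finset (Finset (Pt n)))
    (f : Finset (Pt n) → Pt n → Matrix (Fin n) (Fin n) ℂ) :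
    sqT T f = ∑ K ∈ T, nsq (volK K) (flat (f K)) := by
  simp [sqT, nsq, flat, Fintype.sum_prod_type]

theorem sqV_eq (T : Finset (Finset (Pt n))) (f : Finset (Pt n) → Pt n → Fin n → ℂ) :
    sqV T f = ∑ K ∈ T, nsq (volK K) (f K) := rfl

theorem sqS_eq (T : Finset (Finset (Pt n))) (f : Finset (Pt n) → Pt n → ℂ) :
    sqS T f = ∑ K ∈ T, nsq (volK K) (one (f K)) := by
  simp [sqS, nsq, one]

end Conversions

/-! ### Polynomials as functions: conjugation, derivatives, degrees, rescaling. -/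

section PolynomialFunctions

variable {n : ℕ}

@[simp] theorem evS_add (p q : CPoly n) (x : Pt n) : evS (p + q) x = evS p x + evS q x := by
  simp [evS]
@[simp] theorem evS_sub (p q : CPoly n) (x : Pt n) : evS (p - q) x = evS p x - evS q x := by
  simp [evS]
@[simp] theorem evS_mul (p q : CPoly n) (x : Pt n) : evS (p * q) x = evS p x * evS q x := by
  simp [evS]
@[simp] theorem evS_neg (p : CPoly n) (x : Pt n) : evS (-p) x = -evS p x := by
  simp [evS]
@[simp] theorem evS_zero (x : Pt n) : evS (0 : CPoly n) x = 0 := by simp [evS]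
@[simp] theorem evS_C (c : ℂ) (x : Pt n) : evS (MvPolynomial.C c : CPoly n) x = c := by simp [evS]
@[simp] theorem evS_X (i : Fin n) (x : Pt n) : evS (MvPolynomial.X i : CPoly n) x = x i := by
  simp [evS]
@[simp] theorem evS_sum {ι : Type*} (s : Finset ι) (p : ι → CPoly n) (x : Pt n) :
    evS (∑ i ∈ s, p i) x = ∑ i ∈ s, evS (p i) x := by simp [evS]
@[simp] theorem evS_prod {ι : Type*} (s : Finset ι) (p : ι → CPoly n) (x : Pt n) :
    evS (∏ i ∈ s, p i) x = ∏ i ∈ s, evS (p i) x := by simp [evS]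

/-- The polynomial with complex conjugate coefficients. -/
def conjP (p : CPoly n) : CPoly n := MvPolynomial.map (starRingEnd ℂ) p

-- Points have real coordinates, so conjugating coefficients conjugates values. Green's formulas
-- without conjugation, applied to `conjP p`, thus become statements about sesquilinear products.
@[simp] theorem evS_conjP (p : CPoly n) (x : Pt n) : evS (conjP p) x = conj (evS p x) := by
  simp only [evS, conjP, MvPolynomial.eval_map]
  rw [← MvPolynomial.coe_eval₂Hom, MvPolynomial.eval, ← RingHom.comp_apply,
    MvPolynomial.comp_eval₂Hom]
  simp

@[simp] theorem pderiv_conjP (p : CPoly n) (i : Fin n) :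
    MvPolynomial.pderiv i (conjP p) = conjP (MvPolynomial.pderiv i p) :=
  MvPolynomial.pderiv_map

@[fun_prop] theorem contDiff_evS (p : CPoly n) : ContDiff ℝ ∞ (evS p) := by
  induction p using MvPolynomial.induction_on with
  | C c =>
    have : evS (MvPolynomial.C c : CPoly n) = fun _ => c := by ext; simp
    rw [this]; fun_prop
  | add p q hp hq =>
    have : evS (p + q) = fun x => evS p x + evS q x := by ext; simp
    rw [this]; fun_prop
  | mul_X p i hp =>
    have : evS (p * MvPolynomial.X i) = fun x : Pt n => evS p x * Complex.ofRealCLM (x i) := by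
      ext; simp
    rw [this]; fun_prop

@[fun_prop] theorem continuous_evS (p : CPoly n) : Continuous (evS p) := (contDiff_evS p).continuous

theorem hasFDerivAt_evS (p : CPoly n) (x : Pt n) :
    ∃ L : Pt n →L[ℝ] ℂ, HasFDerivAt (evS p) L x ∧
      ∀ v, L v = ∑ i, (v i : ℂ) * evS (MvPolynomial.pderiv i p) x := by
  induction p using MvPolynomial.induction_on with
  | C c =>
    refine ⟨0, ?_, ?_⟩
    · have : evS (MvPolynomial.C c : CPoly n) = fun _ => c := by ext; simp
      rw [this]; exact hasFDerivAt_const _ _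
    · simp
  | add p q hp hq =>
    obtain ⟨L, hL, hL'⟩ := hp
    obtain ⟨M, hM, hM'⟩ := hq
    refine ⟨L + M, ?_, ?_⟩
    · have : evS (p + q) = evS p + evS q := by ext; simp
      rw [this]; exact hL.add hM
    · intro v
      simp [hL', hM', mul_add, Finset.sum_add_distrib]
  | mul_X p i hp =>
    obtain ⟨L, hL, hL'⟩ := hp
    have h2 : HasFDerivAt (fun x : Pt n => (x i : ℂ))
        (Complex.ofRealCLM.comp (EuclideanSpace.proj i : Pt n →L[ℝ] ℝ)) x :=
      (Complex.ofRealCLM.comp (EuclideanSpace.proj i : Pt n →L[ℝ] ℝ)).hasFDerivAt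
    have h3 := hL.mul h2
    refine ⟨evS p x • (Complex.ofRealCLM.comp (EuclideanSpace.proj i : Pt n →L[ℝ] ℝ))
        + (x i : ℂ) • L, ?_, ?_⟩
    · have : evS (p * MvPolynomial.X i) = fun x : Pt n => evS p x * (x i : ℂ) := by
        ext; simp
      rw [this]; exact h3
    · intro v
      simp [hL', mul_add, Finset.sum_add_distrib, MvPolynomial.pderiv_X, Pi.single_apply,
        Finset.mul_sum, apply_ite evS, ite_apply]
      rw [mul_comm]
      congr 1
      exact Finset.sum_congr rfl fun j _ => by ring

theorem pd_evS (p : CPoly n) (i : Fin n) (x : Pt n) :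
    pd i (evS p) x = evS (MvPolynomial.pderiv i p) x := by
  obtain ⟨L, hL, hL'⟩ := hasFDerivAt_evS p x
  rw [pd, hL.fderiv, hL', Finset.sum_eq_single i (fun j _ hj => by simp [hj]) (by simp)]
  simp

theorem PkS_add {k : ℕ} {p q : CPoly n} (hp : p ∈ PkS n k) (hq : q ∈ PkS n k) : p + q ∈ PkS n k :=
  (MvPolynomial.totalDegree_add _ _).trans (max_le hp hq)
theorem PkS_sub {k : ℕ} {p q : CPoly n} (hp : p ∈ PkS n k) (hq : q ∈ PkS n k) : p - q ∈ PkS n k :=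
  (MvPolynomial.totalDegree_sub _ _).trans (max_le hp hq)
theorem PkS_zero {k : ℕ} : (0 : CPoly n) ∈ PkS n k := by simp [PkS]
theorem PkS_C {k : ℕ} (c : ℂ) : (MvPolynomial.C c : CPoly n) ∈ PkS n k := by simp [PkS]
theorem PkS_sum {k : ℕ} {ι : Type*} {s : Finset ι} {p : ι → CPoly n}
    (h : ∀ i ∈ s, p i ∈ PkS n k) : ∑ i ∈ s, p i ∈ PkS n k :=
  MvPolynomial.totalDegree_finsetSum_le h
theorem PkS_mul {k l : ℕ} {p q : CPoly n} (hp : p ∈ PkS n k) (hq : q ∈ PkS n l) :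
    p * q ∈ PkS n (k + l) :=
  (MvPolynomial.totalDegree_mul _ _).trans (add_le_add hp hq)
theorem PkS_C_mul {k : ℕ} (c : ℂ) {p : CPoly n} (hp : p ∈ PkS n k) :
    MvPolynomial.C c * p ∈ PkS n k := by
  simpa using PkS_mul (PkS_C (k := 0) c) hp
theorem PkS_mono {k l : ℕ} (h : k ≤ l) {p : CPoly n} (hp : p ∈ PkS n k) : p ∈ PkS n l :=
  le_trans hp h

theorem PkS_pderiv {k : ℕ} {p : CPoly n} (i : Fin n) (hp : p ∈ PkS n k) :
    MvPolynomial.pderiv i p ∈ PkS n (k - 1) := by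
  rw [MvPolynomial.as_sum p, map_sum]
  refine PkS_sum fun s hs => ?_
  rw [MvPolynomial.pderiv_monomial]
  -- Only monomials that contain the variable survive differentiation, and for these the degree
  -- drops by one. If `k = 0` there are none, and truncated subtraction does no harm.
  by_cases hsi : s i = 0
  · simp [hsi, PkS_zero]
  refine (MvPolynomial.totalDegree_monomial_le _ _).trans ?_
  have h1 : (s.sum fun _ e => e) ≤ k := (MvPolynomial.le_totalDegree hs).trans hp
  have h2 : Finsupp.single i 1 ≤ s := by
    rw [Finsupp.single_le_iff]; omega
  have h3 := Finsupp.sum_add_index' (f := s - Finsupp.single i 1) (g := Finsupp.single i 1)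
    (h := fun _ e => e) (fun _ => rfl) (fun _ _ _ => rfl)
  rw [tsub_add_cancel_of_le h2, Finsupp.sum_single_index rfl] at h3
  have h4 : ((s - Finsupp.single i 1).sum fun _ => id)
    = (s - Finsupp.single i 1).sum fun _ e => e := rfl
  omega

/-- The polynomial `y ↦ p (x + r y)`. -/
def rescale (x : Pt n) (r : ℝ) (p : CPoly n) : CPoly n :=
  MvPolynomial.aeval (fun i => (MvPolynomial.C (x i : ℂ) + MvPolynomial.C (r : ℂ) *
    MvPolynomial.X i : CPoly n)) p

theorem evS_rescale (x : Pt n) (r : ℝ) (p : CPoly n) (y : Pt n) :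
    evS (rescale x r p) y = evS p (x + r • y) := by
  induction p using MvPolynomial.induction_on with
  | C c => simp [rescale, MvPolynomial.algebraMap_eq]
  | add p q hp hq => 
    simp only [rescale, map_add, evS_add] at *
    rw [hp, hq]
  | mul_X p i hp => 
    simp only [rescale, map_mul, evS_mul, MvPolynomial.aeval_X] at *
    rw [hp]; simp

theorem PkS_rescale (x : Pt n) (r : ℝ) {k : ℕ} {p : CPoly n} (hp : p ∈ PkS n k) :
    rescale x r p ∈ PkS n k := by
  rw [rescale, MvPolynomial.aeval_def, MvPolynomial.eval₂_eq]
  refine PkS_sum fun s hs => ?_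
  refine PkS_C_mul _ ?_
  have h1 : (s.sum fun _ e => e) ≤ k := (MvPolynomial.le_totalDegree hs).trans hp
  refine PkS_mono h1 ?_
  refine (MvPolynomial.totalDegree_finsetProd _ _).trans (Finset.sum_le_sum fun i _ => ?_)
  refine (MvPolynomial.totalDegree_pow _ _).trans ?_
  have : (MvPolynomial.C (x i : ℂ) + MvPolynomial.C (r : ℂ) * MvPolynomial.X i : CPoly n)
      ∈ PkS n 1 := PkS_add (PkS_C _) (PkS_C_mul _ (by simp [PkS]))
  calc _ ≤ s i * 1 := Nat.mul_le_mul_left _ this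
    _ = _ := by simp

theorem pderiv_rescale (x : Pt n) (r : ℝ) (p : CPoly n) (i : Fin n) :
    MvPolynomial.pderiv i (rescale x r p)
      = MvPolynomial.C (r : ℂ) * rescale x r (MvPolynomial.pderiv i p) := by
  induction p using MvPolynomial.induction_on with
  | C c => simp [rescale, MvPolynomial.algebraMap_eq]
  | add p q hp hq => 
    simp only [rescale, map_add] at *
    rw [hp, hq]; ring
  | mul_X p j hp => 
    simp only [rescale, map_mul, MvPolynomial.aeval_X, Derivation.leibniz, smul_eq_mul, map_add] at *
    rw [hp]
    by_cases hij : i = j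
    · subst hij; simp; ring
    · simp [MvPolynomial.pderiv_X_of_ne (Ne.symm hij)]; ring

/-- The ball contains a cube, a product of infinite sets, and a polynomial vanishing on such a
product is zero. The side `r / (n + 1)` keeps the cube inside the ball and makes sense for `n = 0`
too. -/
theorem eq_zero_of_evS_eq_zero {p : CPoly n} {r : ℝ} (hr : 0 < r)
    (h : ∀ x ∈ Metric.ball (0 : Pt n) r, evS p x = 0) : p = 0 := by
  have hn : (0 : ℝ) < n + 1 := by positivity
  refine MvPolynomial.funext_set (s := fun _ : Fin n => Complex.ofReal '' Set.Ioo 0 (r / (n + 1)))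
    (fun i => ?_) fun x hx => ?_
  · exact (Set.Ioo_infinite (by positivity)).image Complex.ofReal_injective.injOn
  · simp only [Set.mem_pi, Set.mem_univ, forall_true_left, Set.mem_image] at hx
    choose y hy hyx using hx
    have := h (WithLp.toLp 2 y) (by
      rw [mem_ball_zero_iff, EuclideanSpace.norm_eq]
      rw [Real.sqrt_lt' hr]
      calc ∑ i, ‖y i‖ ^ 2 ≤ ∑ i : Fin n, (r / (n + 1)) ^ 2 := by
            gcongr with i
            rw [Real.norm_of_nonneg (hy i).1.le]
            exact (hy i).2.le
        _ = n * (r / (n + 1)) ^ 2 := by simp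
        _ < r ^ 2 := by
            rw [div_pow, mul_div_assoc', div_lt_iff₀ (by positivity), mul_comm]
            gcongr
            nlinarith)
    simp only [evS, hyx] at this
    rw [← funext hyx]
    simpa [funext hyx] using this

/-- In characteristic zero a nonconstant monomial leaves a nonzero multiple of its coefficient in
some partial derivative. -/
theorem eq_C_of_pderiv_eq_zero {p : CPoly n} (h : ∀ i, MvPolynomial.pderiv i p = 0) :
    p = MvPolynomial.C (MvPolynomial.coeff 0 p) := by
  ext s
  rw [MvPolynomial.coeff_C]
  split_ifs with hs
  · rw [hs]
  · obtain ⟨i, hi⟩ : ∃ i, s i ≠ 0 := by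
      by_contra! hc
      exact hs (Finsupp.ext fun i => by simp [hc i])
    have h1 := congrArg (MvPolynomial.coeff (s - Finsupp.single i 1)) (h i)
    rw [MvPolynomial.coeff_pderiv] at h1
    have h2 : Finsupp.single i 1 ≤ s := by
      rw [Finsupp.single_le_iff]; omega
    rw [tsub_add_cancel_of_le h2] at h1
    rcases mul_eq_zero.1 h1 with h1 | h1
    · exact h1
    · exfalso
      exact Nat.cast_add_one_ne_zero _ h1

end PolynomialFunctions

/-! ### Scale invariant estimates for polynomials on concentric balls. -/

section BallEstimates

variable {n : ℕ}

theorem memLp_of_continuous {α : Type*} [TopologicalSpace α] [T2Space α] [MeasurableSpace α]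
    [OpensMeasurableSpace α] [SecondCountableTopologyEither α ℂ] {m : Measure α}
    {S : Set α} (hS : IsCompact S) (hm : m S ≠ ⊤)
    {f : α → ℂ} (hf : Continuous f) (p : ENNReal) : MemLp f p (m.restrict S) := by
  have : IsFiniteMeasure (m.restrict S) := ⟨by simpa using hm.lt_top⟩
  obtain ⟨C, hC⟩ := hS.exists_bound_of_continuousOn hf.continuousOn
  refine MemLp.of_bound hf.aestronglyMeasurable C ?_
  exact (ae_restrict_mem hS.measurableSet).mono fun x hx => hC x hx

/-- By the kernel condition `g` factors through the range of `f`, and the factor is continuous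
because that range is finite dimensional. The constants of the polynomial inequalities on the unit
ball originate here. -/
theorem LinearMap.exists_bound_of_ker_le {V E E' : Type*} [AddCommGroup V] [Module ℂ V]
    [FiniteDimensional ℂ V] [NormedAddCommGroup E] [NormedSpace ℂ E] [NormedAddCommGroup E']
    [NormedSpace ℂ E'] (f : V →ₗ[ℂ] E) (g : V →ₗ[ℂ] E')
    (h : LinearMap.ker f ≤ LinearMap.ker g) : ∃ C : ℝ, 0 < C ∧ ∀ v, ‖g v‖ ≤ C * ‖f v‖ := by
  let φ : LinearMap.range f →ₗ[ℂ] E' :=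
    ((LinearMap.ker f).liftQ g h).comp f.quotKerEquivRange.symm.toLinearMap
  have hφ : ∀ v, φ ⟨f v, LinearMap.mem_range_self f v⟩ = g v := by
    intro v
    have : f.quotKerEquivRange.symm ⟨f v, LinearMap.mem_range_self f v⟩
        = (LinearMap.ker f).mkQ v := by
      rw [LinearEquiv.symm_apply_eq]
      rfl
    simp only [φ, LinearMap.comp_apply, LinearEquiv.coe_coe, this]
    rfl
  refine ⟨‖φ.toContinuousLinearMap‖ + 1, by positivity, fun v => ?_⟩
  have := φ.toContinuousLinearMap.le_opNorm ⟨f v, LinearMap.mem_range_self f v⟩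
  rw [LinearMap.coe_toContinuousLinearMap', hφ] at this
  refine this.trans ?_
  gcongr
  · linarith
  · rfl

/-- Restriction of polynomials to a ball, as square integrable functions. -/
def toL2Ball (r : ℝ) : CPoly n →ₗ[ℂ] Lp ℂ 2 (volume.restrict (Metric.closedBall (0 : Pt n) r)) where
  toFun p := (memLp_of_continuous (isCompact_closedBall 0 r) measure_closedBall_lt_top.ne
    (continuous_evS p) 2).toLp (evS p)
  map_add' p q := by
    rw [← MemLp.toLp_add]
    congr 1
    ext; simp
  map_smul' c p := by
    rw [RingHom.id_apply, ← MemLp.toLp_const_smul]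
    congr 1
    ext; simp [evS]

theorem norm_toL2Ball_sq (r : ℝ) (p : CPoly n) :
    ‖toL2Ball r p‖ ^ 2 = ∫ x in Metric.closedBall (0 : Pt n) r, ‖evS p x‖ ^ 2 := by
  rw [← @inner_self_eq_norm_sq ℂ, MeasureTheory.L2.inner_def, ← integral_re]
  · refine integral_congr_ae ?_
    filter_upwards [MemLp.coeFn_toLp (memLp_of_continuous (isCompact_closedBall 0 r)
      measure_closedBall_lt_top.ne (continuous_evS p) 2)] with x hx
    have h2 : (toL2Ball r p : Pt n → ℂ) x = evS p x := hx
    rw [h2, inner_self_eq_norm_sq]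
  · exact MeasureTheory.L2.integrable_inner _ _

theorem toL2Ball_eq_zero {r : ℝ} (hr : 0 < r) {p : CPoly n} (h : toL2Ball r p = 0) : p = 0 := by
  have h0 := norm_toL2Ball_sq r p
  rw [h, norm_zero] at h0
  refine eq_zero_of_evS_eq_zero hr fun x hx => ?_
  have h1 : IntegrableOn (fun x => ‖evS p x‖ ^ 2) (Metric.closedBall (0 : Pt n) r) :=
    (ContinuousOn.integrableOn_compact (isCompact_closedBall 0 r) (by fun_prop))
  have h2 : ∫ x in Metric.ball (0 : Pt n) r, ‖evS p x‖ ^ 2 = 0 := by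
    refine le_antisymm ?_ (integral_nonneg fun x => by positivity)
    calc _ ≤ ∫ x in Metric.closedBall (0 : Pt n) r, ‖evS p x‖ ^ 2 :=
          setIntegral_mono_set h1 (Filter.Eventually.of_forall fun x => by positivity)
            (Filter.Eventually.of_forall fun x hx => Metric.ball_subset_closedBall hx)
      _ = 0 := by rw [← h0]; simp
  rw [integral_eq_zero_iff_of_nonneg (fun x => by positivity)
    (h1.mono_set Metric.ball_subset_closedBall)] at h2
  have h3 := MeasureTheory.Measure.eqOn_open_of_ae_eq h2 Metric.isOpen_ball
    (by fun_prop) (by fun_prop) hx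
  simpa using h3

/-- A linear quantity of a polynomial is controlled on the unit ball by other linear quantities on a
concentric ball, if it vanishes together with them. -/
theorem exists_unit_ball_bound {ι : Type*} [Fintype ι] (m : ℕ) {θ : ℝ} (hθ : 0 < θ)
    (S : CPoly n →ₗ[ℂ] CPoly n) (T : ι → CPoly n →ₗ[ℂ] CPoly n)
    (h : ∀ p, (∀ j, T j p = 0) → S p = 0) :
    ∃ C : ℝ, 0 < C ∧ ∀ p ∈ PkS n m,
      ∫ x in Metric.closedBall (0 : Pt n) 1, ‖evS (S p) x‖ ^ 2
        ≤ C * ∑ j, ∫ x in Metric.closedBall (0 : Pt n) θ, ‖evS (T j p) x‖ ^ 2 := by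
  let V := MvPolynomial.restrictTotalDegree (Fin n) ℂ m
  let f : V →ₗ[ℂ] (ι → Lp ℂ 2 (volume.restrict (Metric.closedBall (0 : Pt n) θ))) :=
    LinearMap.pi fun j => (toL2Ball θ).comp ((T j).comp V.subtype)
  let g : V →ₗ[ℂ] Lp ℂ 2 (volume.restrict (Metric.closedBall (0 : Pt n) 1)) :=
    (toL2Ball 1).comp (S.comp V.subtype)
  obtain ⟨C, hC, hb⟩ := LinearMap.exists_bound_of_ker_le f g (by
    intro v hv
    have h1 : ∀ j, T j v = 0 := fun j => toL2Ball_eq_zero hθ (congrFun hv j)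
    simp [g, h _ h1])
  refine ⟨C ^ 2, by positivity, fun p hp => ?_⟩
  have h1 := hb ⟨p, (MvPolynomial.mem_restrictTotalDegree _ _ _).2 hp⟩
  simp only [← norm_toL2Ball_sq]
  have h2 : ‖f ⟨p, (MvPolynomial.mem_restrictTotalDegree _ _ _).2 hp⟩‖ ^ 2
      ≤ ∑ j, ‖toL2Ball θ (T j p)‖ ^ 2 := by
    rw [← Real.sqrt_le_sqrt_iff (Finset.sum_nonneg fun _ _ => by positivity),
      Real.sqrt_sq (norm_nonneg _)]
    refine (pi_norm_le_iff_of_nonneg (Real.sqrt_nonneg _)).2 fun j => ?_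
    refine Real.le_sqrt_of_sq_le ?_
    exact Finset.single_le_sum (f := fun j => ‖toL2Ball θ (T j p)‖ ^ 2)
      (fun _ _ => by positivity) (Finset.mem_univ j)
  calc ‖toL2Ball 1 (S p)‖ ^ 2 ≤ (C * ‖f ⟨p, _⟩‖) ^ 2 := by gcongr; exact h1
    _ ≤ _ := by rw [mul_pow]; gcongr

/-- Substitution `y ↦ x + r y`. The factor `r⁻ⁿ` is the same on both sides of an estimate and
cancels; only the powers of `r` produced by differentiating a rescaled polynomial remain. -/
theorem setIntegral_closedBall_rescale (x : Pt n) {r : ℝ} (hr : 0 < r) (θ : ℝ) (p : CPoly n) :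
    ∫ y in Metric.closedBall (0 : Pt n) θ, ‖evS (rescale x r p) y‖ ^ 2
      = (r ^ n)⁻¹ * ∫ y in Metric.closedBall x (r * θ), ‖evS p y‖ ^ 2 := by
  simp only [evS_rescale]
  have := Measure.setIntegral_comp_smul_of_pos (volume : Measure (Pt n))
    (fun y => ‖evS p (x + y)‖ ^ 2) (Metric.closedBall (0 : Pt n) θ) hr
  rw [this, smul_closedBall' hr.ne', smul_zero, finrank_euclideanSpace_fin, smul_eq_mul,
    Real.norm_of_nonneg hr.le]
  congr 1
  have e := (measurePreserving_add_left (volume : Measure (Pt n)) x).setIntegral_preimage_emb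
    (measurableEmbedding_addLeft x) (fun y => ‖evS p y‖ ^ 2) (Metric.closedBall x (r * θ))
  rw [← e]
  congr 2
  ext y
  simp

/-- The norms of a polynomial on concentric balls are equivalent. -/
theorem exists_ball_bound (n m : ℕ) {θ : ℝ} (hθ : 0 < θ) : ∃ C : ℝ, 0 < C ∧ ∀ p ∈ PkS n m,
    ∀ (x : Pt n) (r : ℝ), 0 < r → ∫ y in Metric.closedBall x r, ‖evS p y‖ ^ 2
      ≤ C * ∫ y in Metric.closedBall x (r * θ), ‖evS p y‖ ^ 2 := by
  obtain ⟨C, hC, h⟩ := exists_unit_ball_bound m hθ LinearMap.id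
    (fun _ : Unit => (LinearMap.id : CPoly n →ₗ[ℂ] CPoly n)) (fun p h => h ())
  refine ⟨C, hC, fun p hp x r hr => ?_⟩
  have := h _ (PkS_rescale x r hp)
  simp only [LinearMap.id_apply, Finset.univ_unique, Finset.sum_singleton] at this
  rw [setIntegral_closedBall_rescale x hr, setIntegral_closedBall_rescale x hr, mul_one,
    mul_left_comm] at this
  exact le_of_mul_le_mul_left this (by positivity)

/-- Inverse inequality on balls. -/
theorem exists_ball_inverse (n m : ℕ) {θ : ℝ} (hθ : 0 < θ) : ∃ C : ℝ, 0 < C ∧ ∀ p ∈ PkS n m,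
    ∀ (x : Pt n) (r : ℝ), 0 < r → ∀ i,
      r ^ 2 * ∫ y in Metric.closedBall x r, ‖evS (MvPolynomial.pderiv i p) y‖ ^ 2
      ≤ C * ∫ y in Metric.closedBall x (r * θ), ‖evS p y‖ ^ 2 := by
  have := fun i : Fin n => exists_unit_ball_bound m hθ
    (MvPolynomial.pderiv i : Derivation ℂ (CPoly n) (CPoly n)).toLinearMap
    (fun _ : Unit => (LinearMap.id : CPoly n →ₗ[ℂ] CPoly n)) (fun p h => by
      have : p = 0 := h ()
      simp [this])
  choose C hC h using this
  -- The sum dominates the constants of all directions at once; the additional `1` keeps it positive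
  -- when `n = 0`.
  refine ⟨∑ i, C i + 1, add_pos_of_nonneg_of_pos (Finset.sum_nonneg fun i _ => (hC i).le) one_pos,
    fun p hp x r hr i => ?_⟩
  have := h i _ (PkS_rescale x r hp)
  simp only [LinearMap.id_apply, Finset.univ_unique, Finset.sum_singleton,
    Derivation.coeFn_coe, pderiv_rescale, evS_mul, evS_C, norm_mul, mul_pow,
    integral_const_mul] at this
  rw [setIntegral_closedBall_rescale x hr, setIntegral_closedBall_rescale x hr, mul_one,
    mul_left_comm, mul_left_comm (C i)] at this
  have := le_of_mul_le_mul_left this (by positivity)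
  rw [Complex.norm_real, Real.norm_of_nonneg hr.le] at this
  refine this.trans ?_
  have := Finset.single_le_sum (f := C) (fun i _ => (hC i).le) (Finset.mem_univ i)
  gcongr
  linarith

/-- Poincaré inequality for polynomials on balls. -/
theorem exists_ball_poincare (n m : ℕ) {θ : ℝ} (hθ : 0 < θ) : ∃ C : ℝ, 0 < C ∧ ∀ p ∈ PkS n m,
    ∀ (x : Pt n) (r : ℝ), 0 < r → ∫ y in Metric.closedBall x r, ‖evS p y - evS p x‖ ^ 2
      ≤ C * r ^ 2 * ∑ i, ∫ y in Metric.closedBall x (r * θ),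
        ‖evS (MvPolynomial.pderiv i p) y‖ ^ 2 := by
  obtain ⟨C, hC, h⟩ := exists_unit_ball_bound m hθ
    (LinearMap.id - (Algebra.linearMap ℂ (CPoly n)).comp (MvPolynomial.lcoeff ℂ 0))
    (fun i : Fin n => (MvPolynomial.pderiv i : Derivation ℂ (CPoly n) (CPoly n)).toLinearMap)
    (fun p h => by
      have := eq_C_of_pderiv_eq_zero h
      simpa [MvPolynomial.algebraMap_eq, sub_eq_zero] using this)
  refine ⟨C, hC, fun p hp x r hr => ?_⟩
  have := h _ (PkS_rescale x r hp)
  -- On the unit ball the constant subtracted is the constant coefficient, which for the rescaled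
  -- polynomial is the value of `p` at the centre.
  have h0 : MvPolynomial.coeff 0 (rescale x r p) = evS p x := by
    have := evS_rescale x r p 0
    simp only [smul_zero, add_zero] at this
    rw [← this, evS]
    simp [MvPolynomial.constantCoeff_eq, MvPolynomial.eval_zero']
  have h1 : ∀ y, evS (rescale x r p - MvPolynomial.C (evS p x)) y
      = evS (rescale x r (p - MvPolynomial.C (evS p x))) y := by
    intro y; simp [evS_rescale]
  simp only [Derivation.coeFn_coe, pderiv_rescale, evS_mul, evS_C, norm_mul, mul_pow,
    integral_const_mul, LinearMap.sub_apply, LinearMap.id_apply, LinearMap.comp_apply,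
    Algebra.linearMap_apply, MvPolynomial.algebraMap_eq, MvPolynomial.lcoeff_apply, h0, h1] at this
  simp only [setIntegral_closedBall_rescale x hr, mul_one] at this
  have e : C * ∑ i, ‖(r : ℂ)‖ ^ 2 * ((r ^ n)⁻¹ *
      ∫ y in Metric.closedBall x (r * θ), ‖evS (MvPolynomial.pderiv i p) y‖ ^ 2)
      = (r ^ n)⁻¹ * (C * r ^ 2 * ∑ i, ∫ y in Metric.closedBall x (r * θ),
        ‖evS (MvPolynomial.pderiv i p) y‖ ^ 2) := by
    simp only [Finset.mul_sum, Complex.norm_real, Real.norm_of_nonneg hr.le]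
    exact Finset.sum_congr rfl fun i _ => by ring
  rw [e] at this
  simpa using le_of_mul_le_mul_left this (by positivity)

end BallEstimates

/-! ### Barycentric coordinates and the geometry of a simplex. -/

section Simplices

variable {n : ℕ}

/-- `K` is the vertex set of a nondegenerate simplex of full dimension. -/
structure IsSimplex (K : Finset (Pt n)) : Prop where
  card : K.card = n + 1
  indep : AffineIndependent ℝ (fun x : K => (x : Pt n))

variable {K F : Finset (Pt n)}

/-- The vertices of a simplex form an affine basis. -/
def IsSimplex.basis (hK : IsSimplex K) : AffineBasis K ℝ (Pt n) :=
  ⟨_, hK.indep, by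
    rw [hK.indep.affineSpan_eq_top_iff_card_eq_finrank_add_one]; simp [hK.card]⟩

@[simp] theorem IsSimplex.basis_apply (hK : IsSimplex K) (z : K) : hK.basis z = z := rfl

theorem AffineBasis.affineMap_eq_sum {ι E : Type*} [Fintype ι] [AddCommGroup E]
    [Module ℝ E] (b : AffineBasis ι ℝ E) (l : E →ᵃ[ℝ] ℝ) (x : E) :
    l x = ∑ i, b.coord i x * l (b i) := by
  conv_lhs => rw [← b.affineCombination_coord_eq_self x]
  rw [Finset.map_affineCombination _ _ _ (b.sum_coord_apply_eq_one x),
    Finset.affineCombination_eq_linear_combination _ _ _ (b.sum_coord_apply_eq_one x)]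
  simp

theorem cell_eq_convexHull_range (hK : IsSimplex K) :
    cell K = convexHull ℝ (Set.range hK.basis) := by
  have : Set.range hK.basis = (K : Set (Pt n)) := by
    ext x; simp
  rw [this, cell]

open scoped Classical in
theorem erase_mem_facets (hK : IsSimplex K) {z : Pt n} (hz : z ∈ K) : K.erase z ∈ facets K := by
  rw [facets, Finset.mem_powersetCard]
  refine ⟨Finset.erase_subset _ _, ?_⟩
  rw [Finset.card_erase_of_mem hz, hK.card]; rfl

open scoped Classical in
theorem exists_opposite (hK : IsSimplex K) (hF : F ∈ facets K) :
    ∃ z ∈ K, z ∉ F ∧ F = K.erase z := by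
  obtain ⟨hFK, hFc⟩ := Finset.mem_powersetCard.1 hF
  have hne : (K \ F).card = 1 := by rw [Finset.card_sdiff_of_subset hFK, hK.card]; omega
  obtain ⟨z, hz⟩ := Finset.card_eq_one.1 hne
  have hzK : z ∈ K ∧ z ∉ F := by
    have : z ∈ K \ F := by rw [hz]; simp
    simpa using this
  refine ⟨z, hzK.1, hzK.2, ?_⟩
  ext y
  by_cases hy : y ∈ F
  · simp [hy, hFK hy]; rintro rfl; exact hzK.2 hy
  · simp only [hy, Finset.mem_erase, false_iff, not_and]
    intro h1 h2
    have : y ∈ K \ F := by simp [hy, h2]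
    rw [hz] at this
    exact h1 (by simpa using this)

open scoped Classical in
theorem facets_eq_image (hK : IsSimplex K) : facets K = K.image fun z => K.erase z := by
  ext F
  rw [Finset.mem_image]
  constructor
  · intro hF
    obtain ⟨z, hz, -, rfl⟩ := exists_opposite hK hF
    exact ⟨z, hz, rfl⟩
  · rintro ⟨z, hz, rfl⟩
    exact erase_mem_facets hK hz

open scoped Classical in
theorem sum_facets {M : Type*} [AddCommMonoid M] (hK : IsSimplex K) (f : Finset (Pt n) → M) :
    ∑ F ∈ facets K, f F = ∑ z : K, f (K.erase z) := by
  rw [facets_eq_image hK, Finset.sum_image (Finset.erase_injOn K), ← Finset.sum_coe_sort K]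

open scoped Classical in
-- An affine function is determined by its values at the vertices, so the function chosen by
-- `Classical.epsilon` is the coordinate of the affine basis. The theory of affine bases becomes
-- available.
theorem bary_erase (hK : IsSimplex K) {z : Pt n} (hz : z ∈ K) :
    bary K (K.erase z) = hK.basis.coord ⟨z, hz⟩ := by
  ext x
  obtain ⟨h1, h2⟩ := bary_spec hK.card hK.indep (erase_mem_facets hK hz)
  rw [hK.basis.affineMap_eq_sum (bary K (K.erase z)) x, Finset.sum_eq_single ⟨z, hz⟩]
  · simp [h2 z hz (by simp)]
  · intro y _ hy
    rw [hK.basis_apply, h1 y (by simpa [Subtype.ext_iff] using hy), mul_zero]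
  · simp

theorem bary_vertex (hK : IsSimplex K) (hF : F ∈ facets K) {y : Pt n} (hy : y ∈ F) :
    bary K F y = 0 := (bary_spec hK.card hK.indep hF).1 y hy

theorem bary_opposite (hK : IsSimplex K) (hF : F ∈ facets K) {y : Pt n} (hy : y ∈ K) (hyF : y ∉ F) :
    bary K F y = 1 := (bary_spec hK.card hK.indep hF).2 y hy hyF

theorem mem_cell_iff (hK : IsSimplex K) {x : Pt n} :
    x ∈ cell K ↔ ∀ F ∈ facets K, 0 ≤ bary K F x := by
  classical
  rw [cell_eq_convexHull_range hK, hK.basis.convexHull_eq_nonneg_coord]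
  constructor
  · intro h F hF
    obtain ⟨z, hz, -, rfl⟩ := exists_opposite hK hF
    rw [bary_erase hK hz]
    exact h _
  · intro h z
    rw [← bary_erase hK z.2]
    exact h _ (erase_mem_facets hK z.2)

theorem mem_interior_cell_iff (hK : IsSimplex K) {x : Pt n} :
    x ∈ interior (cell K) ↔ ∀ F ∈ facets K, 0 < bary K F x := by
  classical
  rw [cell_eq_convexHull_range hK, hK.basis.interior_convexHull]
  constructor
  · intro h F hF
    obtain ⟨z, hz, -, rfl⟩ := exists_opposite hK hF
    rw [bary_erase hK hz]
    exact h _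
  · intro h z
    rw [← bary_erase hK z.2]
    exact h _ (erase_mem_facets hK z.2)

theorem bary_eq_zero_of_mem (hK : IsSimplex K) (hF : F ∈ facets K) {x : Pt n} (hx : x ∈ cell F) :
    bary K F x = 0 := by
  have h : cell F ⊆ bary K F ⁻¹' {0} :=
    convexHull_min (fun y hy => bary_vertex hK hF hy)
      ((convex_singleton (0 : ℝ)).affine_preimage (bary K F))
  exact h hx

theorem cell_mono {F K : Finset (Pt n)} (h : F ⊆ K) : cell F ⊆ cell K :=
  convexHull_mono (by exact_mod_cast h)

theorem facet_subset (hF : F ∈ facets K) : F ⊆ K := (Finset.mem_powersetCard.1 hF).1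

theorem facet_card (hF : F ∈ facets K) : F.card = n := (Finset.mem_powersetCard.1 hF).2

theorem sum_coord_smul (hK : IsSimplex K) (x : Pt n) :
    ∑ z : K, hK.basis.coord z x • (z : Pt n) = x := by
  have := hK.basis.linear_combination_coord_eq_self x
  simpa using this

theorem mem_cell_facet_iff (hK : IsSimplex K) (hF : F ∈ facets K) {x : Pt n} :
    x ∈ cell F ↔ x ∈ cell K ∧ bary K F x = 0 := by
  classical
  refine ⟨fun h => ⟨cell_mono (facet_subset hF) h, bary_eq_zero_of_mem hK hF h⟩, ?_⟩
  rintro ⟨h1, h2⟩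
  obtain ⟨z, hz, hzF, rfl⟩ := exists_opposite hK hF
  rw [bary_erase hK hz] at h2
  have hc : ∀ y, 0 ≤ hK.basis.coord y x := fun y => by
    rw [← bary_erase hK y.2]; exact (mem_cell_iff hK).1 h1 _ (erase_mem_facets hK y.2)
  rw [← sum_coord_smul hK x, ← Finset.sum_erase Finset.univ (a := (⟨z, hz⟩ : K)) (by simp [h2])]
  refine (convex_convexHull ℝ _).sum_mem (fun y _ => hc y) ?_ ?_
  · rw [Finset.sum_erase (f := fun i => hK.basis.coord i x) _ h2,
      hK.basis.sum_coord_apply_eq_one]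
  · intro y hy
    refine subset_convexHull ℝ _ ?_
    have : (y : Pt n) ≠ z := fun h => (Finset.mem_erase.1 hy).1 (Subtype.ext h)
    simp [this]

theorem isCompact_cell (K : Finset (Pt n)) : IsCompact (cell K) :=
  (Finset.finite_toSet K).isCompact_convexHull ℝ

theorem convex_cell (K : Finset (Pt n)) : Convex ℝ (cell K) := convex_convexHull ℝ _

theorem continuous_bary (K F : Finset (Pt n)) : Continuous (bary K F) :=
  (bary K F).continuous_of_finiteDimensional

/-- The gradient of the barycentric coordinate as a vector. -/
def gvec (K F : Finset (Pt n)) : Pt n := WithLp.toLp 2 (baryGrad K F)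

@[simp] theorem gvec_apply (K F : Finset (Pt n)) (i : Fin n) : gvec K F i = baryGrad K F i := rfl

theorem bary_linear (K F : Finset (Pt n)) (v : Pt n) :
    (bary K F).linear v = inner ℝ (gvec K F) v := by
  have h : v = ∑ i, v i • EuclideanSpace.single i (1 : ℝ) := by
    ext j; simp [Pi.single_apply]
  conv_lhs => rw [h]
  rw [map_sum, PiLp.inner_apply]
  simp [baryGrad]

theorem bary_sub (K F : Finset (Pt n)) (x y : Pt n) :
    bary K F x - bary K F y = inner ℝ (gvec K F) (x - y) := by
  rw [← bary_linear]
  exact ((bary K F).linearMap_vsub x y).symm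

theorem bary_add (K F : Finset (Pt n)) (x v : Pt n) :
    bary K F (x + v) = bary K F x + inner ℝ (gvec K F) v := by
  have := bary_sub K F (x + v) x
  rw [add_sub_cancel_left] at this
  linarith

theorem evS_baryPoly (K F : Finset (Pt n)) (x : Pt n) :
    evS (baryPoly K F) x = (bary K F x : ℂ) := by
  have := bary_add K F 0 x
  rw [zero_add] at this
  rw [this, PiLp.inner_apply]
  simp [baryPoly, mul_comm]

@[simp] theorem pderiv_baryPoly (K F : Finset (Pt n)) (j : Fin n) :
    MvPolynomial.pderiv j (baryPoly K F) = MvPolynomial.C ((baryGrad K F j : ℝ) : ℂ) := by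
  simp [baryPoly, MvPolynomial.pderiv_X, Pi.single_apply]

theorem PkS_baryPoly (K F : Finset (Pt n)) : baryPoly K F ∈ PkS n 1 :=
  PkS_add (PkS_C _) (PkS_sum fun i _ => PkS_C_mul _ (by simp [PkS]))

theorem facet_nonempty (hn : 0 < n) (hF : F ∈ facets K) : F.Nonempty := by
  rw [← Finset.card_pos, facet_card hF]; exact hn

/-- Between a vertex of the facet and the opposite vertex the coordinate grows by `1` over a
distance of at most the diameter. -/
theorem norm_gvec_mul_diam (hn : 0 < n) (hK : IsSimplex K) (hF : F ∈ facets K) :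
    1 ≤ ‖gvec K F‖ * Metric.diam (cell K) := by
  obtain ⟨z, hz, hzF, -⟩ := exists_opposite hK hF
  obtain ⟨y, hy⟩ := facet_nonempty hn hF
  have h := bary_sub K F z y
  rw [bary_opposite hK hF hz hzF, bary_vertex hK hF hy, sub_zero] at h
  rw [h]
  refine (real_inner_le_norm _ _).trans ?_
  gcongr
  rw [← dist_eq_norm]
  exact Metric.dist_le_diam_of_mem (isCompact_cell K).isBounded
    (subset_convexHull ℝ _ hz) (subset_convexHull ℝ _ (facet_subset hF hy))

theorem gvec_ne_zero (hn : 0 < n) (hK : IsSimplex K) (hF : F ∈ facets K) : gvec K F ≠ 0 := by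
  intro h
  have := norm_gvec_mul_diam hn hK hF
  rw [h, norm_zero, zero_mul] at this
  linarith

theorem norm_gvec_pos (hn : 0 < n) (hK : IsSimplex K) (hF : F ∈ facets K) : 0 < ‖gvec K F‖ :=
  norm_pos_iff.2 (gvec_ne_zero hn hK hF)

theorem diam_cell_pos (hn : 0 < n) (hK : IsSimplex K) : 0 < Metric.diam (cell K) := by
  classical
  obtain ⟨z, hz⟩ : K.Nonempty := by rw [← Finset.card_pos, hK.card]; omega
  have := norm_gvec_mul_diam hn hK (erase_mem_facets hK hz)
  by_contra h
  nlinarith [norm_nonneg (gvec K (K.erase z)), Metric.diam_nonneg (s := cell K)]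

theorem sqrt_sum_baryGrad (K F : Finset (Pt n)) :
    Real.sqrt (∑ j, baryGrad K F j ^ 2) = ‖gvec K F‖ := by
  rw [EuclideanSpace.norm_eq]
  simp

theorem nrm_eq (K F : Finset (Pt n)) (i : Fin n) : nrm K F i = -baryGrad K F i / ‖gvec K F‖ := by
  rw [nrm, sqrt_sum_baryGrad]

theorem sum_nrm_sq (hn : 0 < n) (hK : IsSimplex K) (hF : F ∈ facets K) :
    ∑ i, nrm K F i ^ 2 = 1 := by
  have h := norm_gvec_pos hn hK hF
  have h2 : ∑ i, baryGrad K F i ^ 2 = ‖gvec K F‖ ^ 2 := by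
    rw [EuclideanSpace.norm_sq_eq]; simp
  simp only [nrm_eq, div_pow, neg_sq, ← Finset.sum_div, h2]
  field_simp

theorem abs_nrm_le (hn : 0 < n) (hK : IsSimplex K) (hF : F ∈ facets K) (i : Fin n) :
    |nrm K F i| ≤ 1 := by
  rw [← sq_le_one_iff_abs_le_one, ← sum_nrm_sq hn hK hF]
  exact Finset.single_le_sum (f := fun i => nrm K F i ^ 2) (fun _ _ => by positivity)
    (Finset.mem_univ i)

open scoped Classical in
/-- Expansion of a vector in terms of the gradients of the barycentric coordinates. -/
theorem sum_inner_gvec_smul (hK : IsSimplex K) (v : Pt n) :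
    ∑ z : K, inner ℝ (gvec K (K.erase (z : Pt n))) v • (z : Pt n) = v := by
  have h1 := sum_coord_smul hK v
  have h0 := sum_coord_smul hK 0
  have : ∑ z : K, (hK.basis.coord z v - hK.basis.coord z 0) • (z : Pt n) = v := by
    simp only [sub_smul, Finset.sum_sub_distrib, h1, h0, sub_zero]
  rw [← this]
  refine Finset.sum_congr rfl fun z _ => ?_
  rw [this, ← bary_erase hK z.2, bary_sub, sub_zero]

open scoped Classical in
theorem sum_inner_gvec (hK : IsSimplex K) (v : Pt n) :
    ∑ z : K, inner ℝ (gvec K (K.erase (z : Pt n))) v = 0 := by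
  have h1 := hK.basis.sum_coord_apply_eq_one v
  have h0 := hK.basis.sum_coord_apply_eq_one 0
  rw [← sub_eq_zero.2 (h1.trans h0.symm), ← Finset.sum_sub_distrib]
  refine Finset.sum_congr rfl fun z _ => ?_
  rw [← bary_erase hK z.2, bary_sub, sub_zero]

/-- The gradients of the barycentric coordinates span uniformly. -/
theorem norm_sq_le_sum_inner_gvec (hK : IsSimplex K) (v : Pt n) :
    ‖v‖ ^ 2 ≤ (n + 1) * Metric.diam (cell K) ^ 2 * ∑ F ∈ facets K, inner ℝ (gvec K F) v ^ 2 := by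
  classical
  obtain ⟨z₀, hz₀⟩ : K.Nonempty := by rw [← Finset.card_pos, hK.card]; omega
  -- The gradients sum to zero, so a fixed vertex may be subtracted from every vertex in the
  -- expansion. What remains are differences of vertices, no longer than the diameter.
  have h1 : v = ∑ z : K, inner ℝ (gvec K (K.erase (z : Pt n))) v • ((z : Pt n) - z₀) := by
    simp only [smul_sub, Finset.sum_sub_distrib, sum_inner_gvec_smul hK, ← Finset.sum_smul,
      sum_inner_gvec hK, zero_smul, sub_zero]
  have h2 : ‖v‖ ≤ ∑ z : K, |inner ℝ (gvec K (K.erase (z : Pt n))) v| * Metric.diam (cell K) := by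
    conv_lhs => rw [h1]
    refine (norm_sum_le _ _).trans (Finset.sum_le_sum fun z _ => ?_)
    rw [norm_smul, Real.norm_eq_abs, ← dist_eq_norm]
    gcongr
    exact Metric.dist_le_diam_of_mem (isCompact_cell K).isBounded
      (subset_convexHull ℝ _ z.2) (subset_convexHull ℝ _ hz₀)
  rw [sum_facets hK]
  calc ‖v‖ ^ 2 ≤ (∑ z : K, |inner ℝ (gvec K (K.erase (z : Pt n))) v| * Metric.diam (cell K)) ^ 2 := by
        gcongr
    _ ≤ (Finset.univ : Finset K).card *
        ∑ z : K, (|inner ℝ (gvec K (K.erase (z : Pt n))) v| * Metric.diam (cell K)) ^ 2 :=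
      sq_sum_le_card_mul_sum_sq
    _ = _ := by
      simp only [mul_pow, sq_abs, ← Finset.sum_mul]
      simp [hK.card]; ring

/-- Walking from the centre over the distance `ρ` against the gradient lowers the coordinate by
`‖gvec K F‖ * ρ`, and the end point is still in the simplex, where the coordinate is nonnegative. -/
theorem norm_gvec_mul_radius (hK : IsSimplex K) (hF : F ∈ facets K) {x : Pt n} {ρ : ℝ} (hρ : 0 ≤ ρ)
    (hB : Metric.closedBall x ρ ⊆ cell K) : ‖gvec K F‖ * ρ ≤ bary K F x := by
  rcases eq_or_ne (gvec K F) 0 with h0 | h0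
  · rw [h0, norm_zero, zero_mul]
    exact (mem_cell_iff hK).1 (hB (by simp [hρ])) F hF
  have hg := norm_pos_iff.2 h0
  have h1 : x + (-(ρ / ‖gvec K F‖)) • gvec K F ∈ Metric.closedBall x ρ := by
    rw [mem_closedBall_iff_norm, add_sub_cancel_left, norm_smul, norm_neg, Real.norm_of_nonneg
      (by positivity)]
    field_simp; rfl
  have h2 := (mem_cell_iff hK).1 (hB h1) F hF
  rw [bary_add, inner_smul_right, real_inner_self_eq_norm_sq] at h2
  have : -(ρ / ‖gvec K F‖) * ‖gvec K F‖ ^ 2 = -(‖gvec K F‖ * ρ) := by field_simp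
  linarith

theorem bary_le_one (hK : IsSimplex K) (hF : F ∈ facets K) {x : Pt n} (hx : x ∈ cell K) :
    bary K F x ≤ 1 := by
  classical
  have h : cell K ⊆ bary K F ⁻¹' Set.Iic 1 := by
    refine convexHull_min (fun y hy => ?_) ((convex_Iic (1 : ℝ)).affine_preimage (bary K F))
    by_cases hyF : y ∈ F
    · simp [bary_vertex hK hF hyF]
    · simp [bary_opposite hK hF hy hyF]
  exact h hx

theorem norm_gvec_mul_radius_le_one (hK : IsSimplex K) (hF : F ∈ facets K) {x : Pt n} {ρ : ℝ}
    (hρ : 0 ≤ ρ) (hB : Metric.closedBall x ρ ⊆ cell K) : ‖gvec K F‖ * ρ ≤ 1 :=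
  (norm_gvec_mul_radius hK hF hρ hB).trans (bary_le_one hK hF (hB (by simp [hρ])))

/-- On the concentric ball of half the radius, the barycentric coordinates are bounded below. -/
theorem bary_lower_bound (hn : 0 < n) (hK : IsSimplex K) (hF : F ∈ facets K) {x y : Pt n} {ρ : ℝ}
    (hρ : 0 ≤ ρ) (hB : Metric.closedBall x ρ ⊆ cell K) (hy : y ∈ Metric.closedBall x (ρ / 2)) :
    ρ / (2 * Metric.diam (cell K)) ≤ bary K F y := by
  have h1 := norm_gvec_mul_radius hK hF hρ hB
  have h2 := bary_sub K F y x
  have h3 := neg_le_of_abs_le (abs_real_inner_le_norm (gvec K F) (y - x))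
  rw [mem_closedBall_iff_norm] at hy
  have h4 := norm_gvec_mul_diam hn hK hF
  have h5 := diam_cell_pos hn hK
  have h6 : ‖gvec K F‖ * ‖y - x‖ ≤ ‖gvec K F‖ * (ρ / 2) := by gcongr
  have h7 : ρ / (2 * Metric.diam (cell K)) ≤ ‖gvec K F‖ * (ρ / 2) := by
    rw [div_le_iff₀ (by positivity)]
    nlinarith
  linarith

theorem volume_cell_ne_top (K : Finset (Pt n)) : volume (cell K) ≠ ⊤ :=
  (isCompact_cell K).measure_lt_top.ne

instance (K : Finset (Pt n)) : IsFiniteMeasure (volK K) :=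
  ⟨by simpa [volK] using (volume_cell_ne_top K).lt_top⟩

theorem memLp_evS (K : Finset (Pt n)) (p : CPoly n) : MemLp (evS p) 2 (volK K) :=
  memLp_of_continuous (isCompact_cell K) (volume_cell_ne_top K) (continuous_evS p) 2

theorem integrable_of_continuous (K : Finset (Pt n)) {f : Pt n → ℂ} (hf : Continuous f) :
    Integrable f (volK K) := by
  rw [← memLp_one_iff_integrable]
  exact memLp_of_continuous (isCompact_cell K) (volume_cell_ne_top K) hf 1

theorem volume_frontier_cell (K : Finset (Pt n)) : volume (frontier (cell K)) = 0 :=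
  (convex_cell K).addHaar_frontier volume

theorem interior_cell_nonempty (hK : IsSimplex K) : (interior (cell K)).Nonempty := by
  rw [cell_eq_convexHull_range hK, interior_convexHull_nonempty_iff_affineSpan_eq_top]
  exact hK.basis.tot

end Simplices

/-! ### Gauss' theorem on a simplex by means of cone coordinates. -/

section Cone

variable {n : ℕ} {K F : Finset (Pt n)}

/-- The hyperplane direction orthogonal to a vector. -/
abbrev orthHyp (g : Pt n) : Submodule ℝ (Pt n) := (ℝ ∙ g)ᗮ

theorem finrank_orthHyp {g : Pt n} (hg : g ≠ 0) : Module.finrank ℝ (orthHyp g) = n - 1 := by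
  have := (ℝ ∙ g).finrank_add_finrank_orthogonal
  rw [finrank_span_singleton hg, finrank_euclideanSpace_fin] at this
  exact (Nat.sub_eq_of_eq_add' this.symm).symm

/-- Orthogonal coordinates: distance in the direction of a unit vector, and the hyperplane. -/
theorem measurePreserving_orthCoord (z : Pt n) {ν : Pt n} (hν : ‖ν‖ = 1) :
    MeasurePreserving (fun q : ℝ × orthHyp ν => z + q.1 • ν + (q.2 : Pt n))
      (volume.prod volume) volume ∧
    MeasurableEmbedding (fun q : ℝ × orthHyp ν => z + q.1 • ν + (q.2 : Pt n)) := by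
  have h1 := ((ℝ ∙ ν).measurePreserving_measurableEquivProd z).symm
  rw [InnerProductSpace.euclideanHausdorffMeasure_eq_volume] at h1
  have h2 := (LinearIsometryEquiv.toSpanUnitSingleton ν hν).measurePreserving
  have h3 := h2.prod (MeasurePreserving.id (volume : Measure (orthHyp ν)))
  have h4 : (fun q : ℝ × orthHyp ν => z + q.1 • ν + (q.2 : Pt n))
      = ((ℝ ∙ ν).measurableEquivProd z).symm ∘
        (Prod.map (LinearIsometryEquiv.toSpanUnitSingleton ν hν) id) := by
    funext q
    simp only [Function.comp, Submodule.measurableEquivProd_symm_apply, Prod.map_fst, Prod.map_snd,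
      LinearIsometryEquiv.toSpanUnitSingleton_apply, id, vadd_eq_add]
    abel
  rw [h4]
  refine ⟨h1.comp h3, (MeasurableEquiv.measurableEmbedding _).comp ?_⟩
  exact ((LinearIsometryEquiv.toSpanUnitSingleton ν hν).toHomeomorph.measurableEmbedding).prodMap
    MeasurableEmbedding.id

theorem isometry_orthShift (p : Pt n) (ν : Pt n) :
    Isometry (fun w : orthHyp ν => p + (w : Pt n)) :=
  (IsometryEquiv.addLeft p).isometry.comp isometry_subtype_coe

theorem measurableEmbedding_orthShift (p : Pt n) (ν : Pt n) :
    MeasurableEmbedding (fun w : orthHyp ν => p + (w : Pt n)) :=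
  (isometry_orthShift p ν).isClosedEmbedding.measurableEmbedding

/-- Surface measure in terms of Lebesgue measure on the direction of the hyperplane. -/
theorem surf_eq_map {p ν : Pt n} (hν : ν ≠ 0)
    (hF : cell F ⊆ Set.range (fun w : orthHyp ν => p + (w : Pt n))) :
    surf F = (volume.restrict ((fun w : orthHyp ν => p + (w : Pt n)) ⁻¹' cell F)).map
      (fun w : orthHyp ν => p + (w : Pt n)) := by
  have h := (isometry_orthShift p ν).map_euclideanHausdorffMeasure (d := n - 1)
  have h2 : (μHE[n - 1] : Measure (orthHyp ν)) = volume := by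
    rw [← finrank_orthHyp hν]
    exact InnerProductSpace.euclideanHausdorffMeasure_eq_volume
  rw [h2] at h
  rw [← Measure.restrict_map (measurableEmbedding_orthShift p ν).measurable
    (isCompact_cell F).measurableSet, h,
    Measure.restrict_restrict (isCompact_cell F).measurableSet,
    Set.inter_eq_left.2 hF, surf]

/-- The outward normal as a vector. -/
def nvec (K F : Finset (Pt n)) : Pt n := -(‖gvec K F‖⁻¹ • gvec K F)

theorem norm_nvec (hn : 0 < n) (hK : IsSimplex K) (hF : F ∈ facets K) : ‖nvec K F‖ = 1 := by
  have := norm_gvec_pos hn hK hF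
  rw [nvec, norm_neg, norm_smul, norm_inv, norm_norm, inv_mul_cancel₀ this.ne']

theorem bary_orthCoord (hn : 0 < n) (hK : IsSimplex K) (hF : F ∈ facets K) (x : Pt n) (r : ℝ)
    (w : orthHyp (nvec K F)) :
    bary K F (x + r • nvec K F + (w : Pt n)) = bary K F x - r * ‖gvec K F‖ := by
  have hg := norm_gvec_pos hn hK hF
  have h1 : inner ℝ (gvec K F) (w : Pt n) = 0 := by
    have h : inner ℝ (-(‖gvec K F‖⁻¹ • gvec K F)) (w : Pt n) = 0 :=
      (Submodule.mem_orthogonal_singleton_iff_inner_right).1 w.2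
    rw [inner_neg_left, real_inner_smul_left, neg_eq_zero] at h
    exact (mul_eq_zero.1 h).resolve_left (by positivity)
  rw [bary_add, bary_add, h1, inner_smul_right, nvec, inner_neg_right, inner_smul_right,
    real_inner_self_eq_norm_sq]
  field_simp
  ring

theorem cell_facet_subset_range (hK : IsSimplex K) (hF : F ∈ facets K) {p : Pt n}
    (hp : bary K F p = 0) :
    cell F ⊆ Set.range (fun w : orthHyp (nvec K F) => p + (w : Pt n)) := by
  intro x hx
  have h0 := bary_eq_zero_of_mem hK hF hx
  have h1 := bary_sub K F x p
  rw [h0, hp, sub_zero] at h1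
  refine ⟨⟨x - p, ?_⟩, by simp⟩
  rw [Submodule.mem_orthogonal_singleton_iff_inner_right, nvec, inner_neg_left,
    real_inner_smul_left, ← h1]
  simp

theorem isFiniteMeasure_surf (hn : 0 < n) (hK : IsSimplex K) (hF : F ∈ facets K) :
    IsFiniteMeasure (surf F) := by
  obtain ⟨y, hy⟩ := facet_nonempty hn hF
  rw [surf_eq_map (p := y) (ν := nvec K F) (by
      rw [← norm_pos_iff, norm_nvec hn hK hF]; exact one_pos)
    (cell_facet_subset_range hK hF (bary_vertex hK hF hy))]
  have hc : IsCompact ((fun w : orthHyp (nvec K F) => y + (w : Pt n)) ⁻¹' cell F) :=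
    (isometry_orthShift y _).isClosedEmbedding.isCompact_preimage (isCompact_cell F)
  have : IsFiniteMeasure (volume.restrict
      ((fun w : orthHyp (nvec K F) => y + (w : Pt n)) ⁻¹' cell F)) :=
    ⟨by simpa using hc.measure_lt_top⟩
  infer_instance

/-- Along the segment from `z` to `y` the coordinates of the facets through `z` are multiplied by
`t`, and that of `F` is `1 - t`. So slices parallel to `F` are scaled copies of `F`. -/
theorem mem_cell_cone_iff (hK : IsSimplex K) (hF : F ∈ facets K) {z y : Pt n}
    (hz : z ∈ K) (hzF : z ∉ F) (hy : bary K F y = 0) {t : ℝ} (ht : 0 < t) (ht1 : t ≤ 1) :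
    z + t • (y - z) ∈ cell K ↔ y ∈ cell F := by
  have key : ∀ F' ∈ facets K, F' ≠ F → bary K F' (z + t • (y - z)) = t * bary K F' y := by
    intro F' hF' hne
    have hzF' : z ∈ F' := by
      classical
      by_contra h
      obtain ⟨z1, hz1, h1, h2⟩ := exists_opposite hK hF'
      obtain ⟨z2, hz2, h3, h4⟩ := exists_opposite hK hF
      have e1 : z = z1 := by rw [h2] at h; simpa [hz] using h
      have e2 : z = z2 := by rw [h4] at hzF; simpa [hz] using hzF
      exact hne (by rw [h2, h4, ← e1, ← e2])
    rw [bary_add, inner_smul_right, ← bary_sub, bary_vertex hK hF' hzF']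
    ring
  have key2 : bary K F (z + t • (y - z)) = 1 - t := by
    rw [bary_add, inner_smul_right, ← bary_sub, bary_opposite hK hF hz hzF, hy]
    ring
  rw [mem_cell_facet_iff hK hF, mem_cell_iff hK, mem_cell_iff hK]
  constructor
  · intro h
    refine ⟨fun F' hF' => ?_, hy⟩
    rcases eq_or_ne F' F with rfl | hne
    · exact hy.ge
    · have := h F' hF'
      rw [key F' hF' hne] at this
      exact nonneg_of_mul_nonneg_right this ht
  · rintro ⟨h, -⟩ F' hF'
    rcases eq_or_ne F' F with rfl | hne
    · rw [key2]; linarith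
    · rw [key F' hF' hne]
      exact mul_nonneg ht.le (h F' hF')

/-- Integration over a simplex in cone coordinates with respect to a facet. -/
theorem integral_cell_cone (hn : 0 < n) (hK : IsSimplex K) (hF : F ∈ facets K) {z : Pt n}
    (hz : z ∈ K) (hzF : z ∉ F) {f : Pt n → ℂ} (hf : Continuous f) :
    ∫ x, f x ∂(volK K) = ∫ w in (fun w : orthHyp (nvec K F) =>
        z + ‖gvec K F‖⁻¹ • nvec K F + (w : Pt n)) ⁻¹' cell F,
      ∫ r in (0 : ℝ)..‖gvec K F‖⁻¹, (((r * ‖gvec K F‖) ^ (n - 1) : ℝ) : ℂ) *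
        f (z + (r * ‖gvec K F‖) • (‖gvec K F‖⁻¹ • nvec K F + (w : Pt n))) := by
  set G := ‖gvec K F‖ with hG
  set ν := nvec K F with hνdef
  have hGpos : 0 < G := norm_gvec_pos hn hK hF
  have hν : ‖ν‖ = 1 := norm_nvec hn hK hF
  have hν0 : ν ≠ 0 := by rw [← norm_pos_iff, hν]; exact one_pos
  set F' : Set (orthHyp ν) := (fun w : orthHyp ν => z + G⁻¹ • ν + (w : Pt n)) ⁻¹' cell F with hF'
  have hF'c : IsCompact F' :=
    (isometry_orthShift (z + G⁻¹ • ν) ν).isClosedEmbedding.isCompact_preimage (isCompact_cell F)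
  obtain ⟨hmp, hme⟩ := measurePreserving_orthCoord z hν
  have hb : ∀ (r : ℝ) (w : orthHyp ν), bary K F (z + r • ν + (w : Pt n)) = 1 - r * G := by
    intro r w
    rw [bary_orthCoord hn hK hF, bary_opposite hK hF hz hzF]
  have hmeas := (isCompact_cell K).measurableSet
  have hint : Integrable ((cell K).indicator f) volume :=
    (integrable_indicator_iff hmeas).2 (integrable_of_continuous K hf)
  -- Fubini in orthogonal coordinates with origin `z`: the distance along the normal, and the
  -- hyperplane.
  have step1 : ∫ x, f x ∂(volK K) = ∫ r : ℝ, ∫ w : orthHyp ν,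
      (cell K).indicator f (z + r • ν + (w : Pt n)) := by
    rw [volK, ← integral_indicator hmeas, ← hmp.integral_comp hme, integral_prod]
    exact (hmp.integrable_comp_emb hme).2 hint
  -- The slice at distance `r` is `F` scaled by `r * G`; the substitution in the hyperplane yields
  -- the factor with exponent `n - 1`. The value `r = 0` is excluded, being negligible.
  have step2 : ∀ r : ℝ, r ≠ 0 → ∫ w : orthHyp ν, (cell K).indicator f (z + r • ν + (w : Pt n))
      = (Set.Ioc 0 G⁻¹).indicator (fun r => ∫ w in F', (((r * G) ^ (n - 1) : ℝ) : ℂ) *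
        f (z + (r * G) • (G⁻¹ • ν + (w : Pt n)))) r := by
    intro r hr0
    by_cases hr : r ∈ Set.Ioc 0 G⁻¹
    · rw [Set.indicator_of_mem hr]
      have ht : 0 < r * G := mul_pos hr.1 hGpos
      have ht1 : r * G ≤ 1 := by
        have := hr.2
        rwa [← one_div, le_div_iff₀ hGpos] at this
      have e1 : ∀ w : orthHyp ν, (cell K).indicator f (z + r • ν + (w : Pt n))
          = F'.indicator (fun w : orthHyp ν => f (z + (r * G) • (G⁻¹ • ν + (w : Pt n))))
            ((r * G)⁻¹ • w) := by
        intro w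
        have e2 : z + r • ν + (w : Pt n)
            = z + (r * G) • (G⁻¹ • ν + (((r * G)⁻¹ • w : orthHyp ν) : Pt n)) := by
          rw [Submodule.coe_smul, smul_add, smul_smul, smul_smul, mul_inv_cancel₀ ht.ne',
            mul_assoc, mul_inv_cancel₀ hGpos.ne', mul_one, one_smul, add_assoc]
        have e3 : z + r • ν + (w : Pt n) ∈ cell K ↔ (r * G)⁻¹ • w ∈ F' := by
          rw [e2]
          have := mem_cell_cone_iff hK hF (y := z + G⁻¹ • ν + (((r * G)⁻¹ • w : orthHyp ν) : Pt n))
            hz hzF (by rw [hb]; field_simp; ring) ht ht1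
          rw [show z + G⁻¹ • ν + (((r * G)⁻¹ • w : orthHyp ν) : Pt n) - z
            = G⁻¹ • ν + (((r * G)⁻¹ • w : orthHyp ν) : Pt n) by abel] at this
          exact this
        by_cases hm : z + r • ν + (w : Pt n) ∈ cell K
        · rw [Set.indicator_of_mem hm, Set.indicator_of_mem (e3.1 hm), ← e2]
        · rw [Set.indicator_of_notMem hm, Set.indicator_of_notMem (fun h => hm (e3.2 h))]
      simp only [e1]
      rw [Measure.integral_comp_smul, integral_indicator hF'c.measurableSet, integral_const_mul,
        finrank_orthHyp hν0, abs_of_pos (by positivity), inv_pow, inv_inv, Complex.real_smul]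
    · rw [Set.indicator_of_notMem hr]
      have : ∀ w : orthHyp ν, (cell K).indicator f (z + r • ν + (w : Pt n)) = 0 := by
        intro w
        refine Set.indicator_of_notMem (fun hm => hr ?_) _
        have h1 := (mem_cell_iff hK).1 hm F hF
        have h2 := bary_le_one hK hF hm
        rw [hb] at h1 h2
        have h3 : 0 ≤ r * G := by linarith
        refine ⟨lt_of_le_of_ne (nonneg_of_mul_nonneg_left h3 hGpos) hr0.symm, ?_⟩
        rw [← one_div, le_div_iff₀ hGpos]; linarith
      simp [this]
  rw [step1]
  have step3 := integral_congr_ae (μ := volume) (((Set.finite_singleton (0 : ℝ)).countable.ae_notMem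
    volume).mono fun r hr => step2 r hr)
  rw [step3, integral_indicator measurableSet_Ioc]
  simp only [intervalIntegral.integral_of_le (inv_nonneg.2 hGpos.le)]
  rw [integral_integral_swap]
  rw [Function.uncurry_def, Measure.prod_restrict]
  refine IntegrableOn.mono_set (t := Set.Icc 0 G⁻¹ ×ˢ F') ?_
    (Set.prod_mono Set.Ioc_subset_Icc_self subset_rfl)
  refine ContinuousOn.integrableOn_compact (isCompact_Icc.prod hF'c) (Continuous.continuousOn ?_)
  fun_prop

/-- The cone formula: the flux of the radial field `(x - z) p` through the facet opposite
to the vertex `z`. -/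
theorem cone_formula (hn : 0 < n) (hK : IsSimplex K) (hF : F ∈ facets K) {z : Pt n}
    (hz : z ∈ K) (hzF : z ∉ F) (p : CPoly n) :
    ∫ x, (n * evS p x + ∑ i, ((x i : ℂ) - z i) * evS (MvPolynomial.pderiv i p) x) ∂(volK K)
      = ((‖gvec K F‖⁻¹ : ℝ) : ℂ) * ∫ x, evS p x ∂(surf F) := by
  have hGpos : 0 < ‖gvec K F‖ := norm_gvec_pos hn hK hF
  have hν : ‖nvec K F‖ = 1 := norm_nvec hn hK hF
  have hν0 : nvec K F ≠ 0 := by rw [← norm_pos_iff, hν]; exact one_pos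
  rw [integral_cell_cone hn hK hF hz hzF (by fun_prop)]
  have hp : bary K F (z + ‖gvec K F‖⁻¹ • nvec K F) = 0 := by
    have := bary_orthCoord hn hK hF z ‖gvec K F‖⁻¹ 0
    simp only [ZeroMemClass.coe_zero, add_zero, bary_opposite hK hF hz hzF] at this
    rw [this]; field_simp; ring
  rw [surf_eq_map hν0 (cell_facet_subset_range hK hF hp),
    (measurableEmbedding_orthShift _ _).integral_map, ← integral_const_mul]
  refine integral_congr_ae (Filter.Eventually.of_forall fun w => ?_)
  simp only
  set G := ‖gvec K F‖
  set d : Pt n := G⁻¹ • nvec K F + (w : Pt n) with hd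
  -- The integrand along a ray is an exact derivative in `r`: the radial Jacobian joins with the
  -- Euler operator applied to `p`. The fundamental theorem of calculus leaves only the value at the
  -- facet, since the primitive vanishes at `r = 0`.
  have key : ∀ r : ℝ, HasDerivAt (fun r : ℝ => ((G⁻¹ : ℝ) : ℂ) * (((r * G) ^ n : ℝ) : ℂ) *
      evS p (z + (r * G) • d)) ((((r * G) ^ (n - 1) : ℝ) : ℂ) *
      (n * evS p (z + (r * G) • d) + ∑ i, (((z + (r * G) • d) i : ℝ) - (z i : ℂ)) *
        evS (MvPolynomial.pderiv i p) (z + (r * G) • d))) r := by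
    intro r
    obtain ⟨L, hL, hL'⟩ := hasFDerivAt_evS p (z + (r * G) • d)
    have h1 : HasDerivAt (fun r : ℝ => z + (r * G) • d) (G • d) r := by
      have := (((hasDerivAt_id r).mul_const G).smul_const d).const_add z
      simpa using this
    have h2 := hL.comp_hasDerivAt r h1
    have h3 : HasDerivAt (fun r : ℝ => (((r * G) ^ n : ℝ) : ℂ))
        ((n * (r * G) ^ (n - 1) * G : ℝ) : ℂ) r := by
      have := (((hasDerivAt_id r).mul_const G).pow n).ofReal_comp
      simpa using this
    refine ((h3.const_mul ((G⁻¹ : ℝ) : ℂ)).mul h2).congr_deriv ?_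
    have hGc : (G : ℂ) ≠ 0 := by exact_mod_cast hGpos.ne'
    obtain ⟨k, rfl⟩ : ∃ k, n = k + 1 := ⟨n - 1, by omega⟩
    rw [hL']
    simp only [PiLp.add_apply, PiLp.smul_apply, smul_eq_mul, Complex.ofReal_add, Complex.ofReal_mul,
      add_sub_cancel_left, Complex.ofReal_inv, Complex.ofReal_pow, Nat.add_sub_cancel, mul_assoc,
      ← Finset.mul_sum, Function.comp, Complex.ofReal_natCast]
    field_simp
    ring
  rw [intervalIntegral.integral_eq_sub_of_hasDerivAt (fun r _ => key r)]
  · have hG1 : G⁻¹ * G = 1 := inv_mul_cancel₀ hGpos.ne'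
    simp [hG1, hd, hn.ne', add_assoc]
  · exact Continuous.intervalIntegrable (by fun_prop) _ _

/-- Gauss' theorem for polynomials on a simplex. -/
theorem integral_pderiv_eq_sum_surf (hn : 0 < n) (hK : IsSimplex K) (p : CPoly n) (i : Fin n) :
    ∫ x, evS (MvPolynomial.pderiv i p) x ∂(volK K)
      = ∑ F ∈ facets K, ∫ x, evS p x * (nrm K F i : ℂ) ∂(surf F) := by
  classical
  rw [sum_facets hK]
  -- By the cone formula each facet integral is a volume integral weighted by `-∂_i η`. In the sum
  -- over the vertices `z`, the identity `∑ ∂_i η = 0` removes all that does not depend on `z`, and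
  -- `∑ (∂_i η) z_j = δ_ij` selects exactly `∂_i p`.
  have hterm : ∀ z : K, ∫ x, evS p x * (nrm K (K.erase (z : Pt n)) i : ℂ) ∂(surf (K.erase (z : Pt n)))
      = -(baryGrad K (K.erase (z : Pt n)) i : ℂ) * 
        ∫ x, (n * evS p x + ∑ j, ((x j : ℂ) - (z : Pt n) j) * evS (MvPolynomial.pderiv j p) x)
          ∂(volK K) := by
    intro z
    rw [cone_formula hn hK (erase_mem_facets hK z.2) z.2 (by simp) p, integral_mul_const, nrm_eq]
    push_cast
    ring
  have hsum0 : ∑ z : K, (baryGrad K (K.erase (z : Pt n)) i : ℂ) = 0 := by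
    have := sum_inner_gvec hK (EuclideanSpace.single i (1 : ℝ))
    simp only [← bary_linear] at this
    exact_mod_cast this
  have hsum1 : ∀ j, ∑ z : K, (baryGrad K (K.erase (z : Pt n)) i : ℂ) * ((z : Pt n) j : ℂ)
      = if j = i then 1 else 0 := by
    intro j
    have := congrArg (fun v : Pt n => v j) (sum_inner_gvec_smul hK (EuclideanSpace.single i (1 : ℝ)))
    simp only [← bary_linear, WithLp.ofLp_sum, Finset.sum_apply, PiLp.smul_apply, smul_eq_mul,
      PiLp.single_apply] at this
    simp only [baryGrad, ← Complex.ofReal_mul, ← Complex.ofReal_sum, this]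
    split_ifs <;> simp
  simp only [hterm, ← integral_const_mul]
  rw [← integral_finsetSum]
  · refine integral_congr_ae (Filter.Eventually.of_forall fun x => ?_)
    simp only [mul_add, neg_mul, Finset.sum_add_distrib, Finset.sum_neg_distrib, ← Finset.sum_mul,
      hsum0, zero_mul, neg_zero, zero_add, Finset.mul_sum]
    rw [Finset.sum_comm]
    simp only [sub_mul, mul_sub, Finset.sum_sub_distrib, ← mul_assoc, ← Finset.sum_mul, hsum0, hsum1]
    simp
  · intro z _
    exact (integrable_of_continuous K (by fun_prop)).const_mul _

end Cone

/-! ### Inverse, Poincaré and trace inequalities on shape regular simplices. -/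

section ShapeRegular

variable {n : ℕ} {K F : Finset (Pt n)} {κ : ℝ}

/-- A simplex that contains a ball of radius its diameter over `κ`. -/
structure IsShapeRegular (κ : ℝ) (K : Finset (Pt n)) : Prop where
  simplex : IsSimplex K
  ball : ∃ x, Metric.closedBall x (Metric.diam (cell K) / κ) ⊆ cell K

theorem cell_subset_closedBall {x : Pt n} (hx : x ∈ cell K) :
    cell K ⊆ Metric.closedBall x (Metric.diam (cell K)) := fun _ hy =>
  Metric.dist_le_diam_of_mem (isCompact_cell K).isBounded hy hx

theorem integral_volK_le {f : Pt n → ℝ} (hf : Continuous f) (h0 : ∀ x, 0 ≤ f x) {x : Pt n}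
    (hx : x ∈ cell K) :
    ∫ y, f y ∂(volK K) ≤ ∫ y in Metric.closedBall x (Metric.diam (cell K)), f y :=
  setIntegral_mono_set (hf.continuousOn.integrableOn_compact (isCompact_closedBall _ _))
    (Filter.Eventually.of_forall h0)
    (Filter.Eventually.of_forall fun _ hy => cell_subset_closedBall hx hy)

theorem le_integral_volK {f : Pt n → ℝ} (hf : Continuous f) (h0 : ∀ x, 0 ≤ f x) {x : Pt n}
    {r : ℝ} (hB : Metric.closedBall x r ⊆ cell K) :
    ∫ y in Metric.closedBall x r, f y ≤ ∫ y, f y ∂(volK K) :=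
  setIntegral_mono_set (hf.continuousOn.integrableOn_compact (isCompact_cell K))
    (Filter.Eventually.of_forall h0)
    (Filter.Eventually.of_forall fun _ hy => hB hy)

/-- Inverse inequality on shape regular simplices. -/
theorem exists_inverse_bound (hn : 0 < n) (m : ℕ) (hκ : 0 < κ) : ∃ C : ℝ, 0 < C ∧
    ∀ K : Finset (Pt n), IsShapeRegular κ K → ∀ p ∈ PkS n m, ∀ i,
      Metric.diam (cell K) ^ 2 * ∫ y, ‖evS (MvPolynomial.pderiv i p) y‖ ^ 2 ∂(volK K)
        ≤ C * ∫ y, ‖evS p y‖ ^ 2 ∂(volK K) := by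
  -- The simplex lies between the inscribed ball of radius diameter over `κ` and the concentric ball
  -- whose radius is the diameter; `θ` is the ratio of the radii.
  obtain ⟨C, hC, h⟩ := exists_ball_inverse n m (θ := 1 / κ) (by positivity)
  refine ⟨C, hC, fun K hK p hp i => ?_⟩
  obtain ⟨x, hx⟩ := hK.ball
  have hd := diam_cell_pos hn hK.simplex
  have hxK : x ∈ cell K := hx (by simp; positivity)
  calc _ ≤ Metric.diam (cell K) ^ 2 * ∫ y in Metric.closedBall x (Metric.diam (cell K)),
          ‖evS (MvPolynomial.pderiv i p) y‖ ^ 2 := by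
        exact mul_le_mul_of_nonneg_left (integral_volK_le
          (f := fun y => ‖evS (MvPolynomial.pderiv i p) y‖ ^ 2) (by fun_prop)
          (fun _ => by positivity) hxK) (by positivity)
    _ ≤ _ := h p hp x _ hd i
    _ ≤ _ := by
        rw [mul_one_div]
        exact mul_le_mul_of_nonneg_left (le_integral_volK (f := fun y => ‖evS p y‖ ^ 2)
          (by fun_prop) (fun _ => by positivity) hx) hC.le

/-- Poincaré inequality for polynomials on shape regular simplices. -/
theorem exists_poincare_bound (hn : 0 < n) (m : ℕ) (hκ : 0 < κ) : ∃ C : ℝ, 0 < C ∧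
    ∀ K : Finset (Pt n), IsShapeRegular κ K → ∃ x, ∀ p ∈ PkS n m,
      ∫ y, ‖evS p y - evS p x‖ ^ 2 ∂(volK K) ≤ C * Metric.diam (cell K) ^ 2 *
        ∑ i, ∫ y, ‖evS (MvPolynomial.pderiv i p) y‖ ^ 2 ∂(volK K) := by
  obtain ⟨C, hC, h⟩ := exists_ball_poincare n m (θ := 1 / κ) (by positivity)
  refine ⟨C, hC, fun K hK => ?_⟩
  obtain ⟨x, hx⟩ := hK.ball
  refine ⟨x, fun p hp => ?_⟩
  have hd := diam_cell_pos hn hK.simplex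
  have hxK : x ∈ cell K := hx (by simp; positivity)
  calc _ ≤ ∫ y in Metric.closedBall x (Metric.diam (cell K)), ‖evS p y - evS p x‖ ^ 2 :=
        integral_volK_le (by fun_prop) (fun _ => by positivity) hxK
    _ ≤ _ := h p hp x _ hd
    _ ≤ _ := by
        rw [mul_one_div]
        refine mul_le_mul_of_nonneg_left (Finset.sum_le_sum fun i _ => ?_) (by positivity)
        exact le_integral_volK (f := fun y => ‖evS (MvPolynomial.pderiv i p) y‖ ^ 2)
          (by fun_prop) (fun _ => by positivity) hx

/-- The norm of a polynomial on a shape regular simplex is controlled on a small ball. -/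
theorem exists_inner_ball_bound (hn : 0 < n) (m : ℕ) (hκ : 0 < κ) : ∃ C : ℝ, 0 < C ∧
    ∀ K : Finset (Pt n), IsShapeRegular κ K → ∃ x,
      Metric.closedBall x (Metric.diam (cell K) / κ) ⊆ cell K ∧ ∀ p ∈ PkS n m,
      ∫ y, ‖evS p y‖ ^ 2 ∂(volK K) ≤ C * ∫ y in Metric.closedBall x (Metric.diam (cell K) / κ / 2),
        ‖evS p y‖ ^ 2 := by
  -- The additional factor `1 / 2` leads to the half-size ball on which all barycentric coordinates,
  -- hence the bubbles, are bounded below.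
  obtain ⟨C, hC, h⟩ := exists_ball_bound n m (θ := 1 / κ / 2) (by positivity)
  refine ⟨C, hC, fun K hK => ?_⟩
  obtain ⟨x, hx⟩ := hK.ball
  refine ⟨x, hx, fun p hp => ?_⟩
  have hd := diam_cell_pos hn hK.simplex
  have hxK : x ∈ cell K := hx (by simp; positivity)
  calc _ ≤ ∫ y in Metric.closedBall x (Metric.diam (cell K)), ‖evS p y‖ ^ 2 :=
        integral_volK_le (by fun_prop) (fun _ => by positivity) hxK
    _ ≤ _ := h p hp x _ hd
    _ = _ := by rw [mul_div_assoc', mul_one_div]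

theorem norm_gvec_mul_diam_le (hn : 0 < n) (hκ : 0 < κ) (hK : IsShapeRegular κ K)
    (hF : F ∈ facets K) : ‖gvec K F‖ * Metric.diam (cell K) ≤ κ := by
  obtain ⟨x, hx⟩ := hK.ball
  have hd := diam_cell_pos hn hK.simplex
  have := norm_gvec_mul_radius_le_one hK.simplex hF (by positivity) hx
  rwa [mul_div_assoc', div_le_one hκ] at this

/-- Trace inequality for polynomials on shape regular simplices. -/
theorem exists_trace_bound (hn : 0 < n) (m : ℕ) (hκ : 0 < κ) : ∃ C : ℝ, 0 < C ∧
    ∀ K : Finset (Pt n), IsShapeRegular κ K → ∀ p ∈ PkS n m, ∀ F ∈ facets K,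
      Metric.diam (cell K) * ∫ y, ‖evS p y‖ ^ 2 ∂(surf F) ≤ C * ∫ y, ‖evS p y‖ ^ 2 ∂(volK K) := by
  obtain ⟨C, hC, h⟩ := exists_inverse_bound hn m hκ
  refine ⟨κ * (2 * n + n * C), by positivity, fun K hK p hp F hF => ?_⟩
  have hd := diam_cell_pos hn hK.simplex
  obtain ⟨z, hz, hzF, -⟩ := exists_opposite hK.simplex hF
  -- The cone formula for `|p|²`, written as the polynomial `p * conjP p`, expresses the facet
  -- integral through volume integrals of `p` and its derivatives. The inverse inequality bounds the
  -- latter, and `‖gvec K F‖⁻¹` is at least the diameter over `κ`.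
  have hcone := cone_formula hn hK.simplex hF hz hzF (p * conjP p)
  have hsq : ∀ x, evS (p * conjP p) x = ((‖evS p x‖ ^ 2 : ℝ) : ℂ) := by
    intro x; simp [Complex.mul_conj']
  have hG := norm_gvec_pos hn hK.simplex hF
  have hI0 : 0 ≤ ∫ x, ‖evS p x‖ ^ 2 ∂(surf F) := integral_nonneg fun _ => by positivity
  have hR : ‖((‖gvec K F‖⁻¹ : ℝ) : ℂ) * ∫ x, evS (p * conjP p) x ∂(surf F)‖
      = ‖gvec K F‖⁻¹ * ∫ x, ‖evS p x‖ ^ 2 ∂(surf F) := by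
    simp only [hsq]
    rw [integral_complex_ofReal, ← Complex.ofReal_mul, Complex.norm_real, Real.norm_of_nonneg]
    positivity
  have hint : ∀ q : CPoly n, Integrable (fun y => ‖evS q y‖ ^ 2) (volK K) := fun q =>
    (memLp_evS K q).integrable_norm_pow (by norm_num)
  set d := Metric.diam (cell K)
  have hL : ‖∫ x, (n * evS (p * conjP p) x + ∑ i, ((x i : ℂ) - z i) *
        evS (MvPolynomial.pderiv i (p * conjP p)) x) ∂(volK K)‖
      ≤ ∫ x, (2 * n * ‖evS p x‖ ^ 2 + ∑ i, d ^ 2 * ‖evS (MvPolynomial.pderiv i p) x‖ ^ 2)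
        ∂(volK K) := by
    refine norm_integral_le_of_norm_le (((hint p).const_mul _).add
      (integrable_finsetSum _ fun i _ => (hint _).const_mul _)) ?_
    rw [volK]
    refine (ae_restrict_mem (isCompact_cell K).measurableSet).mono fun x hx => ?_
    have hxz : ∀ i, ‖(x i : ℂ) - z i‖ ≤ d := by
      intro i
      rw [← Complex.ofReal_sub, Complex.norm_real]
      refine (PiLp.norm_apply_le (x - z) i).trans ?_
      rw [← dist_eq_norm]
      exact Metric.dist_le_diam_of_mem (isCompact_cell K).isBounded hx
        (subset_convexHull ℝ _ hz)
    have hterm : ∀ i, ‖((x i : ℂ) - z i) * evS (MvPolynomial.pderiv i (p * conjP p)) x‖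
        ≤ ‖evS p x‖ ^ 2 + d ^ 2 * ‖evS (MvPolynomial.pderiv i p) x‖ ^ 2 := by
      intro i
      set a := ‖evS p x‖
      set b := ‖evS (MvPolynomial.pderiv i p) x‖
      have e1 : ‖evS (MvPolynomial.pderiv i (p * conjP p)) x‖ ≤ 2 * (a * b) := by
        simp only [Derivation.leibniz, smul_eq_mul, pderiv_conjP, evS_add, evS_mul, evS_conjP]
        refine (norm_add_le _ _).trans ?_
        simp only [norm_mul, RCLike.norm_conj]
        linarith
      rw [norm_mul]
      calc _ ≤ d * (2 * (a * b)) := by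
            gcongr
            exact hxz i
        _ ≤ _ := by nlinarith [sq_nonneg (a - d * b)]
    refine (norm_add_le _ _).trans ?_
    have h1 : ‖(n : ℂ) * evS (p * conjP p) x‖ = n * ‖evS p x‖ ^ 2 := by
      rw [hsq, norm_mul, Complex.norm_real, Real.norm_of_nonneg (by positivity),
        Complex.norm_natCast]
    have h2 := (norm_sum_le _ _).trans (Finset.sum_le_sum fun i (_ : i ∈ Finset.univ) => hterm i)
    rw [Finset.sum_add_distrib] at h2
    simp only [Finset.sum_const, Finset.card_univ, Fintype.card_fin, nsmul_eq_mul] at h2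
    rw [h1]
    linarith
  rw [hcone, hR] at hL
  rw [integral_add ((hint p).const_mul _) (integrable_finsetSum _ fun i _ => (hint _).const_mul _),
    integral_const_mul, integral_finsetSum _ (fun i _ => (hint _).const_mul _)] at hL
  simp only [integral_const_mul] at hL
  have hS := Finset.sum_le_sum fun i (_ : i ∈ (Finset.univ : Finset (Fin n))) => h K hK p hp i
  simp only [Finset.sum_const, Finset.card_univ, Fintype.card_fin, nsmul_eq_mul] at hS
  have hgd := norm_gvec_mul_diam_le hn hκ hK hF
  have hd' : d ≤ κ * ‖gvec K F‖⁻¹ := by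
    rw [← div_eq_mul_inv, le_div_iff₀ hG]
    linarith
  calc _ ≤ κ * ‖gvec K F‖⁻¹ * ∫ y, ‖evS p y‖ ^ 2 ∂(surf F) := by gcongr
    _ = κ * (‖gvec K F‖⁻¹ * ∫ y, ‖evS p y‖ ^ 2 ∂(surf F)) := by ring
    _ ≤ κ * ((2 * n + n * C) * ∫ y, ‖evS p y‖ ^ 2 ∂(volK K)) := by
        refine mul_le_mul_of_nonneg_left ?_ hκ.le
        linarith
    _ = _ := by ring

end ShapeRegular

/-! ### Two simplices with a common facet. -/

section SharedFacets

variable {n : ℕ} {K K' F : Finset (Pt n)}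

/-- The relatively open facet in terms of barycentric coordinates. -/
def openFacet (K F : Finset (Pt n)) : Set (Pt n) :=
  {x | bary K F x = 0 ∧ ∀ F' ∈ facets K, F' ≠ F → 0 < bary K F' x}

theorem convex_openFacet (K F : Finset (Pt n)) : Convex ℝ (openFacet K F) := by
  have : openFacet K F = bary K F ⁻¹' {0} ∩
      ⋂ F' ∈ facets K, ⋂ _ : F' ≠ F, bary K F' ⁻¹' Set.Ioi 0 := by
    ext x; simp [openFacet]
  rw [this]
  refine ((convex_singleton 0).affine_preimage _).inter ?_
  exact convex_iInter₂ fun F' _ => convex_iInter fun _ => (convex_Ioi 0).affine_preimage _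

theorem openFacet_subset_cell (hK : IsSimplex K) : openFacet K F ⊆ cell K := by
  rintro x ⟨h0, h1⟩
  refine (mem_cell_iff hK).2 fun F' hF' => ?_
  rcases eq_or_ne F' F with rfl | h
  · exact h0.ge
  · exact (h1 F' hF' h).le

/-- If another coordinate vanished at a relatively interior point, prolonging the segment from the
vertex opposite to the corresponding facet slightly beyond that point would stay in `F` but make the
coordinate negative. -/
theorem intrinsicInterior_subset_openFacet (hK : IsSimplex K) (hF : F ∈ facets K) :
    intrinsicInterior ℝ (cell F) ⊆ openFacet K F := by
  classical
  intro x hx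
  have hxF : x ∈ cell F := intrinsicInterior_subset hx
  refine ⟨bary_eq_zero_of_mem hK hF hxF, fun F' hF' hne => ?_⟩
  have h0 : 0 ≤ bary K F' x := (mem_cell_iff hK).1 (cell_mono (facet_subset hF) hxF) F' hF'
  refine lt_of_le_of_ne h0 fun h => ?_
  obtain ⟨y, hy, hyF', hF'e⟩ := exists_opposite hK hF'
  have hyF : y ∈ F := by
    by_contra hc
    obtain ⟨z, hz, hzF, hFe⟩ := exists_opposite hK hF
    have : y = z := by rw [hFe] at hc; simpa [hy] using hc
    exact hne (by rw [hF'e, hFe, this])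
  obtain ⟨x', hx', rfl⟩ := mem_intrinsicInterior.1 hx
  obtain ⟨ε, hε, hball⟩ := Metric.mem_nhds_iff.1 (mem_interior_iff_mem_nhds.1 hx')
  have hyspan : y ∈ affineSpan ℝ (cell F) :=
    subset_affineSpan ℝ _ (subset_convexHull ℝ _ hyF)
  obtain ⟨δ, hδ, hδ'⟩ : ∃ δ : ℝ, 0 < δ ∧ δ * dist (x' : Pt n) y < ε := by
    refine ⟨ε / (2 * (dist (x' : Pt n) y + 1)), by positivity, ?_⟩
    rw [div_mul_eq_mul_div, div_lt_iff₀ (by positivity)]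
    nlinarith [dist_nonneg (x := (x' : Pt n)) (y := y)]
  have hp := AffineMap.lineMap_mem (-δ) x'.2 hyspan
  have hmem : (⟨_, hp⟩ : affineSpan ℝ (cell F)) ∈ Metric.ball x' ε := by
    rw [Metric.mem_ball, Subtype.dist_eq]
    simp only
    rw [dist_lineMap_left, norm_neg, Real.norm_of_nonneg hδ.le]
    exact hδ'
  have h3 := hball hmem
  have h4 : AffineMap.lineMap (x' : Pt n) y (-δ) ∈ cell F := h3
  have h5 := (mem_cell_iff hK).1 (cell_mono (facet_subset hF) h4) F' hF'
  rw [AffineMap.apply_lineMap, ← h, bary_opposite hK hF' hy hyF', AffineMap.lineMap_apply] at h5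
  simp at h5
  linarith

theorem intrinsicInterior_cell_nonempty (hn : 0 < n) (hF : F ∈ facets K) :
    (intrinsicInterior ℝ (cell F)).Nonempty :=
  Set.Nonempty.intrinsicInterior (convex_cell F)
    (convexHull_nonempty_iff.2 (by exact_mod_cast facet_nonempty hn hF))

/-- Both coordinates are affine and vanish on the same hyperplane, so they are proportional. The
factor is read off at the vertex opposite to `F`. -/
theorem exists_bary_eq_mul (hK : IsSimplex K) (hK' : IsSimplex K') (hF : F ∈ facets K)
    (hF' : F ∈ facets K') : ∃ c : ℝ, c ≠ 0 ∧ ∀ x, bary K' F x = c * bary K F x := by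
  classical
  obtain ⟨z, hz, hzF, hFe⟩ := exists_opposite hK hF
  have key : ∀ x, bary K' F x = bary K' F z * bary K F x := by
    intro x
    rw [hK.basis.affineMap_eq_sum (bary K' F) x, Finset.sum_eq_single ⟨z, hz⟩]
    · rw [← bary_erase hK hz, ← hFe, mul_comm]; rfl
    · intro y _ hy
      have : (y : Pt n) ∈ F := by
        rw [hFe, Finset.mem_erase]
        exact ⟨fun h => hy (Subtype.ext h), y.2⟩
      rw [hK.basis_apply, bary_vertex hK' hF' this, mul_zero]
    · simp
  refine ⟨_, fun h => ?_, key⟩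
  obtain ⟨z', hz', hzF', -⟩ := exists_opposite hK' hF'
  have := key z'
  rw [bary_opposite hK' hF' hz' hzF', h, zero_mul] at this
  exact one_ne_zero this

/-- A small shift of a point of the open facet along the gradient keeps the other coordinates of
both simplices positive and, as the factor is positive, makes both coordinates of `F` positive. -/
theorem interior_inter_nonempty_of_pos (hn : 0 < n) (hK : IsSimplex K) (hK' : IsSimplex K')
    (hF : F ∈ facets K) (hF' : F ∈ facets K') {c : ℝ} (hc : 0 < c)
    (h : ∀ x, bary K' F x = c * bary K F x) :
    (interior (cell K) ∩ interior (cell K')).Nonempty := by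
  obtain ⟨x, hx⟩ := intrinsicInterior_cell_nonempty hn hF
  have hx1 := intrinsicInterior_subset_openFacet hK hF hx
  have hx2 := intrinsicInterior_subset_openFacet hK' hF' hx
  have hg := norm_gvec_pos hn hK hF
  have hcont : Tendsto (fun t : ℝ => x + t • gvec K F) (𝓝[>] 0) (𝓝 x) := by
    have : Continuous fun t : ℝ => x + t • gvec K F := by fun_prop
    have := this.tendsto 0
    simp only [zero_smul, add_zero] at this
    exact this.mono_left nhdsWithin_le_nhds
  have hev : ∀ {L : Finset (Pt n)}, x ∈ openFacet L F →
      ∀ᶠ t in 𝓝[>] (0 : ℝ), ∀ F' ∈ facets L, F' ≠ F → 0 < bary L F' (x + t • gvec K F) := by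
    intro L hL
    rw [Filter.eventually_all_finset]
    intro F' hF'
    by_cases hne : F' = F
    · simp [hne]
    · have := ((continuous_bary L F').tendsto x).comp hcont
      filter_upwards [Filter.Tendsto.eventually_const_lt (hL.2 F' hF' hne) this] with t ht _ using ht
  have hpos : ∀ t : ℝ, 0 < t → 0 < bary K F (x + t • gvec K F) := by
    intro t ht
    rw [bary_add, hx1.1, inner_smul_right, real_inner_self_eq_norm_sq]
    positivity
  obtain ⟨t, ⟨h1, h2⟩, ht⟩ := ((hev hx1).and (hev hx2)).and self_mem_nhdsWithin |>.exists
  refine ⟨x + t • gvec K F, (mem_interior_cell_iff hK).2 fun F' hF1 => ?_,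
    (mem_interior_cell_iff hK').2 fun F' hF1 => ?_⟩
  · rcases eq_or_ne F' F with rfl | hne
    · exact hpos t ht
    · exact h1 F' hF1 hne
  · rcases eq_or_ne F' F with rfl | hne
    · rw [h]; exact mul_pos hc (hpos t ht)
    · exact h2 F' hF1 hne

/-- Two simplices with a common facet and disjoint interiors lie on opposite sides. -/
theorem exists_neg_bary_eq_mul (hn : 0 < n) (hK : IsSimplex K) (hK' : IsSimplex K')
    (hF : F ∈ facets K) (hF' : F ∈ facets K')
    (hd : interior (cell K) ∩ interior (cell K') = ∅) :
    ∃ c : ℝ, c < 0 ∧ ∀ x, bary K' F x = c * bary K F x := by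
  obtain ⟨c, hc, h⟩ := exists_bary_eq_mul hK hK' hF hF'
  refine ⟨c, lt_of_le_of_ne (not_lt.1 fun hpos => ?_) hc, h⟩
  have := interior_inter_nonempty_of_pos hn hK hK' hF hF' hpos h
  rw [hd] at this
  simp at this

theorem nrm_eq_neg (hn : 0 < n) (hK : IsSimplex K) (hK' : IsSimplex K')
    (hF : F ∈ facets K) (hF' : F ∈ facets K')
    (hd : interior (cell K) ∩ interior (cell K') = ∅) (i : Fin n) :
    nrm K' F i = -nrm K F i := by
  obtain ⟨c, hc, h⟩ := exists_neg_bary_eq_mul hn hK hK' hF hF' hd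
  have hg : ∀ j, baryGrad K' F j = c * baryGrad K F j := by
    intro j
    have h1 := bary_sub K' F (EuclideanSpace.single j 1) 0
    have h2 := bary_sub K F (EuclideanSpace.single j 1) 0
    rw [sub_zero, ← bary_linear] at h1 h2
    rw [baryGrad, baryGrad, ← h1, ← h2, h, h]; ring
  have hgv : gvec K' F = c • gvec K F := by
    ext j; simp [hg]
  have := norm_gvec_pos hn hK hF
  rw [nrm_eq, nrm_eq, hgv, norm_smul, hg, Real.norm_of_nonpos hc.le]
  have := hc.ne
  field_simp

/-- Near the point the coordinates of all other facets stay positive in both simplices, so the sign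
of `bary K F` alone decides which of the two contains a given neighbour. -/
theorem openFacet_subset_interior_union (hK : IsSimplex K) (hK' : IsSimplex K')
    {c : ℝ} (hc : c < 0) (h : ∀ x, bary K' F x = c * bary K F x)
    {x : Pt n} (hx : x ∈ openFacet K F) (hx' : x ∈ openFacet K' F) :
    x ∈ interior (cell K ∪ cell K') := by
  rw [mem_interior_iff_mem_nhds]
  have hev : ∀ {L : Finset (Pt n)}, x ∈ openFacet L F →
      ∀ᶠ y in 𝓝 x, ∀ F' ∈ facets L, F' ≠ F → 0 < bary L F' y := by
    intro L hL
    rw [Filter.eventually_all_finset]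
    intro F' hF'
    by_cases hne : F' = F
    · simp [hne]
    · filter_upwards [Filter.Tendsto.eventually_const_lt (hL.2 F' hF' hne)
        ((continuous_bary L F').tendsto x)] with t ht _ using ht
  filter_upwards [hev hx, hev hx'] with y h1 h2
  by_cases hy : 0 ≤ bary K F y
  · refine Or.inl ((mem_cell_iff hK).2 fun F' hF' => ?_)
    rcases eq_or_ne F' F with rfl | hne
    · exact hy
    · exact (h1 F' hF' hne).le
  · refine Or.inr ((mem_cell_iff hK').2 fun F' hF' => ?_)
    rcases eq_or_ne F' F with rfl | hne
    · rw [h]; nlinarith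
    · exact (h2 F' hF' hne).le

end SharedFacets

/-! ### Incidence of facets and elements in a triangulation. -/

section Triangulations

variable {n : ℕ} {T : Finset (Finset (Pt n))} {Ω : Set (Pt n)} {K K' F : Finset (Pt n)}

theorem IsTriangulation.simplex (hT : IsTriangulation T Ω) (hK : K ∈ T) : IsSimplex K :=
  ⟨hT.card K hK, hT.indep K hK⟩

theorem IsTriangulation.interior_cell_subset (hT : IsTriangulation T Ω) (hK : K ∈ T) :
    interior (cell K) ⊆ Ω := by
  rw [← hT.cover]
  exact interior_mono (Set.subset_biUnion_of_mem (u := fun K => cell K) hK)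

/-- Only the interior of an element is known to lie in the region, which suffices because the
boundary of a convex set is a null set. -/
theorem IsTriangulation.ae_volK (hT : IsTriangulation T Ω) (hK : K ∈ T) {p : Pt n → Prop}
    (h : ∀ᵐ x ∂(volume.restrict Ω), p x) : ∀ᵐ x ∂(volK K), p x := by
  have h1 : volK K = volume.restrict (interior (cell K)) :=
    (Measure.restrict_congr_set (interior_ae_eq_of_null_frontier (volume_frontier_cell K))).symm
  rw [h1]
  exact ae_restrict_of_ae_restrict_of_subset (hT.interior_cell_subset hK) h

theorem IsTriangulation.volK_le (hT : IsTriangulation T Ω) (hK : K ∈ T) :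
    volK K ≤ volume.restrict Ω := by
  have h1 : volK K = volume.restrict (interior (cell K)) :=
    (Measure.restrict_congr_set (interior_ae_eq_of_null_frontier (volume_frontier_cell K))).symm
  rw [h1]
  exact Measure.restrict_mono_set _ (hT.interior_cell_subset hK)

/-- The common vertices of two different elements sharing `F` are exactly those of `F`, so
conformity confines the intersection to `cell F`, where a barycentric coordinate vanishes. -/
theorem IsTriangulation.disjoint_interior (hT : IsTriangulation T Ω) (hK : K ∈ T) (hK' : K' ∈ T)
    (hne : K ≠ K') (hF : F ∈ facets K) (hF' : F ∈ facets K') :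
    interior (cell K) ∩ interior (cell K') = ∅ := by
  classical
  rw [Set.eq_empty_iff_forall_notMem]
  rintro y ⟨h1, h2⟩
  have h3 : y ∈ cell K ∩ cell K' := ⟨interior_subset h1, interior_subset h2⟩
  rw [hT.conforming K hK K' hK', ← Finset.coe_inter] at h3
  have h4 : F = K ∩ K' := by
    refine Finset.eq_of_subset_of_card_le
      (Finset.subset_inter (facet_subset hF) (facet_subset hF')) ?_
    rw [facet_card hF]
    have : K ∩ K' ⊂ K := by
      refine Finset.inter_subset_left.ssubset_of_ne fun h => hne ?_
      exact Finset.eq_of_subset_of_card_le (Finset.inter_eq_left.1 h)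
        (by rw [hT.card K hK, hT.card K' hK'])
    have := Finset.card_lt_card this
    rw [hT.card K hK] at this
    omega
  rw [← h4] at h3
  have h5 := bary_eq_zero_of_mem (hT.simplex hK) hF h3
  exact ((mem_interior_cell_iff (hT.simplex hK)).1 h1 F hF).ne' h5

theorem IsTriangulation.nrm_eq_neg (hn : 0 < n) (hT : IsTriangulation T Ω) (hK : K ∈ T)
    (hK' : K' ∈ T) (hne : K ≠ K') (hF : F ∈ facets K) (hF' : F ∈ facets K') (i : Fin n) :
    nrm K' F i = -nrm K F i :=
  _root_.nrm_eq_neg hn (hT.simplex hK) (hT.simplex hK') hF hF'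
    (hT.disjoint_interior hK hK' hne hF hF') i

/-- At most two elements share a facet. -/
theorem IsTriangulation.eq_or_eq (hn : 0 < n) (hT : IsTriangulation T Ω) {K₁ K₂ K₃ : Finset (Pt n)}
    (h1 : K₁ ∈ T) (h2 : K₂ ∈ T) (h3 : K₃ ∈ T) (hne : K₁ ≠ K₂) (hF1 : F ∈ facets K₁)
    (hF2 : F ∈ facets K₂) (hF3 : F ∈ facets K₃) : K₃ = K₁ ∨ K₃ = K₂ := by
  by_contra! hc
  obtain ⟨a, ha, hab⟩ := exists_neg_bary_eq_mul hn (hT.simplex h1) (hT.simplex h2) hF1 hF2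
    (hT.disjoint_interior h1 h2 hne hF1 hF2)
  obtain ⟨b, hb, hbb⟩ := exists_neg_bary_eq_mul hn (hT.simplex h1) (hT.simplex h3) hF1 hF3
    (hT.disjoint_interior h1 h3 hc.1.symm hF1 hF3)
  obtain ⟨d, hd, hdb⟩ := exists_neg_bary_eq_mul hn (hT.simplex h2) (hT.simplex h3) hF2 hF3
    (hT.disjoint_interior h2 h3 hc.2.symm hF2 hF3)
  obtain ⟨z, hz, hzF, -⟩ := exists_opposite (hT.simplex h1) hF1
  have e1 := hab z
  have e2 := hbb z
  have e3 := hdb z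
  -- With three elements pairwise on opposite sides the factors would satisfy `b = d * a`, although
  -- all three are negative.
  rw [bary_opposite (hT.simplex h1) hF1 hz hzF] at e1 e2
  rw [e1, e2] at e3
  nlinarith

/-- The interior of a facet shared by two elements is in the triangulated region. -/
theorem IsTriangulation.intrinsicInterior_subset (hn : 0 < n) (hT : IsTriangulation T Ω)
    (hK : K ∈ T) (hK' : K' ∈ T) (hne : K ≠ K') (hF : F ∈ facets K) (hF' : F ∈ facets K') :
    intrinsicInterior ℝ (cell F) ⊆ Ω := by
  intro x hx
  obtain ⟨c, hc, h⟩ := exists_neg_bary_eq_mul hn (hT.simplex hK) (hT.simplex hK') hF hF'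
    (hT.disjoint_interior hK hK' hne hF hF')
  have := openFacet_subset_interior_union (hT.simplex hK) (hT.simplex hK') hc h
    (intrinsicInterior_subset_openFacet (hT.simplex hK) hF hx)
    (intrinsicInterior_subset_openFacet (hT.simplex hK') hF' hx)
  rw [← hT.cover]
  refine interior_mono (Set.union_subset ?_ ?_) this
  · exact Set.subset_biUnion_of_mem (u := fun K => cell K) hK
  · exact Set.subset_biUnion_of_mem (u := fun K => cell K) hK'

/-- A facet that belongs to one element only is on the boundary. -/
theorem IsTriangulation.openFacet_subset_frontier (hn : 0 < n) (hT : IsTriangulation T Ω)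
    (hK : K ∈ T) (hF : F ∈ facets K) (hone : ∀ K' ∈ T, F ∈ facets K' → K' = K) :
    openFacet K F ⊆ frontier Ω := by
  classical
  intro x hx
  have hS := hT.simplex hK
  have hopen : IsOpen Ω := by rw [← hT.cover]; exact isOpen_interior
  rw [hopen.frontier_eq]
  have hxK : x ∈ cell K := openFacet_subset_cell hS hx
  refine ⟨?_, fun hxΩ => ?_⟩
  · refine closure_mono (hT.interior_cell_subset hK) ?_
    rw [(convex_cell K).closure_interior_eq_closure_of_nonempty_interior (interior_cell_nonempty hS)]
    exact subset_closure hxK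
  rw [← hT.cover, mem_interior_iff_mem_nhds] at hxΩ
  have hg := norm_gvec_pos hn hS hF
  have hcont : Tendsto (fun t : ℝ => x - t • gvec K F) (𝓝[>] 0) (𝓝 x) := by
    have : Continuous fun t : ℝ => x - t • gvec K F := by fun_prop
    have := this.tendsto 0
    simp only [zero_smul, sub_zero] at this
    exact this.mono_left nhdsWithin_le_nhds
  -- Points just outside `K` across the facet still belong to the union. If no other element
  -- contained `x`, closedness would keep those elements away from a neighbourhood of `x`.
  obtain ⟨K', hK', hne, hxK'⟩ : ∃ K' ∈ T, K' ≠ K ∧ x ∈ cell K' := by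
    by_contra! hc
    have hev : ∀ᶠ t in 𝓝[>] (0 : ℝ), ∀ K' ∈ T, K' ≠ K → x - t • gvec K F ∉ cell K' := by
      rw [Filter.eventually_all_finset]
      intro K' hK'
      by_cases hne : K' = K
      · simp [hne]
      · have := hcont.eventually ((isCompact_cell K').isClosed.isOpen_compl.mem_nhds (hc K' hK' hne))
        filter_upwards [this] with t ht _ using ht
    obtain ⟨t, ⟨h1, h2⟩, ht⟩ := ((hcont.eventually hxΩ).and hev).and self_mem_nhdsWithin |>.exists
    obtain ⟨K', hK', hmem⟩ := Set.mem_iUnion₂.1 h1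
    rcases eq_or_ne K' K with rfl | hne
    · have := (mem_cell_iff hS).1 hmem F hF
      rw [sub_eq_add_neg, ← smul_neg, bary_add, hx.1, inner_smul_right, inner_neg_right,
        real_inner_self_eq_norm_sq] at this
      have : 0 < t * ‖gvec K' F‖ ^ 2 := mul_pos ht (by positivity)
      linarith
    · exact h2 K' hK' hne hmem
  -- Conformity puts `x` in the hull of the common vertices. Were a vertex of `F` not among them,
  -- its coordinate would vanish at `x`, contrary to the choice of `x` in the open facet. So `F` is
  -- a facet of `K'` too.
  have h3 : x ∈ cell K ∩ cell K' := ⟨hxK, hxK'⟩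
  rw [hT.conforming K hK K' hK', ← Finset.coe_inter] at h3
  refine hne (hone K' hK' (Finset.mem_powersetCard.2 ⟨fun y hy => ?_, facet_card hF⟩))
  by_contra hyK'
  have hyK := facet_subset hF hy
  have h4 : K ∩ K' ⊆ K.erase y := by
    intro w hw
    rw [Finset.mem_inter] at hw
    rw [Finset.mem_erase]
    exact ⟨fun h => hyK' (h ▸ hw.2), hw.1⟩
  have h5 : x ∈ cell (K.erase y) := cell_mono h4 h3
  have h6 := bary_eq_zero_of_mem hS (erase_mem_facets hS hyK) h5
  have h7 := hx.2 _ (erase_mem_facets hS hyK) (fun h => by rw [← h] at hy; simp at hy)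
  exact h7.ne' h6

open scoped Classical in
/-- A sum over the facets of all elements vanishes if the two contributions of every facet
cancel. -/
theorem IsTriangulation.sum_eq_zero (hn : 0 < n) (hT : IsTriangulation T Ω)
    (P : Finset (Pt n) → Prop) [DecidablePred P]
    (hP : ∀ K ∈ T, ∀ F ∈ facets K, P F → ∃ K' ∈ T, K' ≠ K ∧ F ∈ facets K')
    (g : Finset (Pt n) → Finset (Pt n) → ℂ)
    (hg : ∀ K ∈ T, ∀ K' ∈ T, K ≠ K' → ∀ F, F ∈ facets K → F ∈ facets K' → g K' F = -g K F) :
    ∑ K ∈ T, ∑ F ∈ (facets K).filter P, g K F = 0 := by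
  rw [Finset.sum_comm' (t' := (T.biUnion facets).filter P) (s' := fun F => T.filter (F ∈ facets ·))
    (by intro K F; simp only [Finset.mem_filter, Finset.mem_biUnion]; grind)]
  refine Finset.sum_eq_zero fun F hF => ?_
  obtain ⟨h1, hPF⟩ := Finset.mem_filter.1 hF
  obtain ⟨K, hK, hFK⟩ := Finset.mem_biUnion.1 h1
  obtain ⟨K', hK', hne, hFK'⟩ := hP K hK F hFK hPF
  have : T.filter (F ∈ facets ·) = {K, K'} := by
    ext L
    simp only [Finset.mem_filter, Finset.mem_insert, Finset.mem_singleton]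
    constructor
    · rintro ⟨hL, hFL⟩
      exact hT.eq_or_eq hn hK hK' hL hne.symm hFK hFK' hFL
    · rintro (rfl | rfl)
      · exact ⟨hK, hFK⟩
      · exact ⟨hK', hFK'⟩
  rw [this, Finset.sum_pair hne.symm, hg K hK K' hK' hne.symm F hFK hFK']
  ring

open scoped Classical in
-- Passes from sums over the facets of one element to the sums over pairs of elements in which the
-- transmission conditions of the scheme are written.
theorem sum_eq_sum_of_existsUnique {T' : Finset (Finset (Pt n))} {P : Finset (Pt n) → Prop}
    (h : ∀ F ∈ facets K, P F → ∃! K', K' ∈ T' ∧ F ∈ facets K')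
    (g : Finset (Pt n) → ℂ) :
    ∑ F ∈ (facets K).filter P, g F
      = ∑ K' ∈ T', ∑ F ∈ (facets K ∩ facets K').filter P, g F := by
  rw [Finset.sum_comm' (t' := (facets K).filter P) (s' := fun F => T'.filter (F ∈ facets ·))
    (by intro K' F; simp only [Finset.mem_filter, Finset.mem_inter]; grind)]
  refine Finset.sum_congr rfl fun F hF => ?_
  obtain ⟨h1, h2⟩ := Finset.mem_filter.1 hF
  obtain ⟨K', hK', huniq⟩ := h F h1 h2
  have : T'.filter (F ∈ facets ·) = {K'} := by
    ext L
    simp only [Finset.mem_filter, Finset.mem_singleton]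
    exact ⟨fun hL => huniq L hL, fun hL => hL ▸ hK'⟩
  rw [this, Finset.sum_singleton]

end Triangulations

/-! ### Classification of facets: interior, interface, outer boundary. -/

section MeshPair

variable {n : ℕ} {D : Geom n} {κ h : ℝ} {TE TA : Finset (Finset (Pt n))} {K K' F : Finset (Pt n)}

theorem not_liesOn_of_disjoint (hn : 0 < n) (hF : F ∈ facets K) {S S' : Set (Pt n)}
    (hd : Disjoint S S') (h : LiesOn S F) : ¬ LiesOn S' F := by
  intro h'
  obtain ⟨x, hx⟩ := intrinsicInterior_cell_nonempty hn hF
  exact Set.disjoint_left.1 hd (h hx) (h' hx)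

theorem Geom.Γ_subset_O (D : Geom n) : D.Γ ⊆ D.O :=
  frontier_subset_closure.trans D.closure_subset

theorem Geom.disjoint_O_frontier (D : Geom n) : Disjoint D.O (frontier D.O) := by
  rw [D.isOpen_O.frontier_eq]; exact Set.disjoint_sdiff_right

theorem Geom.disjoint_Γ_frontier (D : Geom n) : Disjoint D.Γ (frontier D.O) :=
  D.disjoint_O_frontier.mono_left D.Γ_subset_O

theorem Geom.ΓN_subset (D : Geom n) : D.ΓN ⊆ frontier D.O := by
  rw [← D.union_eq]; exact Set.subset_union_right

theorem Geom.disjoint_ΩE_Γ (D : Geom n) : Disjoint D.ΩE D.Γ := by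
  rw [Geom.Γ, D.isOpen_ΩE.frontier_eq]; exact Set.disjoint_sdiff_right

theorem Geom.disjoint_ΩA_Γ (D : Geom n) : Disjoint D.ΩA D.Γ :=
  Set.disjoint_sdiff_left.mono_right frontier_subset_closure

theorem Geom.disjoint_ΩE_ΩA (D : Geom n) : Disjoint D.ΩE D.ΩA :=
  Set.disjoint_sdiff_right.mono_left subset_closure

theorem Geom.frontier_ΩA_subset (D : Geom n) : frontier D.ΩA ⊆ D.Γ ∪ frontier D.O := by
  rw [Geom.ΩA, Set.sdiff_eq]
  intro x hx
  rcases frontier_inter_subset _ _ hx with h | h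
  · exact Or.inr h.1
  · rw [frontier_compl] at h
    exact Or.inl (frontier_closure_subset h.2)

theorem IsMeshPair.exists_ne_of_elastic (hn : 0 < n) (hM : IsMeshPair D κ h TE TA) (hK : K ∈ TE)
    (hF : F ∈ facets K) (hΓ : ¬ LiesOn D.Γ F) : ∃ K' ∈ TE, K' ≠ K ∧ F ∈ facets K' := by
  by_contra! hc
  refine hΓ fun x hx => ?_
  refine hM.triE.openFacet_subset_frontier hn hK hF (fun K' hK' hF' => ?_)
    (intrinsicInterior_subset_openFacet (hM.triE.simplex hK) hF hx)
  by_contra hne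
  exact hc K' hK' hne hF'

/-- A facet with a single element lies in the boundary of the acoustic region, the union of parts of
the disjoint closed sets `Γ` and `∂O`. Being connected, the open facet lies in one of them, and the
mesh resolves the splitting of `∂O`. -/
theorem IsMeshPair.exists_ne_of_acoustic (hn : 0 < n) (hM : IsMeshPair D κ h TE TA) (hK : K ∈ TA)
    (hF : F ∈ facets K) (hΓ : ¬ LiesOn D.Γ F) (hD : ¬ LiesOn D.ΓD F) (hN : ¬ LiesOn D.ΓN F) :
    ∃ K' ∈ TA, K' ≠ K ∧ F ∈ facets K' := by
  by_contra! hc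
  have h1 := hM.triA.openFacet_subset_frontier hn hK hF (fun K' hK' hF' => by
    by_contra hne
    exact hc K' hK' hne hF')
  have h2 := isPreconnected_iff_subset_of_disjoint_closed.1 (convex_openFacet K F).isPreconnected
    D.Γ (frontier D.O) isClosed_frontier isClosed_frontier (h1.trans D.frontier_ΩA_subset)
    (by rw [D.disjoint_Γ_frontier.inter_eq, Set.inter_empty])
  have h3 := intrinsicInterior_subset_openFacet (hM.triA.simplex hK) hF
  rcases h2 with h2 | h2
  · exact hΓ (h3.trans h2)
  · rcases hM.split F ⟨K, hK, hF⟩ (h3.trans h2) with h | h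
    · exact hD h
    · exact hN h

/-- Existence is the compatibility of the meshes. Two acoustic elements at `F` would place its
relative interior inside the open acoustic region, which does not meet `Γ`. -/
theorem IsMeshPair.existsUnique_acoustic (hn : 0 < n) (hM : IsMeshPair D κ h TE TA) (hK : K ∈ TE)
    (hF : F ∈ facets K) (hΓ : LiesOn D.Γ F) : ∃! K', K' ∈ TA ∧ F ∈ facets K' := by
  obtain ⟨K', hK', hF'⟩ := (hM.compatible F hΓ).1 ⟨K, hK, hF⟩
  refine ⟨K', ⟨hK', hF'⟩, fun L hL => ?_⟩
  by_contra hne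
  exact not_liesOn_of_disjoint hn hF D.disjoint_ΩA_Γ
    (hM.triA.intrinsicInterior_subset hn hL.1 hK' hne hL.2 hF') hΓ

theorem IsMeshPair.existsUnique_elastic (hn : 0 < n) (hM : IsMeshPair D κ h TE TA) (hK : K ∈ TA)
    (hF : F ∈ facets K) (hΓ : LiesOn D.Γ F) : ∃! K', K' ∈ TE ∧ F ∈ facets K' := by
  obtain ⟨K', hK', hF'⟩ := (hM.compatible F hΓ).2 ⟨K, hK, hF⟩
  refine ⟨K', ⟨hK', hF'⟩, fun L hL => ?_⟩
  by_contra hne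
  exact not_liesOn_of_disjoint hn hF D.disjoint_ΩE_Γ
    (hM.triE.intrinsicInterior_subset hn hL.1 hK' hne hL.2 hF') hΓ

theorem IsMeshPair.nrm_eq_neg (hn : 0 < n) (hM : IsMeshPair D κ h TE TA) (hK : K ∈ TE)
    (hK' : K' ∈ TA) (hF : F ∈ facets K) (hF' : F ∈ facets K') (i : Fin n) :
    nrm K' F i = -nrm K F i := by
  refine _root_.nrm_eq_neg hn (hM.triE.simplex hK) (hM.triA.simplex hK') hF hF' ?_ i
  exact (D.disjoint_ΩE_ΩA.mono (hM.triE.interior_cell_subset hK)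
    (hM.triA.interior_cell_subset hK')).inter_eq

end MeshPair

/-! ### The divergence theorem for polynomial vector fields. -/

section ConjugatePolynomials

variable {n : ℕ}

@[simp] theorem conjP_sub (p q : CPoly n) : conjP (p - q) = conjP p - conjP q := map_sub _ _ _
@[simp] theorem conjP_mul (p q : CPoly n) : conjP (p * q) = conjP p * conjP q := map_mul _ _ _

/-- The commutator of two derivations is a derivation, and this one vanishes on the variables. -/
theorem pderiv_comm (i j : Fin n) (p : CPoly n) :
    MvPolynomial.pderiv i (MvPolynomial.pderiv j p)
      = MvPolynomial.pderiv j (MvPolynomial.pderiv i p) := by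
  have h : ⁅(MvPolynomial.pderiv i : Derivation ℂ (CPoly n) (CPoly n)),
      (MvPolynomial.pderiv j : Derivation ℂ (CPoly n) (CPoly n))⁆ = 0 := by
    refine MvPolynomial.derivation_ext fun l => ?_
    simp [Derivation.commutator_apply, MvPolynomial.pderiv_X, Pi.single_apply, apply_ite]
  have := congrArg (fun D : Derivation ℂ (CPoly n) (CPoly n) => D p) h
  simpa [Derivation.commutator_apply, sub_eq_zero] using this

@[simp] theorem evT_apply (t : PolyT n) (x : Pt n) (i j : Fin n) : evT t x i j = evS (t i j) x := rfl
@[simp] theorem evV_apply (t : PolyV n) (x : Pt n) (i : Fin n) : evV t x i = evS (t i) x := rfl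

variable {K F : Finset (Pt n)}

theorem integrable_surf_of_continuous (hn : 0 < n) (hK : IsSimplex K) (hF : F ∈ facets K)
    {f : Pt n → ℂ} (hf : Continuous f) : Integrable f (surf F) := by
  have := isFiniteMeasure_surf hn hK hF
  have h : (μHE[n - 1] : Measure (Pt n)) (cell F) ≠ ⊤ := by
    have := measure_lt_top (surf F) Set.univ
    simpa [surf] using this.ne
  rw [← memLp_one_iff_integrable]
  exact memLp_of_continuous (isCompact_cell F) h hf 1

theorem memLp_surf_evS (hn : 0 < n) (hK : IsSimplex K) (hF : F ∈ facets K) (p : CPoly n) :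
    MemLp (evS p) 2 (surf F) := by
  have := isFiniteMeasure_surf hn hK hF
  have h : (μHE[n - 1] : Measure (Pt n)) (cell F) ≠ ⊤ := by
    have := measure_lt_top (surf F) Set.univ
    simpa [surf] using this.ne
  exact memLp_of_continuous (isCompact_cell F) h (continuous_evS p) 2

theorem ae_surf_mem (F : Finset (Pt n)) : ∀ᵐ x ∂(surf F), x ∈ cell F :=
  ae_restrict_mem (isCompact_cell F).measurableSet

/-- The divergence theorem for polynomial vector fields. -/
theorem integral_divV (hn : 0 < n) (hK : IsSimplex K) (P : PolyV n) :
    ∫ x, evS (divV P) x ∂(volK K) = ∑ F ∈ facets K, ∫ x, dotN K F (evV P x) ∂(surf F) := by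
  simp only [divV, evS_sum, dotN, evV_apply]
  rw [integral_finsetSum _ fun i _ => integrable_of_continuous K (by fun_prop)]
  simp only [integral_pderiv_eq_sum_surf hn hK]
  rw [Finset.sum_comm]
  refine Finset.sum_congr rfl fun F hF => ?_
  rw [integral_finsetSum _ fun i _ => integrable_surf_of_continuous hn hK hF (by fun_prop)]

theorem integral_divV_eq_zero (hn : 0 < n) (hK : IsSimplex K) (P : PolyV n)
    (h : ∀ F ∈ facets K, ∀ x ∈ cell F, dotN K F (evV P x) = 0) :
    ∫ x, evS (divV P) x ∂(volK K) = 0 := by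
  rw [integral_divV hn hK]
  refine Finset.sum_eq_zero fun F hF => ?_
  refine integral_eq_zero_of_ae ?_
  filter_upwards [ae_surf_mem F] with x hx using h F hF x hx

theorem card_facets (hK : IsSimplex K) : (facets K).card = n + 1 := by
  rw [facets, Finset.card_powersetCard, hK.card]
  simp

end ConjugatePolynomials

/-! ### Bounds and scaling common to the bubbles of both dimensions. -/

section BubbleBounds

variable {n : ℕ} {K : Finset (Pt n)} {κ : ℝ}

theorem prod_bary_nonneg (hK : IsSimplex K) {S : Finset (Finset (Pt n))} (hS : S ⊆ facets K)
    {x : Pt n} (hx : x ∈ cell K) : 0 ≤ ∏ F ∈ S, bary K F x :=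
  Finset.prod_nonneg fun F hF => (mem_cell_iff hK).1 hx F (hS hF)

theorem prod_bary_le_one (hK : IsSimplex K) {S : Finset (Finset (Pt n))} (hS : S ⊆ facets K)
    {x : Pt n} (hx : x ∈ cell K) : ∏ F ∈ S, bary K F x ≤ 1 :=
  Finset.prod_le_one (fun F hF => (mem_cell_iff hK).1 hx F (hS hF))
    fun _ hF => bary_le_one hK (hS hF) hx

/-- On the half-size ball each coordinate is at least the inscribed radius over twice the diameter.
This equals `1 / (2 * κ)`, independently of the element. -/
theorem le_prod_bary (hn : 0 < n) (hκ : 0 < κ) (hK : IsSimplex K) {S : Finset (Finset (Pt n))}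
    (hS : S ⊆ facets K) {x y : Pt n} (hx : Metric.closedBall x (Metric.diam (cell K) / κ) ⊆ cell K)
    (hy : y ∈ Metric.closedBall x (Metric.diam (cell K) / κ / 2)) :
    (1 / (2 * κ)) ^ S.card ≤ ∏ F ∈ S, bary K F y := by
  have hd := diam_cell_pos hn hK
  rw [← Finset.prod_const]
  refine Finset.prod_le_prod (fun _ _ => by positivity) fun F hF => ?_
  have := bary_lower_bound hn hK (hS hF) (by positivity) hx hy
  have e : Metric.diam (cell K) / κ / (2 * Metric.diam (cell K)) = 1 / (2 * κ) := by field_simp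
  rwa [e] at this

theorem closedBall_half_subset (hn : 0 < n) (hκ : 0 < κ) (hK : IsSimplex K) {x : Pt n}
    (hx : Metric.closedBall x (Metric.diam (cell K) / κ) ⊆ cell K) :
    Metric.closedBall x (Metric.diam (cell K) / κ / 2) ⊆ cell K := by
  have hd := diam_cell_pos hn hK
  exact (Metric.closedBall_subset_closedBall (half_le_self (by positivity))).trans hx

theorem integrable_volK_of_continuous {f : Pt n → ℝ} (hf : Continuous f) (K : Finset (Pt n)) :
    Integrable f (volK K) :=
  hf.continuousOn.integrableOn_compact (isCompact_cell K)

theorem integral_volK_mono {f g : Pt n → ℝ} (hf : Continuous f) (hg : Continuous g)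
    (h : ∀ x ∈ cell K, f x ≤ g x) : ∫ x, f x ∂(volK K) ≤ ∫ x, g x ∂(volK K) :=
  integral_mono_ae (integrable_volK_of_continuous hf K) (integrable_volK_of_continuous hg K)
    ((ae_restrict_mem (isCompact_cell K).measurableSet).mono h)

theorem le_integral_volK_of_ball {f g : Pt n → ℝ} (hf : Continuous f) (hg : Continuous g)
    {x : Pt n} {r : ℝ} (hB : Metric.closedBall x r ⊆ cell K)
    (h0 : ∀ x ∈ cell K, 0 ≤ g x) (h : ∀ y ∈ Metric.closedBall x r, f y ≤ g y) :
    ∫ y in Metric.closedBall x r, f y ≤ ∫ y, g y ∂(volK K) := by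
  have hgK : IntegrableOn g (cell K) := hg.continuousOn.integrableOn_compact (isCompact_cell K)
  calc _ ≤ ∫ y in Metric.closedBall x r, g y :=
        setIntegral_mono_on (hf.continuousOn.integrableOn_compact (isCompact_closedBall _ _))
          (hgK.mono_set hB) measurableSet_closedBall h
    _ ≤ _ := setIntegral_mono_set hgK
        ((ae_restrict_mem (isCompact_cell K).measurableSet).mono h0)
        (Filter.Eventually.of_forall hB)

theorem nsq_flat_eq_sum (K : Finset (Pt n)) (t : PolyT n) :
    nsq (volK K) (flat (evT t)) = ∑ i, ∑ j, ∫ x, ‖evS (t i j) x‖ ^ 2 ∂(volK K) := by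
  rw [nsq, integral_finsetSum]
  · rw [Fintype.sum_prod_type]; rfl
  · intro p _
    exact integrable_volK_of_continuous (f := fun x => ‖evS (t p.1 p.2) x‖ ^ 2) (by fun_prop) K

/-- A tensor polynomial whose first derivatives are pointwise bounded by a given polynomial tensor
is close to a constant. -/
theorem exists_sub_const_bound (hn : 0 < n) (k : ℕ) (hκ : 0 < κ) : ∃ C : ℝ, 0 < C ∧
    ∀ K : Finset (Pt n), IsShapeRegular κ K → ∀ a ∈ PkT n k, ∀ N : ℝ,
      (∀ i j l, ∫ x, ‖evS (MvPolynomial.pderiv l (a i j)) x‖ ^ 2 ∂(volK K) ≤ N) →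
      ∃ A : Matrix (Fin n) (Fin n) ℂ, nsq (volK K) (flat fun x => evT a x - A)
        ≤ C * Metric.diam (cell K) ^ 2 * N := by
  obtain ⟨C, hC, h⟩ := exists_poincare_bound hn k hκ
  refine ⟨C * n ^ 3, by positivity, fun K hK a ha N hN => ?_⟩
  obtain ⟨x₀, hx₀⟩ := h K hK
  refine ⟨evT a x₀, ?_⟩
  rw [nsq, integral_finsetSum]
  · simp only [Fintype.sum_prod_type, flat, Matrix.sub_apply, evT_apply]
    calc _ ≤ ∑ i : Fin n, ∑ j : Fin n, C * Metric.diam (cell K) ^ 2 * (n * N) := by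
          refine Finset.sum_le_sum fun i _ => Finset.sum_le_sum fun j _ => ?_
          refine (hx₀ _ (ha i j)).trans (mul_le_mul_of_nonneg_left ?_ (by positivity))
          refine (Finset.sum_le_sum fun l _ => hN i j l).trans ?_
          simp
      _ = _ := by simp; ring
  · intro p _
    exact integrable_volK_of_continuous
      (f := fun x => ‖evS (a p.1 p.2) x - evS (a p.1 p.2) x₀‖ ^ 2) (by fun_prop) K

/-- Scaling of a bubble test function. -/
theorem bubble_scaling {a τ₀ : PolyT n} {A : Matrix (Fin n) (Fin n) ℂ} {N J d q c₁ c₂ c₃ : ℝ}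
    (hd : 0 < d) (hq : 0 < q) (hc₁ : 0 < c₁) (hc₂ : 0 < c₂) (hc₃ : 0 < c₃)
    (hJ : ‖ipT (volK K) (evT a) (evT τ₀)‖ = J) (hNJ : N ≤ c₁ * (q * J))
    (hτ : d ^ 2 * q ^ 2 * nsq (volK K) (flat (evT τ₀)) ≤ c₂ * N)
    (hA : nsq (volK K) (flat fun x => evT a x - A) ≤ c₃ * d ^ 2 * N) {τ : PolyT n}
    (hs : evT τ = fun x => ((d ^ 2 * q : ℝ) : ℂ) • evT τ₀ x) :
    nsq (volK K) (flat fun x => evT a x - A)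
        ≤ (c₃ * c₁ + c₂ * c₁) * ‖ipT (volK K) (evT a) (evT τ)‖ ∧
      nsq (volK K) (flat (evT τ)) ≤ (c₃ * c₁ + c₂ * c₁) * ‖ipT (volK K) (evT a) (evT τ)‖ := by
  have hJ0 : 0 ≤ J := hJ ▸ norm_nonneg _
  -- The factor `d ^ 2 * q` gives the test function the size of `a - A`. Two derivatives cost `d⁻²`;
  -- `q` compensates the size of the bubble, being `1` in the plane and `d ^ 2` in space, where
  -- `b_K` carries two gradients of order `d⁻¹`.
  have hnorm : ‖ipT (volK K) (evT a) (evT τ)‖ = d ^ 2 * q * J := by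
    have : ipT (volK K) (evT a) (evT τ)
        = ((d ^ 2 * q : ℝ) : ℂ) * ipT (volK K) (evT a) (evT τ₀) := by
      rw [hs, ipT_eq, ipT_eq]
      have := ip_smul_right (m := volK K) (f := flat (evT a)) (g := flat (evT τ₀))
        ((d ^ 2 * q : ℝ) : ℂ)
      rw [Complex.conj_ofReal] at this
      exact this
    rw [this, norm_mul, Complex.norm_real, Real.norm_of_nonneg (by positivity), hJ]
  have e0 : nsq (volK K) (flat (evT τ)) = (d ^ 2 * q) ^ 2 * nsq (volK K) (flat (evT τ₀)) := by
    have := nsq_smul (m := volK K) (f := flat (evT τ₀)) ((d ^ 2 * q : ℝ) : ℂ)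
    rw [Complex.norm_real, Real.norm_of_nonneg (by positivity)] at this
    rw [hs]
    exact this
  rw [hnorm, e0]
  constructor
  · have e1 : c₃ * d ^ 2 * N ≤ c₃ * d ^ 2 * (c₁ * (q * J)) := by gcongr
    have e2 : 0 ≤ c₂ * c₁ * (d ^ 2 * q * J) := by positivity
    linarith
  · have e2 : d ^ 2 * (c₂ * N) ≤ d ^ 2 * (c₂ * (c₁ * (q * J))) := by gcongr
    have e3 : 0 ≤ c₃ * c₁ * (d ^ 2 * q * J) := by positivity
    have e4 := mul_le_mul_of_nonneg_left hτ (sq_nonneg d)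
    linarith

end BubbleBounds

/-! ### The planar bubble. -/

section Bubble2

variable {K F : Finset (Pt 2)} {κ : ℝ}

theorem evS_bubble2 (K : Finset (Pt 2)) (x : Pt 2) :
    evS (bubble2 K) x = ((∏ F ∈ facets K, bary K F x : ℝ) : ℂ) := by
  simp [bubble2, evS_baryPoly]

theorem bubble2_facet (hK : IsSimplex K) (hF : F ∈ facets K) {x : Pt 2} (hx : x ∈ cell F) :
    evS (bubble2 K) x = 0 := by
  rw [evS_bubble2, Finset.prod_eq_zero hF (bary_eq_zero_of_mem hK hF hx)]
  simp

/-- A row is the rotated gradient of `w i * bubble2 K`. As the bubble vanishes on the facet, the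
gradient there is normal and its rotation tangential. -/
theorem curlV2_mul_normal (hK : IsSimplex K) (hF : F ∈ facets K) (w : PolyV 2) {x : Pt 2}
    (hx : x ∈ cell F) : mulN K F (evT (curlV2 fun i => w i * bubble2 K) x) = 0 := by
  classical
  have h : bubble2 K = baryPoly K F * ∏ F' ∈ (facets K).erase F, baryPoly K F' :=
    (Finset.mul_prod_erase _ _ hF).symm
  have h0 : evS (baryPoly K F) x = 0 := by rw [evS_baryPoly, bary_eq_zero_of_mem hK hF hx]; simp
  funext i
  simp [mulN, curlV2, h, Derivation.leibniz, h0, nrm_eq]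
  ring

theorem divT_curlV2 (w : PolyV 2) : divT (curlV2 w) = 0 := by
  funext i
  simp [divT, curlV2]
  rw [pderiv_comm]
  ring

/-- Integration by parts against a planar bubble. -/
theorem ipT_curlV2 (hK : IsSimplex K) (a : PolyT 2) :
    ipT (volK K) (evT a) (evT (curlV2 fun i => curlT2 a i * bubble2 K))
      = -((∫ x, (∑ i, ‖evS (curlT2 a i) x‖ ^ 2) * ∏ F ∈ facets K, bary K F x ∂(volK K) : ℝ) : ℂ) := by
  -- The divergence theorem for the rotated row of `a` times the conjugate of `curlT2 a i * bubble2
  -- K`. The facet integrals vanish with the bubble, and the product rule yields the two volume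
  -- terms.
  have hdiv := fun i => integral_divV_eq_zero two_pos hK
    (![a i 1 * conjP (curlT2 a i * bubble2 K), -(a i 0 * conjP (curlT2 a i * bubble2 K))])
    (by
      intro F hF x hx
      simp [dotN, Fin.sum_univ_two, bubble2_facet hK hF hx])
  have hsum : ∫ x, ∑ i : Fin 2, evS (divV ![a i 1 * conjP (curlT2 a i * bubble2 K),
      -(a i 0 * conjP (curlT2 a i * bubble2 K))]) x ∂(volK K) = 0 := by
    rw [integral_finsetSum _ fun i _ => integrable_of_continuous K (by fun_prop)]
    simp only [hdiv, Finset.sum_const_zero]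
  rw [← integral_complex_ofReal, ← sub_eq_zero, sub_neg_eq_add, ← hsum, ipT,
    ← integral_add]
  · refine integral_congr_ae (Filter.Eventually.of_forall fun x => ?_)
    have hb : conj (evS (bubble2 K) x) = evS (bubble2 K) x := by
      rw [evS_bubble2, Complex.conj_ofReal]
    have hb2 : ((∏ F ∈ facets K, bary K F x : ℝ) : ℂ) = evS (bubble2 K) x := (evS_bubble2 K x).symm
    simp only
    rw [Complex.ofReal_mul, hb2]
    simp only [Fin.sum_univ_two, curlV2, divV, evT_apply, Matrix.of_apply, Matrix.cons_val_zero,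
      Matrix.cons_val_one, Derivation.leibniz, smul_eq_mul, evS_add, evS_mul, evS_neg, map_add,
      map_mul, map_neg, evS_conjP, pderiv_conjP, conjP_mul, hb, Complex.ofReal_add,
      Complex.ofReal_pow, ← Complex.mul_conj', curlT2, evS_sub, map_sub, conjP_sub]
    ring
  · refine integrable_of_continuous K ?_
    simp only [evT_apply]
    fun_prop
  · refine integrable_of_continuous K ?_
    have : ∀ F, Continuous (bary K F) := continuous_bary K
    fun_prop

theorem skew_apply {n k : ℕ} {a : PolyT n} (ha : a ∈ skewSpace n k) (i j : Fin n) :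
    a i j = -a j i := by
  have := congrFun (congrFun ha.1 i) j
  simpa [eq_neg_iff_add_eq_zero] using this

theorem skew_diag {n k : ℕ} {a : PolyT n} (ha : a ∈ skewSpace n k) (i : Fin n) : a i i = 0 :=
  self_eq_neg.1 (skew_apply ha i i)

theorem PkS_curlT2 {k : ℕ} {a : PolyT 2} (ha : a ∈ PkT 2 k) (i : Fin 2) : curlT2 a i ∈ PkS 2 k :=
  PkS_mono (Nat.sub_le _ _) (PkS_sub (PkS_pderiv _ (ha _ _)) (PkS_pderiv _ (ha _ _)))

theorem PkS_prod_baryPoly {n : ℕ} (K : Finset (Pt n)) (S : Finset (Finset (Pt n))) :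
    ∏ F ∈ S, baryPoly K F ∈ PkS n S.card := by
  refine (MvPolynomial.totalDegree_finsetProd _ _).trans ?_
  calc _ ≤ ∑ F ∈ S, 1 := Finset.sum_le_sum fun F _ => PkS_baryPoly K F
    _ = _ := by simp

/-- The planar bubble test function. -/
theorem exists_bubble_test2 (k : ℕ) (hκ : 0 < κ) : ∃ C : ℝ, 0 < C ∧
    ∀ K : Finset (Pt 2), IsShapeRegular κ K → ∀ a ∈ skewSpace 2 k, ∃ τ ∈ bubbleSpace 2 k K,
      (∃ A : Matrix (Fin 2) (Fin 2) ℂ, nsq (volK K) (flat fun x => evT a x - A)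
        ≤ C * ‖ipT (volK K) (evT a) (evT τ)‖) ∧
      nsq (volK K) (flat (evT τ)) ≤ C * ‖ipT (volK K) (evT a) (evT τ)‖ := by
  obtain ⟨C₁, hC₁, h₁⟩ := exists_inner_ball_bound two_pos k hκ
  obtain ⟨C₂, hC₂, h₂⟩ := exists_inverse_bound two_pos (k + 3) hκ
  obtain ⟨C₃, hC₃, h₃⟩ := exists_sub_const_bound two_pos k hκ
  set c : ℝ := (1 / (2 * κ)) ^ 3 with hc
  have hcpos : 0 < c := by positivity
  refine ⟨C₃ * (C₁ / c) + 2 * C₂ * (C₁ / c), by positivity, fun K hK a ha => ?_⟩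
  have hd := diam_cell_pos two_pos hK.simplex
  set d := Metric.diam (cell K) with hddef
  set m := curlT2 a with hm
  have hmP : ∀ i, m i ∈ PkS 2 k := PkS_curlT2 ha.2
  set N := ∑ i, ∫ x, ‖evS (m i) x‖ ^ 2 ∂(volK K) with hN
  have hNi : ∀ i, ∫ x, ‖evS (m i) x‖ ^ 2 ∂(volK K) ≤ N := fun i =>
    Finset.single_le_sum (f := fun i => ∫ x, ‖evS (m i) x‖ ^ 2 ∂(volK K))
      (fun _ _ => integral_nonneg fun _ => by positivity) (Finset.mem_univ i)
  -- the unscaled test function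
  set τ₀ : PolyT 2 := curlV2 fun i => m i * bubble2 K with hτ₀
  set J := ∫ x, (∑ i, ‖evS (m i) x‖ ^ 2) * ∏ F ∈ facets K, bary K F x ∂(volK K) with hJ
  have hip : ipT (volK K) (evT a) (evT τ₀) = -(J : ℂ) := ipT_curlV2 hK.simplex a
  have hbary : ∀ F, Continuous (bary K F) := continuous_bary K
  -- The weight `∏ η_F` is at least `c` on the half-size ball, and the norm of a polynomial on that
  -- ball controls its norm on the whole element. So the weight can be removed from the integral.
  have hNJ : N ≤ C₁ / c * J := by
    obtain ⟨x, hx, hb⟩ := h₁ K hK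
    have hB := closedBall_half_subset two_pos hκ hK.simplex hx
    have h5 : ∫ y in Metric.closedBall x (d / κ / 2), c * ∑ i, ‖evS (m i) y‖ ^ 2 ≤ J := by
      refine le_integral_volK_of_ball (by fun_prop) (by fun_prop) hB (fun y hy => ?_) fun y hy => ?_
      · exact mul_nonneg (Finset.sum_nonneg fun _ _ => by positivity)
          (prod_bary_nonneg hK.simplex subset_rfl hy)
      · rw [mul_comm]
        refine mul_le_mul_of_nonneg_left ?_ (Finset.sum_nonneg fun _ _ => by positivity)
        have := le_prod_bary two_pos hκ hK.simplex subset_rfl hx hy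
        rwa [card_facets hK.simplex] at this
    rw [integral_const_mul, integral_finsetSum _ fun i _ =>
      ((by fun_prop : Continuous fun y => ‖evS (m i) y‖ ^ 2).continuousOn.integrableOn_compact
        (isCompact_closedBall _ _))] at h5
    have h6 : N ≤ C₁ * ∑ i, ∫ y in Metric.closedBall x (d / κ / 2), ‖evS (m i) y‖ ^ 2 := by
      rw [hN, Finset.mul_sum]
      exact Finset.sum_le_sum fun i _ => hb _ (hmP i)
    rw [div_mul_eq_mul_div, le_div_iff₀ hcpos]
    nlinarith
  have hτN : ∀ i j, d ^ 2 * ∫ x, ‖evS (τ₀ i j) x‖ ^ 2 ∂(volK K)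
      ≤ C₂ * ∫ x, ‖evS (m i) x‖ ^ 2 ∂(volK K) := by
    intro i j
    have hdeg : m i * bubble2 K ∈ PkS 2 (k + 3) := by
      have := PkS_prod_baryPoly K (facets K)
      rw [card_facets hK.simplex] at this
      exact PkS_mul (hmP i) this
    have hle : ∫ x, ‖evS (m i * bubble2 K) x‖ ^ 2 ∂(volK K) ≤ ∫ x, ‖evS (m i) x‖ ^ 2 ∂(volK K) := by
      refine integral_volK_mono (by fun_prop) (by fun_prop) fun x hx => ?_
      rw [evS_mul, evS_bubble2, norm_mul, Complex.norm_real,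
        Real.norm_of_nonneg (prod_bary_nonneg hK.simplex subset_rfl hx)]
      exact pow_le_pow_left₀ (mul_nonneg (norm_nonneg _) (prod_bary_nonneg hK.simplex subset_rfl hx))
        (mul_le_of_le_one_right (norm_nonneg _) (prod_bary_le_one hK.simplex subset_rfl hx)) 2
    have t0 : τ₀ i 0 = -MvPolynomial.pderiv 1 (m i * bubble2 K) := rfl
    have t1 : τ₀ i 1 = MvPolynomial.pderiv 0 (m i * bubble2 K) := rfl
    fin_cases j
    · simp only [Fin.zero_eta, t0, evS_neg, norm_neg]
      exact (h₂ K hK _ hdeg 1).trans (mul_le_mul_of_nonneg_left hle hC₂.le)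
    · simp only [Fin.mk_one, t1]
      exact (h₂ K hK _ hdeg 0).trans (mul_le_mul_of_nonneg_left hle hC₂.le)
  obtain ⟨A, hA⟩ := h₃ K hK a ha.2 N (by
    intro i j l
    -- A planar skew tensor has one independent entry, and up to sign the two components of its curl
    -- are the two partial derivatives of this entry.
    have key : ∫ x, ‖evS (MvPolynomial.pderiv l (a i j)) x‖ ^ 2 ∂(volK K) = 0 ∨
        ∃ i', ∫ x, ‖evS (MvPolynomial.pderiv l (a i j)) x‖ ^ 2 ∂(volK K)
          = ∫ x, ‖evS (m i') x‖ ^ 2 ∂(volK K) := by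
      have h10 := skew_apply ha 1 0
      have h0 := skew_diag ha 0
      have h1 := skew_diag ha 1
      fin_cases i <;> fin_cases j
      · left; simp [h0]
      · right; refine ⟨l, ?_⟩
        fin_cases l <;> simp [m, curlT2, h10, h0, h1]
      · right; refine ⟨l, ?_⟩
        fin_cases l <;> simp [m, curlT2, h10, h0, h1]
      · left; simp [h1]
    rcases key with h | ⟨i', h⟩
    · rw [h]; exact (integral_nonneg fun _ => by positivity).trans (hNi 0)
    · rw [h]; exact hNi i')
  -- The scaling factor is put on the skew tensor that generates the bubble function, so that
  -- membership in the bubble space is immediate.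
  have hscale : evT (curlV2 fun i => curlT2 ((MvPolynomial.C ((d ^ 2 * 1 : ℝ) : ℂ) : CPoly 2) • a) i * bubble2 K)
      = fun x => ((d ^ 2 * 1 : ℝ) : ℂ) • evT τ₀ x := by
    generalize ((d ^ 2 * 1 : ℝ) : ℂ) = s
    funext x
    ext i j
    fin_cases j <;> simp [τ₀, curlV2, curlT2, m, Derivation.leibniz] <;> ring
  have hJn : ‖ipT (volK K) (evT a) (evT τ₀)‖ = |J| := by
    rw [hip, norm_neg, Complex.norm_real, Real.norm_eq_abs]
  have hNJ' : N ≤ C₁ / c * (1 * |J|) := by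
    refine hNJ.trans ?_
    rw [one_mul]
    gcongr
    exact le_abs_self J
  have hτ' : d ^ 2 * 1 ^ 2 * nsq (volK K) (flat (evT τ₀)) ≤ 2 * C₂ * N := by
    rw [nsq_flat_eq_sum, hN, Finset.mul_sum, Finset.mul_sum]
    refine Finset.sum_le_sum fun i _ => ?_
    rw [Finset.mul_sum, one_pow, mul_one]
    refine (Finset.sum_le_sum fun j _ => hτN i j).trans ?_
    simp; linarith
  have hfin := bubble_scaling hd one_pos (by positivity) (by positivity) hC₃ hJn hNJ' hτ' hA hscale
  refine ⟨_, ⟨_, ?_, rfl⟩, ⟨A, hfin.1⟩, hfin.2⟩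
  refine ⟨?_, fun i j => PkS_C_mul _ (ha.2 i j)⟩
  rw [Matrix.transpose_smul, ← smul_add, ha.1, smul_zero]

end Bubble2

/-! ### The bubble matrix in three dimensions. -/

section Bubble3

/-- The spanning property of the gradients for complex vectors, by separating real and imaginary
parts. It makes the form of the bubble matrix positive definite, although each of its summands has
rank one. -/
theorem sum_norm_sq_le_sum_gvec {n : ℕ} {K : Finset (Pt n)} (hK : IsSimplex K) (w : Fin n → ℂ) :
    ∑ j, ‖w j‖ ^ 2 ≤ (n + 1) * Metric.diam (cell K) ^ 2 *
      ∑ F ∈ facets K, ‖∑ j, w j * (baryGrad K F j : ℂ)‖ ^ 2 := by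
  have h1 := norm_sq_le_sum_inner_gvec hK (WithLp.toLp 2 fun j => (w j).re)
  have h2 := norm_sq_le_sum_inner_gvec hK (WithLp.toLp 2 fun j => (w j).im)
  have e1 : ∑ j, ‖w j‖ ^ 2 = ‖WithLp.toLp 2 fun j => (w j).re‖ ^ 2
      + ‖WithLp.toLp 2 fun j => (w j).im‖ ^ 2 := by
    rw [EuclideanSpace.norm_sq_eq, EuclideanSpace.norm_sq_eq, ← Finset.sum_add_distrib]
    refine Finset.sum_congr rfl fun j _ => ?_
    rw [Complex.sq_norm, Complex.normSq_apply]
    simp; ring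
  have e2 : ∀ F, ‖∑ j, w j * (baryGrad K F j : ℂ)‖ ^ 2
      = inner ℝ (gvec K F) (WithLp.toLp 2 fun j => (w j).re) ^ 2
        + inner ℝ (gvec K F) (WithLp.toLp 2 fun j => (w j).im) ^ 2 := by
    intro F
    rw [Complex.sq_norm, Complex.normSq_apply, PiLp.inner_apply, PiLp.inner_apply]
    simp [Complex.re_sum, Complex.im_sum]; ring
  rw [e1]
  simp only [e2, Finset.sum_add_distrib, mul_add]
  linarith

variable {K F : Finset (Pt 3)} {κ : ℝ}

open scoped Classical in
/-- The coefficient of the gradient belonging to the facet `F` in a row of `m b_K`. -/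
def bubbleCoeff (K : Finset (Pt 3)) (w : PolyV 3) (F : Finset (Pt 3)) : CPoly 3 :=
  (∏ F' ∈ (facets K).erase F, baryPoly K F') * ∑ l, w l * MvPolynomial.C (baryGrad K F l : ℂ)

theorem mul_bubble3_apply (K : Finset (Pt 3)) (m : PolyT 3) (i j : Fin 3) :
    (m * bubble3 K) i j
      = ∑ F ∈ facets K, bubbleCoeff K (m i) F * MvPolynomial.C (baryGrad K F j : ℂ) := by
  simp only [Matrix.mul_apply, bubble3, Matrix.of_apply, bubbleCoeff, Finset.mul_sum,
    Complex.ofReal_mul, map_mul]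
  rw [Finset.sum_comm]
  refine Finset.sum_congr rfl fun F _ => ?_
  rw [Finset.sum_mul]
  exact Finset.sum_congr rfl fun l _ => by ring

open scoped Classical in
-- The coefficient belonging to another facet contains the factor `η_F`. Hence on `F` it vanishes,
-- and its gradient is parallel to the normal.
theorem bubbleCoeff_of_ne {F' : Finset (Pt 3)} (hF : F ∈ facets K) (hne : F' ≠ F) (w : PolyV 3) :
    ∃ r : CPoly 3, bubbleCoeff K w F' = baryPoly K F * r := by
  refine ⟨(∏ L ∈ ((facets K).erase F').erase F, baryPoly K L) *
    ∑ l, w l * MvPolynomial.C (baryGrad K F' l : ℂ), ?_⟩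
  rw [bubbleCoeff, ← mul_assoc, Finset.mul_prod_erase _ _ (Finset.mem_erase.2 ⟨hne.symm, hF⟩)]

/-- On a facet, the rows of `m b_K` are normal. -/
theorem evS_mul_bubble3_facet (hK : IsSimplex K) (hF : F ∈ facets K) (m : PolyT 3) (i : Fin 3)
    {x : Pt 3} (hx : x ∈ cell F) :
    ∃ c : ℂ, ∀ j, evS ((m * bubble3 K) i j) x = c * (baryGrad K F j : ℂ) := by
  refine ⟨evS (bubbleCoeff K (m i) F) x, fun j => ?_⟩
  rw [mul_bubble3_apply, evS_sum, Finset.sum_eq_single F]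
  · simp
  · intro F' hF' hne
    obtain ⟨r, hr⟩ := bubbleCoeff_of_ne hF hne (m i)
    rw [hr, evS_mul, evS_mul, evS_baryPoly, bary_eq_zero_of_mem hK hF hx]
    simp
  · intro h; exact absurd hF h

theorem curlT3_apply_zero (M : PolyT 3) (i : Fin 3) : curlT3 M i 0
    = MvPolynomial.pderiv 1 (M i 2) - MvPolynomial.pderiv 2 (M i 1) := rfl

theorem curlT3_apply_one (M : PolyT 3) (i : Fin 3) : curlT3 M i 1
    = MvPolynomial.pderiv 2 (M i 0) - MvPolynomial.pderiv 0 (M i 2) := rfl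

theorem curlT3_apply_two (M : PolyT 3) (i : Fin 3) : curlT3 M i 2
    = MvPolynomial.pderiv 0 (M i 1) - MvPolynomial.pderiv 1 (M i 0) := rfl

/-- A row of `m * bubble3 K` is a sum of terms `c_{F'} ∇η_{F'}`, with curl `∇c_{F'} × ∇η_{F'}`. Its
product with `∇η_F` is a triple product with a repeated direction: for `F' = F` obviously, and
otherwise because `∇c_{F'}` is parallel to `∇η_F` on `F`. -/
theorem curlT3_mul_normal (hK : IsSimplex K) (hF : F ∈ facets K) (m : PolyT 3) {x : Pt 3}
    (hx : x ∈ cell F) : mulN K F (evT (curlT3 (m * bubble3 K)) x) = 0 := by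
  funext i
  have hd : ∀ l j, evS (MvPolynomial.pderiv l ((m * bubble3 K) i j)) x
      = ∑ F' ∈ facets K, evS (MvPolynomial.pderiv l (bubbleCoeff K (m i) F')) x
        * (baryGrad K F' j : ℂ) := by
    intro l j
    rw [mul_bubble3_apply, map_sum, evS_sum]
    refine Finset.sum_congr rfl fun F' _ => ?_
    simp [Derivation.leibniz]; ring
  have key : ∀ F' ∈ facets K,
      (baryGrad K F 0 : ℂ) * (evS (MvPolynomial.pderiv 1 (bubbleCoeff K (m i) F')) x
        * (baryGrad K F' 2 : ℂ) - evS (MvPolynomial.pderiv 2 (bubbleCoeff K (m i) F')) x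
        * (baryGrad K F' 1 : ℂ)) +
      (baryGrad K F 1 : ℂ) * (evS (MvPolynomial.pderiv 2 (bubbleCoeff K (m i) F')) x
        * (baryGrad K F' 0 : ℂ) - evS (MvPolynomial.pderiv 0 (bubbleCoeff K (m i) F')) x
        * (baryGrad K F' 2 : ℂ)) +
      (baryGrad K F 2 : ℂ) * (evS (MvPolynomial.pderiv 0 (bubbleCoeff K (m i) F')) x
        * (baryGrad K F' 1 : ℂ) - evS (MvPolynomial.pderiv 1 (bubbleCoeff K (m i) F')) x
        * (baryGrad K F' 0 : ℂ)) = 0 := by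
    intro F' hF'
    rcases eq_or_ne F' F with rfl | hne
    · ring
    · obtain ⟨r, hr⟩ := bubbleCoeff_of_ne hF hne (m i)
      have hl : ∀ l, evS (MvPolynomial.pderiv l (bubbleCoeff K (m i) F')) x
          = evS r x * (baryGrad K F l : ℂ) := by
        intro l
        rw [hr]
        simp [Derivation.leibniz, evS_baryPoly, bary_eq_zero_of_mem hK hF hx]
      simp only [hl]; ring
  have hs := Finset.sum_eq_zero key
  simp only [Finset.sum_add_distrib, ← Finset.mul_sum, Finset.sum_sub_distrib, ← hd] at hs
  simp only [mulN, Fin.sum_univ_three, evT_apply, curlT3_apply_zero, curlT3_apply_one,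
    curlT3_apply_two, evS_sub, nrm_eq, Pi.zero_apply]
  push_cast
  linear_combination (-(1 : ℂ) / (‖gvec K F‖ : ℂ)) * hs

theorem divT_curlT3 (W : PolyT 3) : divT (curlT3 W) = 0 := by
  funext i
  simp only [divT, curlT3, Fin.sum_univ_three, Matrix.of_apply, Matrix.cons_val_zero,
    Matrix.cons_val_one, Matrix.cons_val, map_sub, Pi.zero_apply]
  rw [pderiv_comm 1 0, pderiv_comm 2 0, pderiv_comm 2 1]
  ring

open scoped Classical in
/-- The pointwise quadratic form of the bubble matrix. -/
def bubbleForm (K : Finset (Pt 3)) (m : PolyT 3) (x : Pt 3) : ℝ :=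
  ∑ i, ∑ F ∈ facets K, (∏ F' ∈ (facets K).erase F, bary K F' x) *
    ‖∑ l, evS (m i l) x * (baryGrad K F l : ℂ)‖ ^ 2

theorem continuous_bubbleForm (K : Finset (Pt 3)) (m : PolyT 3) : Continuous (bubbleForm K m) := by
  have : ∀ F, Continuous (bary K F) := continuous_bary K
  unfold bubbleForm
  fun_prop

theorem evS_bubbleCoeff (K : Finset (Pt 3)) (w : PolyV 3) (F : Finset (Pt 3)) (x : Pt 3) :
    let := Classical.decEq (Finset (Pt 3))
    evS (bubbleCoeff K w F) x = ((∏ F' ∈ (facets K).erase F, bary K F' x : ℝ) : ℂ) *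
      ∑ l, evS (w l) x * (baryGrad K F l : ℂ) := by
  simp [bubbleCoeff, evS_baryPoly]
  left
  congr!

theorem sum_mul_conj_bubble3 (K : Finset (Pt 3)) (m : PolyT 3) (x : Pt 3) :
    ∑ i, ∑ j, evS (m i j) x * conj (evS ((m * bubble3 K) i j) x) = (bubbleForm K m x : ℂ) := by
  classical
  simp only [bubbleForm, Complex.ofReal_sum]
  refine Finset.sum_congr rfl fun i _ => ?_
  simp only [mul_bubble3_apply, evS_sum, map_sum, evS_mul, evS_C, map_mul, Finset.mul_sum,
    Complex.conj_ofReal]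
  rw [Finset.sum_comm]
  refine Finset.sum_congr rfl fun F _ => ?_
  rw [Complex.ofReal_mul, Complex.ofReal_pow, ← Complex.mul_conj', evS_bubbleCoeff, map_mul,
    Complex.conj_ofReal]
  rw [Finset.sum_mul, Finset.mul_sum]
  refine Finset.sum_congr rfl fun l _ => ?_
  rw [show ((facets K).erase F) = @Finset.erase _ (Classical.decEq _) (facets K) F by congr!]
  ring

/-- Integration by parts against a three dimensional bubble. -/
theorem ipT_curlT3 (hK : IsSimplex K) (a : PolyT 3) :
    ipT (volK K) (evT a) (evT (curlT3 (curlT3 a * bubble3 K)))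
      = ((∫ x, bubbleForm K (curlT3 a) x ∂(volK K) : ℝ) : ℂ) := by
  set W := curlT3 a * bubble3 K with hW
  -- The divergence theorem for the cross product of a row of `a` with the conjugate row of `W`. On
  -- a facet the row of `W` is normal, so the cross product has no flux.
  have hdiv := fun i => integral_divV_eq_zero three_pos hK
    (![a i 1 * conjP (W i 2) - a i 2 * conjP (W i 1), a i 2 * conjP (W i 0) - a i 0 * conjP (W i 2),
      a i 0 * conjP (W i 1) - a i 1 * conjP (W i 0)])
    (by
      intro F hF x hx
      obtain ⟨c, hc⟩ := evS_mul_bubble3_facet hK hF (curlT3 a) i hx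
      rw [← hW] at hc
      simp only [dotN, Fin.sum_univ_three, evV_apply, Matrix.cons_val_zero, Matrix.cons_val_one,
        Matrix.cons_val, evS_sub, evS_mul, evS_conjP, hc, map_mul, Complex.conj_ofReal, nrm_eq]
      push_cast
      ring)
  have hsum : ∫ x, ∑ i : Fin 3, evS (divV ![a i 1 * conjP (W i 2) - a i 2 * conjP (W i 1),
      a i 2 * conjP (W i 0) - a i 0 * conjP (W i 2),
      a i 0 * conjP (W i 1) - a i 1 * conjP (W i 0)]) x ∂(volK K) = 0 := by
    rw [integral_finsetSum _ fun i _ => integrable_of_continuous K (by fun_prop)]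
    simp only [hdiv, Finset.sum_const_zero]
  rw [← integral_complex_ofReal, ← add_zero (ipT _ _ _), ← hsum, ipT, ← integral_add]
  · refine integral_congr_ae (Filter.Eventually.of_forall fun x => ?_)
    simp only
    rw [← sum_mul_conj_bubble3, ← hW]
    simp only [Fin.sum_univ_three, curlT3, divV, evT_apply, Matrix.of_apply, Matrix.cons_val_zero,
      Matrix.cons_val_one, Matrix.cons_val, Derivation.leibniz, smul_eq_mul, evS_add, evS_mul,
      evS_conjP, pderiv_conjP, evS_sub, map_sub]
    ring
  · refine integrable_of_continuous K ?_
    simp only [evT_apply]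
    fun_prop
  · exact integrable_of_continuous K (by fun_prop)

theorem PkS_curlT3 {k : ℕ} {a : PolyT 3} (ha : a ∈ PkT 3 k) (i j : Fin 3) :
    curlT3 a i j ∈ PkS 3 k := by
  have := fun i j l => PkS_mono (Nat.sub_le k 1) (PkS_pderiv l (ha i j))
  fin_cases j <;> exact PkS_sub (this _ _ _) (this _ _ _)

theorem PkS_curlT3_mul_bubble3 (hK : IsSimplex K) {k : ℕ} {m : PolyT 3} (hm : m ∈ PkT 3 k)
    (i j : Fin 3) : (m * bubble3 K) i j ∈ PkS 3 (k + 3) := by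
  classical
  rw [mul_bubble3_apply]
  refine PkS_sum fun F hF => ?_
  rw [mul_comm]
  refine PkS_C_mul _ ?_
  rw [bubbleCoeff, mul_comm]
  refine PkS_mul (PkS_sum fun l _ => ?_) ?_
  · rw [mul_comm]; exact PkS_C_mul _ (hm i l)
  · have := PkS_prod_baryPoly K ((facets K).erase F)
    rw [Finset.card_erase_of_mem hF, card_facets hK] at this
    convert this

theorem norm_sum_mul_baryGrad_sq_le (w : Fin 3 → ℂ) :
    ‖∑ l, w l * (baryGrad K F l : ℂ)‖ ^ 2 ≤ (∑ l, ‖w l‖ ^ 2) * ‖gvec K F‖ ^ 2 := by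
  calc _ ≤ (∑ l, ‖w l‖ * |baryGrad K F l|) ^ 2 := by
        gcongr
        refine (norm_sum_le _ _).trans (Finset.sum_le_sum fun l _ => ?_)
        rw [norm_mul, Complex.norm_real, Real.norm_eq_abs]
    _ ≤ (∑ l, ‖w l‖ ^ 2) * ∑ l, |baryGrad K F l| ^ 2 := Finset.sum_mul_sq_le_sq_mul_sq _ _ _
    _ = _ := by rw [EuclideanSpace.norm_sq_eq]; simp

/-- Each of the four summands contains two gradients bounded by `κ` over the diameter and a product
of coordinates bounded by `1`. The constant `16` is the number of facets, once from Cauchy-Schwarz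
and once from the summation. -/
theorem norm_mul_bubble3_sq_le (hκ : 0 < κ) (hK : IsShapeRegular κ K) (m : PolyT 3) (i j : Fin 3)
    {x : Pt 3} (hx : x ∈ cell K) :
    (Metric.diam (cell K) ^ 2) ^ 2 * ‖evS ((m * bubble3 K) i j) x‖ ^ 2
      ≤ 16 * κ ^ 4 * ∑ l, ‖evS (m i l) x‖ ^ 2 := by
  set d := Metric.diam (cell K)
  have hd : 0 < d := diam_cell_pos three_pos hK.simplex
  set M := ∑ l, ‖evS (m i l) x‖ ^ 2
  have hM : 0 ≤ M := Finset.sum_nonneg fun _ _ => by positivity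
  have hterm : ∀ F ∈ facets K, (d ^ 2) ^ 2 *
      ‖evS (bubbleCoeff K (m i) F) x * (baryGrad K F j : ℂ)‖ ^ 2 ≤ κ ^ 4 * M := by
    intro F hF
    rw [evS_bubbleCoeff, norm_mul, norm_mul, Complex.norm_real, Complex.norm_real]
    let := Classical.decEq (Finset (Pt 3))
    set b := ∏ F' ∈ (facets K).erase F, bary K F' x
    have hb0 : 0 ≤ b := prod_bary_nonneg hK.simplex (Finset.erase_subset F _) hx
    have hb1 : b ≤ 1 := prod_bary_le_one hK.simplex (Finset.erase_subset F _) hx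
    rw [Real.norm_of_nonneg hb0]
    have h1 := norm_sum_mul_baryGrad_sq_le (K := K) (F := F) (fun l => evS (m i l) x)
    have h2 : ‖baryGrad K F j‖ ^ 2 ≤ ‖gvec K F‖ ^ 2 := by
      gcongr
      exact PiLp.norm_apply_le (gvec K F) j
    have h3 := norm_gvec_mul_diam_le three_pos hκ hK hF
    have h4 : (‖gvec K F‖ * d) ^ 4 ≤ κ ^ 4 := by gcongr
    calc _ = (d ^ 2) ^ 2 * (b ^ 2 * ‖∑ l, evS (m i l) x * (baryGrad K F l : ℂ)‖ ^ 2
          * ‖baryGrad K F j‖ ^ 2) := by ring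
      _ ≤ (d ^ 2) ^ 2 * (1 ^ 2 * (M * ‖gvec K F‖ ^ 2) * ‖gvec K F‖ ^ 2) := by gcongr
      _ = (‖gvec K F‖ * d) ^ 4 * M := by ring
      _ ≤ _ := by gcongr
  rw [mul_bubble3_apply, evS_sum]
  simp only [evS_mul, evS_C]
  calc _ ≤ (d ^ 2) ^ 2 * (∑ F ∈ facets K, ‖evS (bubbleCoeff K (m i) F) x
          * (baryGrad K F j : ℂ)‖) ^ 2 := by
        gcongr
        exact norm_sum_le _ _
    _ ≤ (d ^ 2) ^ 2 * ((facets K).card * ∑ F ∈ facets K, ‖evS (bubbleCoeff K (m i) F) x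
          * (baryGrad K F j : ℂ)‖ ^ 2) := by
        gcongr
        exact sq_sum_le_card_mul_sum_sq
    _ = 4 * ∑ F ∈ facets K, (d ^ 2) ^ 2 * ‖evS (bubbleCoeff K (m i) F) x
          * (baryGrad K F j : ℂ)‖ ^ 2 := by
        rw [card_facets hK.simplex, Finset.mul_sum, Finset.mul_sum, Finset.mul_sum]
        refine Finset.sum_congr rfl fun F _ => ?_
        push_cast; ring
    _ ≤ 4 * ∑ F ∈ facets K, κ ^ 4 * M := by
        exact mul_le_mul_of_nonneg_left (Finset.sum_le_sum hterm) (by norm_num)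
    _ = _ := by
        rw [Finset.sum_const, card_facets hK.simplex, nsmul_eq_mul]
        push_cast; ring

-- Six of the nine entries of the curl are, up to sign, single derivatives. The other three are, up
-- to sign, `q1 - p2`, `p2 + r0`, `q1 - r0` in the notation of the proof, and each of `p2`, `q1`,
-- `r0` is half a signed sum of them. So the curl controls the full gradient of a skew tensor.
set_option maxHeartbeats 1000000 in
theorem norm_pderiv_skew_le {k : ℕ} {a : PolyT 3} (ha : a ∈ skewSpace 3 k) (i j l : Fin 3)
    (x : Pt 3) : ‖evS (MvPolynomial.pderiv l (a i j)) x‖ ^ 2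
      ≤ ∑ i, ∑ j, ‖evS (curlT3 a i j) x‖ ^ 2 := by
  have h10 := skew_apply ha 1 0
  have h20 := skew_apply ha 2 0
  have h21 := skew_apply ha 2 1
  have h0 := skew_diag ha 0
  have h1 := skew_diag ha 1
  have h2 := skew_diag ha 2
  have hS : ∑ i, ∑ j, ‖evS (curlT3 a i j) x‖ ^ 2
      = ‖evS (MvPolynomial.pderiv 1 (a 0 2)) x - evS (MvPolynomial.pderiv 2 (a 0 1)) x‖ ^ 2
        + ‖evS (MvPolynomial.pderiv 0 (a 0 2)) x‖ ^ 2 + ‖evS (MvPolynomial.pderiv 0 (a 0 1)) x‖ ^ 2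
        + ‖evS (MvPolynomial.pderiv 1 (a 1 2)) x‖ ^ 2
        + ‖evS (MvPolynomial.pderiv 2 (a 0 1)) x + evS (MvPolynomial.pderiv 0 (a 1 2)) x‖ ^ 2
        + ‖evS (MvPolynomial.pderiv 1 (a 0 1)) x‖ ^ 2 + ‖evS (MvPolynomial.pderiv 2 (a 1 2)) x‖ ^ 2
        + ‖evS (MvPolynomial.pderiv 2 (a 0 2)) x‖ ^ 2
        + ‖evS (MvPolynomial.pderiv 1 (a 0 2)) x - evS (MvPolynomial.pderiv 0 (a 1 2)) x‖ ^ 2 := by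
    simp only [Fin.sum_univ_three, curlT3, Matrix.of_apply, Matrix.cons_val_zero,
      Matrix.cons_val_one, Matrix.cons_val, h10, h20, h21, h0, h1, h2, map_neg, map_zero, evS_sub,
      evS_neg, evS_zero, zero_sub, sub_zero, norm_neg, sub_neg_eq_add]
    rw [show ∀ u v : ℂ, -u - v = -(u + v) from fun u v => by ring, norm_neg,
      show ∀ u v : ℂ, -u + v = -(u - v) from fun u v => by ring, norm_neg,
      norm_sub_rev (evS (MvPolynomial.pderiv 0 (a 1 2)) x) (evS (MvPolynomial.pderiv 1 (a 0 2)) x)]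
    ring_nf
  rw [hS]
  set p2 := evS (MvPolynomial.pderiv 2 (a 0 1)) x
  set q1 := evS (MvPolynomial.pderiv 1 (a 0 2)) x
  set r0 := evS (MvPolynomial.pderiv 0 (a 1 2)) x
  have key : ∀ u v w z : ℂ, 2 * z = u + v + w → ‖z‖ ^ 2 ≤ ‖u‖ ^ 2 + ‖v‖ ^ 2 + ‖w‖ ^ 2 := by
    intro u v w z h
    have h1 : 2 * ‖z‖ ≤ ‖u‖ + ‖v‖ + ‖w‖ := by
      have : ‖2 * z‖ = 2 * ‖z‖ := by simp
      rw [← this, h]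
      exact norm_add₃_le
    nlinarith [sq_nonneg (‖u‖ - ‖v‖), sq_nonneg (‖v‖ - ‖w‖), sq_nonneg (‖u‖ - ‖w‖), norm_nonneg z]
  have kp := key (p2 + r0) (q1 - r0) (-(q1 - p2)) p2 (by ring)
  have kq := key (q1 - p2) (p2 + r0) (q1 - r0) q1 (by ring)
  have kr := key (p2 + r0) (-(q1 - r0)) (q1 - p2) r0 (by ring)
  simp only [norm_neg] at kp kr
  have h3 : ∀ i : Fin 3, i = 0 ∨ i = 1 ∨ i = 2 := by decide
  have n1 := sq_nonneg ‖evS (MvPolynomial.pderiv 0 (a 0 2)) x‖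
  have n2 := sq_nonneg ‖evS (MvPolynomial.pderiv 0 (a 0 1)) x‖
  have n3 := sq_nonneg ‖evS (MvPolynomial.pderiv 1 (a 1 2)) x‖
  have n4 := sq_nonneg ‖evS (MvPolynomial.pderiv 1 (a 0 1)) x‖
  have n5 := sq_nonneg ‖evS (MvPolynomial.pderiv 2 (a 1 2)) x‖
  have n6 := sq_nonneg ‖evS (MvPolynomial.pderiv 2 (a 0 2)) x‖
  have n7 := sq_nonneg ‖q1 - p2‖
  have n8 := sq_nonneg ‖p2 + r0‖
  have n9 := sq_nonneg ‖q1 - r0‖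
  have main01 : ∀ l, ‖evS (MvPolynomial.pderiv l (a 0 1)) x‖ ^ 2 ≤ ‖q1 - p2‖ ^ 2
      + ‖evS (MvPolynomial.pderiv 0 (a 0 2)) x‖ ^ 2 + ‖evS (MvPolynomial.pderiv 0 (a 0 1)) x‖ ^ 2
      + ‖evS (MvPolynomial.pderiv 1 (a 1 2)) x‖ ^ 2 + ‖p2 + r0‖ ^ 2
      + ‖evS (MvPolynomial.pderiv 1 (a 0 1)) x‖ ^ 2 + ‖evS (MvPolynomial.pderiv 2 (a 1 2)) x‖ ^ 2
      + ‖evS (MvPolynomial.pderiv 2 (a 0 2)) x‖ ^ 2 + ‖q1 - r0‖ ^ 2 := by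
    intro l
    rcases h3 l with rfl | rfl | rfl <;> linarith
  have main02 : ∀ l, ‖evS (MvPolynomial.pderiv l (a 0 2)) x‖ ^ 2 ≤ ‖q1 - p2‖ ^ 2
      + ‖evS (MvPolynomial.pderiv 0 (a 0 2)) x‖ ^ 2 + ‖evS (MvPolynomial.pderiv 0 (a 0 1)) x‖ ^ 2
      + ‖evS (MvPolynomial.pderiv 1 (a 1 2)) x‖ ^ 2 + ‖p2 + r0‖ ^ 2
      + ‖evS (MvPolynomial.pderiv 1 (a 0 1)) x‖ ^ 2 + ‖evS (MvPolynomial.pderiv 2 (a 1 2)) x‖ ^ 2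
      + ‖evS (MvPolynomial.pderiv 2 (a 0 2)) x‖ ^ 2 + ‖q1 - r0‖ ^ 2 := by
    intro l
    rcases h3 l with rfl | rfl | rfl <;> linarith
  have main12 : ∀ l, ‖evS (MvPolynomial.pderiv l (a 1 2)) x‖ ^ 2 ≤ ‖q1 - p2‖ ^ 2
      + ‖evS (MvPolynomial.pderiv 0 (a 0 2)) x‖ ^ 2 + ‖evS (MvPolynomial.pderiv 0 (a 0 1)) x‖ ^ 2
      + ‖evS (MvPolynomial.pderiv 1 (a 1 2)) x‖ ^ 2 + ‖p2 + r0‖ ^ 2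
      + ‖evS (MvPolynomial.pderiv 1 (a 0 1)) x‖ ^ 2 + ‖evS (MvPolynomial.pderiv 2 (a 1 2)) x‖ ^ 2
      + ‖evS (MvPolynomial.pderiv 2 (a 0 2)) x‖ ^ 2 + ‖q1 - r0‖ ^ 2 := by
    intro l
    rcases h3 l with rfl | rfl | rfl <;> linarith
  have hz : (0 : ℝ) ≤ ‖q1 - p2‖ ^ 2
      + ‖evS (MvPolynomial.pderiv 0 (a 0 2)) x‖ ^ 2 + ‖evS (MvPolynomial.pderiv 0 (a 0 1)) x‖ ^ 2
      + ‖evS (MvPolynomial.pderiv 1 (a 1 2)) x‖ ^ 2 + ‖p2 + r0‖ ^ 2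
      + ‖evS (MvPolynomial.pderiv 1 (a 0 1)) x‖ ^ 2 + ‖evS (MvPolynomial.pderiv 2 (a 1 2)) x‖ ^ 2
      + ‖evS (MvPolynomial.pderiv 2 (a 0 2)) x‖ ^ 2 + ‖q1 - r0‖ ^ 2 := by linarith
  rcases h3 i with rfl | rfl | rfl <;> rcases h3 j with rfl | rfl | rfl
  · simpa [h0] using hz
  · exact main01 l
  · exact main02 l
  · rw [h10, map_neg, evS_neg, norm_neg]; exact main01 l
  · simpa [h1] using hz
  · exact main12 l
  · rw [h20, map_neg, evS_neg, norm_neg]; exact main02 l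
  · rw [h21, map_neg, evS_neg, norm_neg]; exact main12 l
  · simpa [h2] using hz

/-- The bubble test function in three dimensions. -/
theorem exists_bubble_test3 (k : ℕ) (hκ : 0 < κ) : ∃ C : ℝ, 0 < C ∧
    ∀ K : Finset (Pt 3), IsShapeRegular κ K → ∀ a ∈ skewSpace 3 k, ∃ τ ∈ bubbleSpace 3 k K,
      (∃ A : Matrix (Fin 3) (Fin 3) ℂ, nsq (volK K) (flat fun x => evT a x - A)
        ≤ C * ‖ipT (volK K) (evT a) (evT τ)‖) ∧
      nsq (volK K) (flat (evT τ)) ≤ C * ‖ipT (volK K) (evT a) (evT τ)‖ := by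
  classical
  obtain ⟨C₁, hC₁, h₁⟩ := exists_inner_ball_bound three_pos k hκ
  obtain ⟨C₂, hC₂, h₂⟩ := exists_inverse_bound three_pos (k + 3) hκ
  obtain ⟨C₃, hC₃, h₃⟩ := exists_sub_const_bound three_pos k hκ
  set c : ℝ := (1 / (2 * κ)) ^ 3 with hc
  have hcpos : 0 < c := by positivity
  refine ⟨C₃ * (4 * C₁ / c) + (9 * (4 * (C₂ * (16 * κ ^ 4)))) * (4 * C₁ / c), by positivity,
    fun K hK a ha => ?_⟩
  have hd := diam_cell_pos three_pos hK.simplex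
  set d := Metric.diam (cell K) with hddef
  set m := curlT3 a with hm
  have hmP : ∀ i j, m i j ∈ PkS 3 k := PkS_curlT3 ha.2
  set N := ∑ i, ∑ j, ∫ x, ‖evS (m i j) x‖ ^ 2 ∂(volK K) with hN
  have hint : ∀ p : CPoly 3, Integrable (fun x => ‖evS p x‖ ^ 2) (volK K) := fun p =>
    integrable_volK_of_continuous (by fun_prop) K
  have hNint : N = ∫ x, ∑ i, ∑ j, ‖evS (m i j) x‖ ^ 2 ∂(volK K) := by
    refine ((integral_finsetSum _ fun i _ => integrable_finsetSum _ fun j _ => hint _).trans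
      (Finset.sum_congr rfl fun i _ => integral_finsetSum _ fun j _ => hint _)).symm
  set W := m * bubble3 K with hW
  set τ₀ : PolyT 3 := curlT3 W with hτ₀
  set J := ∫ x, bubbleForm K m x ∂(volK K) with hJ
  have hip : ipT (volK K) (evT a) (evT τ₀) = (J : ℂ) := ipT_curlT3 hK.simplex a
  -- On the half-size ball the coordinate products are at least `c`, and the spanning property of
  -- the gradients bounds `|m|²` by `4 * d ^ 2` times the sum of the squared components along them.
  have hNJ : N ≤ 4 * C₁ / c * (d ^ 2 * J) := by
    obtain ⟨x, hx, hb⟩ := h₁ K hK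
    have hB := closedBall_half_subset three_pos hκ hK.simplex hx
    have h5 : ∫ y in Metric.closedBall x (d / κ / 2), c * ∑ i, ∑ j, ‖evS (m i j) y‖ ^ 2
        ≤ ∫ y, 4 * d ^ 2 * bubbleForm K m y ∂(volK K) := by
      refine le_integral_volK_of_ball (by fun_prop)
        ((continuous_bubbleForm K m).const_mul _) hB (fun y hy => ?_) fun y hy => ?_
      · refine mul_nonneg (by positivity) ?_
        exact Finset.sum_nonneg fun i _ => Finset.sum_nonneg fun F _ => mul_nonneg
          (prod_bary_nonneg hK.simplex (Finset.erase_subset _ _) hy) (by positivity)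
      · rw [bubbleForm, Finset.mul_sum, Finset.mul_sum]
        refine Finset.sum_le_sum fun i _ => ?_
        have e1 := sum_norm_sq_le_sum_gvec hK.simplex (fun j => evS (m i j) y)
        calc _ ≤ c * ((3 + 1) * d ^ 2 * ∑ F ∈ facets K,
              ‖∑ j, evS (m i j) y * (baryGrad K F j : ℂ)‖ ^ 2) := by
              refine mul_le_mul_of_nonneg_left ?_ hcpos.le
              exact_mod_cast e1
          _ = 4 * d ^ 2 * ∑ F ∈ facets K, c * ‖∑ j, evS (m i j) y * (baryGrad K F j : ℂ)‖ ^ 2 := by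
              rw [← Finset.mul_sum]; ring
          _ ≤ _ := by
              refine mul_le_mul_of_nonneg_left (Finset.sum_le_sum fun F hF => ?_) (by positivity)
              refine mul_le_mul_of_nonneg_right ?_ (by positivity)
              have := le_prod_bary three_pos hκ hK.simplex
                (Finset.erase_subset F (facets K)) hx hy
              rwa [Finset.card_erase_of_mem hF, card_facets hK.simplex] at this
    have hintB : ∀ i j, IntegrableOn (fun y => ‖evS (m i j) y‖ ^ 2)
        (Metric.closedBall x (d / κ / 2)) := fun i j =>
      ((by fun_prop : Continuous fun y => ‖evS (m i j) y‖ ^ 2).continuousOn.integrableOn_compact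
        (isCompact_closedBall _ _))
    rw [integral_const_mul, integral_const_mul, integral_finsetSum _ fun i _ =>
      integrable_finsetSum _ fun j _ => hintB i j] at h5
    have h6 : N ≤ C₁ * ∑ i, ∫ y in Metric.closedBall x (d / κ / 2), ∑ j, ‖evS (m i j) y‖ ^ 2 := by
      rw [hN, Finset.mul_sum]
      refine Finset.sum_le_sum fun i _ => ?_
      rw [integral_finsetSum _ fun j _ => hintB i j, Finset.mul_sum]
      exact Finset.sum_le_sum fun j _ => hb _ (hmP i j)
    rw [div_mul_eq_mul_div, le_div_iff₀ hcpos]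
    nlinarith
  have hWN : ∀ i j, (d ^ 2) ^ 2 * ∫ x, ‖evS (W i j) x‖ ^ 2 ∂(volK K) ≤ 16 * κ ^ 4 * N := by
    intro i j
    rw [hNint, ← integral_const_mul, ← integral_const_mul]
    refine integral_volK_mono (by fun_prop) (by fun_prop) fun x hx => ?_
    refine (norm_mul_bubble3_sq_le hκ hK m i j hx).trans ?_
    refine mul_le_mul_of_nonneg_left ?_ (by positivity)
    exact Finset.single_le_sum (f := fun i => ∑ j, ‖evS (m i j) x‖ ^ 2)
      (fun _ _ => Finset.sum_nonneg fun _ _ => by positivity) (Finset.mem_univ i)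
  -- The two gradients in the bubble matrix account for `(d ^ 2) ^ 2`, the inverse inequality for
  -- the remaining `d ^ 2`.
  have hdW : ∀ i j l, d ^ 2 * (d ^ 2) ^ 2 *
      ∫ x, ‖evS (MvPolynomial.pderiv l (W i j)) x‖ ^ 2 ∂(volK K) ≤ C₂ * (16 * κ ^ 4) * N := by
    intro i j l
    have h1 := h₂ K hK _ (PkS_curlT3_mul_bubble3 hK.simplex hmP i j) l
    have h2 := mul_le_mul_of_nonneg_left h1 (by positivity : 0 ≤ (d ^ 2) ^ 2)
    have h3 := mul_le_mul_of_nonneg_left (hWN i j) hC₂.le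
    calc _ = (d ^ 2) ^ 2 * (d ^ 2 *
            ∫ x, ‖evS (MvPolynomial.pderiv l (W i j)) x‖ ^ 2 ∂(volK K)) := by ring
      _ ≤ _ := h2
      _ = C₂ * ((d ^ 2) ^ 2 * ∫ x, ‖evS (W i j) x‖ ^ 2 ∂(volK K)) := by ring
      _ ≤ _ := h3
      _ = _ := by ring
  have hτij : ∀ i j, d ^ 2 * (d ^ 2) ^ 2 * ∫ x, ‖evS (τ₀ i j) x‖ ^ 2 ∂(volK K)
      ≤ 4 * (C₂ * (16 * κ ^ 4)) * N := by
    intro i j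
    have hsub : ∀ p q : CPoly 3, ∫ x, ‖evS (p - q) x‖ ^ 2 ∂(volK K)
        ≤ 2 * ∫ x, ‖evS p x‖ ^ 2 ∂(volK K) + 2 * ∫ x, ‖evS q x‖ ^ 2 ∂(volK K) := by
      intro p q
      rw [← integral_const_mul, ← integral_const_mul,
        ← integral_add ((hint p).const_mul _) ((hint q).const_mul _)]
      refine integral_mono (hint _) (((hint p).const_mul _).add ((hint q).const_mul _)) fun x => ?_
      simp only [evS_sub]
      have := norm_sub_le (evS p x) (evS q x)
      nlinarith [sq_nonneg (‖evS p x‖ - ‖evS q x‖), norm_nonneg (evS p x - evS q x)]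
    obtain ⟨l, l', j', j'', hτ⟩ : ∃ l l' j' j'', τ₀ i j
        = MvPolynomial.pderiv l (W i j') - MvPolynomial.pderiv l' (W i j'') := by
      fin_cases j
      · exact ⟨1, 2, 2, 1, rfl⟩
      · exact ⟨2, 0, 0, 2, rfl⟩
      · exact ⟨0, 1, 1, 0, rfl⟩
    rw [hτ]
    have h1 := mul_le_mul_of_nonneg_left (hsub (MvPolynomial.pderiv l (W i j'))
      (MvPolynomial.pderiv l' (W i j''))) (by positivity : 0 ≤ d ^ 2 * (d ^ 2) ^ 2)
    have h2 := hdW i j' l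
    have h3 := hdW i j'' l'
    linarith
  -- There are nine entries, each a difference of two derivatives, whence the factors `9` and `4`.
  have hτ' : d ^ 2 * (d ^ 2) ^ 2 * nsq (volK K) (flat (evT τ₀))
      ≤ 9 * (4 * (C₂ * (16 * κ ^ 4))) * N := by
    rw [nsq_flat_eq_sum, Finset.mul_sum]
    calc _ ≤ ∑ i : Fin 3, ∑ j : Fin 3, 4 * (C₂ * (16 * κ ^ 4)) * N := by
          refine Finset.sum_le_sum fun i _ => ?_
          rw [Finset.mul_sum]
          exact Finset.sum_le_sum fun j _ => hτij i j
      _ = _ := by simp; ring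
  obtain ⟨A, hA⟩ := h₃ K hK a ha.2 N (by
    intro i j l
    rw [hNint]
    exact integral_volK_mono (by fun_prop) (by fun_prop) fun x _ => norm_pderiv_skew_le ha i j l x)
  have hscale : evT (curlT3 (curlT3 ((MvPolynomial.C ((d ^ 2 * d ^ 2 : ℝ) : ℂ) : CPoly 3) • a)
      * bubble3 K)) = fun x => ((d ^ 2 * d ^ 2 : ℝ) : ℂ) • evT τ₀ x := by
    generalize ((d ^ 2 * d ^ 2 : ℝ) : ℂ) = s
    have e1 : curlT3 ((MvPolynomial.C s : CPoly 3) • a) = (MvPolynomial.C s : CPoly 3) • m := by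
      ext1 i j
      fin_cases j <;> simp [m, curlT3, Derivation.leibniz, mul_sub]
    rw [e1, Matrix.smul_mul, ← hW]
    funext x
    ext i j
    fin_cases j <;> simp [τ₀, curlT3, Derivation.leibniz, mul_sub]
  have hJn : ‖ipT (volK K) (evT a) (evT τ₀)‖ = |J| := by
    rw [hip, Complex.norm_real, Real.norm_eq_abs]
  have hNJ' : N ≤ 4 * C₁ / c * (d ^ 2 * |J|) := by
    refine hNJ.trans ?_
    gcongr
    exact le_abs_self J
  have hfin := bubble_scaling hd (by positivity) (by positivity) (by positivity) hC₃ hJn hNJ' hτ' hA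
    hscale
  refine ⟨_, ⟨_, ?_, rfl⟩, ⟨A, hfin.1⟩, hfin.2⟩
  refine ⟨?_, fun i j => PkS_C_mul _ (ha.2 i j)⟩
  rw [Matrix.transpose_smul, ← smul_add, ha.1, smul_zero]

end Bubble3

/-! ### Properties of the bubble space in both dimensions. -/

section BubbleSpace

variable {n : ℕ} {K F : Finset (Pt n)} {κ : ℝ}

/-- Bubble test function for the rotation. -/
theorem exists_bubble_test (hn : n = 2 ∨ n = 3) (k : ℕ) (hκ : 0 < κ) : ∃ C : ℝ, 0 < C ∧
    ∀ K : Finset (Pt n), IsShapeRegular κ K → ∀ a ∈ skewSpace n k, ∃ τ ∈ bubbleSpace n k K,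
      (∃ A : Matrix (Fin n) (Fin n) ℂ, nsq (volK K) (flat fun x => evT a x - A)
        ≤ C * ‖ipT (volK K) (evT a) (evT τ)‖) ∧
      nsq (volK K) (flat (evT τ)) ≤ C * ‖ipT (volK K) (evT a) (evT τ)‖ := by
  rcases hn with rfl | rfl
  · exact exists_bubble_test2 k hκ
  · exact exists_bubble_test3 k hκ

theorem bubbleSpace_mul_normal (hn : n = 2 ∨ n = 3) {k : ℕ} (hK : IsSimplex K) (hF : F ∈ facets K)
    {τ : PolyT n} (hτ : τ ∈ bubbleSpace n k K) {x : Pt n} (hx : x ∈ cell F) :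
    mulN K F (evT τ x) = 0 := by
  rcases hn with rfl | rfl
  · obtain ⟨a, -, rfl⟩ := hτ
    exact curlV2_mul_normal hK hF _ hx
  · obtain ⟨a, -, rfl⟩ := hτ
    exact curlT3_mul_normal hK hF _ hx

theorem bubbleSpace_divT (hn : n = 2 ∨ n = 3) {k : ℕ} {τ : PolyT n} (hτ : τ ∈ bubbleSpace n k K) :
    divT τ = 0 := by
  rcases hn with rfl | rfl
  · obtain ⟨a, -, rfl⟩ := hτ
    exact divT_curlV2 _
  · obtain ⟨a, -, rfl⟩ := hτ
    exact divT_curlT3 _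

theorem zero_mem_skewSpace {k : ℕ} : (0 : PolyT n) ∈ skewSpace n k :=
  ⟨by simp, fun _ _ => PkS_zero⟩

theorem zero_mem_bubbleSpace (hn : n = 2 ∨ n = 3) {k : ℕ} : (0 : PolyT n) ∈ bubbleSpace n k K := by
  rcases hn with rfl | rfl
  · refine ⟨0, zero_mem_skewSpace, ?_⟩
    ext1 i j
    fin_cases j <;> simp [curlV2, curlT2]
  · refine ⟨0, zero_mem_skewSpace, ?_⟩
    have h0 : curlT3 (0 : PolyT 3) = 0 := by
      ext1 i j
      fin_cases j <;> simp [curlT3]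
    rw [h0, zero_mul, h0]

theorem bubbleSpace_subset_stressSpace {k : ℕ} : bubbleSpace n k K ⊆ stressSpace n k K :=
  fun τ hτ => ⟨0, fun _ _ => PkS_zero, τ, hτ, by simp⟩

theorem PkT_subset_stressSpace (hn : n = 2 ∨ n = 3) {k : ℕ} : PkT n k ⊆ stressSpace n k K :=
  fun τ hτ => ⟨τ, hτ, 0, zero_mem_bubbleSpace hn, by simp⟩

end BubbleSpace

/-! ### Rules for the `L²` products of scalars, vectors and tensors. -/

section Sesquilinear

variable {n : ℕ} {m : Measure (Pt n)}

theorem ipS_congr_left {f f' g : Pt n → ℂ} (h : ∀ᵐ x ∂m, f x = f' x) : ipS m f g = ipS m f' g :=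
  integral_congr_ae (h.mono fun x hx => by simp only [hx])

theorem ipS_congr_right {f g g' : Pt n → ℂ} (h : ∀ᵐ x ∂m, g x = g' x) : ipS m f g = ipS m f g' :=
  integral_congr_ae (h.mono fun x hx => by simp only [hx])

theorem ipS_sub_left {f f' g : Pt n → ℂ} (hf : MemLp f 2 m) (hf' : MemLp f' 2 m)
    (hg : MemLp g 2 m) : ipS m (fun x => f x - f' x) g = ipS m f g - ipS m f' g := by
  simp only [ipS_eq]
  exact ip_sub_left (f := one f) (f' := one f') (fun _ => hf) (fun _ => hf') (fun _ => hg)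

theorem ipS_add_left {f f' g : Pt n → ℂ} (hf : MemLp f 2 m) (hf' : MemLp f' 2 m)
    (hg : MemLp g 2 m) : ipS m (fun x => f x + f' x) g = ipS m f g + ipS m f' g := by
  simp only [ipS_eq]
  exact ip_add_left (f := one f) (f' := one f') (fun _ => hf) (fun _ => hf') (fun _ => hg)

theorem ipV_eq_sum {f g : Pt n → Fin n → ℂ} (hf : L2F m f) (hg : L2F m g) :
    ipV m f g = ∑ i, ipS m (fun x => f x i) (fun x => g x i) := by
  rw [ipV, integral_finsetSum _ fun i _ => MemLp.integrable_mul_conj (hf i) (hg i)]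
  rfl

theorem ipT_eq_sum {f g : Pt n → Matrix (Fin n) (Fin n) ℂ} (hf : L2F m (flat f))
    (hg : L2F m (flat g)) : ipT m f g = ∑ i, ipV m (fun x => f x i) (fun x => g x i) := by
  rw [ipT, integral_finsetSum _ fun i _ => ?_]
  · rfl
  · exact integrable_finsetSum _ fun j _ =>
      MemLp.integrable_mul_conj (hf (i, j)) (hg (i, j))

theorem evV_zero (x : Pt n) : evV (0 : PolyV n) x = 0 := by
  funext i; simp [evV]

theorem evT_zero (x : Pt n) : evT (0 : PolyT n) x = 0 := by
  ext i j; simp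

theorem evT_sub (p q : PolyT n) (x : Pt n) : evT (p - q) x = evT p x - evT q x := by
  ext i j; simp

theorem evV_sub (p q : PolyV n) (x : Pt n) : evV (p - q) x = evV p x - evV q x := by
  funext i; simp [evV]

theorem ipS_zero_right (f : Pt n → ℂ) : ipS m f (evS 0) = 0 := by simp [ipS]

theorem ipV_zero_right (f : Pt n → Fin n → ℂ) : ipV m f (evV 0) = 0 := by simp [ipV]

theorem ipT_zero_right (f : Pt n → Matrix (Fin n) (Fin n) ℂ) : ipT m f (evT 0) = 0 := by
  simp [ipT]

theorem L2F_evV (K : Finset (Pt n)) (r : PolyV n) : L2F (volK K) (evV r) :=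
  fun i => memLp_evS K (r i)

theorem L2F_evT (K : Finset (Pt n)) (t : PolyT n) : L2F (volK K) (flat (evT t)) :=
  fun p => memLp_evS K (t p.1 p.2)

theorem memLp_dotN {K F : Finset (Pt n)} {f : Pt n → Fin n → ℂ} (hf : L2F m f) :
    MemLp (fun x => dotN K F (f x)) 2 m :=
  memLp_finsetSum _ fun i _ => by
    simpa only [mul_comm] using (hf i).const_mul (nrm K F i : ℂ)

end Sesquilinear

/-! ### Local properties of the HDG projection. -/

section LocalProjection

variable {n k : ℕ} {K F : Finset (Pt n)} {τ : Pt n → ℝ} {v : Pt n → ℂ}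
  {q qT G : Pt n → Fin n → ℂ} {vT d : Pt n → ℂ} {Pq : PolyV n} {Pv : CPoly n}

/-- Vector fields whose divergence lies in `P_{k-1}` and whose normal traces lie in `P_k`. -/
structure HasPolyTraces (k : ℕ) (K : Finset (Pt n)) (r : PolyV n) : Prop where
  div : divV r ∈ PkS n (k - 1)
  trace : ∀ F ∈ facets K, ∃ ξ ∈ PkS n k, ∀ x ∈ cell F, dotN K F (evV r x) = evS ξ x

theorem hasPolyTraces_of_mem_PkV {r : PolyV n} (hr : r ∈ PkV n k) : HasPolyTraces k K r where
  div := PkS_sum fun i _ => PkS_pderiv i (hr i)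
  trace F _ := ⟨∑ i, MvPolynomial.C ((nrm K F i : ℝ) : ℂ) * r i,
    PkS_sum fun i _ => PkS_C_mul _ (hr i), fun x _ => by
      simp [dotN, evV, mul_comm]⟩

/-- The bubble part may have degree above `k`, but it contributes neither divergence nor normal
trace, so the moments fixed by the projection still suffice for stress test functions. -/
theorem hasPolyTraces_of_mem_stressSpace (hn : n = 2 ∨ n = 3) (hK : IsSimplex K) {t : PolyT n}
    (ht : t ∈ stressSpace n k K) (i : Fin n) : HasPolyTraces k K (t i) := by
  obtain ⟨p, hp, b, hb, rfl⟩ := ht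
  have hpi := hasPolyTraces_of_mem_PkV (K := K) (r := p i) (hp i)
  have hdb : divV (b i) = 0 := congrFun (bubbleSpace_divT hn hb) i
  refine ⟨?_, fun F hF => ?_⟩
  · have : divV ((p + b) i) = divV (p i) + divV (b i) := by
      simp [divV, Finset.sum_add_distrib]
    rw [this, hdb, add_zero]
    exact hpi.div
  · obtain ⟨ξ, hξ, h⟩ := hpi.trace F hF
    refine ⟨ξ, hξ, fun x hx => ?_⟩
    have hbn := congrFun (bubbleSpace_mul_normal hn hK hF hb hx) i
    rw [← h x hx]
    simp only [mulN, evT_apply, Pi.zero_apply] at hbn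
    have : dotN K F (evV ((p + b) i) x) = dotN K F (evV (p i) x) + ∑ j, evS (b i j) x * (nrm K F j : ℂ) := by
      simp [dotN, evV, add_mul, Finset.sum_add_distrib]
    rw [this, hbn, add_zero]

/-- Green's formula for the trace, with polynomial test functions. -/
theorem IsTrace.green (hn : 0 < n) {T : Finset (Finset (Pt n))} (h : IsTrace T v G vT) (hKT : K ∈ T)
    (hK : IsSimplex K) (hv : MemLp v 2 (volK K)) (hG : L2F (volK K) G) (r : PolyV n) :
    ipV (volK K) G (evV r) + ipS (volK K) v (evS (divV r))
      = ∑ F ∈ facets K, ipS (surf F) vT (fun x => dotN K F (evV r x)) := by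
  -- The trace is defined through smooth test functions without conjugation; taking conjugate
  -- polynomials there gives sesquilinear products here.
  have hsum : ∑ i, ∫ x, (v x * pd i (evS (conjP (r i))) x + G x i * evS (conjP (r i)) x) ∂(volK K)
      = ∑ i, ∑ F ∈ facets K, ∫ x, vT x * evS (conjP (r i)) x * (nrm K F i : ℂ) ∂(surf F) :=
    Finset.sum_congr rfl fun i _ => (h K hKT).2 _ (contDiff_evS _) i
  have hint1 : ∀ i, Integrable (fun x => v x * conj (evS (MvPolynomial.pderiv i (r i)) x)) (volK K) :=
    fun i => MemLp.integrable_mul_conj hv (memLp_evS K _)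
  have hint2 : ∀ i, Integrable (fun x => G x i * conj (evS (r i) x)) (volK K) :=
    fun i => MemLp.integrable_mul_conj (hG i) (memLp_evS K _)
  have hL : ∑ i, ∫ x, (v x * pd i (evS (conjP (r i))) x + G x i * evS (conjP (r i)) x) ∂(volK K)
      = ipV (volK K) G (evV r) + ipS (volK K) v (evS (divV r)) := by
    simp only [pd_evS, pderiv_conjP, evS_conjP]
    rw [add_comm, ipS, ipV]
    simp only [divV, evS_sum, map_sum, Finset.mul_sum]
    rw [integral_finsetSum _ fun i _ => hint1 i]
    have : ∫ x, ∑ i, G x i * conj (evV r x i) ∂(volK K) = ∑ i, ∫ x, G x i * conj (evS (r i) x) ∂(volK K) :=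
      integral_finsetSum _ fun i _ => hint2 i
    rw [this, ← Finset.sum_add_distrib]
    exact Finset.sum_congr rfl fun i _ => integral_add (hint1 i) (hint2 i)
  rw [← hL, hsum, Finset.sum_comm]
  refine Finset.sum_congr rfl fun F hF => ?_
  rw [ipS, ← integral_finsetSum]
  · refine integral_congr_ae (Filter.Eventually.of_forall fun x => ?_)
    simp only [dotN, map_sum, map_mul, Complex.conj_ofReal, Finset.mul_sum, evS_conjP, evV]
    exact Finset.sum_congr rfl fun i _ => by ring
  · intro i _
    simp only [evS_conjP]
    exact (MemLp.integrable_mul_conj ((h K hKT).1 F hF) (memLp_surf_evS hn hK hF _)).mul_const _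

/-- Green's formula for the normal trace, with polynomial test functions. -/
theorem IsNormalTrace.green {T : Finset (Finset (Pt n))} (h : IsNormalTrace T q d qT)
    (hKT : K ∈ T) (hq : L2F (volK K) q) (hd : MemLp d 2 (volK K)) (w : CPoly n) :
    ipV (volK K) q (evV (gradS w)) + ipS (volK K) d (evS w)
      = ∑ F ∈ facets K, ipS (surf F) (fun x => dotN K F (qT x)) (evS w) := by
  have h1 := (h K hKT).2 _ (contDiff_evS (conjP w))
  simp only [pd_evS, pderiv_conjP, evS_conjP] at h1
  rw [integral_add (integrable_finsetSum _ fun i _ =>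
    MemLp.integrable_mul_conj (hq i) (memLp_evS K _))
    (MemLp.integrable_mul_conj hd (memLp_evS K _))] at h1
  exact h1

/-- The commuting property of the projection. In Green's formula `v` is seen only through moments
against the divergence, of degree at most `k - 1`, and its trace only through moments against normal
traces in `P_k`; both are preserved. -/
theorem IsHDGProj.gradient_eq (hP : IsHDGProj k τ K q v qT vT Pq Pv) {r : PolyV n}
    (hr : HasPolyTraces k K r) {PM : Finset (Pt n) → CPoly n}
    (hPM : ∀ F ∈ facets K, ∀ ξ ∈ PkS n k, ipS (surf F) (evS (PM F)) (evS ξ) = ipS (surf F) vT (evS ξ))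
    (hgreen : ipV (volK K) G (evV r) + ipS (volK K) v (evS (divV r))
      = ∑ F ∈ facets K, ipS (surf F) vT (fun x => dotN K F (evV r x))) :
    ipV (volK K) G (evV r) + ipS (volK K) (evS Pv) (evS (divV r))
      = ∑ F ∈ facets K, ipS (surf F) (evS (PM F)) (fun x => dotN K F (evV r x)) := by
  rw [hP.2.2.2.1 _ hr.div, hgreen]
  refine Finset.sum_congr rfl fun F hF => ?_
  obtain ⟨ξ, hξ, h⟩ := hr.trace F hF
  have hae : ∀ᵐ x ∂(surf F), dotN K F (evV r x) = evS ξ x := (ae_surf_mem F).mono h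
  rw [ipS_congr_right hae, ipS_congr_right hae, hPM F hF ξ hξ]

/-- The normal trace of an HDG projection against polynomials. -/
def ProjFlux (k : ℕ) (τ : Pt n → ℝ) (K F : Finset (Pt n)) (qT : Pt n → Fin n → ℂ) (Pq : PolyV n)
    (Pv Pm : CPoly n) : Prop :=
  ∀ ξ ∈ PkS n k, ipS (surf F) (fun x => dotN K F (qT x)) (evS ξ)
    = ipS (surf F) (fun x => dotN K F (evV Pq x) - (τ x : ℂ) * (evS Pv x - evS Pm x)) (evS ξ)

theorem memLp_stab_mul (hn : 0 < n) (hK : IsSimplex K) (hF : F ∈ facets K) (hτ : Measurable τ)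
    {M : ℝ} (hM : ∀ x ∈ cell F, |τ x| ≤ M) (p : CPoly n) :
    MemLp (fun x => (τ x : ℂ) * evS p x) 2 (surf F) := by
  have h := memLp_surf_evS hn hK hF p
  refine MemLp.of_le_mul (c := M) h ?_ ?_
  · exact (Complex.measurable_ofReal.comp hτ).aestronglyMeasurable.mul h.1
  · filter_upwards [ae_surf_mem F] with x hx
    rw [norm_mul, Complex.norm_real, Real.norm_eq_abs]
    exact mul_le_mul_of_nonneg_right (hM x hx) (norm_nonneg _)

theorem evS_ae_eq_of_ipS_eq (hn : 0 < n) (hK : IsSimplex K) (hF : F ∈ facets K) {p p' : CPoly n}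
    (hp : p ∈ PkS n k) (hp' : p' ∈ PkS n k)
    (h : ∀ ξ ∈ PkS n k, ipS (surf F) (evS p) (evS ξ) = ipS (surf F) (evS p') (evS ξ)) :
    ∀ᵐ x ∂(surf F), evS p x = evS p' x := by
  have hm := memLp_surf_evS hn hK hF
  have h1 := h (p - p') (PkS_sub hp hp')
  have h2 : ipS (surf F) (evS (p - p')) (evS (p - p')) = 0 := by
    have e : evS (p - p') = fun x => evS p x - evS p' x := by funext x; simp
    rw [e] at h1 ⊢
    rw [ipS_sub_left (hm p) (hm p') (by rw [← e]; exact hm _), h1, sub_self]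
  rw [ipS_eq, ip_self] at h2
  have h3 := (nsq_eq_zero_iff (f := one (evS (p - p'))) fun _ => hm _).1 (by exact_mod_cast h2)
  filter_upwards [h3] with x hx
  have := congrFun hx ()
  simpa [one, sub_eq_zero] using this

/-- The face polynomial in the definition of the projection may differ from one adjacent element to
the other, but only on a null set of the face. It is replaced by a common one, and the terms are
arranged in the form of the numerical flux. -/
theorem IsHDGProj.projFlux (hn : 0 < n) (hK : IsSimplex K) (hF : F ∈ facets K)
    (hP : IsHDGProj k τ K q v qT vT Pq Pv) (hqT : MemLp (fun x => dotN K F (qT x)) 2 (surf F))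
    (hτ : Measurable τ) {M : ℝ} (hM : ∀ x ∈ cell F, |τ x| ≤ M) {p : CPoly n} (hp : p ∈ PkS n k)
    (h : ∀ ξ ∈ PkS n k, ipS (surf F) (evS p) (evS ξ) = ipS (surf F) vT (evS ξ)) :
    ProjFlux k τ K F qT Pq Pv p := by
  obtain ⟨Pm, hPm, h1, h2⟩ := hP.2.2.2.2 F hF
  have hae : ∀ᵐ x ∂(surf F), evS Pm x = evS p x :=
    evS_ae_eq_of_ipS_eq hn hK hF hPm hp fun ξ hξ => by rw [h1 ξ hξ, h ξ hξ]
  intro ξ hξ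
  have hm := memLp_surf_evS hn hK hF
  have hmτ := memLp_stab_mul hn hK hF hτ hM
  have hPq : MemLp (fun x => dotN K F (evV Pq x)) 2 (surf F) := memLp_dotN fun i => hm _
  have h3 := h2 ξ hξ
  rw [ipS_congr_left (f := fun x => dotN K F (qT x) - (τ x : ℂ) * evS Pm x)
    (f' := fun x => dotN K F (qT x) - (τ x : ℂ) * evS p x)
    (hae.mono fun x hx => by simp only [hx]),
    ipS_sub_left hqT (hmτ p) (hm ξ)] at h3
  rw [eq_comm, sub_eq_iff_eq_add] at h3
  refine h3.trans ((ipS_add_left (f := fun x => dotN K F (evV Pq x) - (τ x : ℂ) * evS Pv x)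
    (hPq.sub (hmτ Pv)) (hmτ p) (hm ξ)).symm.trans ?_)
  congr 1
  funext x
  ring

/-- Facewise `L²` projections of a trace that do not depend on the adjacent element. -/
theorem exists_face_projection {T : Finset (Finset (Pt n))}
    (h : ∀ K ∈ T, ∃ τ q v qT Pq Pv, IsHDGProj k τ K q v qT vT Pq Pv) :
    ∃ PM : Finset (Pt n) → CPoly n, ∀ K ∈ T, ∀ F ∈ facets K, PM F ∈ PkS n k ∧
      ∀ ξ ∈ PkS n k, ipS (surf F) (evS (PM F)) (evS ξ) = ipS (surf F) vT (evS ξ) := by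
  have : ∀ F, ∃ p : CPoly n, IsFaceOf T F → p ∈ PkS n k ∧
      ∀ ξ ∈ PkS n k, ipS (surf F) (evS p) (evS ξ) = ipS (surf F) vT (evS ξ) := by
    intro F
    by_cases hF : IsFaceOf T F
    · obtain ⟨K, hK, hFK⟩ := hF
      obtain ⟨τ, q, v, qT, Pq, Pv, hP⟩ := h K hK
      obtain ⟨p, hp, h1, -⟩ := hP.2.2.2.2 F hFK
      exact ⟨p, fun _ => ⟨hp, h1⟩⟩
    · exact ⟨0, fun h => absurd h hF⟩
  choose PM hPM using this
  exact ⟨PM, fun K hK F hF => hPM F ⟨K, hK, hF⟩⟩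

end LocalProjection

/-! ### Linear algebra of tensor products, Hooke's tensor and the local spaces. -/

section Algebra

variable {n : ℕ} {m : Measure (Pt n)}

theorem ipT_sub_left {f f' g : Pt n → Matrix (Fin n) (Fin n) ℂ} (hf : L2F m (flat f))
    (hf' : L2F m (flat f')) (hg : L2F m (flat g)) :
    ipT m (fun x => f x - f' x) g = ipT m f g - ipT m f' g := by
  simp only [ipT_eq]
  exact ip_sub_left hf hf' hg

theorem ipT_add_left {f f' g : Pt n → Matrix (Fin n) (Fin n) ℂ} (hf : L2F m (flat f))
    (hf' : L2F m (flat f')) (hg : L2F m (flat g)) :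
    ipT m (fun x => f x + f' x) g = ipT m f g + ipT m f' g := by
  simp only [ipT_eq]
  exact ip_add_left hf hf' hg

theorem ipV_sub_left {f f' g : Pt n → Fin n → ℂ} (hf : L2F m f) (hf' : L2F m f')
    (hg : L2F m g) : ipV m (fun x => f x - f' x) g = ipV m f g - ipV m f' g :=
  ip_sub_left hf hf' hg

theorem ipV_add_left {f f' g : Pt n → Fin n → ℂ} (hf : L2F m f) (hf' : L2F m f')
    (hg : L2F m g) : ipV m (fun x => f x + f' x) g = ipV m f g + ipV m f' g :=
  ip_add_left hf hf' hg

theorem ipV_smul_left (c : ℂ) (f g : Pt n → Fin n → ℂ) :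
    ipV m (fun x => c • f x) g = c * ipV m f g := ip_smul_left c

theorem ipS_mul_left (c : ℂ) (f g : Pt n → ℂ) : ipS m (fun x => c * f x) g = c * ipS m f g := by
  rw [ipS, ipS, ← integral_const_mul]
  simp only [mul_assoc]

theorem ipT_congr_left {f f' g : Pt n → Matrix (Fin n) (Fin n) ℂ} (h : ∀ᵐ x ∂m, f x = f' x) :
    ipT m f g = ipT m f' g :=
  integral_congr_ae (h.mono fun x hx => by simp only [hx])

theorem ipV_congr_left {f f' g : Pt n → Fin n → ℂ} (h : ∀ᵐ x ∂m, f x = f' x) :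
    ipV m f g = ipV m f' g :=
  integral_congr_ae (h.mono fun x hx => by simp only [hx])

theorem evV_sub' (p q : PolyV n) : evV (p - q) = fun x => evV p x - evV q x :=
  funext fun x => evV_sub p q x

theorem evT_sub' (p q : PolyT n) : evT (p - q) = fun x => evT p x - evT q x :=
  funext fun x => evT_sub p q x

theorem evS_sub' (p q : CPoly n) : evS (p - q) = fun x => evS p x - evS q x :=
  funext fun x => evS_sub p q x

theorem mulN_sub (K F : Finset (Pt n)) (A B : Matrix (Fin n) (Fin n) ℂ) :
    mulN K F (A - B) = mulN K F A - mulN K F B := by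
  funext i
  simp [mulN, sub_mul, Finset.sum_sub_distrib]

theorem dotN_sub (K F : Finset (Pt n)) (a b : Fin n → ℂ) :
    dotN K F (a - b) = dotN K F a - dotN K F b := by
  simp [dotN, sub_mul, Finset.sum_sub_distrib]

theorem Coeff.hookeInv_sub (P : Coeff n) (A B : Matrix (Fin n) (Fin n) ℂ) :
    P.hookeInv (A - B) = P.hookeInv A - P.hookeInv B := by
  simp only [Coeff.hookeInv, Matrix.trace_sub, smul_sub, mul_sub, sub_smul]
  abel

theorem L2F_hookeInv (P : Coeff n) {f : Pt n → Matrix (Fin n) (Fin n) ℂ} (hf : L2F m (flat f)) :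
    L2F m (flat fun x => P.hookeInv (f x)) := by
  rintro ⟨i, j⟩
  have htr : MemLp (fun x => (f x).trace) 2 m := by
    simp only [Matrix.trace, Matrix.diag]
    exact memLp_finsetSum _ fun i _ => hf (i, i)
  have := ((hf (i, j)).const_mul ((1 / (2 * P.mu) : ℝ) : ℂ)).sub
    (htr.const_mul ((((P.lam / (2 * P.mu * (n * P.lam + 2 * P.mu)) : ℝ) : ℂ))
      * (1 : Matrix (Fin n) (Fin n) ℂ) i j))
  refine this.ae_eq (Filter.Eventually.of_forall fun x => ?_)
  simp only [flat, Coeff.hookeInv, Matrix.sub_apply, Matrix.smul_apply, smul_eq_mul, Pi.sub_apply]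
  ring

theorem divT_zero : divT (0 : PolyT n) = 0 := by
  funext i; simp [divT]

theorem gradV_zero : gradV (0 : PolyV n) = 0 := by
  ext1 i j; simp [gradV]

theorem gradS_zero : gradS (0 : CPoly n) = 0 := by
  funext i; simp [gradS]

theorem divV_zero : divV (0 : PolyV n) = 0 := by
  simp [divV]

theorem mulN_zero (K F : Finset (Pt n)) : mulN K F 0 = 0 := by
  funext i; simp [mulN]

theorem dotN_zero (K F : Finset (Pt n)) : dotN K F 0 = 0 := by
  simp [dotN]

theorem conj_ipV (f g : Pt n → Fin n → ℂ) : conj (ipV m f g) = ipV m g f := conj_ip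

theorem conj_ipT (f g : Pt n → Matrix (Fin n) (Fin n) ℂ) : conj (ipT m f g) = ipT m g f := by
  simp only [ipT_eq]; exact conj_ip

theorem conj_ipS (f g : Pt n → ℂ) : conj (ipS m f g) = ipS m g f := by
  simp only [ipS_eq]; exact conj_ip

open scoped Classical in
-- Test functions supported in one element reduce the equations of the scheme, stated as sums over
-- the mesh, to equations on single elements.
theorem sum_update_zero {α : Type*} [Zero α] {T : Finset (Finset (Pt n))} {K : Finset (Pt n)}
    (hK : K ∈ T) (t : α) (g : Finset (Pt n) → α → ℂ) (hg : ∀ K', g K' 0 = 0) :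
    ∑ K' ∈ T, g K' (Function.update (0 : Finset (Pt n) → α) K t K') = g K t := by
  rw [Finset.sum_eq_single_of_mem K hK fun K' _ hne => by
    rw [Function.update_of_ne hne, Pi.zero_apply, hg], Function.update_self]

theorem PkV_sub {k : ℕ} {p q : PolyV n} (hp : p ∈ PkV n k) (hq : q ∈ PkV n k) : p - q ∈ PkV n k :=
  fun i => PkS_sub (hp i) (hq i)

theorem skewSpace_sub {k : ℕ} {p q : PolyT n} (hp : p ∈ skewSpace n k) (hq : q ∈ skewSpace n k) :
    p - q ∈ skewSpace n k := by
  refine ⟨?_, fun i j => PkS_sub (hp.2 i j) (hq.2 i j)⟩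
  rw [Matrix.transpose_sub, sub_add_sub_comm, hp.1, hq.1, sub_zero]

theorem bubbleSpace_sub (hn : n = 2 ∨ n = 3) {k : ℕ} {K : Finset (Pt n)} {p q : PolyT n}
    (hp : p ∈ bubbleSpace n k K) (hq : q ∈ bubbleSpace n k K) : p - q ∈ bubbleSpace n k K := by
  rcases hn with rfl | rfl
  · obtain ⟨a, ha, rfl⟩ := hp
    obtain ⟨b, hb, rfl⟩ := hq
    refine ⟨a - b, skewSpace_sub ha hb, ?_⟩
    ext1 i j
    fin_cases j <;> simp [curlV2, curlT2, Derivation.leibniz] <;> ring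
  · obtain ⟨a, ha, rfl⟩ := hp
    obtain ⟨b, hb, rfl⟩ := hq
    refine ⟨a - b, skewSpace_sub ha hb, ?_⟩
    have hc : ∀ M N : PolyT 3, curlT3 (M - N) = curlT3 M - curlT3 N := by
      intro M N
      ext1 i j
      fin_cases j <;> simp [curlT3] <;> ring
    rw [hc, sub_mul, hc]

theorem stressSpace_sub (hn : n = 2 ∨ n = 3) {k : ℕ} {K : Finset (Pt n)} {p q : PolyT n}
    (hp : p ∈ stressSpace n k K) (hq : q ∈ stressSpace n k K) : p - q ∈ stressSpace n k K := by
  obtain ⟨a, ha, b, hb, rfl⟩ := hp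
  obtain ⟨a', ha', b', hb', rfl⟩ := hq
  exact ⟨a - a', fun i j => PkS_sub (ha i j) (ha' i j), b - b', bubbleSpace_sub hn hb hb', by abel⟩

end Algebra

/-! ### The equations of the scheme on a single element. -/

section LocalScheme

variable {n k : ℕ} {P : Coeff n} {D : Geom n} {B : Data n} {TE TA : Finset (Finset (Pt n))}
  {τE τA : Finset (Pt n) → Pt n → ℝ} {Y : Discrete n} {K : Finset (Pt n)}

theorem zero_mem_stressSpace (hn : n = 2 ∨ n = 3) : (0 : PolyT n) ∈ stressSpace n k K :=
  bubbleSpace_subset_stressSpace (zero_mem_bubbleSpace hn)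

/-- The vanishing test function. -/
def zeroTest (n : ℕ) : Discrete n := ⟨0, 0, 0, 0, 0, 0, 0⟩

theorem zeroTest_mem (hn : n = 2 ∨ n = 3) : InSpaces k TE TA (zeroTest n) where
  σ _ _ := zero_mem_stressSpace hn
  u _ _ _ := PkS_zero
  γ _ _ := zero_mem_skewSpace
  uHat _ _ _ _ _ := PkS_zero
  q _ _ _ := PkS_zero
  v _ _ := PkS_zero
  vHat _ _ _ _ := PkS_zero

theorem update_zero_mem {α : Type*} [Zero α] {S : Finset (Pt n) → Set α} (h0 : ∀ K, 0 ∈ S K)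
    {t : α} [DecidableEq (Finset (Pt n))] (ht : t ∈ S K) (K' : Finset (Pt n)) :
    (Function.update 0 K t : Finset (Pt n) → α) K' ∈ S K' := by
  rcases eq_or_ne K' K with rfl | h
  · rwa [Function.update_self]
  · rw [Function.update_of_ne h]; exact h0 K'

theorem SolvesHDG.hooke_local (hn : n = 2 ∨ n = 3) (hY : SolvesHDG P D B k TE TA τE τA Y)
    (hK : K ∈ TE) {t : PolyT n} (ht : t ∈ stressSpace n k K) :
    ipT (volK K) (fun x => P.hookeInv (evT (Y.σ K) x)) (evT t)
      + ipV (volK K) (evV (Y.u K)) (evV (divT t)) + ipT (volK K) (evT (Y.γ K)) (evT t)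
      - ∑ F ∈ facets K, ipV (surf F) (evV (Y.uHat F)) (fun x => mulN K F (evT t x)) = 0 := by
  classical
  have h := hY.hooke { zeroTest n with σ := Function.update 0 K t }
    { zeroTest_mem hn with
      σ := fun K' _ => update_zero_mem (S := stressSpace n k) (fun _ => zero_mem_stressSpace hn) ht K' }
  rw [← sum_update_zero hK t (fun K t => ipT (volK K) (fun x => P.hookeInv (evT (Y.σ K) x)) (evT t))
      fun _ => ipT_zero_right _,
    ← sum_update_zero hK t (fun K t => ipV (volK K) (evV (Y.u K)) (evV (divT t)))
      fun _ => by simp only [divT_zero, ipV_zero_right],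
    ← sum_update_zero hK t (fun K t => ipT (volK K) (evT (Y.γ K)) (evT t))
      fun _ => ipT_zero_right _,
    ← sum_update_zero hK t (fun K t => ∑ F ∈ facets K, ipV (surf F) (evV (Y.uHat F))
      (fun x => mulN K F (evT t x)))
      fun _ => Finset.sum_eq_zero fun F _ => by simp [ipV, evT_zero, mulN_zero]]
  exact h

theorem SolvesHDG.balance_local (hn : n = 2 ∨ n = 3) (hY : SolvesHDG P D B k TE TA τE τA Y)
    (hK : K ∈ TE) {t : PolyV n} (ht : t ∈ PkV n k) :
    ipT (volK K) (evT (Y.σ K)) (evT (gradV t))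
      - ∑ F ∈ facets K, ipV (surf F) (Y.σHatN τE K F) (evV t)
      + P.rhoE * P.s ^ 2 * ipV (volK K) (evV (Y.u K)) (evV t) = ipV (volK K) B.fE (evV t) := by
  classical
  have h := hY.balance { zeroTest n with u := Function.update 0 K t }
    { zeroTest_mem hn with
      u := fun K' _ => update_zero_mem (S := fun _ => PkV n k) (fun _ _ => PkS_zero) ht K' }
  rw [← sum_update_zero hK t (fun K t => ipT (volK K) (evT (Y.σ K)) (evT (gradV t)))
      fun _ => by simp only [gradV_zero, ipT_zero_right],
    ← sum_update_zero hK t (fun K t => ipV (volK K) (evV (Y.u K)) (evV t))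
      fun _ => ipV_zero_right _,
    ← sum_update_zero hK t (fun K t => ipV (volK K) B.fE (evV t)) fun _ => ipV_zero_right _,
    ← sum_update_zero hK t (fun K t => ∑ F ∈ facets K, ipV (surf F) (Y.σHatN τE K F) (evV t))
      fun _ => Finset.sum_eq_zero fun F _ => ipV_zero_right _]
  exact h

theorem SolvesHDG.symm_local (hn : n = 2 ∨ n = 3) (hY : SolvesHDG P D B k TE TA τE τA Y)
    (hK : K ∈ TE) {t : PolyT n} (ht : t ∈ skewSpace n k) :
    ipT (volK K) (evT (Y.σ K)) (evT t) = 0 := by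
  classical
  have h := hY.symm { zeroTest n with γ := Function.update 0 K t }
    { zeroTest_mem hn with
      γ := fun K' _ => update_zero_mem (S := fun _ => skewSpace n k)
        (fun _ => zero_mem_skewSpace) ht K' }
  rw [← sum_update_zero hK t (fun K t => ipT (volK K) (evT (Y.σ K)) (evT t))
      fun _ => ipT_zero_right _]
  exact h

theorem SolvesHDG.velocity_local (hn : n = 2 ∨ n = 3) (hY : SolvesHDG P D B k TE TA τE τA Y)
    (hK : K ∈ TA) {r : PolyV n} (hr : r ∈ PkV n k) :
    ipV (volK K) (evV (Y.q K)) (evV r) + ipS (volK K) (evS (Y.v K)) (evS (divV r))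
      - ∑ F ∈ facets K, ipS (surf F) (evS (Y.vHat F)) (fun x => dotN K F (evV r x)) = 0 := by
  classical
  have h := hY.velocity { zeroTest n with q := Function.update 0 K r }
    { zeroTest_mem hn with
      q := fun K' _ => update_zero_mem (S := fun _ => PkV n k) (fun _ _ => PkS_zero) hr K' }
  rw [← sum_update_zero hK r (fun K r => ipV (volK K) (evV (Y.q K)) (evV r))
      fun _ => ipV_zero_right _,
    ← sum_update_zero hK r (fun K r => ipS (volK K) (evS (Y.v K)) (evS (divV r)))
      fun _ => by simp only [divV_zero, ipS_zero_right],
    ← sum_update_zero hK r (fun K r => ∑ F ∈ facets K, ipS (surf F) (evS (Y.vHat F))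
      (fun x => dotN K F (evV r x)))
      fun _ => Finset.sum_eq_zero fun F _ => by simp [ipS, evV_zero, dotN_zero]]
  exact h

theorem SolvesHDG.wave_local (hn : n = 2 ∨ n = 3) (hY : SolvesHDG P D B k TE TA τE τA Y)
    (hK : K ∈ TA) {w : CPoly n} (hw : w ∈ PkS n k) :
    ipV (volK K) (evV (Y.q K)) (evV (gradS w))
      - ∑ F ∈ facets K, ipS (surf F) (Y.qHatN τA K F) (evS w)
      + (P.s / P.c) ^ 2 * ipS (volK K) (evS (Y.v K)) (evS w) = ipS (volK K) B.fA (evS w) := by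
  classical
  have h := hY.wave { zeroTest n with v := Function.update 0 K w }
    { zeroTest_mem hn with
      v := fun K' _ => update_zero_mem (S := fun _ => PkS n k) (fun _ => PkS_zero) hw K' }
  rw [← sum_update_zero hK w (fun K w => ipV (volK K) (evV (Y.q K)) (evV (gradS w)))
      fun _ => by simp only [gradS_zero, ipV_zero_right],
    ← sum_update_zero hK w (fun K w => ipS (volK K) (evS (Y.v K)) (evS w))
      fun _ => ipS_zero_right _,
    ← sum_update_zero hK w (fun K w => ipS (volK K) B.fA (evS w)) fun _ => ipS_zero_right _,
    ← sum_update_zero hK w (fun K w => ∑ F ∈ facets K, ipS (surf F) (Y.qHatN τA K F) (evS w))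
      fun _ => Finset.sum_eq_zero fun F _ => ipS_zero_right _]
  exact h

end LocalScheme

/-! ### The data of the error analysis and the error equations. -/

/-- A mesh, an exact solution, its projections with facewise projections `PU`, `PV` of the traces,
and a discrete solution. -/
structure ErrorSetup {n : ℕ} (k : ℕ) (P : Coeff n) (D : Geom n) (κ τ₀ τ₁ : ℝ) where
  h : ℝ
  TE : Finset (Finset (Pt n))
  TA : Finset (Finset (Pt n))
  τE : Finset (Pt n) → Pt n → ℝ
  τA : Finset (Pt n) → Pt n → ℝ
  B : Data n
  X : Fields n
  R : Proj n
  Y : Discrete n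
  PU : Finset (Pt n) → PolyV n
  PV : Finset (Pt n) → CPoly n
  dim : n = 2 ∨ n = 3
  τ₀_pos : 0 < τ₀
  mesh : IsMeshPair D κ h TE TA
  stabE : IsStab τ₀ τ₁ TE τE
  stabA : IsStab τ₀ τ₁ TA τA
  pde : SolvesPDE P D B X
  traces : HasTraces P D B TE TA X
  proj : IsProj k TE TA τE τA X R
  hdg : SolvesHDG P D B k TE TA τE τA Y
  faceE : ∀ K ∈ TE, ∀ F ∈ facets K, ∀ i, PU F i ∈ PkS n k ∧ ∀ ξ ∈ PkS n k,
    ipS (surf F) (evS (PU F i)) (evS ξ) = ipS (surf F) (fun x => X.uT x i) (evS ξ)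
  faceA : ∀ K ∈ TA, ∀ F ∈ facets K, PV F ∈ PkS n k ∧ ∀ ξ ∈ PkS n k,
    ipS (surf F) (evS (PV F)) (evS ξ) = ipS (surf F) X.vT (evS ξ)

/-- The facewise projections of the traces exist. -/
theorem exists_errorSetup {n k : ℕ} {P : Coeff n} {D : Geom n} {κ τ₀ τ₁ h : ℝ}
    {TE TA : Finset (Finset (Pt n))} {τE τA : Finset (Pt n) → Pt n → ℝ} {B : Data n} {X : Fields n}
    {R : Proj n} {Y : Discrete n} (hn : n = 2 ∨ n = 3) (hτ₀ : 0 < τ₀)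
    (hM : IsMeshPair D κ h TE TA) (hE : IsStab τ₀ τ₁ TE τE) (hA : IsStab τ₀ τ₁ TA τA)
    (hX : SolvesPDE P D B X) (hT : HasTraces P D B TE TA X) (hR : IsProj k TE TA τE τA X R)
    (hY : SolvesHDG P D B k TE TA τE τA Y) :
    ∃ S : ErrorSetup k P D κ τ₀ τ₁, S.h = h ∧ S.TE = TE ∧ S.TA = TA ∧ S.X = X ∧ S.R = R ∧
      S.Y = Y := by
  have hU : ∀ i, ∃ PM : Finset (Pt n) → CPoly n, ∀ K ∈ TE, ∀ F ∈ facets K, PM F ∈ PkS n k ∧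
      ∀ ξ ∈ PkS n k, ipS (surf F) (evS (PM F)) (evS ξ) = ipS (surf F) (fun x => X.uT x i) (evS ξ) :=
    fun i => exists_face_projection fun K hK => ⟨_, _, _, _, _, _, hR.elastic K hK i⟩
  choose PU hPU using hU
  obtain ⟨PV, hPV⟩ := exists_face_projection (k := k) (vT := X.vT)
    fun K hK => ⟨_, _, _, _, _, _, hR.acoustic K hK⟩
  exact ⟨⟨h, TE, TA, τE, τA, B, X, R, Y, fun F i => PU i F, PV, hn, hτ₀, hM, hE, hA, hX, hT, hR,
    hY, fun K hK F hF i => hPU i K hK F hF, hPV⟩, rfl, rfl, rfl, rfl, rfl, rfl⟩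

namespace ErrorSetup

variable {n k : ℕ} {P : Coeff n} {D : Geom n} {κ τ₀ τ₁ : ℝ} (S : ErrorSetup k P D κ τ₀ τ₁)
  {K F : Finset (Pt n)}

def eσ (K : Finset (Pt n)) : PolyT n := S.R.σ K - S.Y.σ K
def eu (K : Finset (Pt n)) : PolyV n := S.R.u K - S.Y.u K
def eγ (K : Finset (Pt n)) : PolyT n := S.R.γ K - S.Y.γ K
def euHat (F : Finset (Pt n)) : PolyV n := S.PU F - S.Y.uHat F
def eq (K : Finset (Pt n)) : PolyV n := S.R.q K - S.Y.q K
def ev (K : Finset (Pt n)) : CPoly n := S.R.v K - S.Y.v K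
def evHat (F : Finset (Pt n)) : CPoly n := S.PV F - S.Y.vHat F

/-- The projection errors and the jumps. -/
def dσ (K : Finset (Pt n)) (x : Pt n) : Matrix (Fin n) (Fin n) ℂ := S.X.σ x - evT (S.R.σ K) x
def du (K : Finset (Pt n)) (x : Pt n) : Fin n → ℂ := S.X.u x - evV (S.R.u K) x
def dγ (K : Finset (Pt n)) (x : Pt n) : Matrix (Fin n) (Fin n) ℂ := S.X.γ x - evT (S.R.γ K) x
def dq (K : Finset (Pt n)) (x : Pt n) : Fin n → ℂ := S.X.q x - evV (S.R.q K) x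
def dv (K : Finset (Pt n)) (x : Pt n) : ℂ := S.X.v x - evS (S.R.v K) x
def jumpE (K F : Finset (Pt n)) : PolyV n := S.eu K - S.euHat F
def jumpA (K F : Finset (Pt n)) : CPoly n := S.ev K - S.evHat F

/-- The error of the numerical fluxes. -/
def eσHatN (K F : Finset (Pt n)) (x : Pt n) (i : Fin n) : ℂ :=
  mulN K F (evT (S.eσ K) x) i - (S.τE K x : ℂ) * evS (S.jumpE K F i) x
def eqHatN (K F : Finset (Pt n)) (x : Pt n) : ℂ :=
  dotN K F (evV (S.eq K) x) - (S.τA K x : ℂ) * evS (S.jumpA K F) x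

theorem dim_pos (S : ErrorSetup k P D κ τ₀ τ₁) : 0 < n := by rcases S.dim with rfl | rfl <;> norm_num

theorem simplexE (hK : K ∈ S.TE) : IsSimplex K := S.mesh.triE.simplex hK

theorem simplexA (hK : K ∈ S.TA) : IsSimplex K := S.mesh.triA.simplex hK

theorem memLpE (hK : K ∈ S.TE) {f : Pt n → ℂ} (hf : MemLp f 2 (volume.restrict D.ΩE)) :
    MemLp f 2 (volK K) := hf.mono_measure (S.mesh.triE.volK_le hK)

theorem memLpA (hK : K ∈ S.TA) {f : Pt n → ℂ} (hf : MemLp f 2 (volume.restrict D.ΩA)) :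
    MemLp f 2 (volK K) := hf.mono_measure (S.mesh.triA.volK_le hK)

theorem L2F_σ (hK : K ∈ S.TE) : L2F (volK K) (flat S.X.σ) :=
  fun p => S.memLpE hK ((S.pde.σ_Hdiv p.1).1 p.2)

theorem L2F_u (hK : K ∈ S.TE) : L2F (volK K) S.X.u := fun i => S.memLpE hK (S.pde.u_H1 i).1

theorem L2F_gradU (hK : K ∈ S.TE) : L2F (volK K) (flat S.X.gradU) :=
  fun p => S.memLpE hK ((S.pde.u_H1 p.1).2.1 p.2)

theorem L2F_divσ (hK : K ∈ S.TE) : L2F (volK K) S.X.divσ :=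
  fun i => S.memLpE hK (S.pde.σ_Hdiv i).2.1

theorem L2F_γ (hK : K ∈ S.TE) : L2F (volK K) (flat S.X.γ) := by
  intro p
  have h := (((S.L2F_gradU hK p).sub (S.L2F_gradU hK (p.2, p.1))).const_mul (1 / 2 : ℂ))
  refine h.ae_eq ?_
  filter_upwards [S.mesh.triE.ae_volK hK S.pde.spin] with x hx
  simp [flat, hx]

theorem L2F_q (hK : K ∈ S.TA) : L2F (volK K) S.X.q := fun i => S.memLpA hK (S.pde.q_Hdiv.1 i)

theorem memLp_v (hK : K ∈ S.TA) : MemLp S.X.v 2 (volK K) := S.memLpA hK S.pde.v_H1.1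

theorem L2F_gradV (hK : K ∈ S.TA) : L2F (volK K) S.X.gradV :=
  fun i => S.memLpA hK (S.pde.v_H1.2.1 i)

theorem memLp_divq (hK : K ∈ S.TA) : MemLp S.X.divq 2 (volK K) := S.memLpA hK S.pde.q_Hdiv.2.1

theorem abs_τE_le (hK : K ∈ S.TE) (hF : F ∈ facets K) : ∀ x ∈ cell F, |S.τE K x| ≤ τ₁ := by
  intro x hx
  have h := (S.stabE K hK).2 F hF x hx
  rw [abs_of_nonneg (S.τ₀_pos.le.trans h.1)]
  exact h.2

theorem abs_τA_le (hK : K ∈ S.TA) (hF : F ∈ facets K) : ∀ x ∈ cell F, |S.τA K x| ≤ τ₁ := by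
  intro x hx
  have h := (S.stabA K hK).2 F hF x hx
  rw [abs_of_nonneg (S.τ₀_pos.le.trans h.1)]
  exact h.2

theorem projFluxE (hK : K ∈ S.TE) (hF : F ∈ facets K) (i : Fin n) :
    ProjFlux k (S.τE K) K F (fun x => S.X.σT x i) (S.R.σ K i) (S.R.u K i) (S.PU F i) :=
  (S.proj.elastic K hK i).projFlux S.dim_pos (S.simplexE hK) hF ((S.traces.σ_tr i K hK).1 F hF)
    (S.stabE K hK).1 (S.abs_τE_le hK hF) (S.faceE K hK F hF i).1 (S.faceE K hK F hF i).2

theorem projFluxA (hK : K ∈ S.TA) (hF : F ∈ facets K) :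
    ProjFlux k (S.τA K) K F S.X.qT (S.R.q K) (S.R.v K) (S.PV F) :=
  (S.proj.acoustic K hK).projFlux S.dim_pos (S.simplexA hK) hF ((S.traces.q_tr K hK).1 F hF)
    (S.stabA K hK).1 (S.abs_τA_le hK hF) (S.faceA K hK F hF).1 (S.faceA K hK F hF).2

theorem L2F_surf_evV {K F : Finset (Pt n)} (hn : 0 < n) (hK : IsSimplex K) (hF : F ∈ facets K)
    (r : PolyV n) : L2F (surf F) (evV r) := fun i => memLp_surf_evS hn hK hF (r i)

theorem L2F_surf_mulN {K F : Finset (Pt n)} (hn : 0 < n) (hK : IsSimplex K) (hF : F ∈ facets K)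
    (t : PolyT n) : L2F (surf F) (fun x => mulN K F (evT t x)) :=
  fun i => memLp_dotN (K := K) (F := F) (f := evV (t i)) fun j => memLp_surf_evS hn hK hF (t i j)

/-- First error equation in the elastic region. -/
theorem hooke_error (hK : K ∈ S.TE) {t : PolyT n} (ht : t ∈ stressSpace n k K) :
    ipT (volK K) (fun x => P.hookeInv (S.X.σ x - evT (S.Y.σ K) x)) (evT t)
      + ipT (volK K) (fun x => S.X.γ x - evT (S.Y.γ K) x) (evT t)
      + ipV (volK K) (evV (S.eu K)) (evV (divT t))
      = ∑ F ∈ facets K, ipV (surf F) (evV (S.euHat F)) (fun x => mulN K F (evT t x)) := by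
  have hs := S.simplexE hK
  have hd := S.hdg.hooke_local S.dim hK ht
  -- Green's formula for each component of `u`, with `u` and its trace already replaced by their
  -- projections.
  have hrow := fun i => (S.proj.elastic K hK i).gradient_eq
    (hasPolyTraces_of_mem_stressSpace S.dim hs ht i) (PM := fun F => S.PU F i)
    (fun F hF => (S.faceE K hK F hF i).2)
    ((S.traces.u_tr i).green S.dim_pos hK hs (S.L2F_u hK i) (fun j => S.L2F_gradU hK (i, j)) (t i))
  have hsum := Finset.sum_congr rfl fun i (_ : i ∈ (Finset.univ : Finset (Fin n))) => hrow i
  rw [Finset.sum_add_distrib, Finset.sum_comm] at hsum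
  have e1 : ∑ i, ipV (volK K) (fun x => S.X.gradU x i) (evV (t i)) = ipT (volK K) S.X.gradU (evT t) :=
    (ipT_eq_sum (S.L2F_gradU hK) (L2F_evT K t)).symm
  have e2 : ∑ i, ipS (volK K) (evS (S.R.u K i)) (evS (divV (t i)))
      = ipV (volK K) (evV (S.R.u K)) (evV (divT t)) :=
    (ipV_eq_sum (L2F_evV K _) (L2F_evV K _)).symm
  have e3 : ∑ F ∈ facets K, ∑ i, ipS (surf F) (evS (S.PU F i)) (fun x => dotN K F (evV (t i) x))
      = ∑ F ∈ facets K, ipV (surf F) (evV (S.PU F)) (fun x => mulN K F (evT t x)) :=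
    Finset.sum_congr rfl fun F hF => (ipV_eq_sum (L2F_surf_evV S.dim_pos hs hF _)
      (L2F_surf_mulN S.dim_pos hs hF t)).symm
  rw [e1, e2, e3] at hsum
  -- The constitutive law replaces the gradient of the displacement by `C⁻¹σ + γ`.
  have e4 : ipT (volK K) S.X.gradU (evT t)
      = ipT (volK K) (fun x => P.hookeInv (S.X.σ x)) (evT t) + ipT (volK K) S.X.γ (evT t) := by
    rw [← ipT_add_left (L2F_hookeInv P (S.L2F_σ hK)) (S.L2F_γ hK) (L2F_evT K t)]
    refine ipT_congr_left ?_
    filter_upwards [S.mesh.triE.ae_volK hK S.pde.hooke] with x hx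
    rw [sub_add_eq_add_sub, sub_eq_zero] at hx
    exact hx.symm
  have e5 : ∑ F ∈ facets K, ipV (surf F) (evV (S.euHat F)) (fun x => mulN K F (evT t x))
      = ∑ F ∈ facets K, ipV (surf F) (evV (S.PU F)) (fun x => mulN K F (evT t x))
        - ∑ F ∈ facets K, ipV (surf F) (evV (S.Y.uHat F)) (fun x => mulN K F (evT t x)) := by
    rw [← Finset.sum_sub_distrib]
    refine Finset.sum_congr rfl fun F hF => ?_
    rw [euHat, evV_sub', ipV_sub_left (L2F_surf_evV S.dim_pos hs hF _)
      (L2F_surf_evV S.dim_pos hs hF _) (L2F_surf_mulN S.dim_pos hs hF t)]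
  simp only [Coeff.hookeInv_sub]
  rw [e5, ipT_sub_left (L2F_hookeInv P (S.L2F_σ hK)) (L2F_hookeInv P (L2F_evT K _)) (L2F_evT K t),
    ipT_sub_left (S.L2F_γ hK) (L2F_evT K _) (L2F_evT K t), eu, evV_sub',
    ipV_sub_left (L2F_evV K _) (L2F_evV K _) (L2F_evV K _)]
  rw [e4] at hsum
  linear_combination hsum - hd

theorem L2F_eσHatN (hK : K ∈ S.TE) (hF : F ∈ facets K) : L2F (surf F) (S.eσHatN K F) := fun i =>
  (L2F_surf_mulN S.dim_pos (S.simplexE hK) hF (S.eσ K) i).sub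
    (memLp_stab_mul S.dim_pos (S.simplexE hK) hF (S.stabE K hK).1 (S.abs_τE_le hK hF) _)

theorem memLp_eqHatN (hK : K ∈ S.TA) (hF : F ∈ facets K) : MemLp (S.eqHatN K F) 2 (surf F) :=
  (memLp_dotN (L2F_surf_evV S.dim_pos (S.simplexA hK) hF (S.eq K))).sub
    (memLp_stab_mul S.dim_pos (S.simplexA hK) hF (S.stabA K hK).1 (S.abs_τA_le hK hF) _)

theorem L2F_σHatN (hK : K ∈ S.TE) (hF : F ∈ facets K) : L2F (surf F) (S.Y.σHatN S.τE K F) := by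
  intro i
  have := (L2F_surf_mulN S.dim_pos (S.simplexE hK) hF (S.Y.σ K) i).sub
    (memLp_stab_mul S.dim_pos (S.simplexE hK) hF (S.stabE K hK).1 (S.abs_τE_le hK hF)
      (S.Y.u K i - S.Y.uHat F i))
  refine this.ae_eq (Filter.Eventually.of_forall fun x => ?_)
  simp [Discrete.σHatN]

theorem memLp_qHatN (hK : K ∈ S.TA) (hF : F ∈ facets K) :
    MemLp (S.Y.qHatN S.τA K F) 2 (surf F) := by
  have := (memLp_dotN (K := K) (F := F) (L2F_surf_evV S.dim_pos (S.simplexA hK) hF (S.Y.q K))).sub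
    (memLp_stab_mul S.dim_pos (S.simplexA hK) hF (S.stabA K hK).1 (S.abs_τA_le hK hF)
      (S.Y.v K - S.Y.vHat F))
  refine this.ae_eq (Filter.Eventually.of_forall fun x => ?_)
  simp [Discrete.qHatN]

/-- The flux error is the difference of the exact and the numerical flux. -/
theorem flux_errorE (hK : K ∈ S.TE) (hF : F ∈ facets K) {t : PolyV n} (ht : t ∈ PkV n k) :
    ipV (surf F) (fun x => mulN K F (S.X.σT x)) (evV t)
      = ipV (surf F) (S.eσHatN K F) (evV t) + ipV (surf F) (S.Y.σHatN S.τE K F) (evV t) := by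
  have hs := S.simplexE hK
  rw [← ipV_add_left (S.L2F_eσHatN hK hF) (S.L2F_σHatN hK hF) (L2F_surf_evV S.dim_pos hs hF t),
    ipV_eq_sum (f := fun x => mulN K F (S.X.σT x)) (fun i => (S.traces.σ_tr i K hK).1 F hF)
      (L2F_surf_evV S.dim_pos hs hF t),
    ipV_eq_sum ((S.L2F_eσHatN hK hF).add (S.L2F_σHatN hK hF)) (L2F_surf_evV S.dim_pos hs hF t)]
  refine Finset.sum_congr rfl fun i _ => (S.projFluxE hK hF i (t i) (ht i)).trans ?_
  congr 1
  funext x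
  simp only [eσHatN, Discrete.σHatN, jumpE, eu, euHat, eσ, Pi.add_apply, Pi.sub_apply, evS_sub,
    evT_sub, mulN_sub]
  simp only [mulN, dotN, evV, evT_apply]
  ring

theorem flux_errorA (hK : K ∈ S.TA) (hF : F ∈ facets K) {w : CPoly n} (hw : w ∈ PkS n k) :
    ipS (surf F) (fun x => dotN K F (S.X.qT x)) (evS w)
      = ipS (surf F) (S.eqHatN K F) (evS w) + ipS (surf F) (S.Y.qHatN S.τA K F) (evS w) := by
  have hs := S.simplexA hK
  rw [← ipS_add_left (S.memLp_eqHatN hK hF) (S.memLp_qHatN hK hF) (memLp_surf_evS S.dim_pos hs hF w)]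
  refine (S.projFluxA hK hF w hw).trans ?_
  congr 1
  funext x
  simp only [eqHatN, Discrete.qHatN, jumpA, ev, evHat, eq, evS_sub, evV_sub, dotN_sub]
  ring

/-- Second error equation in the elastic region. -/
theorem balance_error (hK : K ∈ S.TE) {t : PolyV n} (ht : t ∈ PkV n k) :
    ipT (volK K) (evT (S.eσ K)) (evT (gradV t))
      + P.rhoE * P.s ^ 2 * ipV (volK K) (fun x => S.X.u x - evV (S.Y.u K) x) (evV t)
      = ∑ F ∈ facets K, ipV (surf F) (S.eσHatN K F) (evV t) := by
  have hs := S.simplexE hK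
  have hd := S.hdg.balance_local S.dim hK ht
  have hrow := fun i => (S.traces.σ_tr i).green hK (fun j => S.L2F_σ hK (i, j)) (S.L2F_divσ hK i) (t i)
  -- Gradients of functions in `P_k` have degree at most `k - 1`, and these moments of `σ` are
  -- preserved by the projection.
  have hproj : ∀ i, ipV (volK K) (evV (S.R.σ K i)) (evV (gradS (t i)))
      = ipV (volK K) (fun x => S.X.σ x i) (evV (gradS (t i))) := fun i =>
    (S.proj.elastic K hK i).2.2.1 _ fun j => PkS_pderiv j (ht i)
  have hsum := Finset.sum_congr rfl fun i (_ : i ∈ (Finset.univ : Finset (Fin n))) => hrow i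
  simp only [← hproj] at hsum
  rw [Finset.sum_add_distrib, Finset.sum_comm] at hsum
  have e1 : ∑ i, ipV (volK K) (evV (S.R.σ K i)) (evV (gradS (t i)))
      = ipT (volK K) (evT (S.R.σ K)) (evT (gradV t)) :=
    (ipT_eq_sum (L2F_evT K _) (L2F_evT K _)).symm
  have e2 : ∑ i, ipS (volK K) (fun x => S.X.divσ x i) (evS (t i))
      = ipV (volK K) S.X.divσ (evV t) := (ipV_eq_sum (S.L2F_divσ hK) (L2F_evV K _)).symm
  have e3 : ∑ F ∈ facets K, ∑ i, ipS (surf F) (fun x => dotN K F (S.X.σT x i)) (evS (t i))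
      = ∑ F ∈ facets K, ipV (surf F) (S.eσHatN K F) (evV t)
        + ∑ F ∈ facets K, ipV (surf F) (S.Y.σHatN S.τE K F) (evV t) := by
    rw [← Finset.sum_add_distrib]
    refine Finset.sum_congr rfl fun F hF => ?_
    rw [← S.flux_errorE hK hF ht]
    exact (ipV_eq_sum (f := fun x => mulN K F (S.X.σT x)) (fun i => (S.traces.σ_tr i K hK).1 F hF)
      (L2F_surf_evV S.dim_pos hs hF t)).symm
  rw [e1, e2, e3] at hsum
  have e4 : ipV (volK K) S.B.fE (evV t) = -ipV (volK K) S.X.divσ (evV t)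
      + P.rhoE * P.s ^ 2 * ipV (volK K) S.X.u (evV t) := by
    have : ipV (volK K) S.B.fE (evV t) = ipV (volK K)
        (fun x => (P.rhoE * P.s ^ 2 : ℂ) • S.X.u x - S.X.divσ x) (evV t) := by
      refine ipV_congr_left ?_
      filter_upwards [S.mesh.triE.ae_volK hK S.pde.balance] with x hx
      funext i
      rw [← hx i]
      simp only [Pi.sub_apply, Pi.smul_apply, smul_eq_mul]
      ring
    rw [this, ipV_sub_left ((S.L2F_u hK).smul _) (S.L2F_divσ hK) (L2F_evV K t), ipV_smul_left]
    ring
  rw [ipV_sub_left (S.L2F_u hK) (L2F_evV K _) (L2F_evV K t), eσ, evT_sub',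
    ipT_sub_left (L2F_evT K _) (L2F_evT K _) (L2F_evT K _)]
  rw [e4] at hd
  linear_combination hsum - hd

/-- Third error equation in the elastic region. -/
theorem symm_error (hK : K ∈ S.TE) {t : PolyT n} (ht : t ∈ skewSpace n k) :
    ipT (volK K) (fun x => S.X.σ x - evT (S.Y.σ K) x) (evT t) = 0 := by
  rw [ipT_sub_left (S.L2F_σ hK) (L2F_evT K _) (L2F_evT K t), S.hdg.symm_local S.dim hK ht, sub_zero]
  -- The exact stress is symmetric: the trace term of Hooke's law is symmetric, and the skew part of
  -- `∇u` is cancelled by `γ`.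
  have hsym : ∀ᵐ x ∂(volK K), ∀ i j, S.X.σ x i j = S.X.σ x j i := by
    filter_upwards [S.mesh.triE.ae_volK hK S.pde.hooke, S.mesh.triE.ae_volK hK S.pde.spin]
      with x h1 h2 i j
    have a1 := congrFun (congrFun h1 i) j
    have a2 := congrFun (congrFun h1 j) i
    have b1 := congrFun (congrFun h2 i) j
    have b2 := congrFun (congrFun h2 j) i
    simp only [Matrix.add_apply, Matrix.sub_apply, Matrix.smul_apply, smul_eq_mul, Matrix.zero_apply,
      Matrix.transpose_apply, Coeff.hookeInv, Matrix.one_apply, eq_comm (a := j) (b := i)] at a1 a2 b1 b2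
    have hμ : ((1 / (2 * P.mu) : ℝ) : ℂ) ≠ 0 := by
      have := P.mu_pos
      exact_mod_cast (by positivity : (1 / (2 * P.mu)) ≠ 0)
    refine mul_left_cancel₀ hμ ?_
    linear_combination a1 - a2 - b1 + b2
  rw [ipT]
  have : ∀ᵐ x ∂(volK K), ∑ i, ∑ j, S.X.σ x i j * conj (evT t x i j) = 0 := by
    filter_upwards [hsym] with x hx
    refine self_eq_neg.1 ?_
    conv_lhs => rw [Finset.sum_comm]
    rw [← Finset.sum_neg_distrib]
    refine Finset.sum_congr rfl fun i _ => ?_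
    rw [← Finset.sum_neg_distrib]
    refine Finset.sum_congr rfl fun j _ => ?_
    rw [hx j i, evT_apply, evT_apply, skew_apply ht j i]
    simp
  rw [integral_congr_ae this, integral_zero]

/-- First error equation in the acoustic region. -/
theorem velocity_error (hK : K ∈ S.TA) {r : PolyV n} (hr : r ∈ PkV n k) :
    ipV (volK K) (fun x => S.X.q x - evV (S.Y.q K) x) (evV r)
      + ipS (volK K) (evS (S.ev K)) (evS (divV r))
      = ∑ F ∈ facets K, ipS (surf F) (evS (S.evHat F)) (fun x => dotN K F (evV r x)) := by
  have hs := S.simplexA hK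
  have hd := S.hdg.velocity_local S.dim hK hr
  have hrow := (S.proj.acoustic K hK).gradient_eq (hasPolyTraces_of_mem_PkV hr) (PM := S.PV)
    (fun F hF => (S.faceA K hK F hF).2)
    (S.traces.v_tr.green S.dim_pos hK hs (S.memLp_v hK) (S.L2F_gradV hK) r)
  have e4 : ipV (volK K) S.X.gradV (evV r) = ipV (volK K) S.X.q (evV r) := by
    refine ipV_congr_left ?_
    filter_upwards [S.mesh.triA.ae_volK hK S.pde.velocity] with x hx
    exact funext fun i => (sub_eq_zero.1 (hx i)).symm
  have e5 : ∑ F ∈ facets K, ipS (surf F) (evS (S.evHat F)) (fun x => dotN K F (evV r x))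
      = ∑ F ∈ facets K, ipS (surf F) (evS (S.PV F)) (fun x => dotN K F (evV r x))
        - ∑ F ∈ facets K, ipS (surf F) (evS (S.Y.vHat F)) (fun x => dotN K F (evV r x)) := by
    rw [← Finset.sum_sub_distrib]
    refine Finset.sum_congr rfl fun F hF => ?_
    rw [evHat, evS_sub', ipS_sub_left (memLp_surf_evS S.dim_pos hs hF _)
      (memLp_surf_evS S.dim_pos hs hF _) (memLp_dotN (L2F_surf_evV S.dim_pos hs hF r))]
  rw [e5, ipV_sub_left (S.L2F_q hK) (L2F_evV K _) (L2F_evV K r), ev, evS_sub',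
    ipS_sub_left (memLp_evS K _) (memLp_evS K _) (memLp_evS K _)]
  rw [e4] at hrow
  linear_combination hrow - hd

/-- Second error equation in the acoustic region. -/
theorem wave_error (hK : K ∈ S.TA) {w : CPoly n} (hw : w ∈ PkS n k) :
    ipV (volK K) (evV (S.eq K)) (evV (gradS w))
      + (P.s / P.c) ^ 2 * ipS (volK K) (fun x => S.X.v x - evS (S.Y.v K) x) (evS w)
      = ∑ F ∈ facets K, ipS (surf F) (S.eqHatN K F) (evS w) := by
  have hd := S.hdg.wave_local S.dim hK hw
  have hrow := S.traces.q_tr.green hK (S.L2F_q hK) (S.memLp_divq hK) w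
  rw [← (S.proj.acoustic K hK).2.2.1 (gradS w) fun i => PkS_pderiv i hw,
    Finset.sum_congr rfl fun F hF => S.flux_errorA hK hF hw, Finset.sum_add_distrib] at hrow
  have e4 : ipS (volK K) S.B.fA (evS w) = -ipS (volK K) S.X.divq (evS w)
      + (P.s / P.c) ^ 2 * ipS (volK K) S.X.v (evS w) := by
    have : ipS (volK K) S.B.fA (evS w) = ipS (volK K)
        (fun x => (P.s / P.c) ^ 2 * S.X.v x - S.X.divq x) (evS w) := by
      refine ipS_congr_left ?_
      filter_upwards [S.mesh.triA.ae_volK hK S.pde.wave] with x hx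
      rw [← hx]
      ring
    rw [this, ipS_sub_left ((S.memLp_v hK).const_mul _) (S.memLp_divq hK) (memLp_evS K w),
      ipS_mul_left]
    ring
  rw [ipS_sub_left (S.memLp_v hK) (memLp_evS K _) (memLp_evS K w), eq, evV_sub',
    ipV_sub_left (L2F_evV K _) (L2F_evV K _) (L2F_evV K _)]
  rw [e4] at hd
  linear_combination hrow - hd

end ErrorSetup

/-! ### Cancellation of the flux errors on the skeleton. -/

namespace ErrorSetup

variable {n k : ℕ} {P : Coeff n} {D : Geom n} {κ τ₀ τ₁ : ℝ} (S : ErrorSetup k P D κ τ₀ τ₁)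
  {K K' F : Finset (Pt n)}

theorem euHat_mem (hK : K ∈ S.TE) (hF : F ∈ facets K) : S.euHat F ∈ PkV n k :=
  fun i => PkS_sub (S.faceE K hK F hF i).1 (S.hdg.mem.uHat K hK F hF i)

theorem evHat_mem (hK : K ∈ S.TA) (hF : F ∈ facets K) : S.evHat F ∈ PkS n k :=
  PkS_sub (S.faceA K hK F hF).1 (S.hdg.mem.vHat K hK F hF)

theorem zeroTest_uHat_mem :
    InSpaces k S.TE S.TA { zeroTest n with uHat := S.euHat } :=
  { zeroTest_mem S.dim with uHat := fun _ hK _ hF => S.euHat_mem hK hF }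

theorem zeroTest_vHat_mem :
    InSpaces k S.TE S.TA { zeroTest n with vHat := S.evHat } :=
  { zeroTest_mem S.dim with vHat := fun _ hK _ hF => S.evHat_mem hK hF }

theorem ipS_dotN_left {m : Measure (Pt n)} {f : Pt n → Fin n → ℂ} {g : Pt n → ℂ} (hf : L2F m f)
    (hg : MemLp g 2 m) (K F : Finset (Pt n)) : ipS m (fun x => dotN K F (f x)) g
      = ∑ j, (nrm K F j : ℂ) * ipS m (fun x => f x j) g := by
  simp only [ipS, ← integral_const_mul]
  rw [← integral_finsetSum _ fun j _ => (MemLp.integrable_mul_conj (hf j) hg).const_mul _]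
  refine integral_congr_ae (Filter.Eventually.of_forall fun x => ?_)
  simp only [dotN, Finset.sum_mul]
  exact Finset.sum_congr rfl fun j _ => by ring

theorem ipV_mul_nrm_left {m : Measure (Pt n)} {f : Pt n → ℂ} {g : Pt n → Fin n → ℂ}
    (hf : MemLp f 2 m) (hg : L2F m g) (K F : Finset (Pt n)) :
    ipV m (fun x i => f x * (nrm K F i : ℂ)) g = ∑ j, (nrm K F j : ℂ) * ipS m f (fun x => g x j) := by
  simp only [ipV, ipS, ← integral_const_mul]
  rw [← integral_finsetSum _ fun j _ => (MemLp.integrable_mul_conj hf (hg j)).const_mul _]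
  refine integral_congr_ae (Filter.Eventually.of_forall fun x => ?_)
  exact Finset.sum_congr rfl fun j _ => by ring

theorem L2F_mul_nrm {m : Measure (Pt n)} {f : Pt n → ℂ} (hf : MemLp f 2 m) (K F : Finset (Pt n)) :
    L2F m (fun x i => f x * (nrm K F i : ℂ)) :=
  fun i => by simpa only [mul_comm] using hf.const_mul (nrm K F i : ℂ)

/-- The discrete coupling term. -/
def couplingTerm (K F : Finset (Pt n)) : ℂ :=
  ipS (surf F) (fun x => dotN K F (evV (S.euHat F) x)) (evS (S.evHat F))

open scoped Classical in
/-- The total coupling on the interface. -/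
def coupling : ℂ := ∑ K ∈ S.TE, ∑ K' ∈ S.TA,
  ∑ F ∈ (facets K ∩ facets K').filter (fun F => LiesOn D.Γ F), S.couplingTerm K F

open scoped Classical in
-- A facet off the interface has two elements. The exact normal traces cancel because the normals
-- are opposite, and the numerical fluxes cancel in the sum by the conservation equation tested with
-- the trace error.
theorem sum_interiorE : ∑ K ∈ S.TE, ∑ F ∈ (facets K).filter (fun F => ¬ LiesOn D.Γ F),
    ipV (surf F) (S.eσHatN K F) (evV (S.euHat F)) = 0 := by
  have h1 := S.hdg.conserveE _ S.zeroTest_uHat_mem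
  have h2 := S.mesh.triE.sum_eq_zero S.dim_pos (fun F => ¬ LiesOn D.Γ F)
    (fun K hK F hF hP => S.mesh.exists_ne_of_elastic S.dim_pos hK hF hP)
    (fun K F => ipV (surf F) (fun x => mulN K F (S.X.σT x)) (evV (S.euHat F))) (by
      intro K hK K' hK' hne F hF hF'
      have : (fun x => mulN K' F (S.X.σT x)) = fun x => (-1 : ℂ) • mulN K F (S.X.σT x) := by
        funext x i
        simp [mulN, S.mesh.triE.nrm_eq_neg S.dim_pos hK hK' hne hF hF']
      rw [this, ipV_smul_left, neg_one_mul])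
  have h3 : ∀ K ∈ S.TE, ∀ F ∈ (facets K).filter (fun F => ¬ LiesOn D.Γ F),
      ipV (surf F) (S.eσHatN K F) (evV (S.euHat F))
        = ipV (surf F) (fun x => mulN K F (S.X.σT x)) (evV (S.euHat F))
          - ipV (surf F) (S.Y.σHatN S.τE K F) (evV (S.euHat F)) := by
    intro K hK F hF
    have hF := (Finset.mem_filter.1 hF).1
    rw [S.flux_errorE hK hF (S.euHat_mem hK hF), add_sub_cancel_right]
  rw [Finset.sum_congr rfl fun K hK => Finset.sum_congr rfl (h3 K hK)]
  simp only [Finset.sum_sub_distrib]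
  rw [h2, zero_sub, neg_eq_zero]
  exact h1

/-- The exact condition with the trace of `v` replaced by its face projection, which is allowed
since the components of `euHat` are in `P_k`. The right-hand side consists of terms of the scheme
and vanishes after summation. The conjugate arises because `couplingTerm` has `euHat` in its first
argument; the sign comes from `n_A = -n_E`. -/
theorem dynamic_error_local (hK : K ∈ S.TE) (hK' : K' ∈ S.TA) (hF : F ∈ facets K)
    (hF' : F ∈ facets K') (hΓ : LiesOn D.Γ F) :
    ipV (surf F) (S.eσHatN K F) (evV (S.euHat F)) + P.rhoF * P.s * conj (S.couplingTerm K F)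
      = ipV (surf F) (fun x i => -S.Y.σHatN S.τE K F x i
            + P.rhoF * P.s * evS (S.Y.vHat F) x * (nrm K' F i : ℂ)) (evV (S.euHat F))
        + P.rhoF * P.s * ipV (surf F) (fun x i => S.B.vinc x * (nrm K' F i : ℂ)) (evV (S.euHat F)) := by
  have hs := S.simplexE hK
  have hu := L2F_surf_evV S.dim_pos hs hF (S.euHat F)
  have hm := memLp_surf_evS S.dim_pos hs hF
  have hvT := (S.traces.v_tr K' hK').1 F hF'
  have hσT : L2F (surf F) (fun x => mulN K F (S.X.σT x)) := fun i => (S.traces.σ_tr i K hK).1 F hF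
  have hσh := S.L2F_σHatN hK hF
  set c : ℂ := P.rhoF * P.s with hc
  have hex : ipV (surf F) (fun x => c • (fun i => S.X.vT x * (nrm K' F i : ℂ))
        - mulN K F (S.X.σT x)) (evV (S.euHat F))
      = ipV (surf F) (fun x => (-c) • (fun i => S.B.vinc x * (nrm K' F i : ℂ))) (evV (S.euHat F)) := by
    refine ipV_congr_left ?_
    filter_upwards [S.traces.dynamic K hK K' hK' F hF hF' hΓ] with x hx
    funext i
    have := hx i
    simp only [Pi.sub_apply, Pi.smul_apply, smul_eq_mul, hc]
    linear_combination this
  rw [ipV_sub_left ((L2F_mul_nrm hvT K' F).smul c) hσT hu, ipV_smul_left, ipV_smul_left,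
    S.flux_errorE hK hF (S.euHat_mem hK hF)] at hex
  have hpm : ipV (surf F) (fun x i => S.X.vT x * (nrm K' F i : ℂ)) (evV (S.euHat F))
      = ipV (surf F) (fun x i => evS (S.PV F) x * (nrm K' F i : ℂ)) (evV (S.euHat F)) := by
    rw [ipV_mul_nrm_left hvT hu, ipV_mul_nrm_left (hm _) hu]
    exact Finset.sum_congr rfl fun j _ => congrArg _
      ((S.faceA K' hK' F hF').2 _ (S.euHat_mem hK hF j)).symm
  have hsch : ipV (surf F) (fun x i => -S.Y.σHatN S.τE K F x i
      + P.rhoF * P.s * evS (S.Y.vHat F) x * (nrm K' F i : ℂ)) (evV (S.euHat F))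
      = c * ipV (surf F) (fun x i => evS (S.Y.vHat F) x * (nrm K' F i : ℂ)) (evV (S.euHat F))
        - ipV (surf F) (S.Y.σHatN S.τE K F) (evV (S.euHat F)) := by
    rw [← ipV_smul_left, ← ipV_sub_left ((L2F_mul_nrm (hm _) K' F).smul c) hσh hu]
    congr 1
    funext x i
    simp only [Pi.sub_apply, Pi.smul_apply, smul_eq_mul, hc]
    ring
  have hcoup : conj (S.couplingTerm K F)
      = ipV (surf F) (fun x i => evS (S.Y.vHat F) x * (nrm K' F i : ℂ)) (evV (S.euHat F))
        - ipV (surf F) (fun x i => evS (S.PV F) x * (nrm K' F i : ℂ)) (evV (S.euHat F)) := by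
    rw [← ipV_sub_left (L2F_mul_nrm (hm _) K' F) (L2F_mul_nrm (hm _) K' F) hu, couplingTerm, conj_ipS]
    refine integral_congr_ae (Filter.Eventually.of_forall fun x => ?_)
    simp only [dotN, map_sum, Finset.mul_sum, map_mul, Complex.conj_ofReal, evHat, evS_sub, evV,
      Pi.sub_apply, S.mesh.nrm_eq_neg S.dim_pos hK hK' hF hF', Complex.ofReal_neg]
    exact Finset.sum_congr rfl fun i _ => by ring
  rw [hsch, hcoup]
  rw [hpm] at hex
  linear_combination -hex

open scoped Classical in
theorem sum_interfaceE : ∑ K ∈ S.TE, ∑ F ∈ (facets K).filter (fun F => LiesOn D.Γ F),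
    ipV (surf F) (S.eσHatN K F) (evV (S.euHat F)) = -(P.rhoF * P.s * conj S.coupling) := by
  have h1 := S.hdg.dynamic _ S.zeroTest_uHat_mem
  rw [Finset.sum_congr rfl fun K hK => sum_eq_sum_of_existsUnique (T' := S.TA)
    (fun F hF hP => S.mesh.existsUnique_acoustic S.dim_pos hK hF hP) _]
  rw [eq_neg_iff_add_eq_zero, coupling, map_sum, Finset.mul_sum, ← Finset.sum_add_distrib]
  have h2 : ∀ K ∈ S.TE, (∑ K' ∈ S.TA, ∑ F ∈ (facets K ∩ facets K').filter (fun F => LiesOn D.Γ F),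
      ipV (surf F) (S.eσHatN K F) (evV (S.euHat F))) + P.rhoF * P.s * conj (∑ K' ∈ S.TA,
        ∑ F ∈ (facets K ∩ facets K').filter (fun F => LiesOn D.Γ F), S.couplingTerm K F)
      = ∑ K' ∈ S.TA, ∑ F ∈ (facets K ∩ facets K').filter (fun F => LiesOn D.Γ F),
        (ipV (surf F) (fun x i => -S.Y.σHatN S.τE K F x i
            + P.rhoF * P.s * evS (S.Y.vHat F) x * (nrm K' F i : ℂ)) (evV (S.euHat F))
        + P.rhoF * P.s * ipV (surf F) (fun x i => S.B.vinc x * (nrm K' F i : ℂ)) (evV (S.euHat F))) := by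
    intro K hK
    rw [map_sum, Finset.mul_sum, ← Finset.sum_add_distrib]
    refine Finset.sum_congr rfl fun K' hK' => ?_
    rw [map_sum, Finset.mul_sum, ← Finset.sum_add_distrib]
    refine Finset.sum_congr rfl fun F hF => ?_
    obtain ⟨hF, hΓ⟩ := Finset.mem_filter.1 hF
    obtain ⟨hF, hF'⟩ := Finset.mem_inter.1 hF
    exact S.dynamic_error_local hK hK' hF hF' hΓ
  rw [Finset.sum_congr rfl h2]
  simp only [Finset.sum_add_distrib, ← Finset.mul_sum]
  rw [← eq_neg_iff_add_eq_zero]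
  exact h1

/-- The flux stands in the second argument here, as in the energy identities. Conjugation turns the
factor `s` into `conj s` and removes the conjugate from the coupling. -/
theorem sum_fluxE : ∑ K ∈ S.TE, ∑ F ∈ facets K, ipV (surf F) (evV (S.euHat F)) (S.eσHatN K F)
    = -(P.rhoF * conj P.s * S.coupling) := by
  classical
  have h : ∑ K ∈ S.TE, ∑ F ∈ facets K, ipV (surf F) (S.eσHatN K F) (evV (S.euHat F))
      = -(P.rhoF * P.s * conj S.coupling) := by
    rw [← S.sum_interfaceE, ← add_zero (∑ K ∈ S.TE, ∑ F ∈ (facets K).filter _, _),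
      ← S.sum_interiorE, ← Finset.sum_add_distrib]
    exact Finset.sum_congr rfl fun K _ => (Finset.sum_filter_add_sum_filter_not _ _ _).symm
  have h' := congrArg conj h
  simpa only [map_sum, conj_ipV, map_neg, map_mul, Complex.conj_ofReal, Complex.conj_conj] using h'

/-- Testing the discrete Dirichlet condition with the trace error itself makes a sum of squared
norms zero, hence every summand. -/
theorem evHat_dirichlet (hK : K ∈ S.TA) (hF : F ∈ facets K) (hD : LiesOn D.ΓD F) :
    nsq (surf F) (one (evS (S.evHat F))) = 0 := by
  classical
  have h1 := S.hdg.dirichlet _ S.zeroTest_vHat_mem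
  have h2 : ∀ K ∈ S.TA, ∀ F ∈ (facets K).filter (fun F => LiesOn D.ΓD F),
      (nsq (surf F) (one (evS (S.evHat F))) : ℂ)
        = ipS (surf F) S.B.gD (evS (S.evHat F))
          - ipS (surf F) (evS (S.Y.vHat F)) (evS (S.evHat F)) := by
    intro K hK F hF
    obtain ⟨hF, hD⟩ := Finset.mem_filter.1 hF
    have hm := memLp_surf_evS S.dim_pos (S.simplexA hK) hF
    rw [← ipS_congr_left (S.traces.dirichlet K hK F hF hD),
      ← (S.faceA K hK F hF).2 _ (S.evHat_mem hK hF), ← ip_self, ← ipS_eq,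
      ← ipS_sub_left (hm _) (hm _) (hm _)]
    congr 1
    exact evS_sub' _ _
  have h3 : ∑ K ∈ S.TA, ∑ F ∈ (facets K).filter (fun F => LiesOn D.ΓD F),
      (nsq (surf F) (one (evS (S.evHat F))) : ℂ) = 0 := by
    rw [Finset.sum_congr rfl fun K hK => Finset.sum_congr rfl (h2 K hK)]
    simp only [Finset.sum_sub_distrib]
    rw [sub_eq_zero]
    exact h1.symm
  have h4 : ∑ K ∈ S.TA, ∑ F ∈ (facets K).filter (fun F => LiesOn D.ΓD F),
      nsq (surf F) (one (evS (S.evHat F))) = 0 := by exact_mod_cast h3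
  have h5 := (Finset.sum_eq_zero_iff_of_nonneg
    fun K _ => Finset.sum_nonneg fun F _ => nsq_nonneg).1 h4 K hK
  exact (Finset.sum_eq_zero_iff_of_nonneg fun F _ => nsq_nonneg).1 h5 F
    (Finset.mem_filter.2 ⟨hF, hD⟩)

theorem not_Γ_of_ΓN (hF : F ∈ facets K) (h : LiesOn D.ΓN F) (hn : 0 < n) : ¬ LiesOn D.Γ F :=
  not_liesOn_of_disjoint hn hF (D.disjoint_Γ_frontier.symm.mono_left D.ΓN_subset) h

open scoped Classical in
-- Off the interface there are three kinds of facets. On Dirichlet facets the trace error is zero;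
-- on Neumann facets the exact flux equals the data on the right-hand side of the scheme; on the
-- others the exact fluxes of the two elements cancel.
theorem sum_interiorA : ∑ K ∈ S.TA, ∑ F ∈ (facets K).filter (fun F => ¬ LiesOn D.Γ F),
    ipS (surf F) (S.eqHatN K F) (evS (S.evHat F)) = 0 := by
  have hn := S.dim_pos
  have h1 := S.hdg.conserveA _ S.zeroTest_vHat_mem
  have h2 := S.mesh.triA.sum_eq_zero hn
    (fun F => (¬ LiesOn D.Γ F ∧ ¬ LiesOn D.ΓD F) ∧ ¬ LiesOn D.ΓN F)
    (fun K hK F hF hP => S.mesh.exists_ne_of_acoustic hn hK hF hP.1.1 hP.1.2 hP.2)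
    (fun K F => ipS (surf F) (fun x => dotN K F (S.X.qT x)) (evS (S.evHat F))) (by
      intro K hK K' hK' hne F hF hF'
      have : (fun x => dotN K' F (S.X.qT x)) = fun x => (-1 : ℂ) * dotN K F (S.X.qT x) := by
        funext x
        simp [dotN, S.mesh.triA.nrm_eq_neg hn hK hK' hne hF hF']
      rw [this, ipS_mul_left, neg_one_mul])
  have hD : ∀ K ∈ S.TA, ∑ F ∈ (facets K).filter (fun F => ¬ LiesOn D.Γ F),
      ipS (surf F) (S.eqHatN K F) (evS (S.evHat F))
      = ∑ F ∈ (facets K).filter (fun F => ¬ LiesOn D.Γ F ∧ ¬ LiesOn D.ΓD F),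
        ipS (surf F) (S.eqHatN K F) (evS (S.evHat F)) := by
    intro K hK
    symm
    refine Finset.sum_subset (fun F hF => ?_) fun F hF hF' => ?_
    · simp only [Finset.mem_filter] at hF ⊢
      exact ⟨hF.1, hF.2.1⟩
    · simp only [Finset.mem_filter, not_and, not_not] at hF hF'
      rw [ipS_eq]
      exact ip_eq_zero_of_nsq_right (fun _ => S.memLp_eqHatN hK hF.1)
        (fun _ => memLp_surf_evS hn (S.simplexA hK) hF.1 _)
        (S.evHat_dirichlet hK hF.1 (hF' hF.1 hF.2))
  have h3 : ∀ K ∈ S.TA, ∀ F ∈ (facets K).filter (fun F => ¬ LiesOn D.Γ F ∧ ¬ LiesOn D.ΓD F),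
      ipS (surf F) (S.eqHatN K F) (evS (S.evHat F))
        = ipS (surf F) (fun x => dotN K F (S.X.qT x)) (evS (S.evHat F))
          - ipS (surf F) (S.Y.qHatN S.τA K F) (evS (S.evHat F)) := by
    intro K hK F hF
    have hF := (Finset.mem_filter.1 hF).1
    rw [S.flux_errorA hK hF (S.evHat_mem hK hF), add_sub_cancel_right]
  have h4 : ∀ K ∈ S.TA, ∑ F ∈ (facets K).filter (fun F => ¬ LiesOn D.Γ F ∧ ¬ LiesOn D.ΓD F),
      ipS (surf F) (fun x => dotN K F (S.X.qT x)) (evS (S.evHat F))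
      = ∑ F ∈ (facets K).filter (fun F => LiesOn D.ΓN F), ipS (surf F) S.B.gN (evS (S.evHat F))
        + ∑ F ∈ (facets K).filter
          (fun F => (¬ LiesOn D.Γ F ∧ ¬ LiesOn D.ΓD F) ∧ ¬ LiesOn D.ΓN F),
          ipS (surf F) (fun x => dotN K F (S.X.qT x)) (evS (S.evHat F)) := by
    intro K hK
    rw [← Finset.sum_filter_add_sum_filter_not ((facets K).filter _) (fun F => LiesOn D.ΓN F)]
    simp only [Finset.filter_filter]
    congr 1
    have : (facets K).filter (fun F => (¬ LiesOn D.Γ F ∧ ¬ LiesOn D.ΓD F) ∧ LiesOn D.ΓN F)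
        = (facets K).filter (fun F => LiesOn D.ΓN F) := by
      refine Finset.filter_congr fun F hF => ⟨fun h => h.2, fun h => ⟨⟨?_, ?_⟩, h⟩⟩
      · exact not_Γ_of_ΓN hF h hn
      · exact not_liesOn_of_disjoint hn hF D.disj.symm h
    rw [this]
    refine Finset.sum_congr rfl fun F hF => ?_
    obtain ⟨hF, hN⟩ := Finset.mem_filter.1 hF
    exact ipS_congr_left (S.traces.neumann K hK F hF hN)
  rw [Finset.sum_congr rfl hD, Finset.sum_congr rfl fun K hK => Finset.sum_congr rfl (h3 K hK)]
  simp only [Finset.sum_sub_distrib]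
  rw [Finset.sum_congr rfl h4, Finset.sum_add_distrib, h2, add_zero, sub_eq_zero]
  exact h1.symm

/-- The counterpart of the dynamic condition, tested with `evHat`. Here the trace of `u` is replaced
by its face projection, and the coupling enters without conjugation. -/
theorem kinematic_error_local (hK : K ∈ S.TE) (hK' : K' ∈ S.TA) (hF : F ∈ facets K)
    (hF' : F ∈ facets K') (hΓ : LiesOn D.Γ F) :
    ipS (surf F) (S.eqHatN K' F) (evS (S.evHat F)) - P.s * S.couplingTerm K F
      = -ipS (surf F) (fun x => dotN K' F (S.B.gradVinc x)) (evS (S.evHat F))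
        - ipS (surf F) (fun x => S.Y.qHatN S.τA K' F x - P.s * dotN K F (evV (S.Y.uHat F) x))
          (evS (S.evHat F)) := by
  have hs := S.simplexE hK
  have hm := memLp_surf_evS S.dim_pos hs hF
  have hv := hm (S.evHat F)
  have huT : L2F (surf F) S.X.uT := fun i => (S.traces.u_tr i K hK).1 F hF
  have hqT : MemLp (fun x => dotN K' F (S.X.qT x)) 2 (surf F) := (S.traces.q_tr K' hK').1 F hF'
  have hqh := S.memLp_qHatN hK' hF'
  have hP := L2F_surf_evV S.dim_pos hs hF
  have hex : ipS (surf F) (fun x => dotN K' F (S.X.qT x) - P.s * dotN K F (S.X.uT x))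
      (evS (S.evHat F))
      = ipS (surf F) (fun x => (-1 : ℂ) * dotN K' F (S.B.gradVinc x)) (evS (S.evHat F)) := by
    refine ipS_congr_left ?_
    filter_upwards [S.traces.kinematic K hK K' hK' F hF hF' hΓ] with x hx
    rw [hx, neg_one_mul]
  rw [ipS_sub_left hqT ((memLp_dotN huT).const_mul _) hv, ipS_mul_left, ipS_mul_left,
    S.flux_errorA hK' hF' (S.evHat_mem hK' hF')] at hex
  have hpm : ipS (surf F) (fun x => dotN K F (S.X.uT x)) (evS (S.evHat F))
      = ipS (surf F) (fun x => dotN K F (evV (S.PU F) x)) (evS (S.evHat F)) := by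
    rw [ipS_dotN_left huT hv, ipS_dotN_left (hP _) hv]
    exact Finset.sum_congr rfl fun j _ => congrArg _
      ((S.faceE K hK F hF j).2 _ (S.evHat_mem hK' hF')).symm
  have hcoup : S.couplingTerm K F
      = ipS (surf F) (fun x => dotN K F (evV (S.PU F) x)) (evS (S.evHat F))
        - ipS (surf F) (fun x => dotN K F (evV (S.Y.uHat F) x)) (evS (S.evHat F)) := by
    rw [← ipS_sub_left (memLp_dotN (hP _)) (memLp_dotN (hP _)) hv, couplingTerm]
    simp only [euHat, evV_sub, dotN_sub]
  rw [ipS_sub_left hqh ((memLp_dotN (hP _)).const_mul _) hv, ipS_mul_left, hcoup]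
  rw [hpm] at hex
  linear_combination hex

open scoped Classical in
theorem sum_interfaceA : ∑ K ∈ S.TA, ∑ F ∈ (facets K).filter (fun F => LiesOn D.Γ F),
    ipS (surf F) (S.eqHatN K F) (evS (S.evHat F)) = P.s * S.coupling := by
  have h1 := S.hdg.kinematic _ S.zeroTest_vHat_mem
  rw [Finset.sum_congr rfl fun K hK => sum_eq_sum_of_existsUnique (T' := S.TE)
    (fun F hF hP => S.mesh.existsUnique_elastic S.dim_pos hK hF hP) _, Finset.sum_comm]
  rw [← sub_eq_zero, coupling, Finset.mul_sum, ← Finset.sum_sub_distrib]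
  have h2 : ∀ K ∈ S.TE, (∑ K' ∈ S.TA, ∑ F ∈ (facets K' ∩ facets K).filter (fun F => LiesOn D.Γ F),
      ipS (surf F) (S.eqHatN K' F) (evS (S.evHat F))) - P.s * (∑ K' ∈ S.TA,
        ∑ F ∈ (facets K ∩ facets K').filter (fun F => LiesOn D.Γ F), S.couplingTerm K F)
      = ∑ K' ∈ S.TA, ∑ F ∈ (facets K ∩ facets K').filter (fun F => LiesOn D.Γ F),
        (-ipS (surf F) (fun x => dotN K' F (S.B.gradVinc x)) (evS (S.evHat F))
        - ipS (surf F) (fun x => S.Y.qHatN S.τA K' F x - P.s * dotN K F (evV (S.Y.uHat F) x))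
          (evS (S.evHat F))) := by
    intro K hK
    rw [Finset.mul_sum, ← Finset.sum_sub_distrib]
    refine Finset.sum_congr rfl fun K' hK' => ?_
    rw [Finset.mul_sum, Finset.inter_comm, ← Finset.sum_sub_distrib]
    refine Finset.sum_congr rfl fun F hF => ?_
    obtain ⟨hF, hΓ⟩ := Finset.mem_filter.1 hF
    obtain ⟨hF, hF'⟩ := Finset.mem_inter.1 hF
    exact S.kinematic_error_local hK hK' hF hF' hΓ
  rw [Finset.sum_congr rfl h2]
  simp only [Finset.sum_sub_distrib, Finset.sum_neg_distrib]
  rw [sub_eq_zero]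
  exact h1.symm

theorem sum_fluxA : ∑ K ∈ S.TA, ∑ F ∈ facets K, ipS (surf F) (evS (S.evHat F)) (S.eqHatN K F)
    = conj P.s * conj S.coupling := by
  classical
  have h : ∑ K ∈ S.TA, ∑ F ∈ facets K, ipS (surf F) (S.eqHatN K F) (evS (S.evHat F))
      = P.s * S.coupling := by
    rw [← S.sum_interfaceA, ← add_zero (∑ K ∈ S.TA, ∑ F ∈ (facets K).filter _, _),
      ← S.sum_interiorA, ← Finset.sum_add_distrib]
    exact Finset.sum_congr rfl fun K _ => (Finset.sum_filter_add_sum_filter_not _ _ _).symm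
  have h' := congrArg conj h
  simpa only [map_sum, conj_ipS, map_mul] using h'

/-- The fluxes on the skeleton do not contribute to the energy. -/
theorem re_sum_flux :
    (P.s * (∑ K ∈ S.TE, ∑ F ∈ facets K, ipV (surf F) (evV (S.euHat F)) (S.eσHatN K F))
      + P.rhoF * P.s * ∑ K ∈ S.TA, ∑ F ∈ facets K,
        ipS (surf F) (evS (S.evHat F)) (S.eqHatN K F)).re = 0 := by
  rw [S.sum_fluxE, S.sum_fluxA]
  -- The weights `s` and `ρ_f s` are chosen for this step: the two interface contributions become a
  -- real multiple of the difference between a number and its conjugate.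
  have : P.s * -(P.rhoF * conj P.s * S.coupling) + P.rhoF * P.s * (conj P.s * conj S.coupling)
      = ((P.rhoF * ‖P.s‖ ^ 2 : ℝ) : ℂ) * (conj S.coupling - S.coupling) := by
    push_cast
    rw [← Complex.mul_conj']
    ring
  rw [this, Complex.re_ofReal_mul, Complex.sub_re, Complex.conj_re, sub_self, mul_zero]

end ErrorSetup

/-! ### Green's formulas for polynomials. -/

section Green

variable {n : ℕ} {K : Finset (Pt n)}

/-- Green's formula for polynomials. -/
theorem green_poly (hn : 0 < n) (hK : IsSimplex K) (w : CPoly n) (r : PolyV n) :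
    ipS (volK K) (evS w) (evS (divV r)) + ipV (volK K) (evV (gradS w)) (evV r)
      = ∑ F ∈ facets K, ipS (surf F) (evS w) (fun x => dotN K F (evV r x)) := by
  have h := integral_divV hn hK (fun j => w * conjP (r j))
  have e1 : ∀ x, evS (divV fun j => w * conjP (r j)) x
      = evS w x * conj (evS (divV r) x) + ∑ j, evV (gradS w) x j * conj (evV r x j) := by
    intro x
    simp only [divV, evS_sum, map_sum, Finset.mul_sum, ← Finset.sum_add_distrib, evV, gradS]
    refine Finset.sum_congr rfl fun j _ => ?_
    simp [Derivation.leibniz]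
    ring
  simp only [e1] at h
  rw [integral_add (MemLp.integrable_mul_conj (memLp_evS K w) (memLp_evS K _))
    ((L2F_evV K _).integrable_ip (L2F_evV K r))] at h
  refine h.trans (Finset.sum_congr rfl fun F _ => ?_)
  refine integral_congr_ae (Filter.Eventually.of_forall fun x => ?_)
  simp only [dotN, evV, evS_mul, evS_conjP, map_sum, map_mul, Complex.conj_ofReal, Finset.mul_sum]
  exact Finset.sum_congr rfl fun j _ => by ring

theorem green_polyV (hn : 0 < n) (hK : IsSimplex K) (w : PolyV n) (t : PolyT n) :
    ipV (volK K) (evV w) (evV (divT t)) + ipT (volK K) (evT (gradV w)) (evT t)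
      = ∑ F ∈ facets K, ipV (surf F) (evV w) (fun x => mulN K F (evT t x)) := by
  rw [ipV_eq_sum (L2F_evV K _) (L2F_evV K _), ipT_eq_sum (L2F_evT K _) (L2F_evT K _),
    ← Finset.sum_add_distrib]
  have h : ∀ F ∈ facets K, ipV (surf F) (evV w) (fun x => mulN K F (evT t x))
      = ∑ i, ipS (surf F) (evS (w i)) (fun x => dotN K F (evV (t i) x)) := fun F hF =>
    ipV_eq_sum (ErrorSetup.L2F_surf_evV hn hK hF w) (ErrorSetup.L2F_surf_mulN hn hK hF t)
  rw [Finset.sum_congr rfl h, Finset.sum_comm]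
  exact Finset.sum_congr rfl fun i _ => green_poly hn hK (w i) (t i)

end Green

/-! ### Coercivity and boundedness of the inverse of Hooke's tensor. -/

section Hooke

variable {n : ℕ}

theorem norm_trace_sq_le (M : Matrix (Fin n) (Fin n) ℂ) :
    ‖M.trace‖ ^ 2 ≤ n * ∑ i, ∑ j, ‖M i j‖ ^ 2 := by
  calc ‖M.trace‖ ^ 2 ≤ (∑ i, ‖M i i‖) ^ 2 := by
        gcongr
        exact norm_sum_le _ _
    _ ≤ n * ∑ i, ‖M i i‖ ^ 2 := by
        simpa using sq_sum_le_card_mul_sum_sq (s := Finset.univ) (f := fun i => ‖M i i‖)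
    _ ≤ _ := by
        gcongr with i
        exact Finset.single_le_sum (f := fun j => ‖M i j‖ ^ 2) (fun j _ => by positivity)
          (Finset.mem_univ i)

theorem Coeff.hookeInv_form (P : Coeff n) (M : Matrix (Fin n) (Fin n) ℂ) :
    ∑ i, ∑ j, P.hookeInv M i j * conj (M i j)
      = ((1 / (2 * P.mu) * (∑ i, ∑ j, ‖M i j‖ ^ 2)
        - P.lam / (2 * P.mu * (n * P.lam + 2 * P.mu)) * ‖M.trace‖ ^ 2 : ℝ) : ℂ) := by
  set a := 1 / (2 * P.mu) with ha
  set b := P.lam / (2 * P.mu * (n * P.lam + 2 * P.mu)) with hb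
  have h1 : ∀ i j, P.hookeInv M i j * conj (M i j)
      = (a : ℂ) * (M i j * conj (M i j))
        - (b : ℂ) * M.trace * ((1 : Matrix (Fin n) (Fin n) ℂ) i j * conj (M i j)) := by
    intro i j
    simp only [Coeff.hookeInv, Matrix.sub_apply, Matrix.smul_apply, smul_eq_mul, ← ha, ← hb]
    ring
  simp only [h1, Finset.sum_sub_distrib, ← Finset.mul_sum]
  have h2 : ∑ i, ∑ j, (1 : Matrix (Fin n) (Fin n) ℂ) i j * conj (M i j) = conj M.trace := by
    simp [Matrix.one_apply, Matrix.trace]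
  rw [h2, mul_assoc, Complex.mul_conj']
  push_cast
  simp only [Complex.mul_conj']

/-- The form is `a |M|² - b |tr M|²` with `|tr M|² ≤ n |M|²`. If `b ≤ 0` the constant `a` serves; if
`b ≥ 0` the worst tensors are the multiples of the identity, with constant `a - b * n = 1 / (nλ +
2μ)`, positive by assumption. -/
theorem Coeff.hookeInv_coercive (P : Coeff n) : ∃ c : ℝ, 0 < c ∧
    ∀ (m : Measure (Pt n)) (f : Pt n → Matrix (Fin n) (Fin n) ℂ), L2F m (flat f) →
      ∃ r : ℝ, ipT m (fun x => P.hookeInv (f x)) f = r ∧ c * nsq m (flat f) ≤ r := by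
  set a := 1 / (2 * P.mu) with ha
  set b := P.lam / (2 * P.mu * (n * P.lam + 2 * P.mu)) with hb
  have hμ := P.mu_pos
  have hl := P.lam_pos
  have hpos : ∃ c : ℝ, 0 < c ∧ ∀ N t : ℝ, 0 ≤ t → t ≤ n * N → c * N ≤ a * N - b * t := by
    rcases le_total b 0 with h | h
    · exact ⟨a, by positivity, fun N t ht _ => by nlinarith⟩
    · refine ⟨1 / (n * P.lam + 2 * P.mu), by positivity, fun N t ht htN => ?_⟩
      have : 1 / (n * P.lam + 2 * P.mu) = a - b * n := by
        rw [ha, hb]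
        field_simp
        ring
      rw [this]
      nlinarith
  obtain ⟨c, hc, h⟩ := hpos
  refine ⟨c, hc, fun m f hf => ⟨∫ x, (a * (∑ i, ∑ j, ‖f x i j‖ ^ 2) - b * ‖(f x).trace‖ ^ 2) ∂m,
    ?_, ?_⟩⟩
  · simp only [ipT, Coeff.hookeInv_form]
    exact integral_complex_ofReal
  · have htr : MemLp (fun x => (f x).trace) 2 m := by
      simp only [Matrix.trace, Matrix.diag]
      exact memLp_finsetSum _ fun i _ => hf (i, i)
    have hi : Integrable (fun x => ∑ i, ∑ j, ‖f x i j‖ ^ 2) m :=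
      integrable_finsetSum _ fun i _ => integrable_finsetSum _ fun j _ =>
        (hf (i, j)).integrable_norm_pow (by norm_num)
    have hnsq : nsq m (flat f) = ∫ x, ∑ i, ∑ j, ‖f x i j‖ ^ 2 ∂m := by
      simp [nsq, flat, Fintype.sum_prod_type]
    rw [hnsq, ← integral_const_mul]
    exact integral_mono (hi.const_mul _) ((hi.const_mul _).sub
      ((htr.integrable_norm_pow (by norm_num)).const_mul _))
      fun x => h _ _ (by positivity) (norm_trace_sq_le _)

theorem Coeff.hookeInv_bounded (P : Coeff n) : ∃ C : ℝ, 0 < C ∧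
    ∀ (m : Measure (Pt n)) (f : Pt n → Matrix (Fin n) (Fin n) ℂ), L2F m (flat f) →
      nsq m (flat fun x => P.hookeInv (f x)) ≤ C * nsq m (flat f) := by
  set a := 1 / (2 * P.mu) with ha
  set b := P.lam / (2 * P.mu * (n * P.lam + 2 * P.mu)) with hb
  have hμ := P.mu_pos
  refine ⟨2 * a ^ 2 + 2 * b ^ 2 * (n * n * n), by positivity, fun m f hf => ?_⟩
  have hnsq : ∀ g : Pt n → Matrix (Fin n) (Fin n) ℂ,
      nsq m (flat g) = ∫ x, ∑ i, ∑ j, ‖g x i j‖ ^ 2 ∂m := fun g => by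
    simp [nsq, flat, Fintype.sum_prod_type]
  have hi : ∀ g : Pt n → Matrix (Fin n) (Fin n) ℂ, L2F m (flat g) →
      Integrable (fun x => ∑ i, ∑ j, ‖g x i j‖ ^ 2) m := fun g hg =>
    integrable_finsetSum _ fun i _ => integrable_finsetSum _ fun j _ =>
      (hg (i, j)).integrable_norm_pow (by norm_num)
  rw [hnsq, hnsq, ← integral_const_mul]
  refine integral_mono (hi _ (L2F_hookeInv P hf)) ((hi f hf).const_mul _) fun x => ?_
  have hij : ∀ i j, ‖P.hookeInv (f x) i j‖ ^ 2
      ≤ 2 * a ^ 2 * ‖f x i j‖ ^ 2 + 2 * b ^ 2 * ‖(f x).trace‖ ^ 2 := by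
    intro i j
    have h1 : ‖P.hookeInv (f x) i j‖ ≤ |a| * ‖f x i j‖ + |b| * ‖(f x).trace‖ := by
      simp only [Coeff.hookeInv, Matrix.sub_apply, Matrix.smul_apply, smul_eq_mul, ← ha, ← hb]
      refine (norm_sub_le _ _).trans (add_le_add ?_ ?_)
      · rw [norm_mul, Complex.norm_real, Real.norm_eq_abs]
      · rw [norm_mul, norm_mul, Complex.norm_real, Real.norm_eq_abs]
        refine mul_le_of_le_one_right (by positivity) ?_
        rw [Matrix.one_apply]
        split_ifs <;> simp
    calc _ ≤ (|a| * ‖f x i j‖ + |b| * ‖(f x).trace‖) ^ 2 := by gcongr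
      _ ≤ 2 * (|a| * ‖f x i j‖) ^ 2 + 2 * (|b| * ‖(f x).trace‖) ^ 2 := by
          nlinarith [sq_nonneg (|a| * ‖f x i j‖ - |b| * ‖(f x).trace‖)]
      _ = _ := by rw [mul_pow, mul_pow, sq_abs, sq_abs]; ring
  calc ∑ i, ∑ j, ‖P.hookeInv (f x) i j‖ ^ 2
      ≤ ∑ i, ∑ j, (2 * a ^ 2 * ‖f x i j‖ ^ 2 + 2 * b ^ 2 * ‖(f x).trace‖ ^ 2) :=
        Finset.sum_le_sum fun i _ => Finset.sum_le_sum fun j _ => hij i j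
    _ = 2 * a ^ 2 * (∑ i, ∑ j, ‖f x i j‖ ^ 2) + 2 * b ^ 2 * (n * n * ‖(f x).trace‖ ^ 2) := by
        simp only [Finset.sum_add_distrib, ← Finset.mul_sum, Finset.sum_const, Finset.card_univ,
          Fintype.card_fin, nsmul_eq_mul]
        ring
    _ ≤ 2 * a ^ 2 * (∑ i, ∑ j, ‖f x i j‖ ^ 2)
        + 2 * b ^ 2 * (n * n * (n * ∑ i, ∑ j, ‖f x i j‖ ^ 2)) := by
        gcongr
        exact norm_trace_sq_le _
    _ = _ := by ring

end Hooke

/-! ### Energy identities on single elements. -/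

namespace ErrorSetup

variable {n k : ℕ} {P : Coeff n} {D : Geom n} {κ τ₀ τ₁ : ℝ} (S : ErrorSetup k P D κ τ₀ τ₁)
  {K K' F : Finset (Pt n)}

/-- The squares of the jumps weighted by the stabilization. -/
def jumpSqE (K F : Finset (Pt n)) : ℝ :=
  ∫ x, S.τE K x * ∑ i, ‖evS (S.jumpE K F i) x‖ ^ 2 ∂(surf F)
def jumpSqA (K F : Finset (Pt n)) : ℝ := ∫ x, S.τA K x * ‖evS (S.jumpA K F) x‖ ^ 2 ∂(surf F)

theorem eσ_mem (hK : K ∈ S.TE) : S.eσ K ∈ stressSpace n k K :=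
  stressSpace_sub S.dim (PkT_subset_stressSpace S.dim fun i => (S.proj.elastic K hK i).1)
    (S.hdg.mem.σ K hK)

theorem eu_mem (hK : K ∈ S.TE) : S.eu K ∈ PkV n k :=
  PkV_sub (fun i => (S.proj.elastic K hK i).2.1) (S.hdg.mem.u K hK)

theorem eγ_mem (hK : K ∈ S.TE) : S.eγ K ∈ skewSpace n k :=
  skewSpace_sub (S.proj.spin K hK).1 (S.hdg.mem.γ K hK)

theorem eq_mem (hK : K ∈ S.TA) : S.eq K ∈ PkV n k :=
  PkV_sub (S.proj.acoustic K hK).1 (S.hdg.mem.q K hK)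

theorem ev_mem (hK : K ∈ S.TA) : S.ev K ∈ PkS n k :=
  PkS_sub (S.proj.acoustic K hK).2.1 (S.hdg.mem.v K hK)

theorem L2F_dσ (hK : K ∈ S.TE) : L2F (volK K) (flat (S.dσ K)) := (S.L2F_σ hK).sub (L2F_evT K _)
theorem L2F_dγ (hK : K ∈ S.TE) : L2F (volK K) (flat (S.dγ K)) := (S.L2F_γ hK).sub (L2F_evT K _)
theorem L2F_du (hK : K ∈ S.TE) : L2F (volK K) (S.du K) := (S.L2F_u hK).sub (L2F_evV K _)
theorem L2F_dq (hK : K ∈ S.TA) : L2F (volK K) (S.dq K) := (S.L2F_q hK).sub (L2F_evV K _)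
theorem memLp_dv (hK : K ∈ S.TA) : MemLp (S.dv K) 2 (volK K) := (S.memLp_v hK).sub (memLp_evS K _)

theorem σ_sub_eq : (fun x => S.X.σ x - evT (S.Y.σ K) x) = fun x => S.dσ K x + evT (S.eσ K) x := by
  funext x; rw [dσ, eσ, evT_sub]; abel
theorem γ_sub_eq : (fun x => S.X.γ x - evT (S.Y.γ K) x) = fun x => S.dγ K x + evT (S.eγ K) x := by
  funext x; rw [dγ, eγ, evT_sub]; abel
theorem u_sub_eq : (fun x => S.X.u x - evV (S.Y.u K) x) = fun x => S.du K x + evV (S.eu K) x := by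
  funext x; rw [du, eu, evV_sub]; abel
theorem q_sub_eq : (fun x => S.X.q x - evV (S.Y.q K) x) = fun x => S.dq K x + evV (S.eq K) x := by
  funext x; rw [dq, eq, evV_sub]; abel
theorem v_sub_eq : (fun x => S.X.v x - evS (S.Y.v K) x) = fun x => S.dv K x + evS (S.ev K) x := by
  funext x; rw [dv, ev, evS_sub]; ring

theorem hookeInv_add (A B : Matrix (Fin n) (Fin n) ℂ) :
    P.hookeInv (A + B) = P.hookeInv A + P.hookeInv B := by
  have := P.hookeInv_sub (A + B) B
  rw [add_sub_cancel_right] at this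
  rw [this, sub_add_cancel]

/-- The face terms of the elastic energy. -/
theorem face_energyE (hK : K ∈ S.TE) (hF : F ∈ facets K) :
    ipV (surf F) (evV (S.euHat F)) (fun x => mulN K F (evT (S.eσ K) x))
      + ipV (surf F) (evV (S.eu K)) (S.eσHatN K F)
      - ipV (surf F) (evV (S.eu K)) (fun x => mulN K F (evT (S.eσ K) x))
      = ipV (surf F) (evV (S.euHat F)) (S.eσHatN K F) - S.jumpSqE K F := by
  have hs := S.simplexE hK
  have hj : L2F (surf F) (evV (S.jumpE K F)) := L2F_surf_evV S.dim_pos hs hF _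
  have hτj : L2F (surf F) (fun x i => (S.τE K x : ℂ) * evS (S.jumpE K F i) x) := fun i =>
    memLp_stab_mul S.dim_pos hs hF (S.stabE K hK).1 (S.abs_τE_le hK hF) _
  have hσ := L2F_surf_mulN S.dim_pos hs hF (S.eσ K)
  have hjump : (S.jumpSqE K F : ℂ)
      = ipV (surf F) (evV (S.jumpE K F)) (fun x i => (S.τE K x : ℂ) * evS (S.jumpE K F i) x) := by
    rw [jumpSqE, ← integral_complex_ofReal]
    refine integral_congr_ae (Filter.Eventually.of_forall fun x => ?_)
    simp only [evV, map_mul, Complex.conj_ofReal]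
    push_cast
    rw [Finset.mul_sum]
    refine Finset.sum_congr rfl fun i _ => ?_
    rw [← Complex.mul_conj']
    ring
  have hflux : ∀ f : Pt n → Fin n → ℂ, L2F (surf F) f → ipV (surf F) f (S.eσHatN K F)
      = ipV (surf F) f (fun x => mulN K F (evT (S.eσ K) x))
        - ipV (surf F) f (fun x i => (S.τE K x : ℂ) * evS (S.jumpE K F i) x) := fun f hf =>
    ip_sub_right hσ hτj hf
  have hu := L2F_surf_evV S.dim_pos hs hF (S.eu K)
  have hû := L2F_surf_evV S.dim_pos hs hF (S.euHat F)
  rw [hflux _ hu, hflux _ hû, hjump, jumpE, evV_sub', ipV_sub_left hu hû (by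
    simpa only [jumpE] using hτj)]
  ring

theorem face_energyA (hK : K ∈ S.TA) (hF : F ∈ facets K) :
    ipS (surf F) (evS (S.evHat F)) (fun x => dotN K F (evV (S.eq K) x))
      + ipS (surf F) (evS (S.ev K)) (S.eqHatN K F)
      - ipS (surf F) (evS (S.ev K)) (fun x => dotN K F (evV (S.eq K) x))
      = ipS (surf F) (evS (S.evHat F)) (S.eqHatN K F) - S.jumpSqA K F := by
  have hs := S.simplexA hK
  have hm := memLp_surf_evS S.dim_pos hs hF
  have hτj : MemLp (fun x => (S.τA K x : ℂ) * evS (S.jumpA K F) x) 2 (surf F) :=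
    memLp_stab_mul S.dim_pos hs hF (S.stabA K hK).1 (S.abs_τA_le hK hF) _
  have hq : MemLp (fun x => dotN K F (evV (S.eq K) x)) 2 (surf F) :=
    memLp_dotN (L2F_surf_evV S.dim_pos hs hF (S.eq K))
  have hjump : (S.jumpSqA K F : ℂ)
      = ipS (surf F) (evS (S.jumpA K F)) (fun x => (S.τA K x : ℂ) * evS (S.jumpA K F) x) := by
    rw [jumpSqA, ← integral_complex_ofReal]
    refine integral_congr_ae (Filter.Eventually.of_forall fun x => ?_)
    simp only [map_mul, Complex.conj_ofReal]
    push_cast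
    rw [← Complex.mul_conj']
    ring
  have hflux : ∀ p : CPoly n, ipS (surf F) (evS p) (S.eqHatN K F)
      = ipS (surf F) (evS p) (fun x => dotN K F (evV (S.eq K) x))
        - ipS (surf F) (evS p) (fun x => (S.τA K x : ℂ) * evS (S.jumpA K F) x) := by
    intro p
    have h := congrArg conj (ipS_sub_left hq hτj (hm p))
    rw [map_sub, conj_ipS, conj_ipS, conj_ipS] at h
    exact h
  rw [hflux, hflux, hjump, jumpA, evS_sub', ipS_sub_left (hm _) (hm _) (by
    simpa only [jumpA, evS_sub'] using hτj)]
  ring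

/-- Constant tensors as polynomial tensors. -/
def constT (A : Matrix (Fin n) (Fin n) ℂ) : PolyT n := Matrix.of fun i j => MvPolynomial.C (A i j)

theorem evT_constT (A : Matrix (Fin n) (Fin n) ℂ) : evT (constT A) = fun _ => A := by
  funext x; ext i j; simp [constT]

/-- Constants have degree at most `k - 1` and are therefore among the moments that the projection
preserves. This is why only the mean-free part of the rotation error enters the energy. -/
theorem ipT_const_dσ (hK : K ∈ S.TE) (A : Matrix (Fin n) (Fin n) ℂ) :
    ipT (volK K) (fun _ => A) (S.dσ K) = 0 := by
  have h : ipT (volK K) (S.dσ K) (evT (constT A)) = 0 := by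
    have h0 : ∀ i, ipV (volK K) (evV (S.R.σ K i)) (evV (constT A i))
        = ipV (volK K) (fun x => S.X.σ x i) (evV (constT A i)) := fun i =>
      (S.proj.elastic K hK i).2.2.1 _ fun j => PkS_C _
    have h1 : ipT (volK K) (S.dσ K) (evT (constT A))
        = ipT (volK K) S.X.σ (evT (constT A)) - ipT (volK K) (evT (S.R.σ K)) (evT (constT A)) :=
      ipT_sub_left (S.L2F_σ hK) (L2F_evT K _) (L2F_evT K _)
    rw [h1, ipT_eq_sum (S.L2F_σ hK) (L2F_evT K _), ipT_eq_sum (L2F_evT K _) (L2F_evT K _),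
      ← Finset.sum_sub_distrib]
    exact Finset.sum_eq_zero fun i _ => sub_eq_zero.2 (h0 i).symm
  rw [← conj_ipT, ← evT_constT, h, map_zero]

theorem L2F_const (K : Finset (Pt n)) (A : Matrix (Fin n) (Fin n) ℂ) :
    L2F (volK K) (flat fun _ => A) := fun p => memLp_const (A p.1 p.2)

/-- The local energy identity in the elastic region. -/
theorem energyE (hK : K ∈ S.TE) (A : Matrix (Fin n) (Fin n) ℂ) :
    ipT (volK K) (fun x => P.hookeInv (evT (S.eσ K) x)) (evT (S.eσ K))
      + ipT (volK K) (fun x => P.hookeInv (S.dσ K x)) (evT (S.eσ K))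
      + ipT (volK K) (S.dγ K) (evT (S.eσ K))
      - ipT (volK K) (fun x => evT (S.eγ K) x - A) (S.dσ K)
      + P.rhoE * conj P.s ^ 2 * (nsq (volK K) (evV (S.eu K)) + ipV (volK K) (evV (S.eu K)) (S.du K))
      + (∑ F ∈ facets K, S.jumpSqE K F : ℝ)
      = ∑ F ∈ facets K, ipV (surf F) (evV (S.euHat F)) (S.eσHatN K F) := by
  have hs := S.simplexE hK
  have h1 := S.hooke_error hK (S.eσ_mem hK)
  -- Conjugation brings the product of `∇eu` and `eσ` into the order of Green's formula. It also
  -- replaces `s ^ 2` by its conjugate.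
  have h2 := congrArg conj (S.balance_error hK (S.eu_mem hK))
  -- Weak symmetry trades the product of `eγ` with `eσ` for the product with the projection error
  -- `dσ`.
  have h3 := S.symm_error hK (S.eγ_mem hK)
  have hg := green_polyV S.dim_pos hs (S.eu K) (S.eσ K)
  have hσ := L2F_evT K (S.eσ K)
  have hγ := L2F_evT K (S.eγ K)
  have hdσ := S.L2F_dσ hK
  have hface := Finset.sum_congr rfl fun F hF => S.face_energyE hK (F := F) hF
  simp only [Finset.sum_sub_distrib, Finset.sum_add_distrib] at hface
  rw [S.σ_sub_eq] at h3
  rw [show (fun x => P.hookeInv (S.X.σ x - evT (S.Y.σ K) x))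
    = fun x => P.hookeInv (S.dσ K x) + P.hookeInv (evT (S.eσ K) x) from
      funext fun x => by rw [← hookeInv_add, ← congrFun S.σ_sub_eq x], S.γ_sub_eq,
    ipT_add_left (L2F_hookeInv P hdσ) (L2F_hookeInv P hσ) hσ,
    ipT_add_left (S.L2F_dγ hK) hγ hσ] at h1
  rw [S.u_sub_eq, ipV_add_left (S.L2F_du hK) (L2F_evV K _) (L2F_evV K _)] at h2
  simp only [map_add, map_mul, map_pow, Complex.conj_ofReal, map_sum, conj_ipV, conj_ipT] at h2
  rw [ipT_add_left hdσ hσ hγ] at h3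
  have h3' := congrArg conj h3
  simp only [map_add, conj_ipT, map_zero] at h3'
  -- An arbitrary constant may be subtracted from `eγ`; it will be the one provided by the bubble
  -- estimate.
  have hA : ipT (volK K) (fun x => evT (S.eγ K) x - A) (S.dσ K)
      = ipT (volK K) (evT (S.eγ K)) (S.dσ K) := by
    rw [ipT_sub_left hγ (L2F_const K A) hdσ, S.ipT_const_dσ hK, sub_zero]
  have hself : (nsq (volK K) (evV (S.eu K)) : ℂ) = ipV (volK K) (evV (S.eu K)) (evV (S.eu K)) :=
    ip_self.symm
  rw [hA, hself]
  push_cast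
  linear_combination h1 + h2 - hg + hface - h3'

/-- The local energy identity in the acoustic region. -/
theorem energyA (hK : K ∈ S.TA) :
    nsq (volK K) (evV (S.eq K)) + ipV (volK K) (S.dq K) (evV (S.eq K))
      + conj (P.s / P.c) ^ 2 * (nsq (volK K) (one (evS (S.ev K)))
        + ipS (volK K) (evS (S.ev K)) (S.dv K))
      + (∑ F ∈ facets K, S.jumpSqA K F : ℝ)
      = ∑ F ∈ facets K, ipS (surf F) (evS (S.evHat F)) (S.eqHatN K F) := by
  have hs := S.simplexA hK
  have h1 := S.velocity_error hK (S.eq_mem hK)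
  have h2 := congrArg conj (S.wave_error hK (S.ev_mem hK))
  have hg := green_poly S.dim_pos hs (S.ev K) (S.eq K)
  have hface := Finset.sum_congr rfl fun F hF => S.face_energyA hK (F := F) hF
  simp only [Finset.sum_sub_distrib, Finset.sum_add_distrib] at hface
  rw [S.q_sub_eq, ipV_add_left (S.L2F_dq hK) (L2F_evV K _) (L2F_evV K _)] at h1
  rw [S.v_sub_eq, ipS_add_left (S.memLp_dv hK) (memLp_evS K _) (memLp_evS K _)] at h2
  simp only [map_add, map_mul, map_pow, map_sum, conj_ipV, conj_ipS] at h2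
  have hself : (nsq (volK K) (evV (S.eq K)) : ℂ) = ipV (volK K) (evV (S.eq K)) (evV (S.eq K)) :=
    ip_self.symm
  have hself' : (nsq (volK K) (one (evS (S.ev K))) : ℂ)
      = ipS (volK K) (evS (S.ev K)) (evS (S.ev K)) := by rw [ipS_eq, ip_self]
  rw [hself, hself']
  push_cast
  linear_combination h1 + h2 - hg + hface

end ErrorSetup

/-! ### Real part of the energy and absorption by Young's inequality. -/

section Absorption

theorem norm_ip_le_young' {α ι : Type*} [MeasurableSpace α] [Fintype ι] {m : Measure α}
    {f g : α → ι → ℂ} (hf : L2F m f) (hg : L2F m g) {ε : ℝ} (hε : 0 < ε) :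
    ‖ip m f g‖ ≤ ε * nsq m g + 1 / (4 * ε) * nsq m f := by
  rw [← conj_ip, RCLike.norm_conj]
  exact norm_ip_le_young hg hf hε

theorem norm_sum_ip_le {α ι β : Type*} [MeasurableSpace α] [Fintype ι] {m : β → Measure α}
    {T : Finset β} {f g : β → α → ι → ℂ} (hf : ∀ K ∈ T, L2F (m K) (f K))
    (hg : ∀ K ∈ T, L2F (m K) (g K)) {ε : ℝ} (hε : 0 < ε) :
    ‖∑ K ∈ T, ip (m K) (f K) (g K)‖
      ≤ ε * ∑ K ∈ T, nsq (m K) (f K) + 1 / (4 * ε) * ∑ K ∈ T, nsq (m K) (g K) := by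
  rw [Finset.mul_sum, Finset.mul_sum, ← Finset.sum_add_distrib]
  exact (norm_sum_le _ _).trans
    (Finset.sum_le_sum fun K hK => norm_ip_le_young (hf K hK) (hg K hK) hε)

theorem norm_sum_ip_le' {α ι β : Type*} [MeasurableSpace α] [Fintype ι] {m : β → Measure α}
    {T : Finset β} {f g : β → α → ι → ℂ} (hf : ∀ K ∈ T, L2F (m K) (f K))
    (hg : ∀ K ∈ T, L2F (m K) (g K)) {ε : ℝ} (hε : 0 < ε) :
    ‖∑ K ∈ T, ip (m K) (f K) (g K)‖
      ≤ ε * ∑ K ∈ T, nsq (m K) (g K) + 1 / (4 * ε) * ∑ K ∈ T, nsq (m K) (f K) := by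
  rw [Finset.mul_sum, Finset.mul_sum, ← Finset.sum_add_distrib]
  exact (norm_sum_le _ _).trans
    (Finset.sum_le_sum fun K hK => norm_ip_le_young' (hf K hK) (hg K hK) hε)

/-- The term `i₃` is the product with the rotation error, whose square is bounded by `Cb * (E + T)`.
The six bounds have room for absorption because the weight `ε` is free and can be fixed before the
data. -/
theorem exists_absorption {r₀ m c₀ ρ₁ ρ₂ ρ₃ C₁ Cb : ℝ} (hr : 0 < r₀) (hm : 0 < m) (hc : 0 < c₀)
    (h₁ : 0 < ρ₁) (h₂ : 0 < ρ₂) (h₃ : 0 < ρ₃) (hC₁ : 0 < C₁) (hCb : 0 < Cb) :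
    ∃ C : ℝ, 0 < C ∧ ∀ E U Q V JE JA T i₁ i₂ i₃ i₄ i₅ i₆ : ℝ, 0 ≤ E → 0 ≤ U → 0 ≤ Q → 0 ≤ V →
      0 ≤ JE → 0 ≤ JA → 0 ≤ T →
      r₀ * (c₀ * E + ρ₁ * U + JE + ρ₂ * Q + ρ₃ * V + ρ₂ * JA)
        ≤ m * (i₁ + i₂ + i₃ + ρ₁ * i₄ + ρ₂ * i₅ + ρ₃ * i₆) →
      (∀ ε : ℝ, 0 < ε → i₁ ≤ ε * E + 1 / (4 * ε) * (C₁ * T)) →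
      (∀ ε : ℝ, 0 < ε → i₂ ≤ ε * E + 1 / (4 * ε) * T) →
      (∀ ε : ℝ, 0 < ε → i₃ ≤ ε * (Cb * (E + T)) + 1 / (4 * ε) * T) →
      (∀ ε : ℝ, 0 < ε → i₄ ≤ ε * U + 1 / (4 * ε) * T) →
      (∀ ε : ℝ, 0 < ε → i₅ ≤ ε * Q + 1 / (4 * ε) * T) →
      (∀ ε : ℝ, 0 < ε → i₆ ≤ ε * V + 1 / (4 * ε) * T) → E + JE ≤ C * T := by
  -- The second condition leaves half of the coercivity in `E`, which receives contributions from
  -- three terms; the first lets `U`, `Q` and `V` be absorbed entirely.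
  obtain ⟨ε, hε, hε1, hε2⟩ : ∃ ε : ℝ, 0 < ε ∧ m * ε ≤ r₀ ∧ m * ε * (2 + Cb) ≤ r₀ * c₀ / 2 := by
    refine ⟨min (r₀ / m) (r₀ * c₀ / 2 / (m * (2 + Cb))), by positivity, ?_, ?_⟩
    · have := min_le_left (r₀ / m) (r₀ * c₀ / 2 / (m * (2 + Cb)))
      rw [le_div_iff₀ hm] at this
      linarith
    · have := min_le_right (r₀ / m) (r₀ * c₀ / 2 / (m * (2 + Cb)))
      rw [le_div_iff₀ (by positivity)] at this
      linarith
  set δ := 1 / (4 * ε) with hδ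
  have hδ0 : 0 < δ := by positivity
  set M := m * (δ * C₁ + δ + (ε * Cb + δ) + ρ₁ * δ + ρ₂ * δ + ρ₃ * δ) with hM
  have hM0 : 0 < M := by positivity
  refine ⟨2 / (r₀ * c₀) * M + 1 / r₀ * M, by positivity, ?_⟩
  intro E U Q V JE JA T i₁ i₂ i₃ i₄ i₅ i₆ hE hU hQ hV hJE hJA hT h b₁ b₂ b₃ b₄ b₅ b₆
  have b₁ := b₁ ε hε
  have b₂ := b₂ ε hε
  have b₃ := b₃ ε hε
  have b₄ := mul_le_mul_of_nonneg_left (b₄ ε hε) h₁.le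
  have b₅ := mul_le_mul_of_nonneg_left (b₅ ε hε) h₂.le
  have b₆ := mul_le_mul_of_nonneg_left (b₆ ε hε) h₃.le
  have hsum := mul_le_mul_of_nonneg_left
    (add_le_add (add_le_add (add_le_add (add_le_add (add_le_add b₁ b₂) b₃) b₄) b₅) b₆) hm.le
  have hmain : r₀ * (c₀ * E + ρ₁ * U + JE + ρ₂ * Q + ρ₃ * V + ρ₂ * JA)
      ≤ (m * ε * (2 + Cb)) * E + (m * ε) * (ρ₁ * U) + (m * ε) * (ρ₂ * Q) + (m * ε) * (ρ₃ * V)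
        + M * T := by
    refine (h.trans hsum).trans (le_of_eq ?_)
    rw [hM]
    ring
  have e1 := mul_le_mul_of_nonneg_right hε2 hE
  have e2 := mul_le_mul_of_nonneg_right hε1 (mul_nonneg h₁.le hU)
  have e3 := mul_le_mul_of_nonneg_right hε1 (mul_nonneg h₂.le hQ)
  have e4 := mul_le_mul_of_nonneg_right hε1 (mul_nonneg h₃.le hV)
  have e5 : 0 ≤ r₀ * (ρ₂ * JA) := by positivity
  have hfin : r₀ * c₀ / 2 * E + r₀ * JE ≤ M * T := by nlinarith
  have g1 : E ≤ 2 / (r₀ * c₀) * M * T := by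
    have : r₀ * c₀ / 2 * E ≤ M * T := by nlinarith [mul_nonneg hr.le hJE]
    calc E = 2 / (r₀ * c₀) * (r₀ * c₀ / 2 * E) := by field_simp
      _ ≤ 2 / (r₀ * c₀) * (M * T) := by gcongr
      _ = _ := by ring
  have g2 : JE ≤ 1 / r₀ * M * T := by
    have : r₀ * JE ≤ M * T := by
      have : 0 ≤ r₀ * c₀ / 2 * E := by positivity
      linarith
    calc JE = 1 / r₀ * (r₀ * JE) := by field_simp
      _ ≤ 1 / r₀ * (M * T) := by gcongr
      _ = _ := by ring
  linarith

/-- The inertial terms carry `s * conj s ^ 2 = |s|² conj s`, with real part `|s|² Re s`. Thus every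
quadratic term acquires the positive factor `Re s`, and all remaining products carry a factor of
modulus `‖s‖`. -/
theorem re_energy_le {s : ℂ} {ae JE U Q V JA ρE ρf c : ℝ} {I₁ I₂ I₃ I₄ I₅ I₆ : ℂ} (hρE : 0 < ρE)
    (hρf : 0 < ρf)
    (h : (s * (ae + I₁ + I₂ - I₃ + ρE * conj s ^ 2 * (U + I₄) + JE)
      + ρf * s * (Q + I₅ + conj (s / c) ^ 2 * (V + I₆) + JA)).re = 0) :
    s.re * (ae + ρE * ‖s‖ ^ 2 * U + JE + ρf * Q + ρf * (‖s‖ / c) ^ 2 * V + ρf * JA)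
      ≤ ‖s‖ * (‖I₁‖ + ‖I₂‖ + ‖I₃‖ + ρE * ‖s‖ ^ 2 * ‖I₄‖ + ρf * ‖I₅‖
        + ρf * (‖s‖ / c) ^ 2 * ‖I₆‖) := by
  set a := ρE * ‖s‖ ^ 2 with ha
  set b := ρf * (‖s‖ / c) ^ 2 with hb
  have ha0 : 0 ≤ a := by positivity
  have hb0 : 0 ≤ b := by positivity
  set W := s * (I₁ + I₂ - I₃ + ρf * I₅) + conj s * (a * I₄ + b * I₆) with hW
  have hss : s * conj s = (‖s‖ : ℂ) ^ 2 := Complex.mul_conj' s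
  have key : s * (ae + I₁ + I₂ - I₃ + ρE * conj s ^ 2 * (U + I₄) + JE)
      + ρf * s * (Q + I₅ + conj (s / c) ^ 2 * (V + I₆) + JA)
      = ((ae + JE + ρf * Q + ρf * JA : ℝ) : ℂ) * s + ((a * U + b * V : ℝ) : ℂ) * conj s + W := by
    rw [hW, ha, hb]
    push_cast
    rw [map_div₀, Complex.conj_ofReal, div_pow, div_pow, ← hss]
    ring
  rw [key, Complex.add_re, Complex.add_re, Complex.re_ofReal_mul, Complex.re_ofReal_mul,
    Complex.conj_re] at h
  have hn : ‖W‖ ≤ ‖s‖ * (‖I₁‖ + ‖I₂‖ + ‖I₃‖ + ρf * ‖I₅‖) + ‖s‖ * (a * ‖I₄‖ + b * ‖I₆‖) := by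
    refine (norm_add_le _ _).trans (add_le_add ?_ ?_)
    · rw [norm_mul]
      gcongr
      refine (norm_add_le _ _).trans (add_le_add ((norm_sub_le _ _).trans
        (add_le_add (norm_add_le _ _) le_rfl)) ?_)
      rw [norm_mul, Complex.norm_real, Real.norm_of_nonneg hρf.le]
    · rw [norm_mul, RCLike.norm_conj]
      gcongr
      refine (norm_add_le _ _).trans (add_le_add ?_ ?_)
      · rw [norm_mul, Complex.norm_real, Real.norm_of_nonneg ha0]
      · rw [norm_mul, Complex.norm_real, Real.norm_of_nonneg hb0]
  have hre := Complex.abs_re_le_norm W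
  have := neg_abs_le W.re
  nlinarith

end Absorption

/-! ### Bubble estimate of the rotation error, and the energy estimate. -/

namespace ErrorSetup

variable {n k : ℕ} {P : Coeff n} {D : Geom n} {κ τ₀ τ₁ : ℝ} (S : ErrorSetup k P D κ τ₀ τ₁)
  {K K' F : Finset (Pt n)}

/-- The square of `Θ`. -/
def thetaSq : ℝ := ∑ K ∈ S.TE, nsq (volK K) (flat (S.dσ K)) + ∑ K ∈ S.TE, nsq (volK K) (S.du K)
  + ∑ K ∈ S.TE, nsq (volK K) (flat (S.dγ K)) + ∑ K ∈ S.TA, nsq (volK K) (S.dq K)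
  + ∑ K ∈ S.TA, nsq (volK K) (one (S.dv K))

theorem Theta_eq : Theta S.TE S.TA S.X S.R = √S.thetaSq := by
  rw [Theta, sqT_eq, sqV_eq, sqT_eq, sqV_eq, sqS_eq]
  rfl

theorem sum_nsq_nonneg {ι : Type*} [Fintype ι] (T : Finset (Finset (Pt n)))
    (f : Finset (Pt n) → Pt n → ι → ℂ) : 0 ≤ ∑ K ∈ T, nsq (volK K) (f K) :=
  Finset.sum_nonneg fun _ _ => nsq_nonneg

theorem thetaSq_nonneg : 0 ≤ S.thetaSq := by
  unfold thetaSq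
  have := sum_nsq_nonneg S.TE fun K => flat (S.dσ K)
  have := sum_nsq_nonneg S.TE S.du
  have := sum_nsq_nonneg S.TE fun K => flat (S.dγ K)
  have := sum_nsq_nonneg S.TA S.dq
  have := sum_nsq_nonneg S.TA fun K => one (S.dv K)
  positivity

theorem sum_dσ_dγ_le : ∑ K ∈ S.TE, nsq (volK K) (flat (S.dσ K))
    + ∑ K ∈ S.TE, nsq (volK K) (flat (S.dγ K)) ≤ S.thetaSq := by
  have := sum_nsq_nonneg S.TE S.du
  have := sum_nsq_nonneg S.TA S.dq
  have := sum_nsq_nonneg S.TA fun K => one (S.dv K)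
  unfold thetaSq
  linarith

theorem sum_dσ_le : ∑ K ∈ S.TE, nsq (volK K) (flat (S.dσ K)) ≤ S.thetaSq := by
  have := S.sum_dσ_dγ_le
  have := sum_nsq_nonneg S.TE fun K => flat (S.dγ K)
  linarith

theorem sum_dγ_le : ∑ K ∈ S.TE, nsq (volK K) (flat (S.dγ K)) ≤ S.thetaSq := by
  have := S.sum_dσ_dγ_le
  have := sum_nsq_nonneg S.TE fun K => flat (S.dσ K)
  linarith

theorem sum_du_le : ∑ K ∈ S.TE, nsq (volK K) (S.du K) ≤ S.thetaSq := by
  have := sum_nsq_nonneg S.TE fun K => flat (S.dσ K)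
  have := sum_nsq_nonneg S.TE fun K => flat (S.dγ K)
  have := sum_nsq_nonneg S.TA S.dq
  have := sum_nsq_nonneg S.TA fun K => one (S.dv K)
  unfold thetaSq
  linarith

theorem sum_dq_le : ∑ K ∈ S.TA, nsq (volK K) (S.dq K) ≤ S.thetaSq := by
  have := sum_nsq_nonneg S.TE fun K => flat (S.dσ K)
  have := sum_nsq_nonneg S.TE fun K => flat (S.dγ K)
  have := sum_nsq_nonneg S.TE S.du
  have := sum_nsq_nonneg S.TA fun K => one (S.dv K)
  unfold thetaSq
  linarith

theorem sum_dv_le : ∑ K ∈ S.TA, nsq (volK K) (one (S.dv K)) ≤ S.thetaSq := by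
  have := sum_nsq_nonneg S.TE fun K => flat (S.dσ K)
  have := sum_nsq_nonneg S.TE fun K => flat (S.dγ K)
  have := sum_nsq_nonneg S.TE S.du
  have := sum_nsq_nonneg S.TA S.dq
  unfold thetaSq
  linarith

theorem shapeRegular (hK : K ∈ S.TE) : IsShapeRegular κ K :=
  ⟨S.simplexE hK, (S.mesh.regE K hK).1⟩

/-- The rotation error is controlled, up to a constant on each element, by bubble functions. -/
theorem exists_eγ_bound (hn : n = 2 ∨ n = 3) (hκ : 0 < κ) : ∃ C : ℝ, 0 < C ∧
    ∀ S : ErrorSetup k P D κ τ₀ τ₁, ∀ K ∈ S.TE, ∃ A : Matrix (Fin n) (Fin n) ℂ,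
      nsq (volK K) (flat fun x => evT (S.eγ K) x - A)
        ≤ C * (nsq (volK K) (flat (evT (S.eσ K))) + nsq (volK K) (flat (S.dσ K))
          + nsq (volK K) (flat (S.dγ K))) := by
  obtain ⟨C₀, hC₀, hb⟩ := exists_bubble_test hn k hκ
  obtain ⟨C₁, hC₁, hH⟩ := P.hookeInv_bounded
  refine ⟨C₀ * (2 * C₀ * (2 * C₁ + 1)), by positivity, fun S K hK => ?_⟩
  obtain ⟨t, ht, ⟨A, hA⟩, hnt⟩ := hb K (S.shapeRegular hK) (S.eγ K) (S.eγ_mem hK)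
  refine ⟨A, hA.trans ?_⟩
  rw [mul_assoc]
  refine mul_le_mul_of_nonneg_left ?_ hC₀.le
  have hdσ := S.L2F_dσ hK
  have hdγ := S.L2F_dγ hK
  have hσ := L2F_evT K (S.eσ K)
  have hte := L2F_evT K t
  have hsum : L2F (volK K) (flat fun x => S.dσ K x + evT (S.eσ K) x) := hdσ.add hσ
  have h1 := S.hooke_error hK (bubbleSpace_subset_stressSpace ht)
  -- The facet terms vanish with the normal trace of the bubble, and the `eu` term with its
  -- divergence, so the equation relates `eγ` only to `eσ` and the projection errors.
  have h0 : ∀ F ∈ facets K, ipV (surf F) (evV (S.euHat F)) (fun x => mulN K F (evT t x)) = 0 := by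
    intro F hF
    refine integral_eq_zero_of_ae ?_
    filter_upwards [ae_surf_mem F] with x hx
    simp [bubbleSpace_mul_normal S.dim (S.simplexE hK) hF ht hx]
  rw [Finset.sum_eq_zero h0, bubbleSpace_divT S.dim ht, ipV_zero_right, add_zero,
    S.γ_sub_eq, ipT_add_left hdγ (L2F_evT K _) hte] at h1
  simp only [show ∀ x, S.X.σ x - evT (S.Y.σ K) x = S.dσ K x + evT (S.eσ K) x from
    congrFun S.σ_sub_eq] at h1
  set J := ‖ipT (volK K) (evT (S.eγ K)) (evT t)‖ with hJ
  have hJ0 : 0 ≤ J := norm_nonneg _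
  have h2 : J ≤ ‖ipT (volK K) (fun x => P.hookeInv (S.dσ K x + evT (S.eσ K) x)) (evT t)‖
      + ‖ipT (volK K) (S.dγ K) (evT t)‖ := by
    have : ipT (volK K) (evT (S.eγ K)) (evT t)
        = -(ipT (volK K) (fun x => P.hookeInv (S.dσ K x + evT (S.eσ K) x)) (evT t)
          + ipT (volK K) (S.dγ K) (evT t)) := by linear_combination h1
    rw [hJ, this, norm_neg]
    exact norm_add_le _ _
  rw [ipT_eq, ipT_eq] at h2
  -- With the weight `C₀` the bound of the square of `t` by `C₀ * J` makes each of the two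
  -- applications cost `J / 4`. Half of `J` remains on the left.
  have h3 := norm_ip_le_young (L2F_hookeInv P hsum) hte hC₀
  have h4 := norm_ip_le_young hdγ hte hC₀
  have h5 := hH (volK K) _ hsum
  have h6 : nsq (volK K) (flat fun x => S.dσ K x + evT (S.eσ K) x)
      ≤ 2 * nsq (volK K) (flat (S.dσ K)) + 2 * nsq (volK K) (flat (evT (S.eσ K))) :=
    nsq_add_le hdσ hσ
  have h7 : 1 / (4 * C₀) * nsq (volK K) (flat (evT t)) ≤ J / 4 := by
    calc _ ≤ 1 / (4 * C₀) * (C₀ * J) := by gcongr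
      _ = J / 4 := by field_simp
  have e1 : 0 ≤ nsq (volK K) (flat (S.dσ K)) := nsq_nonneg
  have e2 : 0 ≤ nsq (volK K) (flat (evT (S.eσ K))) := nsq_nonneg
  have e3 : 0 ≤ nsq (volK K) (flat (S.dγ K)) := nsq_nonneg
  have h8 : C₀ * nsq (volK K) (flat fun x => P.hookeInv (S.dσ K x + evT (S.eσ K) x))
      ≤ C₀ * (C₁ * (2 * nsq (volK K) (flat (S.dσ K)) + 2 * nsq (volK K) (flat (evT (S.eσ K))))) := by
    gcongr
    exact h5.trans (by gcongr)
  have h9 : J ≤ 2 * (C₀ * (C₁ * (2 * nsq (volK K) (flat (S.dσ K))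
      + 2 * nsq (volK K) (flat (evT (S.eσ K)))))) + 2 * (C₀ * nsq (volK K) (flat (S.dγ K))) := by
    linarith
  refine h9.trans ?_
  have p1 : 0 ≤ C₀ * nsq (volK K) (flat (S.dσ K)) := by positivity
  have p2 : 0 ≤ C₀ * nsq (volK K) (flat (evT (S.eσ K))) := by positivity
  have p3 : 0 ≤ C₀ * C₁ * nsq (volK K) (flat (S.dγ K)) := by positivity
  nlinarith

theorem jumpSqE_nonneg (hK : K ∈ S.TE) (hF : F ∈ facets K) : 0 ≤ S.jumpSqE K F := by
  refine integral_nonneg_of_ae ?_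
  filter_upwards [ae_surf_mem F] with x hx
  have := S.τ₀_pos.le.trans ((S.stabE K hK).2 F hF x hx).1
  simp only [Pi.zero_apply]
  positivity

theorem jumpSqA_nonneg (hK : K ∈ S.TA) (hF : F ∈ facets K) : 0 ≤ S.jumpSqA K F := by
  refine integral_nonneg_of_ae ?_
  filter_upwards [ae_surf_mem F] with x hx
  have := S.τ₀_pos.le.trans ((S.stabA K hK).2 F hF x hx).1
  simp only [Pi.zero_apply]
  positivity

/-- The energy estimate. -/
theorem exists_energy_bound (hn : n = 2 ∨ n = 3) (hκ : 0 < κ) : ∃ C : ℝ, 0 < C ∧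
    ∀ S : ErrorSetup k P D κ τ₀ τ₁,
      ∑ K ∈ S.TE, nsq (volK K) (flat (evT (S.eσ K))) + ∑ K ∈ S.TE, ∑ F ∈ facets K, S.jumpSqE K F
        ≤ C * S.thetaSq := by
  obtain ⟨Cb, hCb, hbub⟩ := exists_eγ_bound (k := k) (P := P) (D := D) (τ₀ := τ₀) (τ₁ := τ₁) hn hκ
  obtain ⟨c₀, hc₀, hco⟩ := P.hookeInv_coercive
  obtain ⟨C₁, hC₁, hH⟩ := P.hookeInv_bounded
  have hs : 0 < ‖P.s‖ := P.s_pos.trans_le (Complex.re_le_norm _)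
  have hρE := P.rhoE_pos
  have hρf := P.rhoF_pos
  have hc := P.c_pos
  obtain ⟨C, hC, habs⟩ := exists_absorption (ρ₁ := P.rhoE * ‖P.s‖ ^ 2) (ρ₂ := P.rhoF)
    (ρ₃ := P.rhoF * (‖P.s‖ / P.c) ^ 2) P.s_pos hs hc₀ (by positivity) hρf (by positivity) hC₁ hCb
  refine ⟨C, hC, fun S => ?_⟩
  -- The constant of the bubble estimate on each element is the one inserted into the elastic energy
  -- identity.
  choose! A hA using hbub S
  choose r hr hle using fun K => hco (volK K) (evT (S.eσ K)) (L2F_evT K _)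
  have hE := Finset.sum_congr rfl fun K hK => S.energyE hK (A K)
  have hAc := Finset.sum_congr rfl fun K hK => S.energyA hK (K := K)
  simp only [hr, Finset.sum_add_distrib, Finset.sum_sub_distrib, ← Finset.mul_sum,
    ← Complex.ofReal_sum] at hE hAc
  have hre := S.re_sum_flux
  rw [← hE, ← hAc] at hre
  have hen := re_energy_le hρE hρf hre
  have hT := S.thetaSq_nonneg
  have hσ : ∀ K ∈ S.TE, L2F (volK K) (flat (evT (S.eσ K))) := fun K _ => L2F_evT K _
  refine habs _ _ _ _ _ _ S.thetaSq _ _ _ _ _ _ (sum_nsq_nonneg S.TE fun K => flat (evT (S.eσ K)))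
    (sum_nsq_nonneg S.TE fun K => evV (S.eu K)) (sum_nsq_nonneg S.TA fun K => evV (S.eq K))
    (sum_nsq_nonneg S.TA fun K => one (evS (S.ev K)))
    (Finset.sum_nonneg fun K hK => Finset.sum_nonneg fun F hF => S.jumpSqE_nonneg hK hF)
    (Finset.sum_nonneg fun K hK => Finset.sum_nonneg fun F hF => S.jumpSqA_nonneg hK hF) hT
    (le_trans ?_ hen) ?_ ?_ ?_ ?_ ?_ ?_
  · have h1 : c₀ * ∑ K ∈ S.TE, nsq (volK K) (flat (evT (S.eσ K))) ≤ ∑ K ∈ S.TE, r K := by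
      rw [Finset.mul_sum]
      exact Finset.sum_le_sum fun K _ => hle K
    have := P.s_pos
    gcongr
  · intro ε hε
    simp only [ipT_eq]
    refine (norm_sum_ip_le' (fun K hK => L2F_hookeInv P (S.L2F_dσ hK)) hσ hε).trans ?_
    gcongr
    refine (Finset.sum_le_sum fun K hK => hH (volK K) _ (S.L2F_dσ hK)).trans ?_
    rw [← Finset.mul_sum]
    gcongr
    exact S.sum_dσ_le
  · intro ε hε
    simp only [ipT_eq]
    refine (norm_sum_ip_le' (fun K hK => S.L2F_dγ hK) hσ hε).trans ?_
    gcongr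
    exact S.sum_dγ_le
  · intro ε hε
    simp only [ipT_eq]
    refine (norm_sum_ip_le (fun K _ => (L2F_evT K _).sub (L2F_const K _))
      (fun K hK => S.L2F_dσ hK) hε).trans ?_
    gcongr
    · refine (Finset.sum_le_sum fun K hK => hA K hK).trans ?_
      rw [← Finset.mul_sum, Finset.sum_add_distrib, Finset.sum_add_distrib, add_assoc]
      gcongr
      exact S.sum_dσ_dγ_le
    · exact S.sum_dσ_le
  · intro ε hε
    refine (norm_sum_ip_le (fun K _ => L2F_evV K _) (fun K hK => S.L2F_du hK) hε).trans ?_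
    gcongr
    exact S.sum_du_le
  · intro ε hε
    refine (norm_sum_ip_le' (fun K hK => S.L2F_dq hK) (fun K _ => L2F_evV K _) hε).trans ?_
    gcongr
    exact S.sum_dq_le
  · intro ε hε
    simp only [ipS_eq]
    refine (norm_sum_ip_le (f := fun K => one (evS (S.ev K))) (g := fun K => one (S.dv K))
      (fun K _ _ => memLp_evS K _) (fun K hK _ => S.memLp_dv hK) hε).trans ?_
    gcongr
    exact S.sum_dv_le

end ErrorSetup

/-! ### Mean values and traces of families of polynomials. -/

section MeanValue

variable {n : ℕ} {K F : Finset (Pt n)} {κ : ℝ}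

/-- The mean value is the best constant approximation. -/
theorem integral_norm_sub_average_sq_le {α : Type*} [MeasurableSpace α] {m : Measure α}
    [IsFiniteMeasure m] {f : α → ℂ} (hf : MemLp f 2 m) (a : ℂ) :
    ∫ x, ‖f x - ⨍ y, f y ∂m‖ ^ 2 ∂m ≤ ∫ x, ‖f x - a‖ ^ 2 ∂m := by
  set c := ⨍ y, f y ∂m with hc
  have hfc : MemLp (fun x => f x - c) 2 m := hf.sub (memLp_const c)
  -- The cross term in the expansion of the square around the mean value integrates to zero.
  have h0 : ∫ x, (f x - c) * conj (c - a) ∂m = 0 := by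
    rw [integral_mul_const, integral_sub_average, zero_mul]
  have hi : Integrable (fun x => (f x - c) * conj (c - a)) m :=
    (hfc.integrable one_le_two).mul_const _
  have hi' : Integrable (fun x => ((f x - c) * conj (c - a)).re) m := hi.re
  have hre : ∫ x, ((f x - c) * conj (c - a)).re ∂m = 0 := by
    have := integral_re hi
    simp only [RCLike.re_eq_complex_re] at this
    rw [this, h0, Complex.zero_re]
  have h1 : ∫ x, (‖f x - c‖ ^ 2 + 2 * ((f x - c) * conj (c - a)).re) ∂m
      ≤ ∫ x, ‖f x - a‖ ^ 2 ∂m := by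
    refine integral_mono ((hfc.integrable_norm_pow (by norm_num)).add (hi'.const_mul 2))
      ((hf.sub (memLp_const a)).integrable_norm_pow (by norm_num)) fun x => ?_
    have e : f x - a = (f x - c) + (c - a) := by ring
    simp only [e, ← Complex.normSq_eq_norm_sq, Complex.normSq_add]
    have := Complex.normSq_nonneg (c - a)
    linarith
  rw [integral_add (hfc.integrable_norm_pow (by norm_num)) (hi'.const_mul 2),
    integral_const_mul, hre, mul_zero, add_zero] at h1
  exact h1

theorem nsq_eq_sum {α ι : Type*} [MeasurableSpace α] [Fintype ι] {m : Measure α}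
    {f : α → ι → ℂ} (hf : L2F m f) : nsq m f = ∑ i, ∫ x, ‖f x i‖ ^ 2 ∂m :=
  integral_finsetSum _ fun i _ => (hf i).integrable_norm_pow (by norm_num)

/-- The trace inequality for families of polynomials. -/
theorem exists_trace_bound_family (hn : 0 < n) (m : ℕ) (hκ : 0 < κ) : ∃ C : ℝ, 0 < C ∧
    ∀ K : Finset (Pt n), IsShapeRegular κ K → ∀ {ι : Type} [Fintype ι] (p : ι → CPoly n),
      (∀ i, p i ∈ PkS n m) → ∀ F ∈ facets K,
      Metric.diam (cell K) * nsq (surf F) (fun x i => evS (p i) x)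
        ≤ C * nsq (volK K) (fun x i => evS (p i) x) := by
  obtain ⟨C, hC, h⟩ := exists_trace_bound hn m hκ
  refine ⟨C, hC, fun K hK ι _ p hp F hF => ?_⟩
  rw [nsq_eq_sum fun i => memLp_surf_evS hn hK.simplex hF (p i),
    nsq_eq_sum fun i => memLp_evS K (p i), Finset.mul_sum, Finset.mul_sum]
  exact Finset.sum_le_sum fun i _ => h K hK (p i) (hp i) F hF

theorem norm_mulN_sq_le (hn : 0 < n) (hK : IsSimplex K) (hF : F ∈ facets K)
    (M : Matrix (Fin n) (Fin n) ℂ) :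
    ∑ i, ‖mulN K F M i‖ ^ 2 ≤ n * ∑ i, ∑ j, ‖M i j‖ ^ 2 := by
  rw [Finset.mul_sum]
  refine Finset.sum_le_sum fun i _ => ?_
  calc ‖mulN K F M i‖ ^ 2 ≤ (∑ j, ‖M i j‖) ^ 2 := by
        gcongr
        refine (norm_sum_le _ _).trans (Finset.sum_le_sum fun j _ => ?_)
        rw [norm_mul, Complex.norm_real, Real.norm_eq_abs]
        exact mul_le_of_le_one_right (norm_nonneg _) (abs_nrm_le hn hK hF j)
    _ ≤ _ := by
        simpa using sq_sum_le_card_mul_sum_sq (s := Finset.univ) (f := fun j => ‖M i j‖)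

theorem nsq_mulN_le (hn : 0 < n) (hK : IsSimplex K) (hF : F ∈ facets K) (t : PolyT n) :
    nsq (surf F) (fun x => mulN K F (evT t x)) ≤ n * nsq (surf F) (flat (evT t)) := by
  have ht : L2F (surf F) (flat (evT t)) := fun p => memLp_surf_evS hn hK hF (t p.1 p.2)
  rw [nsq, nsq, ← integral_const_mul]
  refine integral_mono (ErrorSetup.L2F_surf_mulN hn hK hF t).integrable_sq
    (ht.integrable_sq.const_mul _) fun x => ?_
  refine (norm_mulN_sq_le hn hK hF _).trans (le_of_eq ?_)
  rw [Fintype.sum_prod_type]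
  rfl

end MeanValue

/-! ### The two parts of the rotation error. -/

namespace ErrorSetup

variable {n k : ℕ} {P : Coeff n} {D : Geom n} {κ τ₀ τ₁ : ℝ} (S : ErrorSetup k P D κ τ₀ τ₁)
  {K K' F : Finset (Pt n)}

/-- The mean value of the rotation error on an element. -/
def eγMean (K : Finset (Pt n)) : Matrix (Fin n) (Fin n) ℂ :=
  Matrix.of fun i j => ⨍ y, evS (S.eγ K i j) y ∂(volK K)

theorem errγ_eq : errγ S.R S.Y K = evT (S.eγ K) := by
  funext x
  rw [errγ, eγ, evT_sub]

theorem errγc_eq : errγc S.R S.Y K = fun _ => S.eγMean K := by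
  funext x
  ext i j
  simp only [errγc, eγMean, Matrix.of_apply, errγ_eq]
  rfl

theorem errγ0_eq : errγ0 S.R S.Y K = fun x => evT (S.eγ K) x - S.eγMean K := by
  funext x
  rw [errγ0, errγc_eq, errγ_eq]

theorem errU_eq : errU S.R S.Y K = evV (S.eu K) := by
  funext x
  rw [errU, eu, evV_sub]

theorem nsq_sub_eγMean_le (A : Matrix (Fin n) (Fin n) ℂ) :
    nsq (volK K) (flat fun x => evT (S.eγ K) x - S.eγMean K)
      ≤ nsq (volK K) (flat fun x => evT (S.eγ K) x - A) := by
  rw [nsq_eq_sum (f := flat fun x => evT (S.eγ K) x - S.eγMean K)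
      ((L2F_evT K (S.eγ K)).sub (L2F_const K (S.eγMean K))),
    nsq_eq_sum (f := flat fun x => evT (S.eγ K) x - A)
      ((L2F_evT K (S.eγ K)).sub (L2F_const K A))]
  exact Finset.sum_le_sum fun p _ => integral_norm_sub_average_sq_le (memLp_evS K _) _

theorem eγMean_mem (hK : K ∈ S.TE) : constT (S.eγMean K) ∈ skewSpace n k := by
  refine ⟨?_, fun i j => PkS_C _⟩
  ext1 i j
  have h : evS (S.eγ K j i) = fun x => -evS (S.eγ K i j) x := by
    funext x
    rw [skew_apply (S.eγ_mem hK) j i, evS_neg]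
  simp only [constT, eγMean, Matrix.add_apply, Matrix.transpose_apply, Matrix.of_apply,
    Matrix.zero_apply, h]
  rw [← map_add, average_neg, add_neg_cancel, map_zero]

theorem divT_constT (A : Matrix (Fin n) (Fin n) ℂ) : divT (constT A) = 0 := by
  funext i
  simp [divT, constT]

/-- The estimate of the mean-free part of the rotation error. -/
theorem exists_mean_free_bound (hn : n = 2 ∨ n = 3) (hκ : 0 < κ) : ∃ C : ℝ, 0 < C ∧
    ∀ S : ErrorSetup k P D κ τ₀ τ₁,
      ∑ K ∈ S.TE, nsq (volK K) (flat fun x => evT (S.eγ K) x - S.eγMean K) ≤ C * S.thetaSq := by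
  obtain ⟨C₁, hC₁, h₁⟩ := exists_energy_bound (k := k) (P := P) (D := D) (τ₀ := τ₀) (τ₁ := τ₁) hn hκ
  obtain ⟨C₂, hC₂, h₂⟩ := exists_eγ_bound (k := k) (P := P) (D := D) (τ₀ := τ₀) (τ₁ := τ₁) hn hκ
  refine ⟨C₂ * (C₁ + 1), by positivity, fun S => ?_⟩
  have hJ : 0 ≤ ∑ K ∈ S.TE, ∑ F ∈ facets K, S.jumpSqE K F :=
    Finset.sum_nonneg fun K hK => Finset.sum_nonneg fun F hF => S.jumpSqE_nonneg hK hF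
  have hE : ∑ K ∈ S.TE, nsq (volK K) (flat (evT (S.eσ K))) ≤ C₁ * S.thetaSq := by
    linarith [h₁ S]
  have hsum : ∑ K ∈ S.TE, nsq (volK K) (flat fun x => evT (S.eγ K) x - S.eγMean K)
      ≤ ∑ K ∈ S.TE, C₂ * (nsq (volK K) (flat (evT (S.eσ K))) + nsq (volK K) (flat (S.dσ K))
          + nsq (volK K) (flat (S.dγ K))) := by
    refine Finset.sum_le_sum fun K hK => ?_
    obtain ⟨A, hA⟩ := h₂ S K hK
    exact (S.nsq_sub_eγMean_le A).trans hA
  rw [← Finset.mul_sum, Finset.sum_add_distrib, Finset.sum_add_distrib, add_assoc] at hsum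
  calc _ ≤ _ := hsum
    _ ≤ C₂ * (C₁ * S.thetaSq + S.thetaSq) := by
        gcongr
        exact S.sum_dσ_dγ_le
    _ = _ := by ring

theorem nsq_jumpE_le (hK : K ∈ S.TE) (hF : F ∈ facets K) :
    τ₀ * nsq (surf F) (evV (S.jumpE K F)) ≤ S.jumpSqE K F := by
  have hs := S.simplexE hK
  have hj := L2F_surf_evV S.dim_pos hs hF (S.jumpE K F)
  have hint : Integrable (fun x => S.τE K x * ∑ i, ‖evS (S.jumpE K F i) x‖ ^ 2) (surf F) := by
    refine Integrable.bdd_mul (c := τ₁) hj.integrable_sq (S.stabE K hK).1.aestronglyMeasurable ?_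
    filter_upwards [ae_surf_mem F] with x hx
    rw [Real.norm_eq_abs]
    exact S.abs_τE_le hK hF x hx
  rw [nsq, ← integral_const_mul]
  refine integral_mono_ae (hj.integrable_sq.const_mul _) hint ?_
  filter_upwards [ae_surf_mem F] with x hx
  exact mul_le_mul_of_nonneg_right ((S.stabE K hK).2 F hF x hx).1
    (Finset.sum_nonneg fun i _ => by positivity)

/-- An element lies in the closure of the elastic region, hence in `O`. The bound serves to estimate
`Θ` by `h^{-1/2} Θ` with a constant that depends on the region and `κ`. -/
theorem h_le (hn : 0 < n) (hκ : 0 < κ) (hK : K ∈ S.TE) : S.h ≤ κ * Metric.diam D.O := by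
  refine (S.mesh.regE K hK).2.2.trans ?_
  have hd := diam_cell_pos hn (S.simplexE hK)
  obtain ⟨x, hx⟩ := (S.mesh.regE K hK).1
  have hint : (interior (cell K)).Nonempty :=
    ⟨x, interior_mono hx (Metric.ball_subset_interior_closedBall
      (Metric.mem_ball_self (by positivity)))⟩
  have hsub : cell K ⊆ D.O := by
    refine Set.Subset.trans ?_ D.closure_subset
    refine Set.Subset.trans ?_ (closure_mono (S.mesh.triE.interior_cell_subset hK))
    rw [(convex_cell K).closure_interior_eq_closure_of_nonempty_interior hint]
    exact subset_closure
  gcongr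
  exact Metric.diam_mono hsub D.bounded_O

/-- The local estimate of the mean value of the rotation error. -/
theorem exists_local_mean_bound (hn : n = 2 ∨ n = 3) (hκ : 0 < κ) (hτ₀ : 0 < τ₀) : ∃ C : ℝ, 0 < C ∧
    ∀ S : ErrorSetup k P D κ τ₀ τ₁, ∀ K ∈ S.TE,
      nsq (volK K) (flat fun _ => S.eγMean K)
        ≤ C * (nsq (volK K) (flat (evT (S.eσ K))) + nsq (volK K) (flat (S.dσ K))
          + nsq (volK K) (flat (S.dγ K))
          + nsq (volK K) (flat fun x => evT (S.eγ K) x - S.eγMean K)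
          + S.h⁻¹ * ∑ F ∈ facets K, S.jumpSqE K F
          + S.h⁻¹ ^ 2 * nsq (volK K) (evV (S.eu K))) := by
  have hn0 : 0 < n := by rcases hn with rfl | rfl <;> norm_num
  have hnR : (0 : ℝ) < n := by exact_mod_cast hn0
  obtain ⟨C₁, hC₁, hH⟩ := P.hookeInv_bounded
  obtain ⟨Ct, hCt, htr⟩ := exists_trace_bound_family (κ := κ) hn0 k hκ
  set c := κ * Ct with hc
  have hc0 : 0 < c := by positivity
  -- Chosen so that Young's inequality with weight `d / h` on each of the `n + 1` facets costs `N /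
  -- 8` in total. The three volume products, with weight `2`, cost `N / 8` each, so half of `N` is
  -- left.
  set d := 2 * n * (n + 1) * c with hd
  have hd0 : 0 < d := by positivity
  refine ⟨2 * (4 * C₁ + 4 * C₁ + 2 + 2 + 2 * d / τ₀ + 2 * d * (n + 1) * c), by positivity,
    fun S K hK => ?_⟩
  have hs := S.simplexE hK
  have hh := S.mesh.h_pos
  have hdiam := diam_cell_pos hn0 hs
  -- The trace inequality with `h` in place of the diameter, by `h ≤ κ h_K`.
  have htrace : ∀ {ι : Type} [Fintype ι] (p : ι → CPoly n), (∀ i, p i ∈ PkS n k) →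
      ∀ F ∈ facets K, nsq (surf F) (fun x i => evS (p i) x)
        ≤ c * S.h⁻¹ * nsq (volK K) (fun x i => evS (p i) x) := by
    intro ι _ p hp F hF
    have h1 := htr K (S.shapeRegular hK) p hp F hF
    have h2 := (S.mesh.regE K hK).2.2
    have h3 : (0 : ℝ) ≤ nsq (surf F) (fun x i => evS (p i) x) := nsq_nonneg
    have h4 : S.h * nsq (surf F) (fun x i => evS (p i) x)
        ≤ c * nsq (volK K) (fun x i => evS (p i) x) := by
      calc _ ≤ κ * Metric.diam (cell K) * nsq (surf F) (fun x i => evS (p i) x) := by gcongr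
        _ = κ * (Metric.diam (cell K) * nsq (surf F) (fun x i => evS (p i) x)) := by ring
        _ ≤ κ * (Ct * nsq (volK K) (fun x i => evS (p i) x)) := by gcongr
        _ = _ := by rw [hc]; ring
    calc _ = S.h⁻¹ * (S.h * nsq (surf F) (fun x i => evS (p i) x)) := by field_simp
      _ ≤ S.h⁻¹ * (c * nsq (volK K) (fun x i => evS (p i) x)) := by gcongr
      _ = _ := by ring
  -- The test function is the mean value itself. It is constant, so its divergence vanishes and `eu`
  -- can enter only through the facets.
  set t := constT (S.eγMean K) with ht
  have htm : t ∈ skewSpace n k := S.eγMean_mem hK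
  have hte := L2F_evT K t
  set N := nsq (volK K) (flat fun _ => S.eγMean K) with hN
  have hNt : nsq (volK K) (flat (evT t)) = N := by rw [ht, evT_constT]
  have hN0 : 0 ≤ N := nsq_nonneg
  have hdσ := S.L2F_dσ hK
  have hdγ := S.L2F_dγ hK
  have hσ := L2F_evT K (S.eσ K)
  have hγ := L2F_evT K (S.eγ K)
  have hsum : L2F (volK K) (flat fun x => S.dσ K x + evT (S.eσ K) x) := hdσ.add hσ
  have hγ0 : L2F (volK K) (flat fun x => evT (S.eγ K) x - S.eγMean K) :=
    hγ.sub (L2F_const K (S.eγMean K))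
  have h1 := S.hooke_error hK (PkT_subset_stressSpace S.dim htm.2)
  rw [divT_constT, ipV_zero_right, add_zero, S.γ_sub_eq, ipT_add_left hdγ hγ hte] at h1
  simp only [show ∀ x, S.X.σ x - evT (S.Y.σ K) x = S.dσ K x + evT (S.eσ K) x from
    congrFun S.σ_sub_eq] at h1
  have h2 : ipT (volK K) (fun x => evT (S.eγ K) x - S.eγMean K) (evT t)
      = ipT (volK K) (evT (S.eγ K)) (evT t) - N := by
    rw [ipT_sub_left hγ (L2F_const K _) hte, ht, evT_constT, ipT_eq _ (fun _ => S.eγMean K), ip_self]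
  have h3 : (N : ℂ) = ∑ F ∈ facets K, ipV (surf F) (evV (S.euHat F)) (fun x => mulN K F (evT t x))
      - ipT (volK K) (fun x => P.hookeInv (S.dσ K x + evT (S.eσ K) x)) (evT t)
      - ipT (volK K) (S.dγ K) (evT t)
      - ipT (volK K) (fun x => evT (S.eγ K) x - S.eγMean K) (evT t) := by
    rw [h2]; linear_combination h1
  have h4 : N ≤ ∑ F ∈ facets K, ‖ipV (surf F) (evV (S.euHat F)) (fun x => mulN K F (evT t x))‖
      + ‖ipT (volK K) (fun x => P.hookeInv (S.dσ K x + evT (S.eσ K) x)) (evT t)‖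
      + ‖ipT (volK K) (S.dγ K) (evT t)‖
      + ‖ipT (volK K) (fun x => evT (S.eγ K) x - S.eγMean K) (evT t)‖ := by
    have : N = ‖(N : ℂ)‖ := by rw [Complex.norm_real, Real.norm_of_nonneg hN0]
    rw [this, h3]
    refine (norm_sub_le _ _).trans (add_le_add ((norm_sub_le _ _).trans (add_le_add
      ((norm_sub_le _ _).trans (add_le_add (norm_sum_le _ _) le_rfl)) le_rfl)) le_rfl)
  have y1 := norm_ip_le_young (L2F_hookeInv P hsum) hte (zero_lt_two' ℝ)
  have y2 := norm_ip_le_young hdγ hte (zero_lt_two' ℝ)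
  have y3 := norm_ip_le_young hγ0 hte (zero_lt_two' ℝ)
  rw [← ipT_eq, hNt] at y1 y2 y3
  have b1 := hH (volK K) _ hsum
  have b2 : nsq (volK K) (flat fun x => S.dσ K x + evT (S.eσ K) x)
      ≤ 2 * nsq (volK K) (flat (S.dσ K)) + 2 * nsq (volK K) (flat (evT (S.eσ K))) :=
    nsq_add_le hdσ hσ
  have b3 : nsq (volK K) (flat fun x => P.hookeInv (S.dσ K x + evT (S.eσ K) x))
      ≤ C₁ * (2 * nsq (volK K) (flat (S.dσ K)) + 2 * nsq (volK K) (flat (evT (S.eσ K)))) :=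
    b1.trans (by gcongr)
  have hface : ∀ F ∈ facets K, ‖ipV (surf F) (evV (S.euHat F)) (fun x => mulN K F (evT t x))‖
      ≤ 2 * d / τ₀ * (S.h⁻¹ * S.jumpSqE K F) + 2 * d * c * (S.h⁻¹ ^ 2 * nsq (volK K) (evV (S.eu K)))
        + 1 / (8 * (n + 1)) * N := by
    intro F hF
    have hû := L2F_surf_evV hn0 hs hF (S.euHat F)
    have hu := L2F_surf_evV hn0 hs hF (S.eu K)
    have hj := L2F_surf_evV hn0 hs hF (S.jumpE K F)
    have hm := L2F_surf_mulN hn0 hs hF t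
    have hε : 0 < d * S.h⁻¹ := by positivity
    have f1 := norm_ip_le_young hû hm hε
    have f2 : nsq (surf F) (evV (S.euHat F))
        ≤ 2 * nsq (surf F) (evV (S.eu K)) + 2 * nsq (surf F) (evV (S.jumpE K F)) := by
      -- The trace error is `eu` minus the jump. The jump is measured by the stabilized energy and
      -- needs no trace inequality, which saves the factor `h⁻¹` in front of its square.
      have e : evV (S.euHat F) = fun x => evV (S.eu K) x - evV (S.jumpE K F) x := by
        funext x
        rw [jumpE, evV_sub, sub_sub_cancel]
      rw [e]
      exact nsq_sub_le hu hj
    have f3 : nsq (surf F) (evV (S.jumpE K F)) ≤ S.jumpSqE K F / τ₀ := by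
      rw [le_div_iff₀ hτ₀, mul_comm]
      exact S.nsq_jumpE_le hK hF
    have f4 : nsq (surf F) (evV (S.eu K)) ≤ c * S.h⁻¹ * nsq (volK K) (evV (S.eu K)) :=
      htrace (S.eu K) (S.eu_mem hK) F hF
    have f5 : nsq (surf F) (flat (evT t)) ≤ c * S.h⁻¹ * N := by
      rw [← hNt]
      exact htrace (fun p : Fin n × Fin n => t p.1 p.2) (fun p => htm.2 p.1 p.2) F hF
    have f6 := nsq_mulN_le hn0 hs hF t
    have f7 : 1 / (4 * (d * S.h⁻¹)) * nsq (surf F) (fun x => mulN K F (evT t x))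
        ≤ 1 / (8 * (n + 1)) * N := by
      calc _ ≤ 1 / (4 * (d * S.h⁻¹)) * (n * (c * S.h⁻¹ * N)) := by
            gcongr
            exact f6.trans (by gcongr)
        _ = _ := by
            rw [hd]
            field_simp
            ring
    have f8 : d * S.h⁻¹ * nsq (surf F) (evV (S.euHat F))
        ≤ d * S.h⁻¹ * (2 * (c * S.h⁻¹ * nsq (volK K) (evV (S.eu K))) + 2 * (S.jumpSqE K F / τ₀)) := by
      gcongr
      exact f2.trans (by gcongr)
    refine f1.trans ((add_le_add f8 f7).trans (le_of_eq ?_))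
    field_simp
    ring
  have hfaces : ∑ F ∈ facets K, ‖ipV (surf F) (evV (S.euHat F)) (fun x => mulN K F (evT t x))‖
      ≤ 2 * d / τ₀ * (S.h⁻¹ * ∑ F ∈ facets K, S.jumpSqE K F)
        + 2 * d * (n + 1) * c * (S.h⁻¹ ^ 2 * nsq (volK K) (evV (S.eu K))) + 1 / 8 * N := by
    refine (Finset.sum_le_sum hface).trans (le_of_eq ?_)
    rw [Finset.sum_add_distrib, Finset.sum_add_distrib, Finset.sum_const, Finset.sum_const,
      card_facets hs, ← Finset.mul_sum, ← Finset.mul_sum]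
    simp only [nsmul_eq_mul]
    push_cast
    field_simp
    try ring
  set a1 := nsq (volK K) (flat (evT (S.eσ K)))
  set a2 := nsq (volK K) (flat (S.dσ K))
  set a3 := nsq (volK K) (flat (S.dγ K))
  set a4 := nsq (volK K) (flat fun x => evT (S.eγ K) x - S.eγMean K)
  set a5 := S.h⁻¹ * ∑ F ∈ facets K, S.jumpSqE K F
  set a6 := S.h⁻¹ ^ 2 * nsq (volK K) (evV (S.eu K))
  have p1 : 0 ≤ a1 := nsq_nonneg
  have p2 : 0 ≤ a2 := nsq_nonneg
  have p3 : 0 ≤ a3 := nsq_nonneg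
  have p4 : 0 ≤ a4 := nsq_nonneg
  have p5 : 0 ≤ a5 := mul_nonneg (by positivity) (Finset.sum_nonneg fun F hF => S.jumpSqE_nonneg hK hF)
  have p6 : 0 ≤ a6 := mul_nonneg (by positivity) nsq_nonneg
  have hfin : N ≤ 2 * (4 * C₁ * a1 + 4 * C₁ * a2 + 2 * a3 + 2 * a4 + 2 * d / τ₀ * a5
      + 2 * d * (n + 1) * c * a6) := by
    norm_num at y1 y2 y3
    linarith
  have hA : ∀ {M x y : ℝ}, 0 ≤ M → x ≤ y → M * x ≤ M * y := by
    intro M x y h1 h2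
    exact mul_le_mul_of_nonneg_left h2 h1
  have s1 : a1 ≤ a1 + a2 + a3 + a4 + a5 + a6 := by linarith
  have s2 : a2 ≤ a1 + a2 + a3 + a4 + a5 + a6 := by linarith
  have s3 : a3 ≤ a1 + a2 + a3 + a4 + a5 + a6 := by linarith
  have s4 : a4 ≤ a1 + a2 + a3 + a4 + a5 + a6 := by linarith
  have s5 : a5 ≤ a1 + a2 + a3 + a4 + a5 + a6 := by linarith
  have s6 : a6 ≤ a1 + a2 + a3 + a4 + a5 + a6 := by linarith
  have m1 := hA (M := 4 * C₁) (by positivity) s1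
  have m2 := hA (M := 4 * C₁) (by positivity) s2
  have m5 := hA (M := 2 * d / τ₀) (by positivity) s5
  have m6 := hA (M := 2 * d * (n + 1) * c) (by positivity) s6
  linarith

/-- The estimate of the piecewise constant part of the rotation error. -/
theorem exists_mean_bound (hn : n = 2 ∨ n = 3) (hκ : 0 < κ) (hτ₀ : 0 < τ₀) : ∃ C : ℝ, 0 < C ∧
    ∀ S : ErrorSetup k P D κ τ₀ τ₁, ∑ K ∈ S.TE, nsq (volK K) (flat fun _ => S.eγMean K)
      ≤ C * (S.h⁻¹ * S.thetaSq + S.h⁻¹ ^ 2 * ∑ K ∈ S.TE, nsq (volK K) (evV (S.eu K))) := by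
  have hn0 : 0 < n := by rcases hn with rfl | rfl <;> norm_num
  obtain ⟨C₁, hC₁, h₁⟩ := exists_energy_bound (k := k) (P := P) (D := D) (τ₀ := τ₀) (τ₁ := τ₁) hn hκ
  obtain ⟨C₂, hC₂, h₂⟩ := exists_mean_free_bound (k := k) (P := P) (D := D) (τ₀ := τ₀) (τ₁ := τ₁)
    hn hκ
  obtain ⟨C₃, hC₃, h₃⟩ := exists_local_mean_bound (k := k) (P := P) (D := D) (τ₁ := τ₁) hn hκ hτ₀
  set H := κ * Metric.diam D.O with hH
  have hH0 : 0 ≤ H := mul_nonneg hκ.le Metric.diam_nonneg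
  refine ⟨C₃ * ((C₁ + 1 + C₂) * H + C₁ + 1), by positivity, fun S => ?_⟩
  have hh := S.mesh.h_pos
  have hT := S.thetaSq_nonneg
  set U := ∑ K ∈ S.TE, nsq (volK K) (evV (S.eu K)) with hU
  have hU0 : 0 ≤ U := sum_nsq_nonneg S.TE fun K => evV (S.eu K)
  -- The bound of `h` by the size of the region requires an element; without elements the left-hand
  -- side is zero.
  rcases S.TE.eq_empty_or_nonempty with he | ⟨K₀, hK₀⟩
  · rw [he, Finset.sum_empty]
    positivity
  have hTh : S.thetaSq ≤ H * (S.h⁻¹ * S.thetaSq) := by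
    have h5 := S.h_le hn0 hκ hK₀
    calc S.thetaSq = S.h * (S.h⁻¹ * S.thetaSq) := by field_simp
      _ ≤ _ := by gcongr
  have hE := h₁ S
  have hE0 : 0 ≤ ∑ K ∈ S.TE, nsq (volK K) (flat (evT (S.eσ K))) :=
    sum_nsq_nonneg S.TE fun K => flat (evT (S.eσ K))
  have hJ0 : 0 ≤ ∑ K ∈ S.TE, ∑ F ∈ facets K, S.jumpSqE K F :=
    Finset.sum_nonneg fun K hK => Finset.sum_nonneg fun F hF => S.jumpSqE_nonneg hK hF
  have hJ : S.h⁻¹ * ∑ K ∈ S.TE, ∑ F ∈ facets K, S.jumpSqE K F ≤ S.h⁻¹ * (C₁ * S.thetaSq) := by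
    gcongr
    linarith
  have hsum := Finset.sum_le_sum (h₃ S)
  rw [← Finset.mul_sum] at hsum
  simp only [Finset.sum_add_distrib, ← Finset.mul_sum] at hsum
  refine hsum.trans ?_
  rw [mul_assoc]
  refine mul_le_mul_of_nonneg_left ?_ hC₃.le
  have hM := h₂ S
  have hd := S.sum_dσ_dγ_le
  have hT' : (C₁ + 1 + C₂) * S.thetaSq ≤ (C₁ + 1 + C₂) * (H * (S.h⁻¹ * S.thetaSq)) := by gcongr
  have hx : 0 ≤ S.h⁻¹ * S.thetaSq := by positivity
  have hy : 0 ≤ S.h⁻¹ ^ 2 * U := by positivity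
  have hz : 0 ≤ ((C₁ + 1 + C₂) * H + C₁) * (S.h⁻¹ ^ 2 * U) := by positivity
  nlinarith

end ErrorSetup

/-! ### From squared norms to the stated estimates. -/

theorem sqrt_le_of_le_mul_sq {x C a : ℝ} (hC : 0 ≤ C) (ha : 0 ≤ a) (h : x ≤ C * a ^ 2) :
    √x ≤ √C * a := by
  rw [← Real.sqrt_sq ha, ← Real.sqrt_mul hC]
  exact Real.sqrt_le_sqrt h

end

theorem lemma5p3 (n : ℕ) (hn : n = 2 ∨ n = 3) (k : ℕ) (hk : 1 ≤ k) (P : Coeff n) (D : Geom n)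
    (κ τ₀ τ₁ : ℝ) (hκ : 0 < κ) (hτ₀ : 0 < τ₀) :
    ∃ C0 Cc : ℝ, 0 < C0 ∧ 0 < Cc ∧
      ∀ (h : ℝ) (TE TA : Finset (Finset (Pt n))) (τE τA : Finset (Pt n) → Pt n → ℝ),
        IsMeshPair D κ h TE TA → IsStab τ₀ τ₁ TE τE → IsStab τ₀ τ₁ TA τA →
        ∀ (B : Data n) (X : Fields n) (R : Proj n) (Y : Discrete n),
          SolvesPDE P D B X → HasTraces P D B TE TA X → IsProj k TE TA τE τA X R →
          SolvesHDG P D B k TE TA τE τA Y →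
          Real.sqrt (sqT TE (errγ0 R Y)) ≤ C0 * Theta TE TA X R ∧
          Real.sqrt (sqT TE (errγc R Y)) ≤
            Cc * (h ^ (-(1 / 2) : ℝ) * Theta TE TA X R
              + Real.sqrt (sqV TE (fun K x => ((h⁻¹ : ℝ) : ℂ) • errU R Y K x))) := by
  obtain ⟨C₀, hC₀, h₀⟩ := ErrorSetup.exists_mean_free_bound (k := k) (P := P) (D := D) (τ₀ := τ₀)
    (τ₁ := τ₁) hn hκ
  obtain ⟨C₁, hC₁, h₁⟩ := ErrorSetup.exists_mean_bound (k := k) (P := P) (D := D) (τ₁ := τ₁)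
    hn hκ hτ₀
  refine ⟨√C₀, √C₁, Real.sqrt_pos.2 hC₀, Real.sqrt_pos.2 hC₁, ?_⟩
  intro h TE TA τE τA hM hE hA B X R Y hX hT hR hY
  obtain ⟨S, rfl, rfl, rfl, rfl, rfl, rfl⟩ :=
    exists_errorSetup hn hτ₀ hM hE hA hX hT hR hY
  have hh := S.mesh.h_pos
  have hθ := S.thetaSq_nonneg
  rw [S.Theta_eq]
  constructor
  · refine sqrt_le_of_le_mul_sq hC₀.le (Real.sqrt_nonneg _) ?_
    rw [Real.sq_sqrt hθ, sqT_eq]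
    simp only [S.errγ0_eq]
    exact h₀ S
  · set V := sqV S.TE (fun K x => ((S.h⁻¹ : ℝ) : ℂ) • errU S.R S.Y K x) with hV
    have hVe : V = S.h⁻¹ ^ 2 * ∑ K ∈ S.TE, nsq (volK K) (evV (S.eu K)) := by
      rw [hV, sqV_eq, Finset.mul_sum]
      refine Finset.sum_congr rfl fun K _ => ?_
      rw [S.errU_eq]
      have := nsq_smul (m := volK K) (f := evV (S.eu K)) ((S.h⁻¹ : ℝ) : ℂ)
      rw [Complex.norm_real, Real.norm_eq_abs, sq_abs] at this
      exact this
    have hV0 : 0 ≤ V := by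
      rw [hVe]
      exact mul_nonneg (by positivity) (ErrorSetup.sum_nsq_nonneg S.TE fun K => evV (S.eu K))
    have hpow : (S.h ^ (-(1 / 2) : ℝ)) ^ 2 = S.h⁻¹ := by
      rw [← Real.rpow_natCast, ← Real.rpow_mul hh.le, ← Real.rpow_neg_one]
      norm_num
    have hp0 : 0 ≤ S.h ^ (-(1 / 2) : ℝ) := Real.rpow_nonneg hh.le _
    refine sqrt_le_of_le_mul_sq hC₁.le (by positivity) ?_
    have h2 := h₁ S
    rw [← hVe] at h2
    -- A sum of squares is at most the square of the sum of nonnegative numbers, which separates the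
    -- two contributions after taking roots.
    have h3 : S.h⁻¹ * S.thetaSq + V ≤ (S.h ^ (-(1 / 2) : ℝ) * √S.thetaSq + √V) ^ 2 := by
      have e1 : (S.h ^ (-(1 / 2) : ℝ) * √S.thetaSq) ^ 2 = S.h⁻¹ * S.thetaSq := by
        rw [mul_pow, hpow, Real.sq_sqrt hθ]
      have e2 := Real.sq_sqrt hV0
      have e3 : 0 ≤ S.h ^ (-(1 / 2) : ℝ) * √S.thetaSq * √V := by positivity
      nlinarith
    rw [sqT_eq]
    simp only [S.errγc_eq]
    exact h2.trans (by gcongr)
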